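/- **Setting.** Let $\mathcal A$ be a compact set of real $2\times2$ matrices, $0\notin\mathcal A$, without a common invariant subspace other than $\{0\}$ and $\mathbb R^2$. A trajectory of $\mathcal A$ is a solution of $\dot x(t)=A(t)x(t)$, $t\ge 0$, with a measurable $A(\cdot)$ taking values in $\mathcal A$. The Lyapunov exponent $\sigma(\mathcal A)$ is the infimum of all $\sigma$ such that every trajectory satisfies $\|x(t)\|\le Ce^{\sigma t}$, $t\ge 0$, with $C=C(x)$. A norm $f$ is a Barabanov norm of $\mathcal A$ if $f(x(t))\le e^{\sigma(\mathcal A)t}f(x(0))$, $t\ge0$, for every trajectory, and for every $x_0$ some trajectory of the convex hull ${\rm co}(\mathcal A)$ starting at $x_0$ satisfies $f(x(t))=e^{\sigma(\mathcal A) t}f(x_0)$ for all $t\ge0$; its unit sphere $S$ is called an invariant sphere. Assume $\sigma(\mathcal A)=0$. Let $u(\gamma)=(\cos\gamma,\sin\gamma)$, let $x(\gamma)$ be the point of $S$ of argument $\gamma$, and $g(\gamma)=\ln\|x(\gamma)\|$ (Euclidean norm), $\gamma\in[0,\pi]$. For an interval $I=(\gamma_1,\gamma_2)$ put $\Delta_S(I)=g(\gamma_2)-g(\gamma_1)$.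 **Kernels.** A *degenerate operator* is a nonzero singular matrix of ${\rm co}(\mathcal A)$ (in the exceptional case $0\in{\rm co}(\mathcal A)$ only those in $\mathcal A$ are counted). Two degenerate operators $A_1,A_2$ with negative second eigenvalues, a common image $L$ and different kernels form a reverse pair; a segment parallel to $L$ with nonzero ends $x_1\in{\rm Ker}A_1$, $x_2\in {\rm Ker}A_2$ is a reverse segment. $R$ is the set of maximal open intervals in the union of the open angles spanned by reverse segments. $D$ is the set of $\gamma\in[0,\pi]$ such that $u(\gamma)$ is in the kernel of a degenerate operator and $\gamma$ is in no interval of $R$. The coordinates are chosen so that $0\in D$, unless $D=\emptyset$. The rest of $(0,\pi)$ is a disjoint union of open intervals (*gaps*). **Leading trajectories.** A point $x$ is feasible if $Ax\ne\lambda x$ for all $A\in\mathcal A,\lambda\ge0$. At a feasible $x$, the left leading direction is that of the vector $Ax$, $A\in\mathcal A$, that makes with $x$ the least oriented angle in $(0,\pi)$ (the longest one if there are several), if such vectors exist; the right leading direction is that of the vector with the largest angle in $(-\pi,0)$. A left (right) leading trajectory is a curve which moves at each point in the left (right) leading direction; its ends are understood as limits. For a gap $(\gamma_1,\gamma_2)$,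 a *source* is an $s\in[\gamma_1,\gamma_2]$ from whose ray a right leading trajectory goes to the ray $\gamma_1$ and a left leading trajectory goes to the ray $\gamma_2$ (one of them is empty if $s$ is an end). $P$ is the set of gaps having a source inside the open interval; $H$ is the set of gaps having a source, but only at an end; $Q=R\cup H$. For $p=(\gamma_1,\gamma_2)\in P$ let $\ln k_1$ be the increment of $\ln\|x\|$ along a left leading trajectory from the ray $\gamma_1$ to the ray $\gamma_2$ ($-\infty$ if there is none), $\ln k_2$ the increment along a right leading trajectory from the ray $\gamma_2$ to the ray $\gamma_1$ ($-\infty$ if there is none), $m_p=\min\{\ln k_1,-\ln k_2\}$, $M_p=\max\{\ln k_1,-\ln k_2\}$. For $q=(\gamma_1,\gamma_2)\in Q$ let $\Delta(q)$ be the increment of $\ln\|x\|$ from the ray $\gamma_1$ to the ray $\gamma_2$ along the reverse segment (if $q\in R$) or along the leading trajectory that joins these rays (if $q\in H$). **Theorem.** For every $\tau\in D$ there is an angle in $(0,\pi)$ between $u(\tau)$ and the image of a degenerate operator whose kernel contains $u(\tau)$; let $\varphi(\tau)$ be any such angle. The numbers $\Delta(q)$, $q\in Q$, are well defined, $\cot\varphi$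 is integrable on $D$ and $\sum_{q\in Q}\Delta(q)$ converges absolutely. (1) Let $S$ be an invariant sphere of $\mathcal A$. Then for almost all $\tau\in D$, $\varphi(\tau)$ is the angle between $x(\tau)$ and the left tangent to $S$ at $x(\tau)$; $\Delta_S(q)=\Delta(q)$ for $q\in Q$; $\Delta_S(p)\in[m_p,M_p]$ for $p\in P$; $\sum_{p\in P}\Delta_S(p)$ converges absolutely; and for every $\gamma\in[0,\pi]$ that is an element of $D$ or an end of an interval of $Q$ or $P$, $$g(\gamma)=g(0)+\int_{[0,\gamma]\cap D}\cot\varphi(\tau)\,d\tau+\sum_{q\in Q,\,q\subset[0,\gamma]}\Delta(q)+\sum_{p\in P,\,p\subset[0,\gamma]}\Delta_S(p).$$ (2) Let real numbers $s_p\in[m_p,M_p]$, $p\in P$, be given. There is an invariant sphere $S$ with $\Delta_S(p)=s_p$ for all $p\in P$ if and only if $\sum_{p\in P}s_p$ converges absolutely and $$\sum_{p\in P}s_p=-\int_D\cot\varphi(\tau)\,d\tau-\sum_{q\in Q}\Delta(q).$$ (3) For given $(s_p)$ this invariant sphere is unique up to multiplication by a positive constant. -/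

import Mathlib

open MeasureTheory Filter Topology

namespace PlanarSwitching

/-- The Euclidean plane. -/
abbrev Plane : Type := EuclideanSpace ℝ (Fin 2)

/-- Real `2 × 2` matrices. -/
abbrev Mat : Type := Matrix (Fin 2) (Fin 2) ℝ

/-- The vector `A x`. -/
noncomputable def act (A : Mat) (x : Plane) : Plane := Matrix.toEuclideanLin A x

/-- The image of `A`. -/
noncomputable def image (A : Mat) : Submodule ℝ Plane := LinearMap.range (Matrix.toEuclideanLin A)

/-- The kernel of `A`. -/
noncomputable def kernel (A : Mat) : Submodule ℝ Plane := LinearMap.ker (Matrix.toEuclideanLin A)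

/-- The unit vector of argument `γ`. -/
noncomputable def unitVec (γ : ℝ) : Plane := !₂[Real.cos γ, Real.sin γ]

/-- The oriented angle, in `(-π, π]`, of the rotation that maps the direction of `x` to that of
`y`; counterclockwise is positive. Only used for nonzero `x`. -/
noncomputable def orientedAngle (x y : Plane) : ℝ :=
  Complex.arg ((⟨y 0, y 1⟩ : ℂ) / (⟨x 0, x 1⟩ : ℂ))

/-! ### Switching systems, Lyapunov exponent, Barabanov norms -/

/-- `x` (restricted to `[0, ∞)`) is a trajectory of the system with control set `𝒜`: a
(Carathéodory) solution of `x' (t) = A (t) x (t)` for a measurable switching law `A (·)` with values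
in `𝒜`. -/
def IsTrajectory (𝒜 : Set Mat) (x : ℝ → Plane) : Prop :=
  ∃ law : ℝ → Mat, (∀ i j, Measurable fun t => law t i j) ∧ (∀ t, 0 ≤ t → law t ∈ 𝒜) ∧
    ∀ t, 0 ≤ t → IntervalIntegrable (fun τ => act (law τ) (x τ)) volume 0 t ∧
      x t = x 0 + ∫ τ in (0 : ℝ)..t, act (law τ) (x τ)

/-- The Lyapunov exponent `σ(𝒜)`. -/
noncomputable def lyapunovExponent (𝒜 : Set Mat) : ℝ :=
  sInf {σ : ℝ | ∀ x : ℝ → Plane, IsTrajectory 𝒜 x →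
    ∃ C : ℝ, ∀ t, 0 ≤ t → ‖x t‖ ≤ C * Real.exp (σ * t)}

/-- The matrices of `𝒜` have no common invariant subspace besides `0` and the plane. -/
def IsIrreducibleFamily (𝒜 : Set Mat) : Prop :=
  ∀ W : Submodule ℝ Plane, (∀ A ∈ 𝒜, ∀ x ∈ W, act A x ∈ W) → W = ⊥ ∨ W = ⊤

/-- `f` is an invariant (Barabanov) norm of the system with control set `𝒜`. -/
def IsBarabanov (𝒜 : Set Mat) (f : Seminorm ℝ Plane) : Prop :=
  (∀ x, f x = 0 → x = 0) ∧
  (∀ x : ℝ → Plane, IsTrajectory 𝒜 x →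
    ∀ t, 0 ≤ t → f (x t) ≤ Real.exp (lyapunovExponent 𝒜 * t) * f (x 0)) ∧
  ∀ x₀ : Plane, ∃ x : ℝ → Plane, IsTrajectory (convexHull ℝ 𝒜) x ∧ x 0 = x₀ ∧
    ∀ t, 0 ≤ t → f (x t) = Real.exp (lyapunovExponent 𝒜 * t) * f x₀

/-! ### Polar parametrization of the unit sphere -/

/-- The point `x(γ)` of argument `γ` on the unit sphere `{x | f x = 1}`. -/
noncomputable def spherePoint (f : Seminorm ℝ Plane) (γ : ℝ) : Plane :=
  (f (unitVec γ))⁻¹ • unitVec γ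

/-- The function `g(γ) = ln ‖x(γ)‖` (Euclidean norm). -/
noncomputable def logRadius (f : Seminorm ℝ Plane) (γ : ℝ) : ℝ := Real.log ‖spherePoint f γ‖

/-- `φ` is the angle between `x(γ)` and the left tangent ray of the unit sphere at `x(γ)`, the
limit of the rays from `x(γ)` to `x(γ + δ)` as `δ → +0`. -/
def IsTangentAngle (f : Seminorm ℝ Plane) (γ φ : ℝ) : Prop :=
  Tendsto (fun δ => orientedAngle (spherePoint f γ) (spherePoint f (γ + δ) - spherePoint f γ))
    (𝓝[>] 0) (𝓝 φ)

/-- `Δ(I) = g(γ₂) - g(γ₁)` for the interval `I = (γ₁, γ₂)` and the unit sphere of `f`. -/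
noncomputable def increment (f : Seminorm ℝ Plane) (I : ℝ × ℝ) : ℝ :=
  logRadius f I.2 - logRadius f I.1

/-! ### Degenerate operators, reverse intervals, the set `D` -/

/-- The degenerate operators of the system: the nonzero singular matrices of `co(𝒜)`. In the
exceptional case when `0 ∈ co(𝒜)`, only those that belong to `𝒜` are counted. -/
def degenerate (𝒜 : Set Mat) : Set Mat :=
  {A | A ∈ convexHull ℝ 𝒜 ∧ A ≠ 0 ∧ A.det = 0 ∧ (A ∈ 𝒜 ∨ (0 : Mat) ∉ convexHull ℝ 𝒜)}

/-- `A₁, A₂` generate a reverse pencil: they are degenerate operators of the system with negative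
second eigenvalues (the second eigenvalue of a singular `2 × 2` matrix is its trace), with a common
image and with different kernels. -/
def IsReversePair (𝒜 : Set Mat) (A₁ A₂ : Mat) : Prop :=
  A₁ ∈ degenerate 𝒜 ∧ A₂ ∈ degenerate 𝒜 ∧ A₁.trace < 0 ∧ A₂.trace < 0 ∧
    image A₁ = image A₂ ∧ kernel A₁ ≠ kernel A₂

/-- `x₁, x₂` are the ends of a reverse segment of the pair `A₁, A₂`: they are nonzero, lie in the
respective kernels, and the segment is parallel to the common image. -/
def IsReverseSegment (A₁ A₂ : Mat) (x₁ x₂ : Plane) : Prop :=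
  x₁ ≠ 0 ∧ x₂ ≠ 0 ∧ x₁ ∈ kernel A₁ ∧ x₂ ∈ kernel A₂ ∧ x₂ - x₁ ∈ image A₁

/-- The arguments of the points in the open angles spanned by the reverse segments. -/
def reverseSet (𝒜 : Set Mat) : Set ℝ :=
  {γ | ∃ A₁ A₂ x₁ x₂, IsReversePair 𝒜 A₁ A₂ ∧ IsReverseSegment A₁ A₂ x₁ x₂ ∧
    ∃ a b : ℝ, 0 < a ∧ 0 < b ∧ unitVec γ = a • x₁ + b • x₂}

/-- The open interval `(I.1, I.2)` is nonempty and is a maximal interval in `W`, for an open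
set `W` of reals. -/
def IsComponent (W : Set ℝ) (I : ℝ × ℝ) : Prop :=
  I.1 < I.2 ∧ Set.Ioo I.1 I.2 ⊆ W ∧ I.1 ∉ W ∧ I.2 ∉ W

/-- `R`: the (maximal) reverse open intervals of the upper half-circle `[0, π]`. -/
def setR (𝒜 : Set Mat) : Set (ℝ × ℝ) :=
  {I | 0 ≤ I.1 ∧ I.2 ≤ Real.pi ∧ IsComponent (reverseSet 𝒜) I}

/-- `D`: the points of `[0, π]` that lie in kernels of degenerate operators and not in reverse open
intervals. -/
def setD (𝒜 : Set Mat) : Set ℝ :=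
  {γ | γ ∈ Set.Icc 0 Real.pi ∧ γ ∉ reverseSet 𝒜 ∧ ∃ A ∈ degenerate 𝒜, unitVec γ ∈ kernel A}

/-- The open intervals that make up the rest of the half-circle. -/
def gaps (𝒜 : Set Mat) : Set (ℝ × ℝ) :=
  {I | IsComponent (Set.Ioo 0 Real.pi \ (reverseSet 𝒜 ∪ setD 𝒜)) I}

/-- `φ ∈ (0, π)` is the angle between `x(γ)` and the image of a degenerate operator whose kernel
contains `x(γ)`. -/
def IsKernelAngle (𝒜 : Set Mat) (γ φ : ℝ) : Prop :=
  φ ∈ Set.Ioo 0 Real.pi ∧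
    ∃ A ∈ degenerate 𝒜, unitVec γ ∈ kernel A ∧ unitVec (γ + φ) ∈ image A

/-! ### Leading trajectories -/

/-- `x` is feasible: it is not an eigenvector of a matrix of `𝒜` with a nonnegative eigenvalue. -/
def IsFeasible (𝒜 : Set Mat) (x : Plane) : Prop :=
  ¬ ∃ A ∈ 𝒜, ∃ c : ℝ, 0 ≤ c ∧ act A x = c • x

/-- `A` is a leading left matrix at `x`: `A x` makes the minimal angle in `(0, π)` with `x` and,
among those vectors, has the maximal length. -/
def IsLeadingLeft (𝒜 : Set Mat) (x : Plane) (A : Mat) : Prop :=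
  IsFeasible 𝒜 x ∧ A ∈ 𝒜 ∧ orientedAngle x (act A x) ∈ Set.Ioo 0 Real.pi ∧
  ∀ B ∈ 𝒜, orientedAngle x (act B x) ∈ Set.Ioo 0 Real.pi →
    orientedAngle x (act A x) ≤ orientedAngle x (act B x) ∧
    (orientedAngle x (act B x) = orientedAngle x (act A x) → ‖act B x‖ ≤ ‖act A x‖)

/-- `A` is a leading right matrix at `x`: `A x` makes the maximal angle in `(-π, 0)` with `x` and,
among those vectors, has the maximal length. -/
def IsLeadingRight (𝒜 : Set Mat) (x : Plane) (A : Mat) : Prop :=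
  IsFeasible 𝒜 x ∧ A ∈ 𝒜 ∧ orientedAngle x (act A x) ∈ Set.Ioo (-Real.pi) 0 ∧
  ∀ B ∈ 𝒜, orientedAngle x (act B x) ∈ Set.Ioo (-Real.pi) 0 →
    orientedAngle x (act B x) ≤ orientedAngle x (act A x) ∧
    (orientedAngle x (act B x) = orientedAngle x (act A x) → ‖act B x‖ ≤ ‖act A x‖)

/-- A left leading trajectory going from the ray of argument `α` to the ray of argument `β`
(`α ≤ β`; for `α = β` it is empty, i.e. a single point). A leading trajectory
`x' = A^{(l)} x` turns strictly counterclockwise; it is written here in the parametrization by the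
argument, as `γ ↦ ρ(γ) (cos γ, sin γ)`, whose velocity is everywhere a positive multiple of
`A^{(l)} x`. Its ends are included as limits, since it may need infinite time to
reach the ray `β` or to leave the ray `α`. -/
def LeftArc (𝒜 : Set Mat) (α β : ℝ) (ρ : ℝ → ℝ) : Prop :=
  α ≤ β ∧ ContinuousOn ρ (Set.Icc α β) ∧ (∀ γ ∈ Set.Icc α β, 0 < ρ γ) ∧
  ∀ γ ∈ Set.Ioo α β, ∃ A, IsLeadingLeft 𝒜 (ρ γ • unitVec γ) A ∧
    ∃ c : ℝ, 0 < c ∧ HasDerivAt (fun τ => ρ τ • unitVec τ) (c • act A (ρ γ • unitVec γ)) γ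

/-- A right leading trajectory going (clockwise) from the ray of argument `β` to the ray of argument
`α`, in the parametrization by the argument; it is run through in the direction of
decreasing argument. -/
def RightArc (𝒜 : Set Mat) (α β : ℝ) (ρ : ℝ → ℝ) : Prop :=
  α ≤ β ∧ ContinuousOn ρ (Set.Icc α β) ∧ (∀ γ ∈ Set.Icc α β, 0 < ρ γ) ∧
  ∀ γ ∈ Set.Ioo α β, ∃ A, IsLeadingRight 𝒜 (ρ γ • unitVec γ) A ∧
    ∃ c : ℝ, 0 < c ∧ HasDerivAt (fun τ => ρ τ • unitVec τ) (-(c • act A (ρ γ • unitVec γ))) γ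

/-- The possible sources in the closed interval `[I.1, I.2]`: the arguments `s` from which a right
leading trajectory goes to the ray `I.1` and a left leading trajectory goes to the ray `I.2`; one of
the two is empty when `s` is an end of the interval. -/
def sources (𝒜 : Set Mat) (I : ℝ × ℝ) : Set ℝ :=
  {s | (∃ ρ, RightArc 𝒜 I.1 s ρ) ∧ ∃ ρ, LeftArc 𝒜 s I.2 ρ}

/-- `P`: the intervals without kernels that admit two (nonempty) leading trajectories going from a
common source to the ends. -/
def setP (𝒜 : Set Mat) : Set (ℝ × ℝ) :=
  {I | I ∈ gaps 𝒜 ∧ (sources 𝒜 I ∩ Set.Ioo I.1 I.2).Nonempty}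

/-- `H`: the intervals without kernels that admit only one leading trajectory, the source being
necessarily an end of the interval. -/
def setH (𝒜 : Set Mat) : Set (ℝ × ℝ) :=
  {I | I ∈ gaps 𝒜 ∧ (sources 𝒜 I).Nonempty ∧ sources 𝒜 I ∩ Set.Ioo I.1 I.2 = ∅}

/-- `Q = R ∪ H`. -/
def setQ (𝒜 : Set Mat) : Set (ℝ × ℝ) := setR 𝒜 ∪ setH 𝒜

/-- `r` is the increment of the logarithm of the radius over the interval `q ∈ Q`: along the
reverse segment if `q ∈ R`, along the (unique) leading trajectory that joins the two ends if
`q ∈ H`. -/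
def IsIncrement (𝒜 : Set Mat) (q : ℝ × ℝ) (r : ℝ) : Prop :=
  (q ∈ setR 𝒜 ∧ ∃ A₁ A₂, IsReversePair 𝒜 A₁ A₂ ∧ ∃ r₁ r₂ : ℝ, 0 < r₁ ∧ 0 < r₂ ∧
    IsReverseSegment A₁ A₂ (r₁ • unitVec q.1) (r₂ • unitVec q.2) ∧ r = Real.log (r₂ / r₁)) ∨
  (q ∈ setH 𝒜 ∧ ∃ ρ, (LeftArc 𝒜 q.1 q.2 ρ ∨ RightArc 𝒜 q.1 q.2 ρ) ∧
    r = Real.log (ρ q.2 / ρ q.1))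

/-- `ln k₁`, where `k₁ = ‖x₂‖ / ‖z₁‖` for the left leading trajectory from a point `z₁` of
the ray `I.1` to a point `x₂` of the ray `I.2` (the set below has at most one element); it is `-∞` if
no left leading trajectory joins the two rays. -/
noncomputable def logK₁ (𝒜 : Set Mat) (I : ℝ × ℝ) : EReal :=
  sSup {r : EReal | ∃ ρ, LeftArc 𝒜 I.1 I.2 ρ ∧ r = ((Real.log (ρ I.2 / ρ I.1) : ℝ) : EReal)}

/-- `-ln k₂`, where `k₂ = ‖x₁‖ / ‖z₂‖` for the right leading trajectory from a point `z₂` of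
the ray `I.2` to a point `x₁` of the ray `I.1` (the set below has at most one element); it is `+∞` if
no right leading trajectory joins the two rays. -/
noncomputable def negLogK₂ (𝒜 : Set Mat) (I : ℝ × ℝ) : EReal :=
  sInf {r : EReal | ∃ ρ, RightArc 𝒜 I.1 I.2 ρ ∧ r = ((-Real.log (ρ I.1 / ρ I.2) : ℝ) : EReal)}

/-- `m = min {ln k₁, -ln k₂}`. -/
noncomputable def lowerBd (𝒜 : Set Mat) (I : ℝ × ℝ) : EReal := min (logK₁ 𝒜 I) (negLogK₂ 𝒜 I)

/-- `M = max {ln k₁, -ln k₂}`. -/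
noncomputable def upperBd (𝒜 : Set Mat) (I : ℝ × ℝ) : EReal := max (logK₁ 𝒜 I) (negLogK₂ 𝒜 I)

end PlanarSwitching

open PlanarSwitching

/-! Everything rests on a differential description of the invariant norms. When the exponent is
zero, `isBarabanov_iff` says that a norm is a Barabanov norm exactly when it is `Dissipative` (no
velocity `A x` makes it grow) and `Sustained` (at every point some `A` of the convex hull gives a
ray `x + h A x` on which the norm never falls below its value at `x`). One such norm exists by a
vanishing discount argument, `exists_dissipative_sustained`.

In polar coordinates the logarithm `g` of the radius is Lipschitz and semiconcave, its
superdifferentials being the slopes of the lines of support, and dissipativity forces `radial A ≤ m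
* angular A` for every such slope `m` and every operator `A`. This makes `g` rigid. At a kernel, the
second eigenvalue of the degenerate operator is negative, so its flow contracts the plane onto the
kernel along the image. The line parallel to the image is therefore a line of support, and `g' = cot
φ` wherever `g` is differentiable (`isSupportSlope_cot`). Over a reverse interval, both ends of a
reverse segment minimize the norm on the line of the segment, so a proportional segment lies on the
sphere. Over a gap, the left or the right leading direction is tangent at each point. If 0 is not in
the convex hull, a left tangency is never followed by a right one; if it is, both tangencies hold
everywhere. In either case `g` is a right and a left leading trajectory with a common source
(`exists_topArcs`). Part (1) is then the fundamental theorem of calculus for `g`, split over `D` and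
the countably many complementary intervals, and the closing condition of part (2) is `g π = g 0`.

The main tool is the comparison `SemiconcaveAdmissible.monotoneOn_sub`: a semiconcave function with
admissible superdifferentials grows at least as fast as a left leading trajectory, the statement for
right ones being its reflection. It yields the bounds on the increments. It also yields uniqueness:
over a gap, the difference of two log-radii first decreases and then increases, and so does its
negative, hence equal end values make it constant.

For existence, the curve of a known sphere is replaced over each gap of `P` by a curve with the
prescribed increment, found by moving the source and using the intermediate value theorem. The
corrections are summed, and the sum condition makes the curve close up. Its gauge does not increase
along the flows of the convex hull, but its convexity is not evident. So the largest seminorm below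
the gauge is taken: it inherits the decrease, agrees with the gauge on the kernels because the
projections onto them are limits of flows, and agrees over the gaps by comparison
(`IsSphereRadius.exists_seminorm`, `IsSphereRadius.exists_setting`). If `D` is empty, there is at
most one interval in `P`, its increment is forced, and nothing has to be constructed. -/

namespace PlanarSwitching

/-! ### Linear algebra in the plane -/

/-- The continuous linear map of the plane given by a matrix. -/
noncomputable def op (A : Mat) : Plane →L[ℝ] Plane := Matrix.toEuclideanCLM (n := Fin 2) (𝕜 := ℝ) A

theorem act_eq_op (A : Mat) (x : Plane) : act A x = op A x := rfl

theorem act_zero_left (x : Plane) : act 0 x = 0 := by simp [act]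

theorem act_add_right (A : Mat) (x y : Plane) : act A (x + y) = act A x + act A y := by simp [act]

theorem act_sub_right (A : Mat) (x y : Plane) : act A (x - y) = act A x - act A y := by simp [act]

theorem act_smul_right (A : Mat) (c : ℝ) (x : Plane) : act A (c • x) = c • act A x := by simp [act]

theorem act_add_left (A B : Mat) (x : Plane) : act (A + B) x = act A x + act B x := by simp [act]

theorem act_sub_left (A B : Mat) (x : Plane) : act (A - B) x = act A x - act B x := by simp [act]

theorem act_smul_left (c : ℝ) (A : Mat) (x : Plane) : act (c • A) x = c • act A x := by simp [act]

theorem act_apply (A : Mat) (x : Plane) (i : Fin 2) : act A x i = A i 0 * x 0 + A i 1 * x 1 := by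
  fin_cases i <;> simp [act, Matrix.toLpLin_apply]

theorem plane_ext {x y : Plane} (h0 : x 0 = y 0) (h1 : x 1 = y 1) : x = y := by
  ext i; fin_cases i <;> assumption

theorem norm_sq_eq (x : Plane) : ‖x‖ ^ 2 = x 0 ^ 2 + x 1 ^ 2 := by
  simp [EuclideanSpace.norm_sq_eq, Fin.sum_univ_two]

theorem norm_unitVec (γ : ℝ) : ‖unitVec γ‖ = 1 := by
  have h := norm_sq_eq (unitVec γ)
  have e : unitVec γ 0 ^ 2 + unitVec γ 1 ^ 2 = 1 := by simp [unitVec]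
  rw [e] at h
  nlinarith [norm_nonneg (unitVec γ)]

theorem continuous_op : Continuous op :=
  LinearMap.continuous_of_finiteDimensional
    (Matrix.toEuclideanCLM (n := Fin 2) (𝕜 := ℝ)).toAlgEquiv.toLinearMap

theorem continuous_act : Continuous fun p : Mat × Plane => act p.1 p.2 := by
  have : (fun p : Mat × Plane => act p.1 p.2) = fun p => (op p.1) p.2 := rfl
  rw [this]
  exact (continuous_op.comp continuous_fst).clm_apply continuous_snd

theorem exists_act_bound {𝒜 : Set Mat} (h : IsCompact 𝒜) :
    ∃ K : ℝ, 0 < K ∧ ∀ A ∈ 𝒜, ∀ x, ‖act A x‖ ≤ K * ‖x‖ := by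
  obtain ⟨K, hK⟩ := (h.image continuous_op).isBounded.exists_norm_le
  refine ⟨max K 1, by positivity, fun A hA x => ?_⟩
  calc ‖act A x‖ ≤ ‖op A‖ * ‖x‖ := (op A).le_opNorm x
    _ ≤ max K 1 * ‖x‖ := by
      gcongr
      exact (hK _ ⟨A, hA, rfl⟩).trans (le_max_left _ _)

/-- The convex hull of a compact set in a finite-dimensional space is compact. -/
theorem isCompact_convexHull_of_finiteDimensional {V : Type*} [AddCommGroup V] [Module ℝ V]
    [TopologicalSpace V] [IsTopologicalAddGroup V] [ContinuousSMul ℝ V] [FiniteDimensional ℝ V]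
    {s : Set V} (hs : IsCompact s) : IsCompact (convexHull ℝ s) := by
  set n := Module.finrank ℝ V + 1
  have hcomp : IsCompact (stdSimplex ℝ (Fin n) ×ˢ Set.univ.pi fun _ : Fin n => s) :=
    (isCompact_stdSimplex ℝ (Fin n)).prod (isCompact_univ_pi fun _ => hs)
  have hcont : Continuous fun p : (Fin n → ℝ) × (Fin n → V) => ∑ i, p.1 i • p.2 i := by fun_prop
  convert! hcomp.image hcont using 1
  ext x
  constructor
  · intro hx
    obtain ⟨ι, _, z, w, hz, haff, hw, hsum, hx⟩ := eq_pos_convex_span_of_mem_convexHull hx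
    have hcard : Fintype.card ι ≤ n := by
      have := haff.card_le_finrank_succ
      have h2 := Submodule.finrank_le (vectorSpan ℝ (Set.range z))
      omega
    obtain ⟨e⟩ : Nonempty (ι ↪ Fin n) := by
      rw [Function.Embedding.nonempty_iff_card_le]; simpa using hcard
    have : Nonempty ι := by
      by_contra h
      rw [not_nonempty_iff] at h
      simp at hsum
    obtain ⟨i₀⟩ := this
    have hext : ∀ φ : ι → ℝ, ∑ j, Function.extend e φ 0 j = ∑ i, φ i := by
      intro φ
      classical
      rw [← Finset.sum_subset (Finset.subset_univ (Finset.univ.map e)), Finset.sum_map]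
      · exact Finset.sum_congr rfl fun i _ => e.injective.extend_apply _ _ _
      · intro j _ hj
        rw [Function.extend_apply']
        · rfl
        · rintro ⟨i, rfl⟩; simp at hj
    -- By Carathéodory `n` points suffice. The unused indices get weight 0 and an arbitrary point `z
    -- i₀` of the set, which gives a fixed compact parameter space.
    refine ⟨(Function.extend e w 0, Function.extend e z fun _ => z i₀), ⟨⟨fun j => ?_, ?_⟩, ?_⟩, ?_⟩
    · by_cases hj : ∃ i, e i = j
      · obtain ⟨i, rfl⟩ := hj
        simpa [e.injective.extend_apply] using (hw i).le
      · simp [Function.extend_apply' _ _ _ hj]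
    · simpa [hext] using hsum
    · intro j _
      by_cases hj : ∃ i, e i = j
      · obtain ⟨i, rfl⟩ := hj
        simpa [e.injective.extend_apply] using hz ⟨i, rfl⟩
      · simpa [Function.extend_apply' _ _ _ hj] using hz ⟨i₀, rfl⟩
    · classical
      rw [← hx]
      change ∑ j, Function.extend e w 0 j • Function.extend e z (fun _ => z i₀) j = _
      rw [← Finset.sum_subset (Finset.subset_univ (Finset.univ.map e)), Finset.sum_map]
      · exact Finset.sum_congr rfl fun i _ => by simp [e.injective.extend_apply]
      · intro j _ hj
        rw [Function.extend_apply' w]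
        · simp
        · rintro ⟨i, rfl⟩; simp at hj
  · rintro ⟨⟨w, z⟩, ⟨hw, hz⟩, rfl⟩
    exact (convex_convexHull ℝ s).sum_mem (fun i _ => hw.1 i) hw.2
      fun i _ => subset_convexHull ℝ s (hz i trivial)

/-! ### Seminorms on the plane -/

theorem seminorm_le_norm (f : Seminorm ℝ Plane) : ∃ C : ℝ, 0 < C ∧ ∀ x, f x ≤ C * ‖x‖ := by
  refine ⟨f !₂[1, 0] + f !₂[0, 1] + 1, by positivity, fun x => ?_⟩
  have hx : x = x 0 • (!₂[1, 0] : Plane) + x 1 • (!₂[0, 1] : Plane) := by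
    apply plane_ext <;> simp
  have h0 : |x 0| ≤ ‖x‖ := by simpa using PiLp.norm_apply_le x 0
  have h1 : |x 1| ≤ ‖x‖ := by simpa using PiLp.norm_apply_le x 1
  calc f x ≤ f (x 0 • (!₂[1, 0] : Plane)) + f (x 1 • (!₂[0, 1] : Plane)) := by
        conv_lhs => rw [hx]
        exact map_add_le_add f _ _
    _ = |x 0| * f !₂[1, 0] + |x 1| * f !₂[0, 1] := by
        rw [map_smul_eq_mul, map_smul_eq_mul]; rfl
    _ ≤ ‖x‖ * f !₂[1, 0] + ‖x‖ * f !₂[0, 1] := by gcongr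
    _ ≤ _ := by nlinarith [norm_nonneg x]

theorem abs_seminorm_sub_le {f : Seminorm ℝ Plane} {C : ℝ} (h : ∀ x, f x ≤ C * ‖x‖) (x y : Plane) :
    |f x - f y| ≤ C * ‖x - y‖ :=
  (abs_sub_map_le_sub f x y).trans (h _)

theorem seminorm_le_add {f : Seminorm ℝ Plane} {C : ℝ} (h : ∀ x, f x ≤ C * ‖x‖) (x y : Plane) :
    f x ≤ f y + C * ‖x - y‖ := by
  have := (abs_le.1 (abs_seminorm_sub_le h x y)).2
  linarith

theorem continuous_seminorm (f : Seminorm ℝ Plane) : Continuous f := by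
  obtain ⟨C, hC, h⟩ := seminorm_le_norm f
  refine (LipschitzWith.of_dist_le_mul (K := ⟨C, hC.le⟩) fun x y => ?_).continuous
  rw [Real.dist_eq, dist_eq_norm]
  exact abs_seminorm_sub_le h x y

theorem norm_le_seminorm {f : Seminorm ℝ Plane} (hf : ∀ x, f x = 0 → x = 0) :
    ∃ c : ℝ, 0 < c ∧ ∀ x, c * ‖x‖ ≤ f x := by
  obtain ⟨z, hz, hmin⟩ := (isCompact_sphere (0 : Plane) 1).exists_isMinOn
    ⟨unitVec 0, by simp [norm_unitVec]⟩ (continuous_seminorm f).continuousOn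
  have hz0 : z ≠ 0 := by rintro rfl; simp at hz
  refine ⟨f z, (apply_nonneg f z).lt_of_ne fun h => hz0 (hf z h.symm), fun x => ?_⟩
  rcases eq_or_ne x 0 with rfl | hx
  · simp
  · have hx' := norm_pos_iff.2 hx
    have h1 : f z ≤ f (‖x‖⁻¹ • x) := hmin (by simp [norm_smul, hx])
    rw [map_smul_eq_mul, norm_inv, norm_norm] at h1
    calc f z * ‖x‖ ≤ ‖x‖⁻¹ * f x * ‖x‖ := by gcongr
      _ = f x := by field_simp

/-- Convexity of a seminorm along a ray. -/
theorem seminorm_ray_convex (f : Seminorm ℝ Plane) (x v : Plane) {h h₀ : ℝ} (hh : 0 ≤ h)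
    (hh₀ : h ≤ h₀) (hpos : 0 < h₀) :
    h₀ * f (x + h • v) ≤ (h₀ - h) * f x + h * f (x + h₀ • v) := by
  have key : h₀ • (x + h • v) = (h₀ - h) • x + h • (x + h₀ • v) := by module
  calc h₀ * f (x + h • v) = f (h₀ • (x + h • v)) := by
        rw [map_smul_eq_mul, Real.norm_of_nonneg hpos.le]
    _ ≤ f ((h₀ - h) • x) + f (h • (x + h₀ • v)) := by rw [key]; exact map_add_le_add f _ _
    _ = _ := by
        rw [map_smul_eq_mul, map_smul_eq_mul, Real.norm_of_nonneg (by linarith),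
          Real.norm_of_nonneg hh]

/-! ### Dissipative seminorms -/

/-- The directional derivative of `f` at every `x` in the directions `A x`, `A ∈ 𝒜`, is at most
`-c f x`. -/
def Dissipative (𝒜 : Set Mat) (f : Seminorm ℝ Plane) (c : ℝ) : Prop :=
  ∀ A ∈ 𝒜, ∀ x, ∀ ε > 0, ∃ h₀ > 0, ∀ h, 0 ≤ h → h ≤ h₀ → f (x + h • act A x) ≤ f x + h * (ε - c * f x)

/-- Convexity along the ray: one good step length gives all the shorter ones. -/
theorem ray_le_of_le {f : Seminorm ℝ Plane} {x v : Plane} {h₀ s : ℝ} (hpos : 0 < h₀)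
    (hs : f (x + h₀ • v) ≤ f x + h₀ * s) {h : ℝ} (hh : 0 ≤ h) (hh₀ : h ≤ h₀) :
    f (x + h • v) ≤ f x + h * s := by
  have h1 := seminorm_ray_convex f x v hh hh₀ hpos
  have h2 : h₀ * f (x + h • v) ≤ h₀ * (f x + h * s) := by nlinarith
  exact le_of_mul_le_mul_left h2 hpos

theorem dissipative_of_exists {𝒜 : Set Mat} {f : Seminorm ℝ Plane} {c : ℝ}
    (hf : ∀ A ∈ 𝒜, ∀ x, ∀ ε > 0, ∃ h > 0, f (x + h • act A x) ≤ f x + h * (ε - c * f x)) :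
    Dissipative 𝒜 f c := by
  intro A hA x ε hε
  obtain ⟨h, hh, hle⟩ := hf A hA x ε hε
  exact ⟨h, hh, fun h' h1 h2 => ray_le_of_le hh hle h1 h2⟩

/-- At a fixed point the condition is convex in the matrix, by the triangle inequality and with the
smaller of the two step lengths. -/
theorem Dissipative.convexHull {𝒜 : Set Mat} {f : Seminorm ℝ Plane} {c : ℝ}
    (hf : Dissipative 𝒜 f c) : Dissipative (convexHull ℝ 𝒜) f c := by
  intro A hA x
  have hconv : Convex ℝ {A : Mat | ∀ ε > 0, ∃ h₀ > 0, ∀ h, 0 ≤ h → h ≤ h₀ →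
      f (x + h • act A x) ≤ f x + h * (ε - c * f x)} := by
    intro A hA B hB a b ha hb hab ε hε
    obtain ⟨h₁, h₁pos, h₁le⟩ := hA ε hε
    obtain ⟨h₂, h₂pos, h₂le⟩ := hB ε hε
    refine ⟨min h₁ h₂, lt_min h₁pos h₂pos, fun h hh hle => ?_⟩
    have e : x + h • act (a • A + b • B) x
        = a • (x + h • act A x) + b • (x + h • act B x) := by
      rw [act_add_left, act_smul_left, act_smul_left]
      have : a • (x + h • act A x) + b • (x + h • act B x)
          = (a + b) • x + h • (a • act A x + b • act B x) := by module
      rw [this, hab, one_smul]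
    rw [e]
    calc _ ≤ f (a • (x + h • act A x)) + f (b • (x + h • act B x)) := map_add_le_add f _ _
      _ = a * f (x + h • act A x) + b * f (x + h • act B x) := by
        rw [map_smul_eq_mul, map_smul_eq_mul, Real.norm_of_nonneg ha, Real.norm_of_nonneg hb]
      _ ≤ a * (f x + h * (ε - c * f x)) + b * (f x + h * (ε - c * f x)) := by
        gcongr
        · exact h₁le h hh (hle.trans (min_le_left _ _))
        · exact h₂le h hh (hle.trans (min_le_right _ _))
      _ = _ := by rw [← add_mul, hab, one_mul]
  exact convexHull_min (fun A hA => hf A hA x) hconv hA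

theorem Dissipative.mono {𝒜 ℬ : Set Mat} {f : Seminorm ℝ Plane} {c : ℝ}
    (hf : Dissipative 𝒜 f c) (h : ℬ ⊆ 𝒜) : Dissipative ℬ f c := fun A hA => hf A (h hA)

/-- A nonincreasing criterion for absolutely continuous functions. -/
theorem le_of_ae_deriv_nonpos {y : ℝ → ℝ} {a b : ℝ} (hab : a ≤ b)
    (hy : AbsolutelyContinuousOnInterval y a b)
    (h : ∀ᵐ t, t ∈ Set.Ioo a b → ∀ d, HasDerivAt y d t → d ≤ 0) : y b ≤ y a := by
  have h1 := hy.integral_deriv_eq_sub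
  have h2 : ∫ t in a..b, deriv y t ≤ ∫ t in a..b, (0 : ℝ) := by
    refine intervalIntegral.integral_mono_ae_restrict hab hy.intervalIntegrable_deriv (by simp) ?_
    have hne : ∀ᵐ t : ℝ, t ≠ a ∧ t ≠ b := by
      have : ({a, b} : Set ℝ)ᶜ ∈ ae volume :=
        compl_mem_ae_iff.2 ((Set.toFinite {a, b}).measure_zero volume)
      filter_upwards [this] with t ht
      simpa [not_or] using ht
    refine (ae_restrict_iff' measurableSet_Icc).2 ?_
    filter_upwards [h, hy.ae_differentiableAt, hne] with t ht hd hne hmem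
    rw [Set.uIcc_of_le hab] at hd
    exact ht ⟨hmem.1.lt_of_ne hne.1.symm, hmem.2.lt_of_ne hne.2⟩ _ (hd hmem).hasDerivAt
  simp only [intervalIntegral.integral_zero] at h2
  linarith

/-! ### Regularity of trajectories and the decay of dissipative seminorms along them -/

theorem IsTrajectory.continuousOn {𝒜 : Set Mat} {x : ℝ → Plane} (hx : IsTrajectory 𝒜 x) (T : ℝ) :
    ContinuousOn x (Set.Icc 0 T) := by
  obtain ⟨law, -, -, h⟩ := hx
  rcases lt_or_ge T 0 with hT | hT
  · simp [Set.Icc_eq_empty_of_lt hT]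
  · have h1 := intervalIntegral.continuousOn_primitive_interval' (h T hT).1 (Set.left_mem_uIcc)
    rw [Set.uIcc_of_le hT] at h1
    exact (continuousOn_const.add h1).congr fun t ht => (h t ht.1).2

theorem IsTrajectory.exists_lipschitz {𝒜 : Set Mat} {K : ℝ}
    (hK : ∀ A ∈ 𝒜, ∀ x, ‖act A x‖ ≤ K * ‖x‖) (hK0 : 0 ≤ K) {x : ℝ → Plane}
    (hx : IsTrajectory 𝒜 x) (T : ℝ) :
    ∃ M : ℝ, 0 ≤ M ∧ (∀ s ∈ Set.Icc 0 T, ‖x s‖ ≤ M) ∧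
      ∀ s ∈ Set.Icc 0 T, ∀ t ∈ Set.Icc 0 T, ‖x t - x s‖ ≤ K * M * |t - s| := by
  obtain ⟨M, hM⟩ := isCompact_Icc.exists_bound_of_continuousOn (hx.continuousOn T)
  obtain ⟨law, -, hlaw, h⟩ := hx
  refine ⟨max M 0, le_max_right _ _, fun s hs => (hM s hs).trans (le_max_left _ _),
    fun s hs t ht => ?_⟩
  have e : x t - x s = ∫ τ in s..t, act (law τ) (x τ) := by
    rw [(h t ht.1).2, (h s hs.1).2, add_sub_add_left_eq_sub,
      intervalIntegral.integral_interval_sub_left (h t ht.1).1 (h s hs.1).1]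
  rw [e]
  refine intervalIntegral.norm_integral_le_of_norm_le_const fun τ hτ => ?_
  have hτ' : τ ∈ Set.Icc 0 T := by
    have := Set.uIoc_subset_uIcc hτ
    exact (Set.uIcc_subset_Icc hs ht) this
  calc _ ≤ K * ‖x τ‖ := hK _ (hlaw τ hτ'.1) _
    _ ≤ K * max M 0 := by gcongr; exact (hM τ hτ').trans (le_max_left _ _)

theorem IsTrajectory.ae_hasDerivAt {law : ℝ → Mat} {x : ℝ → Plane}
    (h : ∀ t, 0 ≤ t → IntervalIntegrable (fun τ => act (law τ) (x τ)) volume 0 t ∧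
      x t = x 0 + ∫ τ in (0 : ℝ)..t, act (law τ) (x τ)) {T : ℝ} (hT : 0 ≤ T) :
    ∀ᵐ t, t ∈ Set.Ioo 0 T → HasDerivAt x (act (law t) (x t)) t := by
  filter_upwards [(h T hT).1.ae_hasDerivAt_integral] with t ht hmem
  have h1 := (ht (by rw [Set.uIcc_of_le hT]; exact Set.Ioo_subset_Icc_self hmem) 0
    Set.left_mem_uIcc).const_add (x 0)
  refine h1.congr_of_eventuallyEq ?_
  filter_upwards [lt_mem_nhds hmem.1] with s hs
  exact (h s hs.le).2

/-- A dissipative seminorm decays along trajectories. -/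
theorem Dissipative.le_exp {𝒜 : Set Mat} {f : Seminorm ℝ Plane} {c K : ℝ}
    (hf : Dissipative 𝒜 f c) (hK : ∀ A ∈ 𝒜, ∀ x, ‖act A x‖ ≤ K * ‖x‖) (hK0 : 0 ≤ K)
    {x : ℝ → Plane} (hx : IsTrajectory 𝒜 x) {T : ℝ} (hT : 0 ≤ T) :
    f (x T) ≤ Real.exp (-c * T) * f (x 0) := by
  obtain ⟨M, hM0, hM, hlip⟩ := hx.exists_lipschitz hK hK0 T
  obtain ⟨C, hC0, hC⟩ := seminorm_le_norm f
  obtain ⟨law, -, hlaw, hint⟩ := hx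
  -- The function `exp (c t) * f (x t)` is absolutely continuous, so the sign of its derivative
  -- almost everywhere decides its monotonicity.
  have hacf : AbsolutelyContinuousOnInterval (fun t => f (x t)) 0 T := by
    refine LipschitzOnWith.absolutelyContinuousOnInterval (K := ⟨C * (K * M), by positivity⟩) ?_
    refine LipschitzOnWith.of_dist_le_mul fun s hs t ht => ?_
    rw [Set.uIcc_of_le hT] at hs ht
    rw [Real.dist_eq, Real.dist_eq]
    calc |f (x s) - f (x t)| ≤ C * ‖x s - x t‖ := abs_seminorm_sub_le hC _ _
      _ ≤ C * (K * M * |s - t|) := by gcongr; exact hlip t ht s hs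
      _ = C * (K * M) * |s - t| := by ring
  have hexp : AbsolutelyContinuousOnInterval (fun t => Real.exp (c * t)) 0 T :=
    ContDiffOn.absolutelyContinuousOnInterval (by fun_prop)
  have hz := hexp.mul hacf
  have key : ((fun t => Real.exp (c * t)) * fun t => f (x t)) T ≤
      ((fun t => Real.exp (c * t)) * fun t => f (x t)) 0 := by
    refine le_of_ae_deriv_nonpos hT hz ?_
    filter_upwards [IsTrajectory.ae_hasDerivAt hint hT, hacf.ae_differentiableAt] with t ht hd hmem d hdz
    have hy := (hd (by rw [Set.uIcc_of_le hT]; exact Set.Ioo_subset_Icc_self hmem)).hasDerivAt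
    have hx' := ht hmem
    set y : ℝ → ℝ := fun t => f (x t)
    set d' := deriv y t
    have hd' : d' ≤ -c * y t := by
      refine le_of_forall_pos_le_add fun ε hε => ?_
      obtain ⟨h₀, h₀pos, hle⟩ := hf (law t) (hlaw t hmem.1.le) (x t) ε hε
      have s1 : Tendsto (fun h => h⁻¹ * (y (t + h) - y t)) (𝓝[>] 0) (𝓝 d') := by
        have := hy.tendsto_slope_zero_right
        simpa using this
      have s2 : Tendsto (fun h => h⁻¹ • (x (t + h) - x t)) (𝓝[>] 0) (𝓝 (act (law t) (x t))) :=
        hx'.tendsto_slope_zero_right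
      -- The curve is compared with its tangent ray, on which dissipativity gives the bound; the
      -- error is `o(h)` and disappears in the difference quotient.
      have s3 : Tendsto (fun h => (ε - c * y t) +
          C * ‖h⁻¹ • (x (t + h) - x t) - act (law t) (x t)‖) (𝓝[>] 0)
          (𝓝 ((ε - c * y t) + C * ‖act (law t) (x t) - act (law t) (x t)‖)) :=
        ((s2.sub_const _).norm.const_mul C).const_add _
      rw [sub_self, norm_zero, mul_zero, add_zero] at s3
      have := le_of_tendsto_of_tendsto s1 s3 ?_
      · linarith
      filter_upwards [self_mem_nhdsWithin, nhdsWithin_le_nhds (Iic_mem_nhds h₀pos)] with h hh hh'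
      have hh0 : 0 < h := hh
      have h1 := hle h hh0.le hh'
      have h2 := seminorm_le_add hC (x (t + h)) (x t + h • act (law t) (x t))
      have e : x (t + h) - (x t + h • act (law t) (x t))
          = h • (h⁻¹ • (x (t + h) - x t) - act (law t) (x t)) := by
        rw [smul_sub, smul_smul, mul_inv_cancel₀ hh0.ne', one_smul]; abel
      rw [e, norm_smul, Real.norm_of_nonneg hh0.le] at h2
      rw [inv_mul_le_iff₀ hh0]
      calc y (t + h) - y t ≤ h * (ε - c * f (x t)) + C * (h * _) := by
            simp only [y]; linarith
        _ = _ := by simp only [y]; ring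
    have hprod : HasDerivAt ((fun t => Real.exp (c * t)) * y)
        (Real.exp (c * t) * c * y t + Real.exp (c * t) * d') t := by
      have he : HasDerivAt (fun t => Real.exp (c * t)) (Real.exp (c * t) * c) t := by
        simpa using ((hasDerivAt_id t).const_mul c).exp
      exact he.mul hy
    rw [hdz.unique hprod]
    have := Real.exp_pos (c * t)
    nlinarith
  simp only [Pi.mul_apply, mul_zero, Real.exp_zero, one_mul] at key
  rw [neg_mul, Real.exp_neg, ← div_eq_inv_mul, le_div_iff₀ (Real.exp_pos _)]
  linarith

/-- The Euclidean norm as a dissipative seminorm with a negative rate. -/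
theorem dissipative_norm {𝒜 : Set Mat} {K : ℝ} (hK : ∀ A ∈ 𝒜, ∀ x, ‖act A x‖ ≤ K * ‖x‖) :
    Dissipative 𝒜 (normSeminorm ℝ Plane) (-K) := by
  refine dissipative_of_exists fun A hA x ε hε => ⟨1, one_pos, ?_⟩
  simp only [coe_normSeminorm, one_smul, one_mul]
  linarith [norm_add_le x (act A x), hK A hA x]

/-! ### Piecewise constant switching laws -/

/-- The flow `exp (t A)`. -/
noncomputable def flow (A : Mat) (t : ℝ) : Plane →L[ℝ] Plane := NormedSpace.exp (t • op A)

theorem flow_zero (A : Mat) (x : Plane) : flow A 0 x = x := by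
  have h : (0 : ℝ) • op A = 0 := zero_smul ℝ (op A)
  rw [flow, h, NormedSpace.exp_zero]
  rfl

theorem flow_add (A : Mat) (s t : ℝ) (x : Plane) : flow A (s + t) x = flow A s (flow A t x) := by
  have h : (s + t) • op A = s • op A + t • op A := add_smul s t (op A)
  have hcomm : Commute (s • op A) (t • op A) := by
    ext1 y
    change s • op A (t • op A y) = t • op A (s • op A y)
    rw [map_smul, map_smul, smul_comm]
  let : NormedAlgebra ℚ (Plane →L[ℝ] Plane) := NormedAlgebra.restrictScalars ℚ ℝ _
  rw [flow, h, NormedSpace.exp_add_of_commute hcomm]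
  rfl

theorem flow_neg_flow (A : Mat) (t : ℝ) (x : Plane) : flow A (-t) (flow A t x) = x := by
  rw [← flow_add, neg_add_cancel, flow_zero]

theorem hasDerivAt_flow (A : Mat) (x : Plane) (t : ℝ) :
    HasDerivAt (fun s => flow A s x) (act A (flow A t x)) t := by
  have h := hasDerivAt_exp_smul_const' (op A) t
  exact h.clm_apply (hasDerivAt_const t x) |>.congr_deriv (by simp [flow, act_eq_op])

theorem continuous_flow (A : Mat) (x : Plane) : Continuous fun s => flow A s x :=
  continuous_iff_continuousAt.2 fun t => (hasDerivAt_flow A x t).continuousAt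

theorem intervalIntegrable_act {law : ℝ → Mat} {x : ℝ → Plane} {K T : ℝ} (hT : 0 ≤ T)
    (hmeas : ∀ i j, Measurable fun t => law t i j)
    (hK : ∀ t, 0 ≤ t → ∀ y, ‖act (law t) y‖ ≤ K * ‖y‖) (hK0 : 0 ≤ K)
    (hx : ContinuousOn x (Set.Icc 0 T)) :
    IntervalIntegrable (fun τ => act (law τ) (x τ)) volume 0 T := by
  rw [intervalIntegrable_iff_integrableOn_Icc_of_le hT]
  obtain ⟨M, hM⟩ := isCompact_Icc.exists_bound_of_continuousOn hx
  refine Integrable.of_bound ?_ (K * M) ?_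
  · have hxm : AEMeasurable x (volume.restrict (Set.Icc 0 T)) := hx.aemeasurable measurableSet_Icc
    have hxi : ∀ i, AEMeasurable (fun t => x t i) (volume.restrict (Set.Icc 0 T)) := fun i =>
      (EuclideanSpace.proj (𝕜 := ℝ) i : Plane →L[ℝ] ℝ).continuous.measurable.comp_aemeasurable hxm
    have hpi : AEMeasurable (fun t => (fun i => act (law t) (x t) i))
        (volume.restrict (Set.Icc 0 T)) := by
      refine aemeasurable_pi_lambda _ fun i => ?_
      simp only [act_apply]
      exact ((hmeas i 0).aemeasurable.mul (hxi 0)).add ((hmeas i 1).aemeasurable.mul (hxi 1))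
    have h := ((PiLp.continuous_toLp 2 fun _ : Fin 2 => ℝ).measurable.comp_aemeasurable
      hpi).aestronglyMeasurable
    exact h
  · refine (ae_restrict_iff' measurableSet_Icc).2 (Eventually.of_forall fun t ht => ?_)
    calc _ ≤ K * ‖x t‖ := hK t ht.1 _
      _ ≤ K * M := by gcongr; exact hM t ht

/-- A continuous curve with the right derivative given by a measurable law is a trajectory. -/
theorem isTrajectory_of_hasDerivWithinAt {𝒜 : Set Mat} (hcomp : IsCompact 𝒜) {law : ℝ → Mat}
    {x : ℝ → Plane} (hmeas : ∀ i j, Measurable fun t => law t i j)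
    (hlaw : ∀ t, 0 ≤ t → law t ∈ 𝒜) (hx : ∀ T, 0 ≤ T → ContinuousOn x (Set.Icc 0 T))
    (hd : ∀ t, 0 ≤ t → HasDerivWithinAt x (act (law t) (x t)) (Set.Ioi t) t) :
    IsTrajectory 𝒜 x := by
  obtain ⟨K, hK0, hK⟩ := exists_act_bound hcomp
  refine ⟨law, hmeas, hlaw, fun T hT => ?_⟩
  have hint := intervalIntegrable_act hT hmeas (fun t ht => hK _ (hlaw t ht)) hK0.le (hx T hT)
  refine ⟨hint, ?_⟩
  have := intervalIntegral.integral_eq_sub_of_hasDeriv_right (f := x)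
    (f' := fun τ => act (law τ) (x τ)) (a := 0) (b := T) (by rw [Set.uIcc_of_le hT]; exact hx T hT)
    (fun t ht => hd t (by rw [min_eq_left hT] at ht; exact ht.1.le)) hint
  rw [this]; abel

theorem isTrajectory_const {𝒜 : Set Mat} (hcomp : IsCompact 𝒜) {A : Mat} (hA : A ∈ 𝒜)
    {x : ℝ → Plane} (hx : ∀ t, HasDerivAt x (act A (x t)) t) : IsTrajectory 𝒜 x :=
  isTrajectory_of_hasDerivWithinAt hcomp (law := fun _ => A) (fun _ _ => measurable_const)
    (fun _ _ => hA) (fun _ _ t _ => (hx t).continuousAt.continuousWithinAt)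
    (fun t _ => (hx t).hasDerivWithinAt)

theorem isTrajectory_flow {𝒜 : Set Mat} (hcomp : IsCompact 𝒜) {A : Mat} (hA : A ∈ 𝒜) (x : Plane) :
    IsTrajectory 𝒜 fun t => flow A t x :=
  isTrajectory_const hcomp hA fun t => hasDerivAt_flow A x t

theorem Dissipative.flow_le {𝒜 : Set Mat} (hcomp : IsCompact 𝒜) {f : Seminorm ℝ Plane} {c : ℝ}
    (hf : Dissipative 𝒜 f c) {A : Mat} (hA : A ∈ 𝒜) {t : ℝ} (ht : 0 ≤ t) (x : Plane) :
    f (flow A t x) ≤ Real.exp (-c * t) * f x := by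
  obtain ⟨K, hK0, hK⟩ := exists_act_bound hcomp
  simpa [flow_zero] using hf.le_exp hK hK0.le (isTrajectory_flow hcomp hA x) ht

theorem norm_flow_le {𝒜 : Set Mat} (hcomp : IsCompact 𝒜) {K : ℝ}
    (hK : ∀ A ∈ 𝒜, ∀ x, ‖act A x‖ ≤ K * ‖x‖) {A : Mat} (hA : A ∈ 𝒜) {t : ℝ} (ht : 0 ≤ t)
    (x : Plane) : ‖flow A t x‖ ≤ Real.exp (K * t) * ‖x‖ := by
  simpa using (dissipative_norm hK).flow_le hcomp hA ht x

theorem norm_flow_sub_le {𝒜 : Set Mat} (hcomp : IsCompact 𝒜) {K : ℝ} (hK0 : 0 ≤ K)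
    (hK : ∀ A ∈ 𝒜, ∀ x, ‖act A x‖ ≤ K * ‖x‖) {A : Mat} (hA : A ∈ 𝒜) {t : ℝ} (ht : 0 ≤ t)
    (ht1 : t ≤ 1) (x : Plane) : ‖flow A t x - x‖ ≤ K * Real.exp K * ‖x‖ * t := by
  have := norm_image_sub_le_of_norm_deriv_le_segment' (f := fun s => flow A s x)
    (f' := fun s => act A (flow A s x)) (a := 0) (b := t) (C := K * Real.exp K * ‖x‖)
    (fun s _ => (hasDerivAt_flow A x s).hasDerivWithinAt) (fun s hs => ?_) t ⟨ht, le_rfl⟩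
  · simpa [flow_zero] using this
  · calc _ ≤ K * ‖flow A s x‖ := hK A hA _
      _ ≤ K * (Real.exp (K * s) * ‖x‖) := by gcongr; exact norm_flow_le hcomp hK hA hs.1 x
      _ ≤ K * (Real.exp (K * 1) * ‖x‖) := by
        gcongr; linarith [hs.2]
      _ = _ := by rw [mul_one]; ring

theorem norm_flow_sub_sub_le {𝒜 : Set Mat} (hcomp : IsCompact 𝒜) {K : ℝ} (hK0 : 0 ≤ K)
    (hK : ∀ A ∈ 𝒜, ∀ x, ‖act A x‖ ≤ K * ‖x‖) {A : Mat} (hA : A ∈ 𝒜) {t : ℝ} (ht : 0 ≤ t)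
    (ht1 : t ≤ 1) (x : Plane) :
    ‖flow A t x - (x + t • act A x)‖ ≤ K ^ 2 * Real.exp K * ‖x‖ * t ^ 2 := by
  have := norm_image_sub_le_of_norm_deriv_le_segment'
    (f := fun s => flow A s x - (x + s • act A x))
    (f' := fun s => act A (flow A s x) - act A x) (a := 0) (b := t)
    (C := K * (K * Real.exp K * ‖x‖ * t))
    (fun s _ => ?_) (fun s hs => ?_) t ⟨ht, le_rfl⟩
  · simp only [flow_zero, zero_smul, add_zero, sub_self, sub_zero] at this
    calc _ ≤ _ := this
      _ = _ := by ring
  · have h1 := (hasDerivAt_flow A x s).sub (((hasDerivAt_id s).smul_const (act A x)).const_add x)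
    simp only [one_smul] at h1
    exact h1.hasDerivWithinAt
  · rw [← act_sub_right]
    calc _ ≤ K * ‖flow A s x - x‖ := hK A hA _
      _ ≤ K * (K * Real.exp K * ‖x‖ * s) := by
        gcongr; exact norm_flow_sub_le hcomp hK0 hK hA hs.1 (hs.2.le.trans ht1) x
      _ ≤ _ := by gcongr; exact hs.2.le

/-- A seminorm that does not increase (up to the factor `exp (-c t)`) along the flows is
dissipative. -/
theorem dissipative_of_flow_le {𝒜 : Set Mat} (hcomp : IsCompact 𝒜) {f : Seminorm ℝ Plane} {c : ℝ}
    (hf : ∀ A ∈ 𝒜, ∀ x, ∀ ε > 0, ∃ t₀ > 0, ∀ t, 0 < t → t ≤ t₀ →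
      f (flow A t x) ≤ f x + t * (ε - c * f x)) :
    Dissipative 𝒜 f c := by
  obtain ⟨K, hK0, hK⟩ := exists_act_bound hcomp
  obtain ⟨C, hC0, hC⟩ := seminorm_le_norm f
  refine dissipative_of_exists fun A hA x ε hε => ?_
  obtain ⟨t₀, ht₀, hle⟩ := hf A hA x (ε / 2) (by linarith)
  set Q := C * (K ^ 2 * Real.exp K * ‖x‖) with hQ
  have hQ0 : 0 ≤ Q := by positivity
  -- Replacing the flow by the tangent ray costs at most `Q * t ^ 2`; this `t` makes the cost at
  -- most `t * ε / 2`, the half of `ε` that was kept in reserve.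
  set t := min (min t₀ 1) (ε / (2 * (Q + 1)))
  have ht : 0 < t := by positivity
  have ht1 : t ≤ 1 := (min_le_left _ _).trans (min_le_right _ _)
  have ht2 : t * (Q + 1) ≤ ε / 2 := by
    have : t ≤ ε / (2 * (Q + 1)) := min_le_right _ _
    rw [le_div_iff₀ (by positivity)] at this
    linarith
  refine ⟨t, ht, ?_⟩
  have h1 := seminorm_le_add hC (x + t • act A x) (flow A t x)
  have h2 := hle t ht ((min_le_left _ _).trans (min_le_left _ _))
  have h3 := norm_flow_sub_sub_le hcomp hK0.le hK hA ht.le ht1 x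
  rw [norm_sub_rev] at h3
  have h4 : C * ‖x + t • act A x - flow A t x‖ ≤ Q * t ^ 2 := by
    calc _ ≤ C * (K ^ 2 * Real.exp K * ‖x‖ * t ^ 2) := by gcongr
      _ = _ := by rw [hQ]; ring
  nlinarith

/-- The switching points of the piecewise constant law `w` with step `δ`, started at `x`. -/
noncomputable def node (w : ℕ → Mat) (δ : ℝ) (x : Plane) : ℕ → Plane
  | 0 => x
  | n + 1 => flow (w n) δ (node w δ x n)

/-- The trajectory of the piecewise constant law `w` with step `δ`, started at `x`. -/
noncomputable def stepTrajectory (w : ℕ → Mat) (δ : ℝ) (x : Plane) (t : ℝ) : Plane :=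
  flow (w ⌊t / δ⌋₊) (t - ⌊t / δ⌋₊ * δ) (node w δ x ⌊t / δ⌋₊)

theorem stepTrajectory_eq (w : ℕ → Mat) {δ : ℝ} (hδ : 0 < δ) (x : Plane) (n : ℕ) {t : ℝ}
    (ht : t ∈ Set.Icc (n * δ) ((n + 1) * δ)) :
    stepTrajectory w δ x t = flow (w n) (t - n * δ) (node w δ x n) := by
  rcases ht.2.lt_or_eq with hlt | rfl
  · have : ⌊t / δ⌋₊ = n := by
      rw [Nat.floor_eq_iff (div_nonneg ((by positivity : (0 : ℝ) ≤ n * δ).trans ht.1) hδ.le)]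
      exact ⟨(le_div_iff₀ hδ).2 ht.1, (div_lt_iff₀ hδ).2 hlt⟩
    rw [stepTrajectory, this]
  -- At the right end the floor has already jumped to `n + 1`; the flow for zero time from the next
  -- node gives the same point.
  · have : ⌊((n : ℝ) + 1) * δ / δ⌋₊ = n + 1 := by
      rw [mul_div_assoc, div_self hδ.ne', mul_one]
      exact_mod_cast Nat.floor_natCast (R := ℝ) (n + 1)
    rw [stepTrajectory, this]
    push_cast
    rw [sub_self, flow_zero, node]
    congr 1
    ring_nf

theorem node_cons_succ (A : Mat) (w : ℕ → Mat) (δ : ℝ) (x : Plane) (n : ℕ) :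
    node (fun i => Nat.casesOn i A w) δ x (n + 1) = node w δ (flow A δ x) n := by
  induction n with
  | zero => rfl
  | succ n ih => rw [node, ih]; rfl

theorem node_tail (w : ℕ → Mat) (δ : ℝ) (x : Plane) (n : ℕ) :
    node w δ x (n + 1) = node (fun i => w (i + 1)) δ (flow (w 0) δ x) n := by
  induction n with
  | zero => rfl
  | succ n ih => rw [node, ih]; rfl

theorem node_congr {w w' : ℕ → Mat} (δ : ℝ) (x : Plane) {n : ℕ} (h : ∀ i < n, w i = w' i) :
    node w δ x n = node w' δ x n := by
  induction n with
  | zero => rfl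
  | succ n ih => rw [node, node, ih fun i hi => h i (hi.trans n.lt_succ_self), h n n.lt_succ_self]

theorem node_append (w w' : ℕ → Mat) (δ : ℝ) (x : Plane) (k n : ℕ) :
    node (fun i => if i < k then w i else w' (i - k)) δ x (k + n)
      = node w' δ (node w δ x k) n := by
  induction n with
  | zero => exact node_congr δ x fun i hi => if_pos hi
  | succ n ih =>
    rw [← add_assoc, node, ih, node]
    simp

theorem node_add (w : ℕ → Mat) (δ : ℝ) (x y : Plane) (n : ℕ) :
    node w δ (x + y) n = node w δ x n + node w δ y n := by
  induction n with
  | zero => rfl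
  | succ n ih => rw [node, ih, map_add]; rfl

theorem node_smul (w : ℕ → Mat) (δ : ℝ) (c : ℝ) (x : Plane) (n : ℕ) :
    node w δ (c • x) n = c • node w δ x n := by
  induction n with
  | zero => rfl
  | succ n ih => rw [node, ih, map_smul]; rfl

theorem stepTrajectory_node (w : ℕ → Mat) {δ : ℝ} (hδ : 0 < δ) (x : Plane) (n : ℕ) :
    stepTrajectory w δ x (n * δ) = node w δ x n := by
  rw [stepTrajectory_eq w hδ x n ⟨le_rfl, by nlinarith⟩, sub_self, flow_zero]

theorem continuousOn_stepTrajectory (w : ℕ → Mat) {δ : ℝ} (hδ : 0 < δ) (x : Plane) (n : ℕ) :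
    ContinuousOn (stepTrajectory w δ x) (Set.Icc 0 (n * δ)) := by
  induction n with
  | zero => simp
  | succ n ih =>
    have hU : Set.Icc 0 (((n + 1 : ℕ) : ℝ) * δ)
        = Set.Icc 0 (n * δ) ∪ Set.Icc (n * δ) ((n + 1) * δ) := by
      push_cast
      rw [Set.Icc_union_Icc_eq_Icc (by positivity) (by nlinarith)]
    rw [hU]
    refine ih.union_of_isClosed ?_ isClosed_Icc isClosed_Icc
    refine ContinuousOn.congr (f := fun t => flow (w n) (t - n * δ) (node w δ x n)) ?_
      fun t ht => stepTrajectory_eq w hδ x n ht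
    exact ((continuous_flow (w n) (node w δ x n)).comp (continuous_id.sub continuous_const)).continuousOn

theorem isTrajectory_stepTrajectory {𝒜 : Set Mat} (hcomp : IsCompact 𝒜) {w : ℕ → Mat}
    (hw : ∀ n, w n ∈ 𝒜) {δ : ℝ} (hδ : 0 < δ) (x : Plane) :
    IsTrajectory 𝒜 (stepTrajectory w δ x) := by
  refine isTrajectory_of_hasDerivWithinAt hcomp (law := fun t => w ⌊t / δ⌋₊) (fun i j => ?_)
    (fun t _ => hw _) (fun T hT => ?_) (fun t ht => ?_)
  · exact (measurable_from_nat (f := fun n => w n i j)).comp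
      (Nat.measurable_floor.comp (measurable_id.div_const δ))
  · obtain ⟨n, hn⟩ := exists_nat_ge (T / δ)
    exact (continuousOn_stepTrajectory w hδ x n).mono
      (Set.Icc_subset_Icc_right ((div_le_iff₀ hδ).1 hn))
  · set n := ⌊t / δ⌋₊
    have h1 : (n : ℝ) * δ ≤ t := (le_div_iff₀ hδ).1 (Nat.floor_le (by positivity))
    have h2 : t < (n + 1) * δ := (div_lt_iff₀ hδ).1 (Nat.lt_floor_add_one _)
    have h3 : HasDerivAt (fun s => flow (w n) (s - n * δ) (node w δ x n))
        (act (w n) (stepTrajectory w δ x t)) t := by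
      rw [stepTrajectory_eq w hδ x n ⟨h1, h2.le⟩]
      simpa using (hasDerivAt_flow (w n) (node w δ x n) (t - n * δ)).comp_sub_const t (n * δ)
    refine h3.hasDerivWithinAt.congr_of_eventuallyEq ?_
      (stepTrajectory_eq w hδ x n ⟨h1, h2.le⟩)
    filter_upwards [self_mem_nhdsWithin, nhdsWithin_le_nhds (Iio_mem_nhds h2)] with s hs hs'
    exact stepTrajectory_eq w hδ x n ⟨h1.trans (le_of_lt hs), (Set.mem_Iio.1 hs').le⟩

/-! ### The Lyapunov exponent -/

/-- The set of growth exponents of the system. -/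
def growthExponents (𝒜 : Set Mat) : Set ℝ :=
  {σ : ℝ | ∀ x : ℝ → Plane, IsTrajectory 𝒜 x → ∃ C : ℝ, ∀ t, 0 ≤ t → ‖x t‖ ≤ C * Real.exp (σ * t)}

theorem IsIrreducibleFamily.nonempty {𝒜 : Set Mat} (h : IsIrreducibleFamily 𝒜) : 𝒜.Nonempty := by
  by_contra hne
  rw [Set.not_nonempty_iff_eq_empty] at hne
  subst hne
  have h0 : unitVec 0 ≠ 0 := fun h0 => by simpa [h0] using norm_unitVec 0
  rcases h (Submodule.span ℝ {unitVec 0}) (by simp) with h | h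
  · exact h0 (Submodule.span_singleton_eq_bot.1 h)
  · have h1 := finrank_span_singleton (K := ℝ) h0
    rw [h, finrank_top, finrank_euclideanSpace_fin] at h1
    omega

/-- Time reversal: a flow run backwards is a trajectory of `-A`, which grows at most like `exp (K
t)`. Hence no flow decays faster than `exp (-K t)`. -/
theorem bddBelow_growthExponents {𝒜 : Set Mat} (hcomp : IsCompact 𝒜) (hne : 𝒜.Nonempty) :
    BddBelow (growthExponents 𝒜) := by
  obtain ⟨K, hK0, hK⟩ := exists_act_bound hcomp
  obtain ⟨A, hA⟩ := hne
  refine ⟨-K, fun σ hσ => ?_⟩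
  by_contra! hlt
  obtain ⟨C, hC⟩ := hσ _ (isTrajectory_flow hcomp hA (unitVec 0))
  have hlow : ∀ t, 0 ≤ t → 1 ≤ C * Real.exp ((σ + K) * t) := by
    intro t ht
    have htraj : IsTrajectory {-A} fun s => flow A (t - s) (unitVec 0) := by
      refine isTrajectory_const isCompact_singleton rfl fun s => ?_
      refine ((hasDerivAt_flow A (unitVec 0) (t - s)).scomp s
        ((hasDerivAt_id s).const_sub t)).congr_deriv ?_
      simp [act]
    have hb : ∀ B ∈ ({-A} : Set Mat), ∀ x, ‖act B x‖ ≤ K * ‖x‖ := by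
      rintro B rfl x
      have : act (-A) x = -act A x := by simp [act]
      rw [this, norm_neg]
      exact hK A hA x
    have h2 := (dissipative_norm hb).le_exp hb hK0.le htraj ht
    simp only [coe_normSeminorm, sub_self, flow_zero, sub_zero, norm_unitVec, neg_neg] at h2
    calc (1 : ℝ) ≤ Real.exp (K * t) * ‖flow A t (unitVec 0)‖ := h2
      _ ≤ Real.exp (K * t) * (C * Real.exp (σ * t)) := by gcongr; exact hC t ht
      _ = C * (Real.exp (σ * t) * Real.exp (K * t)) := by ring
      _ = _ := by rw [← Real.exp_add]; ring_nf
  have hlim : Tendsto (fun t : ℝ => C * Real.exp ((σ + K) * t)) atTop (𝓝 (C * 0)) :=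
    (Real.tendsto_exp_atBot.comp (tendsto_id.const_mul_atTop_of_neg (by linarith))).const_mul C
  rw [mul_zero] at hlim
  have := ge_of_tendsto hlim (by filter_upwards [eventually_ge_atTop 0] with t ht using hlow t ht)
  linarith

theorem nonempty_growthExponents {𝒜 : Set Mat} (hcomp : IsCompact 𝒜) :
    (growthExponents 𝒜).Nonempty := by
  obtain ⟨K, hK0, hK⟩ := exists_act_bound hcomp
  refine ⟨K, fun x hx => ⟨‖x 0‖, fun t ht => ?_⟩⟩
  have := (dissipative_norm hK).le_exp hK hK0.le hx ht
  simp only [coe_normSeminorm, neg_neg] at this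
  linarith

theorem lyapunovExponent_le_of_dissipative {𝒜 : Set Mat} (hcomp : IsCompact 𝒜) (hne : 𝒜.Nonempty)
    {f : Seminorm ℝ Plane} (hdef : ∀ x, f x = 0 → x = 0) {c : ℝ} (hf : Dissipative 𝒜 f c) :
    lyapunovExponent 𝒜 ≤ -c := by
  obtain ⟨K, hK0, hK⟩ := exists_act_bound hcomp
  obtain ⟨m, hm0, hm⟩ := norm_le_seminorm hdef
  refine csInf_le (bddBelow_growthExponents hcomp hne) fun x hx => ⟨m⁻¹ * f (x 0), fun t ht => ?_⟩
  have h1 := hf.le_exp hK hK0.le hx ht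
  have h2 := hm (x t)
  calc ‖x t‖ = m⁻¹ * (m * ‖x t‖) := by field_simp
    _ ≤ m⁻¹ * (Real.exp (-c * t) * f (x 0)) :=
      mul_le_mul_of_nonneg_left (h2.trans h1) (by positivity)
    _ = _ := by ring

/-! ### Limits along an ultrafilter -/

/-- A fixed ultrafilter replaces the choice of subsequences: the limits along it exist for all
points, times and matrices at once and are compatible with each other. -/
theorem exists_hyperfilter_limit {X : Type*} [TopologicalSpace X] {s : Set X} (hs : IsCompact s)
    {u : ℕ → X} (hu : ∀ n, u n ∈ s) : ∃ a ∈ s, Tendsto u (hyperfilter ℕ) (𝓝 a) := by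
  have := hs.ultrafilter_le_nhds ((hyperfilter ℕ).map u) (by
    exact le_principal_iff.2 (mem_map.2 (univ_mem' hu)))
  exact this

theorem exists_hyperfilter_limit_real {u : ℕ → ℝ} {a b : ℝ} (hu : ∀ n, u n ∈ Set.Icc a b) :
    ∃ l ∈ Set.Icc a b, Tendsto u (hyperfilter ℕ) (𝓝 l) :=
  exists_hyperfilter_limit isCompact_Icc hu

theorem tendsto_hyperfilter {X : Type*} [TopologicalSpace X] {u : ℕ → X} {a : X}
    (h : Tendsto u atTop (𝓝 a)) : Tendsto u (hyperfilter ℕ) (𝓝 a) :=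
  h.mono_left (Nat.hyperfilter_le_atTop)

theorem exists_seminorm_limit {q : ℕ → Seminorm ℝ Plane} {C : ℝ} (hq : ∀ n x, q n x ≤ C * ‖x‖) :
    ∃ p : Seminorm ℝ Plane, ∀ x, Tendsto (fun n => q n x) (hyperfilter ℕ) (𝓝 (p x)) := by
  have h : ∀ x, ∃ l, Tendsto (fun n => q n x) (hyperfilter ℕ) (𝓝 l) := fun x =>
    let ⟨l, _, hl⟩ := exists_hyperfilter_limit_real (a := 0) (b := C * ‖x‖)
      fun n => ⟨apply_nonneg (q n) x, hq n x⟩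
    ⟨l, hl⟩
  choose p hp using h
  refine ⟨Seminorm.of p (fun x y => ?_) (fun c x => ?_), hp⟩
  · exact le_of_tendsto_of_tendsto' (hp (x + y)) ((hp x).add (hp y)) fun n => map_add_le_add _ _ _
  · refine tendsto_nhds_unique (hp (c • x)) ?_
    simpa only [map_smul_eq_mul] using (hp x).const_mul ‖c‖

/-! ### Discounted costs of piecewise constant laws -/

theorem continuous_flow_left (δ : ℝ) : Continuous fun p : Mat × Plane => flow p.1 δ p.2 := by
  have h : Continuous fun A : Mat => flow A δ := by
    let : NormedAlgebra ℚ (Plane →L[ℝ] Plane) := NormedAlgebra.restrictScalars ℚ ℝ _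
    exact NormedSpace.exp_continuous.comp (continuous_op.const_smul δ)
  exact (h.comp continuous_fst).clm_apply continuous_snd

theorem continuous_node {𝒜 : Set Mat} (δ : ℝ) (x : Plane) (n : ℕ) :
    Continuous fun w : ℕ → 𝒜 => node (fun i => (w i : Mat)) δ x n := by
  induction n with
  | zero => exact continuous_const
  | succ n ih =>
    have h : Continuous fun w : ℕ → 𝒜 => ((w n : Mat), node (fun i => (w i : Mat)) δ x n) :=
      (continuous_subtype_val.comp (continuous_apply n)).prodMk ih
    have h' := Continuous.comp (continuous_flow_left δ) h
    simp only [node]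
    convert! h' using 1

/-- The points from which all piecewise constant laws grow at most at the rate `r`, uniformly. -/
def slowSubmodule (𝒜 : Set Mat) (δ r : ℝ) : Submodule ℝ Plane where
  carrier := {x | ∃ C : ℝ, ∀ w : ℕ → Mat, (∀ n, w n ∈ 𝒜) → ∀ j : ℕ,
    ‖node w δ x j‖ ≤ C * Real.exp (r * (j * δ))}
  add_mem' := by
    rintro x y ⟨C, hC⟩ ⟨D, hD⟩
    refine ⟨C + D, fun w hw j => ?_⟩
    rw [node_add, add_mul]
    exact (norm_add_le _ _).trans (add_le_add (hC w hw j) (hD w hw j))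
  zero_mem' := by
    refine ⟨0, fun w hw j => ?_⟩
    have := node_smul w δ 0 0 j
    simp only [zero_smul] at this
    simp [this]
  smul_mem' := by
    rintro c x ⟨C, hC⟩
    refine ⟨‖c‖ * C, fun w hw j => ?_⟩
    rw [node_smul, norm_smul, mul_assoc]
    gcongr
    exact hC w hw j

/-- Prefixing a law by `A` shows that the flow maps the subspace into itself. The flow is injective,
so in finite dimension it maps the subspace onto itself, which gives the converse. -/
theorem slowSubmodule_flow {𝒜 : Set Mat} {δ r : ℝ} {A : Mat} (hA : A ∈ 𝒜) {x : Plane} :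
    flow A δ x ∈ slowSubmodule 𝒜 δ r ↔ x ∈ slowSubmodule 𝒜 δ r := by
  have h1 : ∀ x ∈ slowSubmodule 𝒜 δ r, flow A δ x ∈ slowSubmodule 𝒜 δ r := by
    rintro x ⟨C, hC⟩
    refine ⟨C * Real.exp (r * δ), fun w hw j => ?_⟩
    have := hC (fun i => Nat.casesOn i A w) (fun i => by cases i <;> simp [hA, hw]) (j + 1)
    rw [node_cons_succ] at this
    refine this.trans_eq ?_
    rw [mul_assoc, ← Real.exp_add]
    push_cast
    ring_nf
  refine ⟨fun h => ?_, h1 x⟩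
  have hinj : Function.Injective (flow A δ : Plane →ₗ[ℝ] Plane) :=
    Function.LeftInverse.injective (g := fun y => flow A (-δ) y) fun y => flow_neg_flow A δ y
  have hmap : (slowSubmodule 𝒜 δ r).map (flow A δ : Plane →ₗ[ℝ] Plane) ≤ slowSubmodule 𝒜 δ r := by
    rintro _ ⟨y, hy, rfl⟩
    exact h1 y hy
  have heq := Submodule.eq_of_le_of_finrank_eq hmap     (Submodule.equivMapOfInjective _ hinj _).finrank_eq.symm
  rw [← heq] at h
  obtain ⟨y, hy, hyx⟩ := h
  rwa [← hinj hyx]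

/-- The definition of the exponent gives a constant for each law separately, while the discounted
cost needs one for all laws. By the Baire theorem in the compact product space of laws, one of the
closed sets `F m` contains a cylinder. So all continuations of some finite prefix obey a uniform
bound. -/
theorem slowSubmodule_eq_top {𝒜 : Set Mat} (hcomp : IsCompact 𝒜) (hne : 𝒜.Nonempty) {δ r : ℝ}
    (hδ : 0 < δ) (hr : lyapunovExponent 𝒜 < r) : slowSubmodule 𝒜 δ r = ⊤ := by
  obtain ⟨σ, hσ, hσr⟩ := exists_lt_of_csInf_lt (nonempty_growthExponents hcomp) hr
  rw [eq_top_iff]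
  rintro x -
  have : CompactSpace 𝒜 := isCompact_iff_compactSpace.1 hcomp
  have : Nonempty 𝒜 := hne.to_subtype
  let F : ℕ → Set (ℕ → 𝒜) := fun m =>
    {w | ∀ j : ℕ, ‖node (fun i => (w i : Mat)) δ x j‖ ≤ m * Real.exp (r * (j * δ))}
  have hclosed : ∀ m, IsClosed (F m) := fun m => by
    simp only [F, Set.ofPred_forall]
    exact isClosed_iInter fun j => isClosed_le (continuous_node δ x j).norm continuous_const
  have hunion : ⋃ m, F m = Set.univ := by
    refine Set.eq_univ_of_forall fun w => Set.mem_iUnion.2 ?_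
    obtain ⟨C, hC⟩ := hσ _ (isTrajectory_stepTrajectory hcomp (w := fun i => (w i : Mat))
      (fun n => (w n).2) hδ x)
    obtain ⟨m, hm⟩ := exists_nat_ge C
    refine ⟨m, fun j => ?_⟩
    have h := hC (j * δ) (by positivity)
    rw [stepTrajectory_node _ hδ] at h
    refine h.trans ?_
    gcongr
  obtain ⟨m, w₀, hw₀⟩ := nonempty_interior_of_iUnion_of_closed hclosed hunion
  obtain ⟨I, u, hu, hsub⟩ := isOpen_pi_iff.1 isOpen_interior w₀ hw₀
  obtain ⟨k, hk⟩ : ∃ k, ∀ i ∈ I, i < k := ⟨I.sup id + 1, fun i hi =>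
    Nat.lt_succ_of_le (Finset.le_sup (f := id) hi)⟩
  have hnode : node (fun i => (w₀ i : Mat)) δ x k ∈ slowSubmodule 𝒜 δ r := by
    refine ⟨m * Real.exp (r * (k * δ)), fun w hw j => ?_⟩
    let w' : ℕ → 𝒜 := fun i => if i < k then w₀ i else ⟨w (i - k), hw _⟩
    have hw' : w' ∈ F m := by
      refine interior_subset (hsub fun i hi => ?_)
      have : w' i = w₀ i := if_pos (hk i hi)
      rw [this]
      exact (hu i hi).2
    have h := hw' (k + j)
    have e : (fun i => (w' i : Mat)) = fun i => if i < k then (w₀ i : Mat) else w (i - k) := by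
      ext1 i
      simp only [w']
      split_ifs <;> rfl
    rw [e, node_append] at h
    refine h.trans_eq ?_
    rw [mul_assoc, ← Real.exp_add]
    push_cast
    ring_nf
  clear_value F
  clear hk hsub
  -- The node reached after the prefix is slow; the prefix is undone one matrix at a time.
  induction k with
  | zero => exact hnode
  | succ k ih => exact ih ((slowSubmodule_flow (w₀ k).2).1 hnode)

/-- The discounted cost of the first `k` steps of a piecewise constant law. -/
noncomputable def stepCost (w : ℕ → Mat) (δ ε : ℝ) (k : ℕ) : Seminorm ℝ Plane :=
  -- The truncation `toNNReal` makes the weights nonnegative for every real `δ`, as a seminorm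
  -- requires.
  Seminorm.of (fun x => ∑ j ∈ Finset.range k, δ.toNNReal * Real.exp (-ε * (j * δ)) * ‖node w δ x j‖)
    (fun x y => by
      rw [← Finset.sum_add_distrib]
      refine Finset.sum_le_sum fun j _ => ?_
      rw [node_add, ← mul_add]
      gcongr
      exact norm_add_le _ _)
    (fun c x => by
      rw [Finset.mul_sum]
      refine Finset.sum_congr rfl fun j _ => ?_
      rw [node_smul, norm_smul]
      ring)

theorem stepCost_apply (w : ℕ → Mat) {δ : ℝ} (hδ : 0 < δ) (ε : ℝ) (k : ℕ) (x : Plane) :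
    stepCost w δ ε k x = ∑ j ∈ Finset.range k, δ * Real.exp (-ε * (j * δ)) * ‖node w δ x j‖ := by
  change ∑ j ∈ Finset.range k, δ.toNNReal * Real.exp (-ε * (j * δ)) * ‖node w δ x j‖ = _
  rw [Real.coe_toNNReal _ hδ.le]

theorem stepCost_succ (w : ℕ → Mat) {δ : ℝ} (hδ : 0 < δ) (ε : ℝ) (k : ℕ) (x : Plane) :
    stepCost w δ ε (k + 1) x = δ * ‖x‖ +
      Real.exp (-ε * δ) * stepCost (fun i => w (i + 1)) δ ε k (flow (w 0) δ x) := by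
  rw [stepCost_apply _ hδ, stepCost_apply _ hδ, Finset.sum_range_succ', add_comm, Finset.mul_sum]
  congr 1
  · simp [node]
  · refine Finset.sum_congr rfl fun j _ => ?_
    rw [node_tail]
    have : Real.exp (-ε * ((j + 1 : ℕ) * δ)) = Real.exp (-ε * δ) * Real.exp (-ε * (j * δ)) := by
      rw [← Real.exp_add]; push_cast; ring_nf
    rw [this]
    ring

/-- The value function of the discounted problem. -/
theorem exists_discounted_value {𝒜 : Set Mat} (hcomp : IsCompact 𝒜) (hne : 𝒜.Nonempty)
    (hσ : lyapunovExponent 𝒜 = 0) {δ ε : ℝ} (hδ : 0 < δ) (hε : 0 < ε) :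
    ∃ f : Seminorm ℝ Plane,
      (∀ A ∈ 𝒜, ∀ x, δ * ‖x‖ + Real.exp (-ε * δ) * f (flow A δ x) ≤ f x) ∧
      ∀ x, ∀ η > 0, ∃ A ∈ 𝒜, f x ≤ δ * ‖x‖ + Real.exp (-ε * δ) * f (flow A δ x) + η := by
  let ι := (ℕ → 𝒜) × ℕ
  have : Nonempty 𝒜 := hne.to_subtype
  let p : ι → Seminorm ℝ Plane := fun i => stepCost (fun n => (i.1 n : Mat)) δ ε i.2
  have hbdd : ∀ x, BddAbove (Set.range fun i => p i x) := by
    intro x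
    have hx : x ∈ slowSubmodule 𝒜 δ (ε / 2) := by
      rw [slowSubmodule_eq_top hcomp hne hδ (by rw [hσ]; linarith)]; trivial
    obtain ⟨C, hC⟩ := hx
    have hC0 : 0 ≤ C := by
      have := hC (fun _ => (Classical.arbitrary 𝒜 : Mat)) (fun _ => Subtype.coe_prop _) 0
      simp only [node, Nat.cast_zero, zero_mul, mul_zero, Real.exp_zero, mul_one] at this
      exact (norm_nonneg x).trans this
    -- The growth rate `ε / 2` against the discount `ε` leaves a geometric series with this ratio,
    -- which bounds the costs of all laws.
    set ρ := Real.exp (-(ε / 2) * δ)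
    have hρ0 : 0 ≤ ρ := (Real.exp_pos _).le
    have hρ1 : ρ < 1 := by
      rw [Real.exp_lt_one_iff]
      nlinarith
    refine ⟨δ * C * (1 - ρ)⁻¹, ?_⟩
    rintro _ ⟨⟨w, k⟩, rfl⟩
    simp only [p]
    rw [stepCost_apply _ hδ]
    have hterm : ∀ j ∈ Finset.range k, δ * Real.exp (-ε * (j * δ)) *
        ‖node (fun n => (w n : Mat)) δ x j‖ ≤ δ * C * ρ ^ j := by
      intro j _
      have h1 := hC (fun n => (w n : Mat)) (fun n => (w n).2) j
      calc _ ≤ δ * Real.exp (-ε * (j * δ)) * (C * Real.exp (ε / 2 * (j * δ))) := by gcongr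
        _ = δ * C * (Real.exp (-ε * (j * δ)) * Real.exp (ε / 2 * (j * δ))) := by ring
        _ = _ := by
          rw [← Real.exp_add, ← Real.exp_nat_mul]
          ring_nf
    refine (Finset.sum_le_sum hterm).trans ?_
    rw [← Finset.mul_sum]
    gcongr
    rw [← tsum_geometric_of_lt_one hρ0 hρ1]
    exact (summable_geometric_of_lt_one hρ0 hρ1).sum_le_tsum _ fun j _ => pow_nonneg hρ0 j
  have hbdd' : BddAbove (Set.range p) := Seminorm.bddAbove_range_iff.2 hbdd
  have hval : ∀ x, (⨆ i, p i) x = ⨆ i, p i x := fun x => Seminorm.iSup_apply hbdd'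
  refine ⟨⨆ i, p i, fun A hA x => ?_, fun x η hη => ?_⟩
  · rw [hval, hval, ← le_sub_iff_add_le', ← le_div_iff₀' (Real.exp_pos _)]
    refine ciSup_le fun i => ?_
    rw [le_div_iff₀' (Real.exp_pos _), le_sub_iff_add_le']
    let w' : ℕ → 𝒜 := fun n => Nat.casesOn n ⟨A, hA⟩ i.1
    have h := le_ciSup (hbdd x) (w', i.2 + 1)
    simp only [p] at h
    rw [stepCost_succ _ hδ] at h
    exact h
  -- The first matrix of a law that is optimal up to `η` is the required one, because its tail costs
  -- at most the value at the next node.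
  · have hlt : (⨆ i, p i x) - η < ⨆ i, p i x := by linarith
    obtain ⟨⟨w, k⟩, hwk⟩ := exists_lt_of_lt_ciSup hlt
    refine ⟨w 0, (w 0).2, ?_⟩
    rw [hval, hval]
    suffices hs : p (w, k) x ≤ δ * ‖x‖ +
        Real.exp (-ε * δ) * ⨆ i, p i (flow (w 0) δ x) by linarith
    simp only [p]
    cases k with
    | zero =>
      have h0 : stepCost (fun n => (w n : Mat)) δ ε 0 x = 0 := by rw [stepCost_apply _ hδ]; simp
      rw [h0]
      have : 0 ≤ ⨆ i, p i (flow (w 0) δ x) := Real.iSup_nonneg fun i => apply_nonneg _ _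
      positivity
    | succ k =>
      rw [stepCost_succ _ hδ]
      gcongr
      exact le_ciSup (hbdd (flow (w 0) δ x)) (fun n => w (n + 1), k)

/-! ### Existence of an invariant norm, in differential form -/

/-- At every point, some matrix of `𝒜` gives a direction in which `f` does not decrease. -/
def Sustained (𝒜 : Set Mat) (f : Seminorm ℝ Plane) : Prop :=
  ∀ x, ∃ A ∈ 𝒜, ∀ h : ℝ, 0 ≤ h → f x ≤ f (x + h • act A x)

/-- The null space of a dissipative seminorm is invariant under all matrices, so irreducibility
makes it trivial unless the seminorm vanishes. -/
theorem eq_zero_of_dissipative_zero {𝒜 : Set Mat} (hirr : IsIrreducibleFamily 𝒜)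
    {f : Seminorm ℝ Plane} (hf : Dissipative 𝒜 f 0) {z : Plane} (hz : f z ≠ 0) {x : Plane}
    (hx : f x = 0) : x = 0 := by
  let W : Submodule ℝ Plane :=
    { carrier := {x | f x = 0}
      add_mem' := fun {x y} hx hy => le_antisymm
        ((map_add_le_add f x y).trans (by rw [hx, hy, add_zero])) (apply_nonneg f _)
      zero_mem' := map_zero f
      smul_mem' := fun c x hx => by
        have : f x = 0 := hx
        change f (c • x) = 0
        rw [map_smul_eq_mul, this, mul_zero] }
  have hW : ∀ A ∈ 𝒜, ∀ x ∈ W, act A x ∈ W := by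
    intro A hA x hx
    have hx0 : f x = 0 := hx
    refine le_antisymm (le_of_forall_pos_le_add fun ε hε => ?_) (apply_nonneg f _)
    obtain ⟨h, hh, hle⟩ := hf A hA x ε hε
    have h1 := hle h hh.le le_rfl
    have h2 := map_sub_le_add f (x + h • act A x) x
    rw [add_sub_cancel_left, map_smul_eq_mul, Real.norm_of_nonneg hh.le, hx0] at h2
    rw [hx0] at h1
    refine le_of_mul_le_mul_left ?_ hh
    linarith
  rcases hirr W hW with h | h
  · have : x ∈ W := hx
    rw [h] at this
    exact this
  · exact absurd (show z ∈ W by rw [h]; trivial) hz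

theorem exists_max_sphere (f : Seminorm ℝ Plane) :
    ∃ z : Plane, ‖z‖ = 1 ∧ ∀ x, f x ≤ f z * ‖x‖ := by
  obtain ⟨z, hz, hmax⟩ := (isCompact_sphere (0 : Plane) 1).exists_isMaxOn
    ⟨unitVec 0, by simp [norm_unitVec]⟩ (continuous_seminorm f).continuousOn
  refine ⟨z, by simpa using hz, fun x => ?_⟩
  rcases eq_or_ne x 0 with rfl | hx
  · simp
  · have hx' := norm_pos_iff.2 hx
    have h1 : f (‖x‖⁻¹ • x) ≤ f z := hmax (by simp [norm_smul, hx])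
    rw [map_smul_eq_mul, norm_inv, norm_norm, inv_mul_le_iff₀ hx'] at h1
    linarith

theorem norm_flow_ge {𝒜 : Set Mat} (hcomp : IsCompact 𝒜) {K : ℝ} (hK0 : 0 < K)
    (hK : ∀ A ∈ 𝒜, ∀ x, ‖act A x‖ ≤ K * ‖x‖) :
    ∃ t₀, 0 < t₀ ∧ t₀ ≤ 1 ∧ ∀ A ∈ 𝒜, ∀ t, 0 ≤ t → t ≤ t₀ → ∀ x, ‖x‖ / 2 ≤ ‖flow A t x‖ := by
  have hE := Real.exp_pos K
  refine ⟨min 1 (1 / (2 * (K * Real.exp K))), by positivity, min_le_left _ _, ?_⟩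
  intro A hA t ht htt x
  have h1 := norm_flow_sub_le hcomp hK0.le hK hA ht (htt.trans (min_le_left _ _)) x
  have h2 : t ≤ 1 / (2 * (K * Real.exp K)) := htt.trans (min_le_right _ _)
  rw [le_div_iff₀ (by positivity)] at h2
  have h3 : K * Real.exp K * ‖x‖ * t ≤ ‖x‖ / 2 := by nlinarith [norm_nonneg x]
  have h4 : ‖x‖ ≤ ‖flow A t x‖ + ‖flow A t x - x‖ := by
    have := norm_sub_le (flow A t x) (flow A t x - x)
    simpa using this
  linarith

/-- Convexity again: the rate of loss observed at a short step bounds the rate of loss at every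
longer one. -/
theorem ray_ge_of_ge {f : Seminorm ℝ Plane} {x v : Plane} {δ H e : ℝ} (hδ : 0 < δ) (hH : δ ≤ H)
    (h : f x - δ * e ≤ f (x + δ • v)) : f x - H * e ≤ f (x + H • v) := by
  have h1 := seminorm_ray_convex f x v hδ.le hH (hδ.trans_le hH)
  have h2 : H * (f x - δ * e) ≤ H * f (x + δ • v) := by
    have : 0 ≤ H := (hδ.trans_le hH).le
    gcongr
  have h3 : δ * (f x - H * e) ≤ δ * f (x + H • v) := by nlinarith
  exact le_of_mul_le_mul_left h3 hδ

/-- The dynamic programming inequality is iterated: each step pays a running cost of at least `δ * μ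
* ‖x‖ / 2`, as the flow stays away from zero up to the time `t₀`. -/
theorem discounted_iterate {q : Seminorm ℝ Plane} {A : Mat} {δ ε μ t₀ : ℝ} (hδ : 0 < δ)
    (hε : 0 < ε) (hμ : 0 ≤ μ)
    (hq : ∀ x, δ * μ * ‖x‖ + Real.exp (-ε * δ) * q (flow A δ x) ≤ q x) {x : Plane}
    (hlow : ∀ t, 0 ≤ t → t ≤ t₀ → ‖x‖ / 2 ≤ ‖flow A t x‖) (k : ℕ) (hk : k * δ ≤ t₀) :
    q (flow A (k * δ) x) ≤ Real.exp (ε * (k * δ)) * q x - k * δ * μ * ‖x‖ / 2 := by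
  induction k with
  | zero => simp [flow_zero]
  | succ k ih =>
    push_cast at hk ⊢
    have hk' : k * δ ≤ t₀ := by nlinarith
    have h1 := ih hk'
    have h2 := hlow (k * δ) (by positivity) hk'
    have h3 := hq (flow A (k * δ) x)
    have e : flow A ((k + 1) * δ) x = flow A δ (flow A (k * δ) x) := by
      rw [← flow_add]; ring_nf
    rw [e]
    set y := flow A (k * δ) x
    have hE : 1 ≤ Real.exp (ε * δ) := Real.one_le_exp (by positivity)
    have h4 : q (flow A δ y) ≤ Real.exp (ε * δ) * (q y - δ * μ * ‖y‖) := by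
      have h5 : Real.exp (-ε * δ) * q (flow A δ y) ≤ q y - δ * μ * ‖y‖ := by linarith
      calc q (flow A δ y) = Real.exp (ε * δ) * (Real.exp (-ε * δ) * q (flow A δ y)) := by
            rw [← mul_assoc, ← Real.exp_add]; simp
        _ ≤ _ := by gcongr
    calc q (flow A δ y) ≤ Real.exp (ε * δ) * (q y - δ * μ * ‖y‖) := h4
      _ ≤ Real.exp (ε * δ) * ((Real.exp (ε * (k * δ)) * q x - k * δ * μ * ‖x‖ / 2)
            - δ * μ * (‖x‖ / 2)) := by gcongr
      _ = Real.exp (ε * δ) * Real.exp (ε * (k * δ)) * q x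
            - Real.exp (ε * δ) * ((k + 1) * δ * μ * ‖x‖ / 2) := by ring
      _ ≤ Real.exp (ε * δ) * Real.exp (ε * (k * δ)) * q x - 1 * ((k + 1) * δ * μ * ‖x‖ / 2) := by
        gcongr
      _ = _ := by rw [← Real.exp_add]; ring_nf

/-- Vanishing discount. The value functions `F n`, with time step and discount rate both equal to `δ
n → 0`, are normalized by their maxima `M n` on the Euclidean unit sphere, and a limit `p` is taken.
The upper Bellman inequality makes `p` dissipative, and the near-optimal matrices converge to
matrices of `𝒜` that sustain it. -/
theorem exists_dissipative_sustained {𝒜 : Set Mat} (hcomp : IsCompact 𝒜)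
    (hirr : IsIrreducibleFamily 𝒜) (hσ : lyapunovExponent 𝒜 = 0) :
    ∃ f : Seminorm ℝ Plane, (∀ x, f x = 0 → x = 0) ∧ Dissipative 𝒜 f 0 ∧ Sustained 𝒜 f := by
  have hne := hirr.nonempty
  obtain ⟨K, hK0, hK⟩ := exists_act_bound hcomp
  let δ : ℕ → ℝ := fun n => 1 / ((n : ℝ) + 1)
  have hδ : ∀ n, 0 < δ n := fun n => by positivity
  have hδ1 : ∀ n, δ n ≤ 1 := fun n => by
    simp only [δ]; rw [div_le_one (by positivity)]; linarith [(Nat.cast_nonneg n : (0 : ℝ) ≤ n)]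
  have hδlim : Tendsto δ (hyperfilter ℕ) (𝓝 0) :=
    tendsto_hyperfilter tendsto_one_div_add_atTop_nhds_zero_nat
  choose F hF1 hF2 using fun n => exists_discounted_value hcomp hne hσ (hδ n) (hδ n)
  choose z hz1 hz using fun n => exists_max_sphere (F n)
  have hM : ∀ n, 0 < F n (z n) := fun n => by
    obtain ⟨A, hA⟩ := hne
    have := hF1 n A hA (z n)
    rw [hz1, mul_one] at this
    have h2 : 0 ≤ Real.exp (-δ n * δ n) * F n (flow A (δ n) (z n)) := by positivity
    linarith [hδ n]
  let M : ℕ → ℝ := fun n => F n (z n)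
  let q : ℕ → Seminorm ℝ Plane := fun n => (M n)⁻¹.toNNReal • F n
  have hqF : ∀ n x, q n x = (M n)⁻¹ * F n x := fun n x => by
    simp only [q, _root_.smul_apply, NNReal.smul_def, smul_eq_mul]
    rw [Real.coe_toNNReal _ (inv_pos.2 (hM n)).le]
  have hq1 : ∀ n x, q n x ≤ 1 * ‖x‖ := fun n x => by
    rw [hqF, one_mul, inv_mul_le_iff₀ (hM n)]; exact hz n x
  have hqz : ∀ n, q n (z n) = 1 := fun n => by rw [hqF]; exact inv_mul_cancel₀ (hM n).ne'
  obtain ⟨p, hp⟩ := exists_seminorm_limit hq1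
  have hp1 : ∀ x, p x ≤ ‖x‖ := fun x => le_of_tendsto' (hp x) fun n => by simpa using hq1 n x
  obtain ⟨w, hw, hwlim⟩ := exists_hyperfilter_limit (isCompact_sphere (0 : Plane) 1)
    (u := z) (fun n => by simp [hz1])
  have hpw : p w = 1 := by
    have h1 : Tendsto (fun n => |q n (z n) - q n w|) (hyperfilter ℕ) (𝓝 0) := by
      refine squeeze_zero (fun _ => abs_nonneg _) (fun n => abs_seminorm_sub_le (hq1 n) _ _) ?_
      have := (hwlim.sub_const w).norm
      simpa using this
    simp only [hqz] at h1
    have h2 := ((hp w).const_sub 1).abs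
    have := tendsto_nhds_unique h1 h2
    rw [eq_comm, abs_eq_zero] at this
    linarith
  -- The normalized running cost, cut off at 1 so that it has a limit.
  let μ : ℕ → ℝ := fun n => min (M n)⁻¹ 1
  have hμ0 : ∀ n, 0 ≤ μ n := fun n => le_min (inv_pos.2 (hM n)).le zero_le_one
  obtain ⟨μ', hμ', hμlim⟩ := exists_hyperfilter_limit_real (u := μ) (a := 0) (b := 1)
    fun n => ⟨hμ0 n, min_le_right _ _⟩
  have hR1 : ∀ n, ∀ A ∈ 𝒜, ∀ x,
      δ n * μ n * ‖x‖ + Real.exp (-δ n * δ n) * q n (flow A (δ n) x) ≤ q n x := by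
    intro n A hA x
    rw [hqF, hqF]
    have h1 := mul_le_mul_of_nonneg_left (hF1 n A hA x) (inv_pos.2 (hM n)).le
    have h2 : δ n * μ n * ‖x‖ ≤ δ n * (M n)⁻¹ * ‖x‖ := by
      have := (hδ n).le
      gcongr
      exact min_le_left _ _
    calc _ ≤ δ n * (M n)⁻¹ * ‖x‖ + Real.exp (-δ n * δ n) * ((M n)⁻¹ * F n (flow A (δ n) x)) := by
          gcongr
      _ = (M n)⁻¹ * (δ n * ‖x‖ + Real.exp (-δ n * δ n) * F n (flow A (δ n) x)) := by ring
      _ ≤ _ := h1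
  obtain ⟨t₀, ht₀, ht₀1, hlow⟩ := norm_flow_ge hcomp hK0 hK
  have hflow : ∀ A ∈ 𝒜, ∀ t, 0 ≤ t → t ≤ t₀ → ∀ x, p (flow A t x) ≤ p x - t * (μ' * ‖x‖ / 2) := by
    intro A hA t ht htt x
    let k : ℕ → ℕ := fun n => ⌊t / δ n⌋₊
    have hk : ∀ n, k n * δ n ≤ t := fun n =>
      (le_div_iff₀ (hδ n)).1 (Nat.floor_le (div_nonneg ht (hδ n).le))
    have hk' : ∀ n, t - δ n ≤ k n * δ n := fun n => by
      have := (div_lt_iff₀ (hδ n)).1 (Nat.lt_floor_add_one (t / δ n))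
      simp only [k]
      linarith
    have hklim : Tendsto (fun n => k n * δ n) (hyperfilter ℕ) (𝓝 t) :=
      tendsto_of_tendsto_of_tendsto_of_le_of_le (by simpa using hδlim.const_sub t)
        tendsto_const_nhds hk' hk
    have h1 : ∀ n, q n (flow A (k n * δ n) x) ≤
        Real.exp (δ n * (k n * δ n)) * q n x - k n * δ n * μ n * ‖x‖ / 2 := fun n =>
      discounted_iterate (hδ n) (hδ n) (hμ0 n) (hR1 n A hA)
        (fun s hs hs' => hlow A hA s hs hs' x) (k n) ((hk n).trans htt)
    have hpt : Tendsto (fun n => q n (flow A (k n * δ n) x)) (hyperfilter ℕ) (𝓝 (p (flow A t x))) := by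
      have hd : Tendsto (fun n => q n (flow A (k n * δ n) x) - q n (flow A t x)) (hyperfilter ℕ)
          (𝓝 0) := by
        refine squeeze_zero_norm (fun n => abs_seminorm_sub_le (hq1 n) _ _) ?_
        have := ((((continuous_flow A x).tendsto t).comp hklim).sub_const (flow A t x)).norm
        simpa using this
      have := hd.add (hp (flow A t x))
      simpa using this
    have hrhs : Tendsto (fun n => Real.exp (δ n * (k n * δ n)) * q n x
        - k n * δ n * μ n * ‖x‖ / 2) (hyperfilter ℕ)
        (𝓝 (Real.exp (0 * t) * p x - t * μ' * ‖x‖ / 2)) :=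
      (((Real.continuous_exp.tendsto _).comp (hδlim.mul hklim)).mul (hp x)).sub
        (((hklim.mul hμlim).mul_const _).div_const _)
    have := le_of_tendsto_of_tendsto' hpt hrhs h1
    rw [zero_mul, Real.exp_zero, one_mul] at this
    linarith
  have hpw0 : p w ≠ 0 := by rw [hpw]; exact one_ne_zero
  -- A positive limit cost would make `p` decay at the rate `μ' / 2`, and the exponent would be
  -- negative. So the cost vanishes in the limit.
  rcases hμ'.1.lt_or_eq with hpos | hzero
  · exfalso
    have hdef : ∀ x, p x = 0 → x = 0 := by
      intro x hx
      obtain ⟨A, hA⟩ := hne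
      have h1 := hflow A hA t₀ ht₀.le le_rfl x
      have h2 : 0 ≤ p (flow A t₀ x) := apply_nonneg _ _
      by_contra hx0
      have : 0 < t₀ * (μ' * ‖x‖ / 2) := by have := norm_pos_iff.2 hx0; positivity
      linarith
    have hdis : Dissipative 𝒜 p (μ' / 2) := by
      refine dissipative_of_flow_le hcomp fun A hA x ε hε => ⟨t₀, ht₀, fun t ht htt => ?_⟩
      have h1 := hflow A hA t ht.le htt x
      have h2 : t * (μ' / 2 * p x) ≤ t * (μ' * ‖x‖ / 2) := by
        have := hp1 x
        have : μ' / 2 * p x ≤ μ' / 2 * ‖x‖ := by gcongr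
        nlinarith
      nlinarith
    have := lyapunovExponent_le_of_dissipative hcomp hne hdef hdis
    linarith
  · have hdis : Dissipative 𝒜 p 0 := by
      refine dissipative_of_flow_le hcomp fun A hA x ε hε => ⟨t₀, ht₀, fun t ht htt => ?_⟩
      have h1 := hflow A hA t ht.le htt x
      rw [← hzero] at h1
      nlinarith
    refine ⟨p, fun x hx => eq_zero_of_dissipative_zero hirr hdis hpw0 hx, hdis, fun x => ?_⟩
    have hA : ∀ n, ∃ A ∈ 𝒜, q n x - δ n * ((M n)⁻¹ * ‖x‖ + δ n + K ^ 2 * Real.exp K * ‖x‖ * δ n)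
        ≤ q n (x + δ n • act A x) := by
      intro n
      -- The tolerance becomes `δ n ^ 2` after division by `M n`, hence negligible against the step.
      obtain ⟨A, hA, hle⟩ := hF2 n x (M n * δ n ^ 2) (by have := hM n; have := hδ n; positivity)
      refine ⟨A, hA, ?_⟩
      have h1 := mul_le_mul_of_nonneg_left hle (inv_pos.2 (hM n)).le
      have h2 : Real.exp (-δ n * δ n) * q n (flow A (δ n) x) ≤ 1 * q n (flow A (δ n) x) := by
        gcongr
        rw [Real.exp_le_one_iff]
        nlinarith [hδ n]
      have h3 := seminorm_le_add (hq1 n) (flow A (δ n) x) (x + δ n • act A x)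
      have h4 := norm_flow_sub_sub_le hcomp hK0.le hK hA (hδ n).le (hδ1 n) x
      have h5 : (M n)⁻¹ * (δ n * ‖x‖ + Real.exp (-δ n * δ n) * F n (flow A (δ n) x) + M n * δ n ^ 2)
          = (M n)⁻¹ * δ n * ‖x‖ + Real.exp (-δ n * δ n) * q n (flow A (δ n) x) + δ n ^ 2 := by
        rw [hqF]
        have := (hM n).ne'
        simp only [M]
        field_simp
      rw [h5, ← hqF] at h1
      nlinarith
    choose A hA hle using hA
    obtain ⟨B, hB, hBlim⟩ := exists_hyperfilter_limit hcomp hA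
    refine ⟨B, hB, fun H hH => ?_⟩
    rcases hH.eq_or_lt with rfl | hH
    · simp
    have hMlim : Tendsto (fun n => (M n)⁻¹) (hyperfilter ℕ) (𝓝 0) := by
      rw [← hzero] at hμlim
      refine hμlim.congr' ?_
      filter_upwards [hμlim (Iio_mem_nhds one_pos)] with n hn
      rcases min_choice (M n)⁻¹ 1 with h | h
      · exact h
      · exact absurd hn (by simp [μ, h])
    have hlim1 : Tendsto (fun n => q n x
        - H * ((M n)⁻¹ * ‖x‖ + δ n + K ^ 2 * Real.exp K * ‖x‖ * δ n)) (hyperfilter ℕ)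
        (𝓝 (p x - H * (0 * ‖x‖ + 0 + K ^ 2 * Real.exp K * ‖x‖ * 0))) :=
      (hp x).sub ((((hMlim.mul_const _).add hδlim).add (hδlim.const_mul _)).const_mul H)
    have hlim2 : Tendsto (fun n => q n (x + H • act (A n) x)) (hyperfilter ℕ)
        (𝓝 (p (x + H • act B x))) := by
      have hd : Tendsto (fun n => q n (x + H • act (A n) x) - q n (x + H • act B x))
          (hyperfilter ℕ) (𝓝 0) := by
        refine squeeze_zero_norm (fun n => abs_seminorm_sub_le (hq1 n) _ _) ?_
        have hc : Continuous fun C : Mat => 1 * ‖x + H • act C x - (x + H • act B x)‖ := by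
          have : Continuous fun C : Mat => act C x :=
            continuous_act.comp (continuous_id.prodMk continuous_const)
          fun_prop
        have := (hc.tendsto B).comp hBlim
        simpa [Function.comp_def] using this
      have := hd.add (hp (x + H • act B x))
      simpa using this
    have := le_of_tendsto_of_tendsto hlim1 hlim2 ?_
    · simpa using this
    filter_upwards [hδlim (Iio_mem_nhds hH)] with n hn
    exact ray_ge_of_ge (hδ n) (le_of_lt hn) (hle n)

/-! ### Invariant norms in differential form -/

theorem IsBarabanov.dissipative {𝒜 : Set Mat} (hcomp : IsCompact 𝒜)
    (hσ : lyapunovExponent 𝒜 = 0) {f : Seminorm ℝ Plane} (hf : IsBarabanov 𝒜 f) :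
    Dissipative 𝒜 f 0 := by
  refine dissipative_of_flow_le hcomp fun A hA x ε hε => ⟨1, one_pos, fun t ht _ => ?_⟩
  have h := hf.2.1 _ (isTrajectory_flow hcomp hA x) t ht.le
  rw [hσ, zero_mul, Real.exp_zero, one_mul, flow_zero] at h
  nlinarith

/-- The mean velocity over `[0, h]` of a trajectory on a level set lies, with the state frozen at
`x₀`, in the compact convex set of velocities of the hull. Along it `f` loses only `O(h²)`. A limit
of the mean matrices as `h → 0` loses nothing, and convexity extends this from short steps to the
whole ray. -/
theorem IsBarabanov.sustained {𝒜 : Set Mat} (hcomp : IsCompact 𝒜)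
    (hσ : lyapunovExponent 𝒜 = 0) {f : Seminorm ℝ Plane} (hf : IsBarabanov 𝒜 f) :
    Sustained (convexHull ℝ 𝒜) f := by
  intro x₀
  have hco := isCompact_convexHull_of_finiteDimensional hcomp
  obtain ⟨K, hK0, hK⟩ := exists_act_bound hco
  obtain ⟨C, hC0, hC⟩ := seminorm_le_norm f
  obtain ⟨x, hx, hx0, hfx⟩ := hf.2.2 x₀
  simp only [hσ, zero_mul, Real.exp_zero, one_mul] at hfx
  obtain ⟨M, hM0, hM, hlip⟩ := hx.exists_lipschitz hK hK0.le 1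
  obtain ⟨law, hmeas, hlaw, hint⟩ := hx
  have hcontL : Continuous fun A : Mat => act A x₀ :=
    continuous_act.comp (continuous_id.prodMk continuous_const)
  have hV : IsCompact ((fun A : Mat => act A x₀) '' convexHull ℝ 𝒜) := hco.image hcontL
  have hVc : Convex ℝ ((fun A : Mat => act A x₀) '' convexHull ℝ 𝒜) := by
    rintro _ ⟨A, hA, rfl⟩ _ ⟨B, hB, rfl⟩ a b ha hb hab
    exact ⟨a • A + b • B, convex_convexHull ℝ 𝒜 hA hB ha hb hab, by
      simp only [act_add_left, act_smul_left]⟩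
  have key : ∀ h, 0 < h → h ≤ 1 → ∃ A ∈ convexHull ℝ 𝒜,
      f x₀ - h * (C * (K * (K * M)) * h) ≤ f (x₀ + h • act A x₀) := by
    intro h hh hh1
    have hi0 : IntervalIntegrable (fun τ => act (law τ) x₀) volume 0 h :=
      intervalIntegrable_act hh.le hmeas (fun t ht => hK _ (hlaw t ht)) hK0.le continuousOn_const
    have hmem : h⁻¹ • ∫ τ in (0 : ℝ)..h, act (law τ) x₀ ∈
        (fun A : Mat => act A x₀) '' convexHull ℝ 𝒜 := by
      have := hVc.set_average_mem hV.isClosed (μ := volume) (t := Set.Ioc 0 h)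
        (f := fun τ => act (law τ) x₀) (by simp [hh]) (by simp)
        ((ae_restrict_iff' measurableSet_Ioc).2 (Eventually.of_forall fun τ hτ =>
          ⟨law τ, hlaw τ hτ.1.le, rfl⟩)) hi0.1
      rw [setAverage_eq] at this
      rw [intervalIntegral.integral_of_le hh.le]
      simpa [Measure.real, hh.le] using this
    obtain ⟨A, hA, hAe⟩ := hmem
    refine ⟨A, hA, ?_⟩
    simp only at hAe
    have e1 : h • act A x₀ = ∫ τ in (0 : ℝ)..h, act (law τ) x₀ := by
      rw [hAe, smul_smul, mul_inv_cancel₀ hh.ne', one_smul]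
    have e2 : x h - (x₀ + h • act A x₀) = ∫ τ in (0 : ℝ)..h, act (law τ) (x τ - x₀) := by
      rw [e1, (hint h hh.le).2, hx0, add_sub_add_left_eq_sub,
        ← intervalIntegral.integral_sub (hint h hh.le).1 hi0]
      simp only [act_sub_right]
    have e3 : ‖x h - (x₀ + h • act A x₀)‖ ≤ K * (K * M * h) * |h - 0| := by
      rw [e2]
      refine intervalIntegral.norm_integral_le_of_norm_le_const fun τ hτ => ?_
      rw [Set.uIoc_of_le hh.le] at hτ
      refine (hK _ (hlaw τ hτ.1.le) _).trans ?_
      have := hlip 0 ⟨le_rfl, zero_le_one⟩ τ ⟨hτ.1.le, hτ.2.trans hh1⟩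
      rw [hx0, sub_zero, abs_of_pos hτ.1] at this
      have h3 : K * M * τ ≤ K * M * h := by gcongr; exact hτ.2
      gcongr
      exact this.trans h3
    rw [sub_zero, abs_of_pos hh] at e3
    have e4 := seminorm_le_add hC (x h) (x₀ + h • act A x₀)
    rw [hfx h hh.le] at e4
    have e5 : C * ‖x h - (x₀ + h • act A x₀)‖ ≤ C * (K * (K * M * h) * h) := by gcongr
    linarith
  let δ : ℕ → ℝ := fun n => 1 / ((n : ℝ) + 1)
  have hδ : ∀ n, 0 < δ n := fun n => by positivity
  have hδ1 : ∀ n, δ n ≤ 1 := fun n => by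
    simp only [δ]; rw [div_le_one (by positivity)]; linarith [(Nat.cast_nonneg n : (0 : ℝ) ≤ n)]
  have hδlim : Tendsto δ (hyperfilter ℕ) (𝓝 0) :=
    tendsto_hyperfilter tendsto_one_div_add_atTop_nhds_zero_nat
  choose A hA hle using fun n => key (δ n) (hδ n) (hδ1 n)
  obtain ⟨B, hB, hBlim⟩ := exists_hyperfilter_limit hco hA
  refine ⟨B, hB, fun H hH => ?_⟩
  rcases hH.eq_or_lt with rfl | hH
  · simp
  have hlim1 : Tendsto (fun n => f x₀ - H * (C * (K * (K * M)) * δ n)) (hyperfilter ℕ)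
      (𝓝 (f x₀ - H * (C * (K * (K * M)) * 0))) :=
    ((hδlim.const_mul _).const_mul H).const_sub _
  have hlim2 : Tendsto (fun n => f (x₀ + H • act (A n) x₀)) (hyperfilter ℕ)
      (𝓝 (f (x₀ + H • act B x₀))) := by
    have hc : Continuous fun A : Mat => f (x₀ + H • act A x₀) :=
      (continuous_seminorm f).comp (continuous_const.add (hcontL.const_smul H))
    exact (hc.tendsto B).comp hBlim
  have := le_of_tendsto_of_tendsto hlim1 hlim2 ?_
  · simpa using this
  filter_upwards [hδlim (Iio_mem_nhds hH)] with n hn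
  exact ray_ge_of_ge (hδ n) (le_of_lt hn) (hle n)

theorem hasDerivAt_plane {X : ℝ → Plane} {v : Plane} {t : ℝ}
    (h : ∀ i, HasDerivAt (fun s => X s i) (v i) t) : HasDerivAt X v t :=
  ((EuclideanSpace.equiv (Fin 2) ℝ).symm : (Fin 2 → ℝ) →L[ℝ] Plane).hasFDerivAt.comp_hasDerivAt t
    (hasDerivAt_pi.2 h)

theorem hasDerivAt_zero_of_sq_bound {V : Type*} [NormedAddCommGroup V] [NormedSpace ℝ V]
    {R : ℝ → V} {t C : ℝ} (h : ∀ᶠ s in 𝓝 t, ‖R s - R t‖ ≤ C * (s - t) ^ 2) :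
    HasDerivAt R 0 t := by
  rw [hasDerivAt_iff_isLittleO]
  simp only [smul_zero, sub_zero]
  refine Asymptotics.IsBigO.trans_isLittleO (g := fun s => (s - t) ^ 2) ?_ ?_
  · refine Asymptotics.IsBigO.of_bound C ?_
    filter_upwards [h] with s hs
    simpa using hs
  · have h1 : (fun s : ℝ => (s - t) ^ 2) = fun s => (s - t) * (s - t) := by ext; ring
    rw [h1]
    have h2 : Tendsto (fun s : ℝ => s - t) (𝓝 t) (𝓝 0) := by
      have := (continuous_sub_right t).tendsto t
      simpa using this
    simpa using ((Asymptotics.isLittleO_one_iff ℝ).2 h2).mul_isBigO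
      (Asymptotics.isBigO_refl (fun s : ℝ => s - t) (𝓝 t))

/-! ### From the differential form to trajectories -/

/-- The Euler scheme with step `h` for the feedback `Φ`. -/
noncomputable def eulerNode (Φ : Plane → Mat) (h : ℝ) (x : Plane) : ℕ → Plane
  | 0 => x
  | n + 1 => eulerNode Φ h x n + h • act (Φ (eulerNode Φ h x n)) (eulerNode Φ h x n)

/-- The accumulated law of the Euler scheme. -/
noncomputable def eulerLaw (Φ : Plane → Mat) (h : ℝ) (x : Plane) (n : ℕ) : Mat :=
  h • ∑ k ∈ Finset.range n, Φ (eulerNode Φ h x k)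

/-- The mean of the matrices used between two nodes stays in the convex set, and so do the limits of
such means. This is what makes the limit law admissible without any regularity of the feedback. -/
theorem eulerLaw_add (Φ : Plane → Mat) {h : ℝ} (x : Plane) {𝒞 : Set Mat} (hconv : Convex ℝ 𝒞)
    (hne : 𝒞.Nonempty) (hΦ : ∀ y, Φ y ∈ 𝒞) (k m : ℕ) :
    ∃ A ∈ 𝒞, eulerLaw Φ h x (k + m) - eulerLaw Φ h x k = (m * h) • A := by
  rcases Nat.eq_zero_or_pos m with rfl | hm
  · obtain ⟨A, hA⟩ := hne
    exact ⟨A, hA, by simp⟩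
  · have hm' : (0 : ℝ) < m := by exact_mod_cast hm
    refine ⟨∑ i ∈ Finset.range m, (m : ℝ)⁻¹ • Φ (eulerNode Φ h x (k + i)),
      hconv.sum_mem (fun _ _ => by positivity) (by simp [hm'.ne']) fun i _ => hΦ _, ?_⟩
    rw [eulerLaw, eulerLaw, Finset.sum_range_add, smul_add, add_sub_cancel_left,
      ← Finset.smul_sum, smul_smul]
    congr 1
    field_simp

theorem eulerNode_sub_le {Φ : Plane → Mat} {h K B : ℝ} (hh : 0 ≤ h) (hK0 : 0 ≤ K)
    (hK : ∀ y z, ‖act (Φ y) z‖ ≤ K * ‖z‖) (x : Plane) (k m : ℕ)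
    (hB : ∀ i < m, ‖eulerNode Φ h x (k + i)‖ ≤ B) :
    ‖eulerNode Φ h x (k + m) - eulerNode Φ h x k‖ ≤ K * B * (m * h) := by
  induction m with
  | zero => simp
  | succ m ih =>
    have h1 := ih fun i hi => hB i (hi.trans m.lt_succ_self)
    have h2 := hK (eulerNode Φ h x (k + m)) (eulerNode Φ h x (k + m))
    have h3 := hB m m.lt_succ_self
    have e : eulerNode Φ h x (k + (m + 1)) - eulerNode Φ h x k
        = (eulerNode Φ h x (k + m) - eulerNode Φ h x k)
          + h • act (Φ (eulerNode Φ h x (k + m))) (eulerNode Φ h x (k + m)) := by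
      rw [← add_assoc, eulerNode]; abel
    rw [e]
    refine (norm_add_le _ _).trans ?_
    rw [norm_smul, Real.norm_of_nonneg hh]
    have h4 : h * ‖act (Φ (eulerNode Φ h x (k + m))) (eulerNode Φ h x (k + m))‖ ≤ h * (K * B) := by
      gcongr
      exact h2.trans (by gcongr)
    push_cast
    linarith

/-- The scheme obeys the integral equation, with the state frozen at the first node, up to an error
quadratic in the elapsed time and uniform in the step. This estimate survives the limit and
identifies the equation. -/
theorem eulerNode_sub_sub_le {Φ : Plane → Mat} {h K B : ℝ} (hh : 0 ≤ h) (hK0 : 0 ≤ K)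
    (hB0 : 0 ≤ B)
    (hK : ∀ y z, ‖act (Φ y) z‖ ≤ K * ‖z‖) (x : Plane) (k m : ℕ)
    (hB : ∀ i < m, ‖eulerNode Φ h x (k + i)‖ ≤ B) :
    ‖eulerNode Φ h x (k + m) - eulerNode Φ h x k
      - act (eulerLaw Φ h x (k + m) - eulerLaw Φ h x k) (eulerNode Φ h x k)‖
      ≤ K ^ 2 * B * (m * h) ^ 2 := by
  -- One factor `m * h` is kept fixed, so that the bound is linear in `n` and the induction closes.
  have main : ∀ n ≤ m, ‖eulerNode Φ h x (k + n) - eulerNode Φ h x k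
      - act (eulerLaw Φ h x (k + n) - eulerLaw Φ h x k) (eulerNode Φ h x k)‖
      ≤ n * h * (K ^ 2 * B * (m * h)) := by
    intro n
    induction n with
    | zero => intro _; simp [act_zero_left]
    | succ n ih =>
      intro hn
      have h1 := ih (Nat.le_of_succ_le hn)
      have hnm : (n : ℝ) ≤ m := by exact_mod_cast Nat.le_of_succ_le hn
      have h2 := eulerNode_sub_le hh hK0 hK x k n fun i hi => hB i (hi.trans_le (Nat.le_of_succ_le hn))
      set y := eulerNode Φ h x (k + n)
      set z := eulerNode Φ h x k
      have e : eulerNode Φ h x (k + (n + 1)) - z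
          - act (eulerLaw Φ h x (k + (n + 1)) - eulerLaw Φ h x k) z
          = (y - z - act (eulerLaw Φ h x (k + n) - eulerLaw Φ h x k) z)
            + h • act (Φ y) (y - z) := by
        have e1 : eulerLaw Φ h x (k + (n + 1)) = eulerLaw Φ h x (k + n) + h • Φ y := by
          rw [← add_assoc, eulerLaw, Finset.sum_range_succ, smul_add, ← eulerLaw]
        have e2 : eulerNode Φ h x (k + (n + 1)) = y + h • act (Φ y) y := by
          rw [← add_assoc, eulerNode]
        rw [e1, e2, act_sub_left, act_sub_left, act_add_left, act_smul_left, act_sub_right, smul_sub]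
        abel
      rw [e]
      refine (norm_add_le _ _).trans ?_
      rw [norm_smul, Real.norm_of_nonneg hh]
      have h4 : h * ‖act (Φ y) (y - z)‖ ≤ h * (K ^ 2 * B * (m * h)) := by
        gcongr
        calc _ ≤ K * ‖y - z‖ := hK _ _
          _ ≤ K * (K * B * (n * h)) := by gcongr
          _ ≤ K * (K * B * (m * h)) := by gcongr
          _ = _ := by ring
      push_cast
      linarith
  refine (main m le_rfl).trans_eq (by ring)

/-- The Euler scheme stays close to the level set of the norm. -/
theorem eulerNode_level {f : Seminorm ℝ Plane} {Φ : Plane → Mat} {h c : ℝ} (hc : 0 ≤ c)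
    (hlow : ∀ y, f y ≤ f (y + h • act (Φ y) y))
    (hup : ∀ y, f (y + h • act (Φ y) y) ≤ f y * (1 + c * h ^ 2)) (x : Plane) (n : ℕ) :
    f x ≤ f (eulerNode Φ h x n) ∧ f (eulerNode Φ h x n) ≤ f x * Real.exp (c * h ^ 2 * n) := by
  induction n with
  | zero => simp [eulerNode]
  | succ n ih =>
    refine ⟨ih.1.trans (hlow _), (hup _).trans ?_⟩
    have h1 : 1 + c * h ^ 2 ≤ Real.exp (c * h ^ 2) := by linarith [Real.add_one_le_exp (c * h ^ 2)]
    calc _ ≤ f x * Real.exp (c * h ^ 2 * n) * Real.exp (c * h ^ 2) := by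
          gcongr
          exact ih.2
      _ = _ := by
        rw [mul_assoc, ← Real.exp_add]; push_cast; ring_nf

/-- A curve driven by an absolutely continuous accumulated law is a trajectory. -/
theorem isTrajectory_of_accumulated {𝒞 : Set Mat} (hcomp : IsCompact 𝒞)
    (hne : 𝒞.Nonempty) {G : ℝ → Mat} {X : ℝ → Plane} {C : ℝ → ℝ}
    (hG0 : ∀ t ≤ 0, G t = G 0)
    (hG : ∀ s t, 0 ≤ s → s ≤ t → ∃ A ∈ 𝒞, G t - G s = (t - s) • A)
    (hX : ∀ T, ∀ s t, 0 ≤ s → s ≤ t → t ≤ T →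
      ‖X t - X s - act (G t - G s) (X s)‖ ≤ C T * (t - s) ^ 2)
    (hXb : ∀ T, ∀ s, 0 ≤ s → s ≤ T → ‖X s‖ ≤ C T) : IsTrajectory 𝒞 X := by
  obtain ⟨K, hK0, hK⟩ := exists_act_bound hcomp
  obtain ⟨A₀, hA₀⟩ := hne
  obtain ⟨Λ, hΛ⟩ : ∃ Λ : ℝ, ∀ A ∈ 𝒞, ∀ i j, |A i j| ≤ Λ := by
    have h : ∀ i j, ∃ Λ : ℝ, ∀ A ∈ 𝒞, |A i j| ≤ Λ := fun i j => by
      obtain ⟨Λ, hΛ⟩ := hcomp.exists_bound_of_continuousOn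
        (f := fun A : Mat => A i j) (by fun_prop)
      exact ⟨Λ, hΛ⟩
    choose L hL using h
    refine ⟨∑ i, ∑ j, |L i j|, fun A hA i j => (hL i j A hA).trans ((le_abs_self _).trans ?_)⟩
    refine (Finset.single_le_sum (f := fun j => |L i j|) (fun _ _ => abs_nonneg _)
      (Finset.mem_univ j)).trans ?_
    exact Finset.single_le_sum (f := fun i => ∑ j, |L i j|)
      (fun _ _ => Finset.sum_nonneg fun _ _ => abs_nonneg _) (Finset.mem_univ i)
  have hΛ0 : 0 ≤ Λ := (abs_nonneg _).trans (hΛ A₀ hA₀ 0 0)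
  have hC0 : ∀ T, 0 ≤ T → 0 ≤ C T := fun T hT => (norm_nonneg _).trans (hXb T T hT le_rfl)
  have hlipG : ∀ i j, LipschitzWith Λ.toNNReal fun t => G t i j := by
    intro i j
    have hle : ∀ s t, s ≤ t → |G t i j - G s i j| ≤ Λ * |t - s| := by
      intro s t hst
      have hmax : G s = G (max s 0) ∧ G t = G (max t 0) := by
        constructor
        · rcases le_total s 0 with h | h
          · rw [max_eq_right h, hG0 s h]
          · rw [max_eq_left h]
        · rcases le_total t 0 with h | h
          · rw [max_eq_right h, hG0 t h]
          · rw [max_eq_left h]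
      obtain ⟨A, hA, hAe⟩ := hG (max s 0) (max t 0) (le_max_right _ _) (max_le_max_right 0 hst)
      rw [hmax.1, hmax.2, ← Matrix.sub_apply, hAe, Matrix.smul_apply, smul_eq_mul, abs_mul, mul_comm]
      exact mul_le_mul (hΛ A hA i j) (abs_max_sub_max_le_abs t s 0) (abs_nonneg _) hΛ0
    refine LipschitzWith.of_dist_le_mul fun s t => ?_
    rw [Real.coe_toNNReal _ hΛ0, Real.dist_eq, Real.dist_eq]
    rcases le_total s t with h | h
    · rw [abs_sub_comm, abs_sub_comm s]; exact hle s t h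
    · exact hle t s h
  let law₀ : ℝ → Mat := fun t i j => deriv (fun t => G t i j) t
  let N : Set ℝ := {t | ¬ ∀ i j, DifferentiableAt ℝ (fun t => G t i j) t}
  have hN : volume N = 0 := by
    have h : ∀ᵐ t, ∀ i j, DifferentiableAt ℝ (fun t => G t i j) t := by
      rw [ae_all_iff]; intro i
      rw [ae_all_iff]; intro j
      exact (hlipG i j).ae_differentiableAt
    exact h
  -- On a measurable null set that contains all bad times, the law is redefined as a fixed matrix;
  -- elsewhere it is the derivative of `G`. This makes it measurable with values in `𝒞` at all
  -- nonnegative times.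
  let N' := toMeasurable volume N
  have hN' : volume N' = 0 := by rw [measure_toMeasurable, hN]
  classical
  let law : ℝ → Mat := fun t => if t ∈ N' then A₀ else law₀ t
  have hdG : ∀ t, t ∉ N' → ∀ i j, HasDerivAt (fun t => G t i j) (law t i j) t := by
    intro t ht i j
    have : t ∉ N := fun h => ht (subset_toMeasurable _ _ h)
    simp only [N, Set.mem_ofPred_eq, not_not] at this
    simp only [law, if_neg ht]
    exact (this i j).hasDerivAt
  have hlaw : ∀ t, 0 ≤ t → law t ∈ 𝒞 := by
    intro t ht
    by_cases htN : t ∈ N'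
    · simpa only [law, if_pos htN] using hA₀
    · have hlim : Tendsto (fun h : ℝ => h⁻¹ • (G (t + h) - G t)) (𝓝[>] 0) (𝓝 (law t)) := by
        refine tendsto_pi_nhds.2 fun i => tendsto_pi_nhds.2 fun j => ?_
        simpa using (hdG t htN i j).tendsto_slope_zero_right
      refine hcomp.isClosed.mem_of_tendsto hlim ?_
      filter_upwards [self_mem_nhdsWithin] with h hh
      have hh0 : 0 < h := hh
      obtain ⟨A, hA, hAe⟩ := hG t (t + h) ht (by linarith)
      rw [hAe, add_sub_cancel_left, smul_smul, inv_mul_cancel₀ hh0.ne', one_smul]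
      exact hA
  have hmeas : ∀ i j, Measurable fun t => law t i j := by
    intro i j
    have : (fun t => law t i j) = fun t => if t ∈ N' then A₀ i j else law₀ t i j := by
      ext t; simp only [law]; split_ifs <;> rfl
    rw [this]
    exact Measurable.ite (measurableSet_toMeasurable _ _) measurable_const (measurable_deriv _)
  have hactG : ∀ s t, 0 ≤ s → s ≤ t → ∀ y, ‖act (G t - G s) y‖ ≤ K * ‖y‖ * (t - s) := by
    intro s t hs hst y
    obtain ⟨A, hA, hAe⟩ := hG s t hs hst
    rw [hAe, act_smul_left, norm_smul, Real.norm_of_nonneg (by linarith), mul_comm]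
    exact mul_le_mul_of_nonneg_right (hK A hA y) (by linarith)
  have hlipX : ∀ T, 0 ≤ T → ∀ s t, 0 ≤ s → s ≤ t → t ≤ T →
      ‖X t - X s‖ ≤ (C T * T + K * C T) * (t - s) := by
    intro T hT s t hs hst htT
    have h1 := hX T s t hs hst htT
    have h2 := hactG s t hs hst (X s)
    have h3 : ‖X t - X s‖ ≤ ‖X t - X s - act (G t - G s) (X s)‖ + ‖act (G t - G s) (X s)‖ := by
      simpa using norm_add_le (X t - X s - act (G t - G s) (X s)) (act (G t - G s) (X s))
    have h4 : C T * (t - s) ^ 2 ≤ C T * T * (t - s) := by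
      have := hC0 T hT
      have h5 : (t - s) ^ 2 ≤ T * (t - s) := by nlinarith
      nlinarith
    have h6 : K * ‖X s‖ * (t - s) ≤ K * C T * (t - s) := by
      have := hXb T s hs (hst.trans htT)
      have : 0 ≤ t - s := by linarith
      gcongr
    linarith
  have hlipX' : ∀ T, 0 ≤ T →
      LipschitzOnWith (C T * T + K * C T).toNNReal X (Set.Icc 0 T) := by
    intro T hT
    refine LipschitzOnWith.of_dist_le_mul fun s hs t ht => ?_
    have := hC0 T hT
    rw [Real.coe_toNNReal _ (by positivity), dist_eq_norm, Real.dist_eq]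
    rcases le_total s t with h | h
    · rw [norm_sub_rev, abs_sub_comm, abs_of_nonneg (by linarith)]
      exact hlipX T hT s t hs.1 h ht.2
    · rw [abs_of_nonneg (by linarith)]
      exact hlipX T hT t s ht.1 h hs.2
  have hdX : ∀ t, 0 < t → t ∉ N' → HasDerivAt X (act (law t) (X t)) t := by
    intro t ht htN
    have h1 : HasDerivAt (fun s => act (G s) (X t)) (act (law t) (X t)) t := by
      refine hasDerivAt_plane fun i => ?_
      simp only [act_apply]
      exact ((hdG t htN i 0).mul_const _).add ((hdG t htN i 1).mul_const _)
    set T := t + 1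
    have hT : 0 ≤ T := by simp only [T]; linarith
    have h2 : HasDerivAt (fun s => X s - act (G s) (X t)) 0 t := by
      refine hasDerivAt_zero_of_sq_bound (C := C T + K * (C T * T + K * C T)) ?_
      filter_upwards [Ioo_mem_nhds ht (show t < T by simp only [T]; linarith)] with s hs
      have e : X s - act (G s) (X t) - (X t - act (G t) (X t))
          = X s - X t - act (G s - G t) (X t) := by rw [act_sub_left]; abel
      rw [e]
      have hq : 0 ≤ K * (C T * T + K * C T) := by have := hC0 T hT; positivity
      rcases le_total t s with hts | hts
      · have := hX T t s ht.le hts hs.2.le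
        nlinarith [sq_nonneg (s - t)]
      · have h3 := hX T s t hs.1.le hts (by simp only [T]; linarith)
        have h4 := hactG s t hs.1.le hts (X t - X s)
        have h5 := hlipX T hT s t hs.1.le hts (by simp only [T]; linarith)
        -- For `s < t` the hypothesis has its base point at `s`; moving the base to `t` costs a
        -- further quadratic term.
        have e2 : X s - X t - act (G s - G t) (X t)
            = -(X t - X s - act (G t - G s) (X s)) + act (G t - G s) (X t - X s) := by
          rw [act_sub_left, act_sub_left, act_sub_left, act_sub_right, act_sub_right]; abel
        rw [e2]
        refine (norm_add_le _ _).trans ?_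
        rw [norm_neg]
        have h6 : K * ‖X t - X s‖ * (t - s) ≤ K * ((C T * T + K * C T) * (t - s)) * (t - s) := by
          have : 0 ≤ t - s := by linarith
          gcongr
        nlinarith
    have h3 := h2.add h1
    simp only [zero_add] at h3
    refine h3.congr_of_eventuallyEq (Eventually.of_forall fun s => ?_)
    simp
  refine ⟨law, hmeas, hlaw, fun T hT => ?_⟩
  have hint := intervalIntegrable_act hT hmeas (fun t ht => hK _ (hlaw t ht)) hK0.le
    (hlipX' T hT).continuousOn
  refine ⟨hint, ?_⟩
  have hac1 : AbsolutelyContinuousOnInterval X 0 T :=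
    LipschitzOnWith.absolutelyContinuousOnInterval (by rw [Set.uIcc_of_le hT]; exact hlipX' T hT)
  have hac2 : AbsolutelyContinuousOnInterval
      (fun t => ∫ τ in (0 : ℝ)..t, act (law τ) (X τ)) 0 T := by
    have hCT := hC0 T hT
    refine LipschitzOnWith.absolutelyContinuousOnInterval (K := (K * C T).toNNReal) ?_
    rw [Set.uIcc_of_le hT]
    refine LipschitzOnWith.of_dist_le_mul fun s hs t ht => ?_
    have hsub : ∀ s ∈ Set.Icc 0 T, IntervalIntegrable (fun τ => act (law τ) (X τ)) volume 0 s :=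
      fun s hs => hint.mono_set (by
        rw [Set.uIcc_of_le hT, Set.uIcc_of_le hs.1]; exact Set.Icc_subset_Icc_right hs.2)
    rw [dist_eq_norm, Real.dist_eq, Real.coe_toNNReal _ (by positivity),
      intervalIntegral.integral_interval_sub_left (hsub s hs) (hsub t ht)]
    refine intervalIntegral.norm_integral_le_of_norm_le_const fun τ hτ => ?_
    have hτ' : τ ∈ Set.Icc 0 T := Set.uIcc_subset_Icc ht hs (Set.uIoc_subset_uIcc hτ)
    refine (hK _ (hlaw τ hτ'.1) _).trans ?_
    gcongr
    exact hXb T τ hτ'.1 hτ'.2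
  obtain ⟨Z, hZ⟩ := (hac1.sub hac2).const_of_ae_hasDerivAt_zero (by
    have hne : ∀ᵐ t : ℝ, t ∉ N' ∧ t ≠ 0 := by
      have h1 : N'ᶜ ∈ ae volume := compl_mem_ae_iff.2 hN'
      have h2 : ({0} : Set ℝ)ᶜ ∈ ae volume := compl_mem_ae_iff.2 (by simp)
      filter_upwards [h1, h2] with t ht1 ht2 using ⟨ht1, ht2⟩
    filter_upwards [hne, hint.ae_hasDerivAt_integral] with t ht1 ht2 htm
    have htm' : t ∈ Set.Icc 0 T := by rwa [Set.uIcc_of_le hT] at htm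
    have := (hdX t (htm'.1.lt_of_ne ht1.2.symm) ht1.1).sub (ht2 htm 0 Set.left_mem_uIcc)
    rwa [sub_self] at this)
  have z0 := hZ 0 Set.left_mem_uIcc
  have zT := hZ T Set.right_mem_uIcc
  simp only [Pi.sub_apply, intervalIntegral.integral_same, sub_zero] at z0 zT
  rw [z0, ← zT]
  abel

theorem tendsto_act {ι : Type*} {l : Filter ι} {u : ι → Mat} {v : ι → Plane} {A : Mat} {x : Plane}
    (hu : Tendsto u l (𝓝 A)) (hv : Tendsto v l (𝓝 x)) :
    Tendsto (fun i => act (u i) (v i)) l (𝓝 (act A x)) := by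
  simp only [act_eq_op]
  have h : Tendsto (fun i => op (u i)) l (𝓝 (op A)) := Tendsto.comp (continuous_op.tendsto A) hu
  have hc : Continuous fun p : (Plane →L[ℝ] Plane) × Plane => p.1 p.2 :=
    continuous_fst.clm_apply continuous_snd
  have h' := (hc.tendsto (op A, x)).comp (h.prodMk_nhds hv)
  exact h'

/-- Euler schemes for the sustaining feedback `Φ`, which is an arbitrary choice function. A step of
length `δ` never decreases `f` and, by dissipativity along the flow, multiplies it by at most `1 + c
δ²`. Over a bounded time the total factor tends to 1, so the ultrafilter limit of the schemes stays
on the level set. -/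
theorem exists_level_trajectory {𝒜 : Set Mat} (hcomp : IsCompact 𝒜) {f : Seminorm ℝ Plane}
    (hdef : ∀ x, f x = 0 → x = 0) (hdis : Dissipative 𝒜 f 0)
    (hsus : Sustained (convexHull ℝ 𝒜) f) (x₀ : Plane) :
    ∃ X : ℝ → Plane, IsTrajectory (convexHull ℝ 𝒜) X ∧ X 0 = x₀ ∧ ∀ t, 0 ≤ t → f (X t) = f x₀ := by
  have hco := isCompact_convexHull_of_finiteDimensional hcomp
  obtain ⟨K, hK0, hK⟩ := exists_act_bound hco
  obtain ⟨C, hC0, hC⟩ := seminorm_le_norm f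
  obtain ⟨m, hm0, hm⟩ := norm_le_seminorm hdef
  choose Φ hΦ hΦle using hsus
  have hdis' := hdis.convexHull
  set c := C * (K ^ 2 * Real.exp K * m⁻¹) with hc
  have hc0 : 0 ≤ c := by positivity
  have hup : ∀ h, 0 ≤ h → h ≤ 1 → ∀ y, f (y + h • act (Φ y) y) ≤ f y * (1 + c * h ^ 2) := by
    intro h hh hh1 y
    have h1 := seminorm_le_add hC (y + h • act (Φ y) y) (flow (Φ y) h y)
    have h2 := hdis'.flow_le hco (hΦ y) hh y
    have h3 := norm_flow_sub_sub_le hco hK0.le hK (hΦ y) hh hh1 y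
    rw [norm_sub_rev] at h3
    simp only [neg_zero, zero_mul, Real.exp_zero, one_mul] at h2
    have h4 : ‖y‖ ≤ m⁻¹ * f y := by
      rw [inv_mul_eq_div, le_div_iff₀ hm0]; linarith [hm y]
    have h5 : C * ‖y + h • act (Φ y) y - flow (Φ y) h y‖ ≤ f y * (c * h ^ 2) := by
      calc _ ≤ C * (K ^ 2 * Real.exp K * ‖y‖ * h ^ 2) := by gcongr
        _ ≤ C * (K ^ 2 * Real.exp K * (m⁻¹ * f y) * h ^ 2) := by gcongr
        _ = _ := by rw [hc]; ring
    linarith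
  let δ : ℕ → ℝ := fun n => 1 / ((n : ℝ) + 1)
  have hδ : ∀ n, 0 < δ n := fun n => by positivity
  have hδ1 : ∀ n, δ n ≤ 1 := fun n => by
    simp only [δ]; rw [div_le_one (by positivity)]; linarith [(Nat.cast_nonneg n : (0 : ℝ) ≤ n)]
  have hδlim : Tendsto δ (hyperfilter ℕ) (𝓝 0) :=
    tendsto_hyperfilter tendsto_one_div_add_atTop_nhds_zero_nat
  let k : ℕ → ℝ → ℕ := fun n t => ⌊t / δ n⌋₊
  have hkle : ∀ n t, 0 ≤ t → k n t * δ n ≤ t := fun n t ht =>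
    (le_div_iff₀ (hδ n)).1 (Nat.floor_le (div_nonneg ht (hδ n).le))
  have hkneg : ∀ n t, t ≤ 0 → k n t = 0 := fun n t ht =>
    Nat.floor_of_nonpos (div_nonpos_of_nonpos_of_nonneg ht (hδ n).le)
  have hkmax : ∀ n t, k n t * δ n ≤ max t 0 := fun n t => by
    rcases le_total t 0 with h | h
    · rw [hkneg n t h]; simp
    · rw [max_eq_left h]; exact hkle n t h
  have hklim : ∀ t, 0 ≤ t → Tendsto (fun n => k n t * δ n) (hyperfilter ℕ) (𝓝 t) := fun t ht => by
    refine tendsto_of_tendsto_of_tendsto_of_le_of_le (by simpa using hδlim.const_sub t)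
        tendsto_const_nhds (fun n => ?_) (fun n => hkle n t ht)
    have := (div_lt_iff₀ (hδ n)).1 (Nat.lt_floor_add_one (t / δ n))
    simp only [k]
    linarith
  let B : ℝ → ℝ := fun T => m⁻¹ * (f x₀ * Real.exp (c * T))
  have hB0 : ∀ T, 0 ≤ B T := fun T => by positivity
  have hlevel : ∀ n j, f x₀ ≤ f (eulerNode Φ (δ n) x₀ j) ∧
      f (eulerNode Φ (δ n) x₀ j) ≤ f x₀ * Real.exp (c * (δ n * (j * δ n))) := by
    intro n j
    have := eulerNode_level (f := f) (Φ := Φ) (h := δ n) hc0 (fun y => hΦle y _ (hδ n).le)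
      (hup _ (hδ n).le (hδ1 n)) x₀ j
    refine ⟨this.1, this.2.trans_eq ?_⟩
    ring_nf
  have hbound : ∀ (n j : ℕ) (T : ℝ), j * δ n ≤ T → ‖eulerNode Φ (δ n) x₀ j‖ ≤ B T := by
    intro n j T hT
    have h1 := hm (eulerNode Φ (δ n) x₀ j)
    have h2 := (hlevel n j).2
    have h3 : δ n * (j * δ n) ≤ T := by
      have : 0 ≤ (j : ℝ) * δ n := by have := hδ n; positivity
      nlinarith [hδ1 n, hδ n]
    simp only [B]
    rw [inv_mul_eq_div, le_div_iff₀ hm0]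
    calc _ = m * ‖eulerNode Φ (δ n) x₀ j‖ := by ring
      _ ≤ f x₀ * Real.exp (c * (δ n * (j * δ n))) := h1.trans h2
      _ ≤ _ := by gcongr
  have hXlim : ∀ t, ∃ X, Tendsto (fun n => eulerNode Φ (δ n) x₀ (k n t)) (hyperfilter ℕ) (𝓝 X) := by
    intro t
    obtain ⟨X, -, hX⟩ := exists_hyperfilter_limit (isCompact_closedBall (0 : Plane) (B (max t 0)))
      (u := fun n => eulerNode Φ (δ n) x₀ (k n t)) (fun n => by
        simpa using hbound n _ _ (hkmax n t))
    exact ⟨X, hX⟩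
  have hGmem : ∀ n s t, 0 ≤ s → s ≤ t → ∃ A ∈ convexHull ℝ 𝒜,
      eulerLaw Φ (δ n) x₀ (k n t) - eulerLaw Φ (δ n) x₀ (k n s)
        = (k n t * δ n - k n s * δ n) • A := by
    intro n s t hs hst
    have hle : k n s ≤ k n t := Nat.floor_mono (by have := (hδ n).le; gcongr)
    obtain ⟨A, hA, hAe⟩ := eulerLaw_add (h := δ n) Φ x₀ (convex_convexHull ℝ 𝒜) ⟨_, hΦ 0⟩ hΦ
      (k n s) (k n t - k n s)
    rw [Nat.add_sub_cancel' hle] at hAe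
    refine ⟨A, hA, hAe.trans ?_⟩
    rw [Nat.cast_sub hle, sub_mul]
  have hGlim : ∀ t, ∃ G, Tendsto (fun n => eulerLaw Φ (δ n) x₀ (k n t)) (hyperfilter ℕ) (𝓝 G) := by
    intro t
    have hc2 : IsCompact ((fun p : ℝ × Mat => p.1 • p.2) '' (Set.Icc 0 (max t 0) ×ˢ convexHull ℝ 𝒜)) :=
      (isCompact_Icc.prod hco).image (by fun_prop)
    obtain ⟨G, -, hG⟩ := exists_hyperfilter_limit hc2
      (u := fun n => eulerLaw Φ (δ n) x₀ (k n t)) (fun n => by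
        obtain ⟨A, hA, hAe⟩ := eulerLaw_add (h := δ n) Φ x₀ (convex_convexHull ℝ 𝒜) ⟨_, hΦ 0⟩ hΦ
          0 (k n t)
        refine ⟨(k n t * δ n, A), ⟨⟨?_, hkmax n t⟩, hA⟩, ?_⟩
        · have := (hδ n).le; simp only; positivity
        · rw [zero_add] at hAe
          change (k n t * δ n) • A = _
          rw [← hAe]
          simp [eulerLaw])
    exact ⟨G, hG⟩
  choose X hXl using hXlim
  choose G hGl using hGlim
  have htraj : IsTrajectory (convexHull ℝ 𝒜) X := by
    refine isTrajectory_of_accumulated hco ⟨_, hΦ 0⟩ (G := G) (X := X)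
      (C := fun T => (K ^ 2 + 1) * B T) (fun t ht => ?_) (fun s t hs hst => ?_)
      (fun T s t hs hst htT => ?_) (fun T s hs hsT => ?_)
    · refine tendsto_nhds_unique ((hGl t).congr fun n => ?_) (hGl 0)
      rw [hkneg n t ht, hkneg n 0 le_rfl]
    · choose A hA hAe using fun n => hGmem n s t hs hst
      obtain ⟨A', hA', hAl⟩ := exists_hyperfilter_limit hco hA
      refine ⟨A', hA', tendsto_nhds_unique ((hGl t).sub (hGl s)) ?_⟩
      simp only [hAe]
      exact ((hklim t (hs.trans hst)).sub (hklim s hs)).smul hAl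
    · have ht := hs.trans hst
      have hact : Tendsto (fun n => act (eulerLaw Φ (δ n) x₀ (k n t) - eulerLaw Φ (δ n) x₀ (k n s))
          (eulerNode Φ (δ n) x₀ (k n s))) (hyperfilter ℕ) (𝓝 (act (G t - G s) (X s))) :=
        tendsto_act ((hGl t).sub (hGl s)) (hXl s)
      have h1 := (((hXl t).sub (hXl s)).sub hact).norm
      have h2 : Tendsto (fun n => K ^ 2 * B T * (k n t * δ n - k n s * δ n) ^ 2) (hyperfilter ℕ)
          (𝓝 (K ^ 2 * B T * (t - s) ^ 2)) :=
        (((hklim t ht).sub (hklim s hs)).pow 2).const_mul _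
      have h3 := le_of_tendsto_of_tendsto' h1 h2 fun n => ?_
      · have := hB0 T
        nlinarith [sq_nonneg (t - s)]
      · have hle : k n s ≤ k n t := Nat.floor_mono (by have := (hδ n).le; gcongr)
        have := eulerNode_sub_sub_le (h := δ n) (hδ n).le hK0.le (hB0 T)
          (fun y z => hK (Φ y) (hΦ y) z) x₀ (k n s) (k n t - k n s) (fun i hi => by
            refine hbound n _ T ?_
            have h5 : k n s + i ≤ k n t := by omega
            have h6 : ((k n s + i : ℕ) : ℝ) * δ n ≤ k n t * δ n := by
              have := (hδ n).le
              gcongr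
            exact h6.trans ((hkle n t ht).trans htT))
        rw [Nat.add_sub_cancel' hle, Nat.cast_sub hle, sub_mul] at this
        exact this
    · have h1 : ‖X s‖ ≤ B T := le_of_tendsto' (hXl s).norm fun n =>
        hbound n _ T ((hkle n s hs).trans hsT)
      have := hB0 T
      nlinarith [sq_nonneg K]
  refine ⟨X, htraj, ?_, fun t ht => ?_⟩
  · refine tendsto_nhds_unique ((hXl 0).congr fun n => ?_) tendsto_const_nhds
    rw [hkneg n 0 le_rfl, eulerNode]
  · have h1 : Tendsto (fun n => f (eulerNode Φ (δ n) x₀ (k n t))) (hyperfilter ℕ) (𝓝 (f (X t))) :=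
      ((continuous_seminorm f).tendsto _).comp (hXl t)
    refine le_antisymm ?_ (ge_of_tendsto' h1 fun n => (hlevel n _).1)
    have h2 : Tendsto (fun n => f x₀ * Real.exp (c * (δ n * (k n t * δ n)))) (hyperfilter ℕ)
        (𝓝 (f x₀ * Real.exp (c * (0 * t)))) :=
      (((Real.continuous_exp.tendsto _).comp ((hδlim.mul (hklim t ht)).const_mul c))).const_mul _
    have := le_of_tendsto_of_tendsto' h1 h2 fun n => (hlevel n _).2
    simpa using this

/-- The differential characterization of the invariant norms of a system with zero exponent. -/
theorem isBarabanov_iff {𝒜 : Set Mat} (hcomp : IsCompact 𝒜) (hσ : lyapunovExponent 𝒜 = 0)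
    {f : Seminorm ℝ Plane} :
    IsBarabanov 𝒜 f ↔
      (∀ x, f x = 0 → x = 0) ∧ Dissipative 𝒜 f 0 ∧ Sustained (convexHull ℝ 𝒜) f := by
  refine ⟨fun h => ⟨h.1, h.dissipative hcomp hσ, h.sustained hcomp hσ⟩,
    fun ⟨hdef, hdis, hsus⟩ => ⟨hdef, fun x hx t ht => ?_, fun x₀ => ?_⟩⟩
  · obtain ⟨K, hK0, hK⟩ := exists_act_bound hcomp
    simpa [hσ] using hdis.le_exp hK hK0.le hx ht
  · obtain ⟨X, hX, hX0, hlev⟩ := exists_level_trajectory hcomp hdef hdis hsus x₀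
    exact ⟨X, hX, hX0, fun t ht => by rw [hσ, hlev t ht]; simp⟩

theorem exists_isBarabanov {𝒜 : Set Mat} (hcomp : IsCompact 𝒜)
    (hirr : IsIrreducibleFamily 𝒜) (hσ : lyapunovExponent 𝒜 = 0) :
    ∃ f : Seminorm ℝ Plane, IsBarabanov 𝒜 f := by
  obtain ⟨f, hdef, hdis, hsus⟩ := exists_dissipative_sustained hcomp hirr hσ
  refine ⟨f, (isBarabanov_iff hcomp hσ).2 ⟨hdef, hdis, fun x => ?_⟩⟩
  obtain ⟨A, hA, hle⟩ := hsus x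
  exact ⟨A, subset_convexHull ℝ 𝒜 hA, hle⟩

/-! ### Polar coordinates -/

/-- The derivative of `unitVec`. -/
noncomputable def normalVec (γ : ℝ) : Plane := !₂[-Real.sin γ, Real.cos γ]

/-- The radial component of `A u`, where `u` is the unit vector of argument `γ`. -/
noncomputable def radial (A : Mat) (γ : ℝ) : ℝ :=
  (A 0 0 * Real.cos γ + A 0 1 * Real.sin γ) * Real.cos γ +
    (A 1 0 * Real.cos γ + A 1 1 * Real.sin γ) * Real.sin γ

/-- The angular component of `A u`, where `u` is the unit vector of argument `γ`. -/
noncomputable def angular (A : Mat) (γ : ℝ) : ℝ :=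
  (A 1 0 * Real.cos γ + A 1 1 * Real.sin γ) * Real.cos γ -
    (A 0 0 * Real.cos γ + A 0 1 * Real.sin γ) * Real.sin γ

theorem unitVec_ne_zero (γ : ℝ) : unitVec γ ≠ 0 := fun h => by
  simpa [h] using norm_unitVec γ

theorem norm_normalVec (γ : ℝ) : ‖normalVec γ‖ = 1 := by
  have h := norm_sq_eq (normalVec γ)
  have e : normalVec γ 0 ^ 2 + normalVec γ 1 ^ 2 = 1 := by simp [normalVec]
  rw [e] at h
  nlinarith [norm_nonneg (normalVec γ)]

theorem hasDerivAt_unitVec (γ : ℝ) : HasDerivAt unitVec (normalVec γ) γ :=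
  hasDerivAt_plane fun i => by
    fin_cases i
    · simpa [unitVec, normalVec] using Real.hasDerivAt_cos γ
    · simpa [unitVec, normalVec] using Real.hasDerivAt_sin γ

theorem continuous_unitVec : Continuous unitVec :=
  continuous_iff_continuousAt.2 fun γ => (hasDerivAt_unitVec γ).continuousAt

theorem unitVec_add (γ δ : ℝ) :
    unitVec (γ + δ) = Real.cos δ • unitVec γ + Real.sin δ • normalVec γ := by
  apply plane_ext <;> simp [unitVec, normalVec, Real.cos_add, Real.sin_add] <;> ring

theorem unitVec_add_pi (γ : ℝ) : unitVec (γ + Real.pi) = -unitVec γ := by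
  apply plane_ext <;> simp [unitVec]

theorem act_unitVec (A : Mat) (γ : ℝ) :
    act A (unitVec γ) = radial A γ • unitVec γ + angular A γ • normalVec γ := by
  have h := Real.cos_sq_add_sin_sq γ
  apply plane_ext
  · rw [act_apply]
    simp [unitVec, normalVec, radial, angular]
    linear_combination (-(A 0 0 * Real.cos γ + A 0 1 * Real.sin γ)) * h
  · rw [act_apply]
    simp [unitVec, normalVec, radial, angular]
    linear_combination (-(A 1 0 * Real.cos γ + A 1 1 * Real.sin γ)) * h

theorem polar_eq_iff {γ a b c d : ℝ} :
    a • unitVec γ + b • normalVec γ = c • unitVec γ + d • normalVec γ ↔ a = c ∧ b = d := by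
  refine ⟨fun h => ?_, fun ⟨h1, h2⟩ => by rw [h1, h2]⟩
  have h0 : (a • unitVec γ + b • normalVec γ) 0 = (c • unitVec γ + d • normalVec γ) 0 := by rw [h]
  have h1 : (a • unitVec γ + b • normalVec γ) 1 = (c • unitVec γ + d • normalVec γ) 1 := by rw [h]
  simp [unitVec, normalVec] at h0 h1
  have e := Real.cos_sq_add_sin_sq γ
  constructor
  · linear_combination Real.cos γ * h0 + Real.sin γ * h1 + (c - a) * e
  · linear_combination -Real.sin γ * h0 + Real.cos γ * h1 + (d - b) * e

theorem exists_polar_components (γ : ℝ) (x : Plane) :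
    ∃ a b : ℝ, x = a • unitVec γ + b • normalVec γ := by
  refine ⟨x 0 * Real.cos γ + x 1 * Real.sin γ, x 1 * Real.cos γ - x 0 * Real.sin γ, ?_⟩
  have e := Real.cos_sq_add_sin_sq γ
  apply plane_ext
  · simp [unitVec, normalVec]; linear_combination -(x 0) * e
  · simp [unitVec, normalVec]; linear_combination -(x 1) * e

theorem exists_eq_smul_unitVec (x : Plane) : ∃ γ : ℝ, x = ‖x‖ • unitVec γ := by
  refine ⟨Complex.arg ⟨x 0, x 1⟩, ?_⟩
  have hn : ‖x‖ = ‖(⟨x 0, x 1⟩ : ℂ)‖ := by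
    rw [← sq_eq_sq₀ (norm_nonneg _) (norm_nonneg _), norm_sq_eq, ← Complex.normSq_eq_norm_sq,
      Complex.normSq_mk]
    ring
  apply plane_ext
  · simp [unitVec, hn]
  · simp [unitVec, hn]

theorem exists_eq_smul_unitVec_mem (x : Plane) :
    ∃ γ ∈ Set.Ico (0 : ℝ) Real.pi, ∃ r : ℝ, |r| = ‖x‖ ∧ x = r • unitVec γ := by
  obtain ⟨γ, h⟩ := exists_eq_smul_unitVec x
  have key : ∀ n : ℕ, ∀ δ : ℝ, (unitVec (δ + n * Real.pi) = unitVec δ ∨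
      unitVec (δ + n * Real.pi) = -unitVec δ) := by
    intro n δ
    induction n with
    | zero => left; simp
    | succ n ih =>
      have : δ + ((n + 1 : ℕ) : ℝ) * Real.pi = δ + n * Real.pi + Real.pi := by push_cast; ring
      rw [this, unitVec_add_pi]
      rcases ih with ih | ih <;> simp [ih]
  have keyz : ∀ n : ℤ, ∀ δ : ℝ, (unitVec (δ + n * Real.pi) = unitVec δ ∨
      unitVec (δ + n * Real.pi) = -unitVec δ) := by
    intro n δ
    rcases Int.eq_nat_or_neg n with ⟨k, rfl | rfl⟩
    · exact_mod_cast key k δ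
    · have := key k (δ + ((-(k : ℤ) : ℤ) : ℝ) * Real.pi)
      have e : δ + ((-(k : ℤ) : ℤ) : ℝ) * Real.pi + k * Real.pi = δ := by push_cast; ring
      rw [e] at this
      rcases this with h | h
      · left; rw [h]
      · right; rw [h, neg_neg]
  have hγ : toIcoMod Real.pi_pos 0 γ + toIcoDiv Real.pi_pos 0 γ * Real.pi = γ := by
    simp
  refine ⟨toIcoMod Real.pi_pos 0 γ, by simpa using toIcoMod_mem_Ico Real.pi_pos 0 γ, ?_⟩
  rcases keyz (toIcoDiv Real.pi_pos 0 γ) (toIcoMod Real.pi_pos 0 γ) with e | e <;> rw [hγ] at e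
  · exact ⟨‖x‖, abs_of_nonneg (norm_nonneg _), by rw [← e]; exact h⟩
  · exact ⟨-‖x‖, by simp, by rw [neg_smul, ← smul_neg, ← e]; exact h⟩

theorem continuous_radial : Continuous fun p : Mat × ℝ => radial p.1 p.2 := by
  unfold radial; fun_prop

theorem continuous_angular : Continuous fun p : Mat × ℝ => angular p.1 p.2 := by
  unfold angular; fun_prop

theorem angular_add_pi (A : Mat) (γ : ℝ) : angular A (γ + Real.pi) = angular A γ := by
  simp [angular]; ring

theorem radial_comb (a b : ℝ) (A B : Mat) (γ : ℝ) :
    radial (a • A + b • B) γ = a * radial A γ + b * radial B γ := by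
  simp [radial]; ring

theorem angular_comb (a b : ℝ) (A B : Mat) (γ : ℝ) :
    angular (a • A + b • B) γ = a * angular A γ + b * angular B γ := by
  simp [angular]; ring

theorem norm_sq_polar (γ a b : ℝ) : ‖a • unitVec γ + b • normalVec γ‖ ^ 2 = a ^ 2 + b ^ 2 := by
  rw [norm_sq_eq]
  simp [unitVec, normalVec]
  linear_combination (a ^ 2 + b ^ 2) * Real.cos_sq_add_sin_sq γ

theorem abs_angular_le {K : ℝ} {A : Mat} (hK : ∀ x, ‖act A x‖ ≤ K * ‖x‖) (γ : ℝ) :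
    |angular A γ| ≤ K := by
  have h := hK (unitVec γ)
  have h2 := norm_sq_polar γ (radial A γ) (angular A γ)
  rw [act_unitVec, norm_unitVec, mul_one] at h
  have h0 := norm_nonneg (radial A γ • unitVec γ + angular A γ • normalVec γ)
  exact abs_le_of_sq_le_sq (by nlinarith) (by linarith)

/-- The bound is uniform over the operators; it limits how fast an angular component can grow from
zero, which `TopArc.exists_pos_left` needs. -/
theorem exists_lipschitz_angular {𝒜 : Set Mat} (hcomp : IsCompact 𝒜) :
    ∃ K : ℝ, 0 < K ∧ ∀ A ∈ 𝒜, ∀ γ δ, |angular A γ - angular A δ| ≤ K * |γ - δ| := by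
  obtain ⟨K, hK0, hK⟩ := exists_act_bound hcomp
  have hd : ∀ A γ, HasDerivAt (angular A) (A 1 1 * Real.cos (2 * γ) - A 0 0 * Real.cos (2 * γ)
      - (A 1 0 + A 0 1) * Real.sin (2 * γ)) γ := by
    intro A γ
    have hc := Real.hasDerivAt_cos γ
    have hs := Real.hasDerivAt_sin γ
    have := ((((hc.const_mul (A 1 0)).add (hs.const_mul (A 1 1))).mul hc).sub
      (((hc.const_mul (A 0 0)).add (hs.const_mul (A 0 1))).mul hs))
    refine this.congr_deriv ?_
    rw [Real.cos_two_mul, Real.sin_two_mul]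
    simp only [Pi.add_apply]
    linear_combination (A 0 0 - A 1 1) * Real.cos_sq_add_sin_sq γ
  have hent : ∀ A ∈ 𝒜, ∀ i j, |A i j| ≤ K := by
    intro A hA i j
    have h := hK A hA (EuclideanSpace.single j 1)
    have h1 := PiLp.norm_apply_le (act A (EuclideanSpace.single j 1)) i
    have e : act A (EuclideanSpace.single j 1) i = A i j := by
      rw [act_apply]; fin_cases j <;> simp
    rw [e] at h1
    simp only [Real.norm_eq_abs] at h1
    simp at h
    linarith
  refine ⟨4 * K, by positivity, fun A hA γ δ => ?_⟩
  have := Convex.norm_image_sub_le_of_norm_hasDerivWithin_le (f := angular A) (s := Set.univ)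
    (C := 4 * K) (fun x _ => (hd A x).hasDerivWithinAt) (fun x _ => ?_) convex_univ
    (Set.mem_univ δ) (Set.mem_univ γ)
  · simpa [Real.norm_eq_abs] using this
  · have hc := Real.abs_cos_le_one (2 * x)
    have hs := Real.abs_sin_le_one (2 * x)
    have b1 : |A 1 1 * Real.cos (2 * x)| ≤ K := by
      rw [abs_mul]; nlinarith [hent A hA 1 1, abs_nonneg (A 1 1), abs_nonneg (Real.cos (2 * x))]
    have b2 : |A 0 0 * Real.cos (2 * x)| ≤ K := by
      rw [abs_mul]; nlinarith [hent A hA 0 0, abs_nonneg (A 0 0), abs_nonneg (Real.cos (2 * x))]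
    have b3 : |A 1 0 * Real.sin (2 * x)| ≤ K := by
      rw [abs_mul]; nlinarith [hent A hA 1 0, abs_nonneg (A 1 0), abs_nonneg (Real.sin (2 * x))]
    have b4 : |A 0 1 * Real.sin (2 * x)| ≤ K := by
      rw [abs_mul]; nlinarith [hent A hA 0 1, abs_nonneg (A 0 1), abs_nonneg (Real.sin (2 * x))]
    rw [Real.norm_eq_abs, abs_le]
    rw [abs_le] at b1 b2 b3 b4
    constructor <;> linarith

/-- Projection along a compact factor is closed. In this form the compactness of the family of
operators gives closed and open conditions on the argument. -/
theorem isClosed_exists_mem {X Y : Type*} [TopologicalSpace X] [TopologicalSpace Y] {s : Set X}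
    (hs : IsCompact s) {Z : Set (X × Y)} (hZ : IsClosed Z) : IsClosed {y | ∃ x ∈ s, (x, y) ∈ Z} := by
  have := isCompact_iff_compactSpace.1 hs
  have hc : IsClosed {q : s × Y | ((q.1 : X), q.2) ∈ Z} :=
    hZ.preimage ((continuous_subtype_val.comp continuous_fst).prodMk continuous_snd)
  have := isClosedMap_snd_of_compactSpace _ hc
  convert! this using 1
  ext y
  simp

/-! ### The polar equation of the unit sphere of a norm -/

theorem seminorm_unitVec_pos {f : Seminorm ℝ Plane} (hdef : ∀ x, f x = 0 → x = 0) (γ : ℝ) :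
    0 < f (unitVec γ) :=
  (apply_nonneg f _).lt_of_ne fun h => unitVec_ne_zero γ (hdef _ h.symm)

theorem logRadius_eq {f : Seminorm ℝ Plane} (hdef : ∀ x, f x = 0 → x = 0) (γ : ℝ) :
    logRadius f γ = -Real.log (f (unitVec γ)) := by
  have h := seminorm_unitVec_pos hdef γ
  rw [logRadius, spherePoint, norm_smul, norm_unitVec, mul_one, norm_inv, Real.norm_of_nonneg h.le,
    Real.log_inv]

theorem seminorm_unitVec_eq {f : Seminorm ℝ Plane} (hdef : ∀ x, f x = 0 → x = 0) (γ : ℝ) :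
    f (unitVec γ) = Real.exp (-logRadius f γ) := by
  rw [logRadius_eq hdef, neg_neg, Real.exp_log (seminorm_unitVec_pos hdef γ)]

theorem logRadius_add_pi {f : Seminorm ℝ Plane} (γ : ℝ) :
    logRadius f (γ + Real.pi) = logRadius f γ := by
  simp [logRadius, spherePoint, unitVec_add_pi, map_neg_eq_map]

/-- `m` is the slope (the derivative of the logarithm of the radius with respect to the argument)
of a line of support of the unit sphere at the point of argument `γ`. -/
def IsSupportSlope (f : Seminorm ℝ Plane) (γ m : ℝ) : Prop :=
  ∀ a b : ℝ, f (unitVec γ) * (a - m * b) ≤ f (a • unitVec γ + b • normalVec γ)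

/-- If `a - m * b` is positive, the vector is that multiple of a point of the line; otherwise the
left side is nonpositive and there is nothing to prove. -/
theorem isSupportSlope_of_line {f : Seminorm ℝ Plane} {γ d r : ℝ} (hr : r ≠ 0)
    (h : ∀ q : ℝ, f (unitVec γ) ≤ f (unitVec γ + q • (d • unitVec γ + r • normalVec γ))) :
    IsSupportSlope f γ (d / r) := by
  intro a b
  set c := a - d / r * b with hc
  rcases le_or_gt c 0 with hc0 | hc0
  · exact (mul_nonpos_of_nonneg_of_nonpos (apply_nonneg f _) hc0).trans (apply_nonneg f _)
  · have e : a • unitVec γ + b • normalVec γ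
        = c • (unitVec γ + (b / r / c) • (d • unitVec γ + r • normalVec γ)) := by
      have : ∀ p q s t : ℝ, p = s → q = t →
        p • unitVec γ + q • normalVec γ = s • unitVec γ + t • normalVec γ := by
          rintro _ _ _ _ rfl rfl; rfl
      have e2 : c • (unitVec γ + (b / r / c) • (d • unitVec γ + r • normalVec γ))
          = (c + b / r * d) • unitVec γ + b • normalVec γ := by
        have h1 : c * (b / r / c) = b / r := by field_simp
        have h2 : b / r * r = b := by field_simp
        rw [smul_add, smul_smul, h1, smul_add, smul_smul, smul_smul, h2]
        module
      rw [e2]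
      exact this _ _ _ _ (by rw [hc]; ring) rfl
    rw [e, map_smul_eq_mul, Real.norm_of_nonneg hc0.le, mul_comm]
    exact mul_le_mul_of_nonneg_left (h _) hc0.le

/-- Hahn–Banach: a functional that equals `f` on the ray of `u(γ)` and is dominated by `f`
everywhere gives the line of support. -/
theorem exists_isSupportSlope {f : Seminorm ℝ Plane} (hdef : ∀ x, f x = 0 → x = 0) (γ : ℝ) :
    ∃ m, IsSupportSlope f γ m := by
  have hF := seminorm_unitVec_pos hdef γ
  have hdom : ∀ x : (LinearPMap.mkSpanSingleton (K := ℝ) (L := ℝ) (σ := RingHom.id ℝ) (unitVec γ)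
      (f (unitVec γ)) (unitVec_ne_zero γ)).domain, LinearPMap.mkSpanSingleton (K := ℝ)
        (σ := RingHom.id ℝ) (unitVec γ) (f (unitVec γ)) (unitVec_ne_zero γ) x ≤ f x := by
    rintro ⟨x, hx⟩
    obtain ⟨c, rfl⟩ := Submodule.mem_span_singleton.1 hx
    rw [LinearPMap.mkSpanSingleton'_apply]
    simp only [RingHom.id_apply, smul_eq_mul, map_smul_eq_mul, Real.norm_eq_abs]
    exact mul_le_mul_of_nonneg_right (le_abs_self c) hF.le
  obtain ⟨ℓ, hℓ, hle⟩ := exists_extension_of_le_sublinear _ f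
    (fun c hc x => by rw [map_smul_eq_mul, Real.norm_of_nonneg hc.le])
    (fun x y => map_add_le_add f x y) hdom
  refine ⟨-ℓ (normalVec γ) / f (unitVec γ), fun a b => ?_⟩
  have h1 : ℓ (unitVec γ) = f (unitVec γ) := by
    have := hℓ ⟨unitVec γ, Submodule.mem_span_singleton_self _⟩
    rw [this, LinearPMap.mkSpanSingleton_apply]
  have h2 := hle (a • unitVec γ + b • normalVec γ)
  rw [map_add, map_smul, map_smul, h1, smul_eq_mul, smul_eq_mul] at h2
  refine le_trans (le_of_eq ?_) h2
  field_simp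
  ring

theorem exists_abs_supportSlope_le {f : Seminorm ℝ Plane} (hdef : ∀ x, f x = 0 → x = 0) :
    ∃ M : ℝ, 0 < M ∧ ∀ γ m, IsSupportSlope f γ m → |m| ≤ M := by
  obtain ⟨C, hC0, hC⟩ := seminorm_le_norm f
  obtain ⟨c, hc0, hc⟩ := norm_le_seminorm hdef
  refine ⟨C / c, by positivity, fun γ m hm => ?_⟩
  have h1 := hm 0 1
  have h2 := hm 0 (-1)
  have h3 := hc (unitVec γ)
  have h4 := hC (normalVec γ)
  rw [norm_unitVec] at h3
  rw [norm_normalVec] at h4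
  simp [map_neg_eq_map] at h1 h2
  rw [le_div_iff₀ hc0]
  have : |m| * f (unitVec γ) ≤ f (normalVec γ) := by
    rcases abs_cases m with ⟨e, -⟩ | ⟨e, -⟩ <;> rw [e] <;> linarith
  nlinarith [abs_nonneg m]

theorem norm_unitVec_sub_le (γ δ : ℝ) : ‖unitVec γ - unitVec δ‖ ≤ |γ - δ| := by
  have := Convex.norm_image_sub_le_of_norm_hasDerivWithin_le (f := unitVec) (s := Set.univ)
    (C := 1) (fun x _ => (hasDerivAt_unitVec x).hasDerivWithinAt)
    (fun x _ => (norm_normalVec x).le) convex_univ (Set.mem_univ δ) (Set.mem_univ γ)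
  simpa using this

theorem exists_lipschitz_logRadius {f : Seminorm ℝ Plane} (hdef : ∀ x, f x = 0 → x = 0) :
    ∃ L : NNReal, LipschitzWith L (logRadius f) := by
  obtain ⟨C, hC0, hC⟩ := seminorm_le_norm f
  obtain ⟨c, hc0, hc⟩ := norm_le_seminorm hdef
  have key : ∀ γ δ, logRadius f γ - logRadius f δ ≤ C / c * |γ - δ| := by
    intro γ δ
    have hγ := seminorm_unitVec_pos hdef γ
    have hδ := seminorm_unitVec_pos hdef δ
    rw [logRadius_eq hdef, logRadius_eq hdef, neg_sub_neg, ← Real.log_div hδ.ne' hγ.ne']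
    refine (Real.log_le_sub_one_of_pos (by positivity)).trans ?_
    have h1 := seminorm_le_add hC (unitVec δ) (unitVec γ)
    have h2 := norm_unitVec_sub_le δ γ
    have h3 := hc (unitVec γ)
    rw [norm_unitVec, mul_one] at h3
    rw [abs_sub_comm] at h2
    have h4 : f (unitVec δ) / f (unitVec γ) - 1 = (f (unitVec δ) - f (unitVec γ)) / f (unitVec γ) := by
      field_simp
    rw [h4, div_le_iff₀ hγ]
    calc f (unitVec δ) - f (unitVec γ) ≤ C * |γ - δ| := by nlinarith
      _ = C / c * |γ - δ| * c := by field_simp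
      _ ≤ C / c * |γ - δ| * f (unitVec γ) := by gcongr
  refine ⟨⟨C / c, by positivity⟩, LipschitzWith.of_dist_le_mul fun γ δ => ?_⟩
  rw [Real.dist_eq, Real.dist_eq, abs_le]
  have h1 := key γ δ
  have h2 := key δ γ
  rw [abs_sub_comm] at h2
  exact ⟨by change -(C / c * _) ≤ _; linarith, h1⟩

theorem continuous_logRadius {f : Seminorm ℝ Plane} (hdef : ∀ x, f x = 0 → x = 0) :
    Continuous (logRadius f) := by
  obtain ⟨L, hL⟩ := exists_lipschitz_logRadius hdef
  exact hL.continuous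

/-- The logarithm of the radius is semiconcave, the support slopes being its superdifferentials. -/
theorem exists_logRadius_le {f : Seminorm ℝ Plane} (hdef : ∀ x, f x = 0 → x = 0) :
    ∃ C > 0, ∃ δ₀ > 0, ∀ γ m, IsSupportSlope f γ m → ∀ δ : ℝ, |δ| ≤ δ₀ →
      logRadius f (γ + δ) ≤ logRadius f γ + m * δ + C * δ ^ 2 := by
  obtain ⟨M, hM0, hM⟩ := exists_abs_supportSlope_le hdef
  refine ⟨1 / 2 + M + 2 * (2 * M + 1) ^ 2, by positivity, 1 / (2 * (2 * M + 1)), by positivity,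
    fun γ m hm δ hδ => ?_⟩
  have hmM := abs_le.1 (hM γ m hm)
  have hδ1 : |δ| ≤ 1 := hδ.trans (by
    rw [div_le_one (by positivity)]; nlinarith)
  have hcos1 := Real.one_sub_sq_div_two_le_cos (x := δ)
  have hcos2 := Real.cos_le_one δ
  have hsin : |Real.sin δ - δ| ≤ δ ^ 2 := by
    have h1 := Real.sin_bound hδ1
    have h2 : |δ ^ 3 / 6| ≤ δ ^ 2 * (1 / 6) := by
      rw [abs_div, abs_pow, ← sq_abs δ, abs_of_pos (by norm_num : (0 : ℝ) < 6)]
      have := mul_le_mul_of_nonneg_left hδ1 (sq_nonneg |δ|)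
      nlinarith
    have h3 : |δ| ^ 5 / 100 ≤ δ ^ 2 / 100 := by
      rw [← sq_abs δ]
      exact div_le_div_of_nonneg_right (pow_le_pow_of_le_one (abs_nonneg δ) hδ1 (by norm_num))
        (by norm_num)
    have h4 : Real.sin δ - δ = (Real.sin δ - (δ - δ ^ 3 / 6)) - δ ^ 3 / 6 := by ring
    rw [h4]
    refine (abs_sub _ _).trans ?_
    nlinarith [sq_nonneg δ]
  -- The support inequality at the unit vector of argument `γ + δ` has the factor `1 - e` with `e =
  -- m δ + O(δ²)`. The choice of `δ₀` gives `|e| ≤ 1/2`, where `log (1 - e) ≥ -e - 2 e²`.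
  set e := 1 - (Real.cos δ - m * Real.sin δ) with he
  have hms : |m * (Real.sin δ - δ)| ≤ M * δ ^ 2 := by
    rw [abs_mul]; exact mul_le_mul (hM γ m hm) hsin (abs_nonneg _) hM0.le
  have hms' := abs_le.1 hms
  have he1 : e ≤ m * δ + (1 / 2 + M) * δ ^ 2 := by
    rw [he]; nlinarith
  have he2 : |e| ≤ (2 * M + 1) * |δ| := by
    have h1 : |m * δ| ≤ M * |δ| := by
      rw [abs_mul]; exact mul_le_mul_of_nonneg_right (hM γ m hm) (abs_nonneg _)
    have h2 : δ ^ 2 ≤ |δ| := by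
      rw [← sq_abs]; nlinarith [abs_nonneg δ]
    have h1' := abs_le.1 h1
    rw [abs_le]
    constructor
    · rw [he]; nlinarith
    · nlinarith
  have he3 : |e| ≤ 1 / 2 := he2.trans (by
    calc (2 * M + 1) * |δ| ≤ (2 * M + 1) * (1 / (2 * (2 * M + 1))) := by gcongr
      _ = 1 / 2 := by field_simp)
  have he4 : e ^ 2 ≤ (2 * M + 1) ^ 2 * δ ^ 2 := by
    rw [← sq_abs e, ← sq_abs δ, ← mul_pow]
    exact pow_le_pow_left₀ (abs_nonneg _) he2 2
  have hw : 1 / 2 ≤ 1 - e := by linarith [(abs_le.1 he3).2]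
  have hw0 : 0 < 1 - e := by linarith
  have hF := seminorm_unitVec_pos hdef γ
  have h1 := hm (Real.cos δ) (Real.sin δ)
  rw [← unitVec_add] at h1
  have e1 : Real.cos δ - m * Real.sin δ = 1 - e := by rw [he]; ring
  rw [e1] at h1
  have h2 := Real.log_le_log (by positivity) h1
  rw [Real.log_mul hF.ne' hw0.ne'] at h2
  have h3 := Real.one_sub_inv_le_log_of_pos hw0
  have h4 : (1 - e)⁻¹ ≤ 1 + e + 2 * e ^ 2 := by
    rw [inv_eq_one_div, div_le_iff₀ hw0]
    nlinarith [sq_nonneg e]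
  rw [logRadius_eq hdef, logRadius_eq hdef]
  nlinarith

/-- The two semiconcavity inequalities at the two points, added: slopes can jump down but never up.
-/
theorem exists_supportSlope_le {f : Seminorm ℝ Plane} (hdef : ∀ x, f x = 0 → x = 0) :
    ∃ C > 0, ∃ δ₀ > 0, ∀ γ₁ m₁ γ₂ m₂, IsSupportSlope f γ₁ m₁ → IsSupportSlope f γ₂ m₂ →
      γ₁ < γ₂ → γ₂ ≤ γ₁ + δ₀ → m₂ ≤ m₁ + C * (γ₂ - γ₁) := by
  obtain ⟨C, hC0, δ₀, hδ₀, h⟩ := exists_logRadius_le hdef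
  refine ⟨2 * C, by positivity, δ₀, hδ₀, fun γ₁ m₁ γ₂ m₂ h₁ h₂ hlt hle => ?_⟩
  have hpos : 0 < γ₂ - γ₁ := by linarith
  have e1 := h γ₁ m₁ h₁ (γ₂ - γ₁) (by rw [abs_of_pos hpos]; linarith)
  have e2 := h γ₂ m₂ h₂ (γ₁ - γ₂) (by rw [abs_sub_comm, abs_of_pos hpos]; linarith)
  rw [add_sub_cancel] at e1 e2
  have : (m₂ - m₁) * (γ₂ - γ₁) ≤ 2 * C * (γ₂ - γ₁) * (γ₂ - γ₁) := by nlinarith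
  have := le_of_mul_le_mul_right this hpos
  linarith

/-- A parabola with slope `m` touches the log-radius from above at `γ`, so their difference has a
local minimum there. -/
theorem IsSupportSlope.eq_of_hasDerivAt {f : Seminorm ℝ Plane} (hdef : ∀ x, f x = 0 → x = 0)
    {γ m d : ℝ} (hm : IsSupportSlope f γ m) (hd : HasDerivAt (logRadius f) d γ) : m = d := by
  obtain ⟨C, hC0, δ₀, hδ₀, h⟩ := exists_logRadius_le hdef
  have hmin : IsLocalMin (fun x => logRadius f γ + m * (x - γ) + C * (x - γ) ^ 2 - logRadius f x) γ := by
    filter_upwards [eventually_abs_sub_lt γ hδ₀] with x hx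
    have := h γ m hm (x - γ) hx.le
    rw [add_sub_cancel] at this
    simp
    linarith
  have hder : HasDerivAt (fun x => logRadius f γ + m * (x - γ) + C * (x - γ) ^ 2 - logRadius f x)
      (m - d) γ := by
    have h1 := ((hasDerivAt_id γ).sub_const γ)
    have h2 := (((h1.const_mul m).const_add (logRadius f γ)).add ((h1.pow 2).const_mul C)).sub hd
    refine h2.congr_deriv ?_
    simp
  linarith [hmin.hasDerivAt_eq_zero hder]

theorem isSupportSlope_of_hasDerivAt {f : Seminorm ℝ Plane} (hdef : ∀ x, f x = 0 → x = 0)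
    {γ d : ℝ} (hd : HasDerivAt (logRadius f) d γ) : IsSupportSlope f γ d := by
  obtain ⟨m, hm⟩ := exists_isSupportSlope hdef γ
  rwa [← hm.eq_of_hasDerivAt hdef hd]

/-- Semiconcavity at `γ` and at the nearby point bounds the increment from above and below by slopes
that converge to each other. -/
theorem hasDerivAt_logRadius_of_continuousAt {f : Seminorm ℝ Plane} (hdef : ∀ x, f x = 0 → x = 0)
    {γ : ℝ} {s : ℝ → ℝ} (hs : ∀ᶠ x in 𝓝 γ, IsSupportSlope f x (s x)) (hc : ContinuousAt s γ) :
    HasDerivAt (logRadius f) (s γ) γ := by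
  obtain ⟨C, hC0, δ₀, hδ₀, h⟩ := exists_logRadius_le hdef
  rw [hasDerivAt_iff_isLittleO, Asymptotics.isLittleO_iff]
  intro ε hε
  have h1 : ∀ᶠ x in 𝓝 γ, |x - γ| < min δ₀ (ε / (2 * C)) :=
    eventually_abs_sub_lt γ (by positivity)
  have h2 : ∀ᶠ x in 𝓝 γ, |s x - s γ| < ε / 2 := by
    exact hc.eventually (eventually_abs_sub_lt (s γ) (half_pos hε))
  filter_upwards [h1, h2, hs] with x hx hsx hx2
  have hx0 := (lt_min_iff.1 hx).1
  have hx1 := (lt_min_iff.1 hx).2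
  have e1 := h γ (s γ) hs.self_of_nhds (x - γ) hx0.le
  have e2 := h x (s x) hx2 (γ - x) (by rw [abs_sub_comm]; exact hx0.le)
  rw [add_sub_cancel] at e1 e2
  have e3 : C * (x - γ) ^ 2 ≤ ε / 2 * |x - γ| := by
    rw [← sq_abs]
    have : C * |x - γ| ≤ ε / 2 := by
      calc C * |x - γ| ≤ C * (ε / (2 * C)) := by gcongr
        _ = ε / 2 := by field_simp
    nlinarith [abs_nonneg (x - γ)]
  have e4 : |(s x - s γ) * (x - γ)| ≤ ε / 2 * |x - γ| := by
    rw [abs_mul]; gcongr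
  have e4' := abs_le.1 e4
  rw [Real.norm_eq_abs, Real.norm_eq_abs, abs_le, smul_eq_mul]
  have e0 := abs_nonneg (x - γ)
  constructor <;> nlinarith

/-! ### Slopes and operators -/

/-- All velocities `A u`, with `u` of argument `γ`, point to the inner side of the line through `u`
with slope `m`. -/
def AdmissibleSlope (𝒜 : Set Mat) (γ m : ℝ) : Prop := ∀ A ∈ 𝒜, radial A γ ≤ m * angular A γ

theorem AdmissibleSlope.convexHull {𝒜 : Set Mat} {γ m : ℝ} (h : AdmissibleSlope 𝒜 γ m) :
    AdmissibleSlope (convexHull ℝ 𝒜) γ m := by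
  have hc : Convex ℝ {A : Mat | radial A γ ≤ m * angular A γ} := by
    intro A hA B hB a b ha hb hab
    simp only [Set.mem_ofPred_eq, radial_comb, angular_comb] at *
    nlinarith
  exact convexHull_min h hc

/-- The ray `u + h A u` is bounded from above by dissipativity and from below by the line of
support; the first-order terms are compared. -/
theorem IsSupportSlope.admissible {𝒜 : Set Mat} {f : Seminorm ℝ Plane}
    (hdef : ∀ x, f x = 0 → x = 0) (hdis : Dissipative 𝒜 f 0) {γ m : ℝ}
    (hm : IsSupportSlope f γ m) : AdmissibleSlope 𝒜 γ m := by
  intro A hA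
  have hF := seminorm_unitVec_pos hdef γ
  refine le_of_forall_pos_le_add fun ε hε => ?_
  obtain ⟨h₀, hh₀, h⟩ := hdis A hA (unitVec γ) (ε * f (unitVec γ)) (by positivity)
  have h1 := h h₀ hh₀.le le_rfl
  have h2 := hm (1 + h₀ * radial A γ) (h₀ * angular A γ)
  have e : unitVec γ + h₀ • act A (unitVec γ) =
      (1 + h₀ * radial A γ) • unitVec γ + (h₀ * angular A γ) • normalVec γ := by
    rw [act_unitVec]; module
  rw [e] at h1
  have h3 : (h₀ * f (unitVec γ)) * (radial A γ) ≤ (h₀ * f (unitVec γ)) * (m * angular A γ + ε) := by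
    linarith
  exact le_of_mul_le_mul_left h3 (by positivity)

/-- A smaller value behind `x` would, by convexity, force `f` to grow linearly ahead of `x`, against
dissipativity. So a sustaining direction makes `x` a minimum on the whole line. -/
theorem le_line_of_le_ray {𝒜 : Set Mat} {f : Seminorm ℝ Plane} (hdis : Dissipative 𝒜 f 0) {A : Mat}
    (hA : A ∈ 𝒜) {x : Plane} (hle : ∀ h : ℝ, 0 ≤ h → f x ≤ f (x + h • act A x)) (q : ℝ) :
    f x ≤ f (x + q • act A x) := by
  rcases le_or_gt 0 q with hq | hq
  · exact hle q hq
  · by_contra! hlt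
    -- Half of the slope that convexity would force.
    obtain ⟨h₀, hh₀, h⟩ := hdis A hA x ((f x - f (x + q • act A x)) / (2 * -q))
      (div_pos (by linarith) (by linarith))
    have h1 := h h₀ hh₀.le le_rfl
    have key : (h₀ - q) • x = h₀ • (x + q • act A x) + (-q) • (x + h₀ • act A x) := by module
    have h2 : f ((h₀ - q) • x) ≤ h₀ * f (x + q • act A x) + -q * f (x + h₀ • act A x) := by
      rw [key]
      refine (map_add_le_add f _ _).trans ?_
      rw [map_smul_eq_mul, map_smul_eq_mul, Real.norm_of_nonneg hh₀.le,
        Real.norm_of_nonneg (by linarith : 0 ≤ -q)]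
    rw [map_smul_eq_mul, Real.norm_of_nonneg (by linarith : 0 ≤ h₀ - q)] at h2
    have h3 : -q * f (x + h₀ • act A x) ≤
        -q * f x + h₀ * ((f x - f (x + q • act A x)) / 2) := by
      have e : h₀ * ((f x - f (x + q • act A x)) / 2) =
          -q * (h₀ * ((f x - f (x + q • act A x)) / (2 * -q))) := by
        have : q ≠ 0 := hq.ne
        field_simp
      rw [e]
      nlinarith
    nlinarith

/-- The structure of a Barabanov norm at a point: an operator whose velocity is tangent to the unit
sphere, or which kills the point. -/
theorem Sustained.exists_slope {𝒜 : Set Mat} {f : Seminorm ℝ Plane}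
    (hdef : ∀ x, f x = 0 → x = 0) (hdis : Dissipative 𝒜 f 0)
    (hsus : Sustained (convexHull ℝ 𝒜) f) (γ : ℝ) :
    ∃ A ∈ convexHull ℝ 𝒜, act A (unitVec γ) = 0 ∨
      angular A γ ≠ 0 ∧ IsSupportSlope f γ (radial A γ / angular A γ) := by
  obtain ⟨A, hA, hle⟩ := hsus (unitVec γ)
  have hF := seminorm_unitVec_pos hdef γ
  have hline := le_line_of_le_ray hdis.convexHull hA hle
  refine ⟨A, hA, ?_⟩
  by_cases h : angular A γ = 0
  · left
    have e : act A (unitVec γ) = radial A γ • unitVec γ := by rw [act_unitVec, h]; simp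
    rw [e] at hline ⊢
    by_cases h0 : radial A γ = 0
    · rw [h0, zero_smul]
    -- A nonzero radial velocity would put the origin on the line, where `f` vanishes.
    · have := hline (-(radial A γ)⁻¹)
      rw [smul_smul, neg_mul, inv_mul_cancel₀ h0] at this
      simp at this
      linarith
  · right
    refine ⟨h, isSupportSlope_of_line h fun q => ?_⟩
    rw [← act_unitVec]
    exact hline q

/-! ### Degenerate operators -/

theorem mem_kernel {A : Mat} {x : Plane} : x ∈ kernel A ↔ act A x = 0 := LinearMap.mem_ker

theorem mem_image {A : Mat} {y : Plane} : y ∈ image A ↔ ∃ x, act A x = y := LinearMap.mem_range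

/-- Cayley–Hamilton with zero determinant. -/
theorem act_act_of_det_eq_zero {A : Mat} (hdet : A.det = 0) (x : Plane) :
    act A (act A x) = A.trace • act A x := by
  rw [Matrix.det_fin_two] at hdet
  apply plane_ext <;> simp only [act_apply, PiLp.smul_apply, smul_eq_mul, Matrix.trace_fin_two]
  · linear_combination (-(x 0)) * hdet
  · linear_combination (-(x 1)) * hdet

theorem act_of_mem_image {A : Mat} (hdet : A.det = 0) {w : Plane} (hw : w ∈ image A) :
    act A w = A.trace • w := by
  obtain ⟨x, rfl⟩ := mem_image.1 hw
  exact act_act_of_det_eq_zero hdet x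

theorem exists_act_ne_zero {A : Mat} (hA : A ≠ 0) : ∃ x, act A x ≠ 0 := by
  by_contra! h
  refine hA (Matrix.toEuclideanLin.injective ?_)
  rw [map_zero]
  exact LinearMap.ext fun x => h x

theorem det_eq_zero_of_act_eq_zero {A : Mat} {x : Plane} (hx : x ≠ 0) (h : act A x = 0) :
    A.det = 0 := by
  by_contra hdet
  have h0 : A 0 0 * x 0 + A 0 1 * x 1 = 0 := by rw [← act_apply, h]; rfl
  have h1 : A 1 0 * x 0 + A 1 1 * x 1 = 0 := by rw [← act_apply, h]; rfl
  have e0 : A.det * x 0 = 0 := by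
    rw [Matrix.det_fin_two]; linear_combination A 1 1 * h0 - A 0 1 * h1
  have e1 : A.det * x 1 = 0 := by
    rw [Matrix.det_fin_two]; linear_combination A 0 0 * h1 - A 1 0 * h0
  exact hx (plane_ext ((mul_eq_zero.1 e0).resolve_left hdet) ((mul_eq_zero.1 e1).resolve_left hdet))

theorem eq_zero_of_act_eq_zero {A : Mat} {x y : Plane} (hxy : x 0 * y 1 - x 1 * y 0 ≠ 0)
    (hx : act A x = 0) (hy : act A y = 0) : A = 0 := by
  have key : ∀ i, A i 0 * x 0 + A i 1 * x 1 = 0 ∧ A i 0 * y 0 + A i 1 * y 1 = 0 := fun i => by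
    constructor
    · rw [← act_apply, hx]; rfl
    · rw [← act_apply, hy]; rfl
  ext i j
  obtain ⟨h1, h2⟩ := key i
  fin_cases j
  · have : A i 0 * (x 0 * y 1 - x 1 * y 0) = 0 := by linear_combination y 1 * h1 - x 1 * h2
    exact (mul_eq_zero.1 this).resolve_right hxy
  · have : A i 1 * (x 0 * y 1 - x 1 * y 0) = 0 := by linear_combination x 0 * h2 - y 0 * h1
    exact (mul_eq_zero.1 this).resolve_right hxy

theorem exists_smul_eq_of_cross_eq_zero {x y : Plane} (hx : x ≠ 0)
    (h : x 0 * y 1 - x 1 * y 0 = 0) : ∃ c : ℝ, y = c • x := by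
  have hn : x 0 ^ 2 + x 1 ^ 2 ≠ 0 := by
    rw [← norm_sq_eq]; exact pow_ne_zero 2 (norm_ne_zero_iff.2 hx)
  refine ⟨(x 0 * y 0 + x 1 * y 1) / (x 0 ^ 2 + x 1 ^ 2), ?_⟩
  apply plane_ext <;> simp only [PiLp.smul_apply, smul_eq_mul] <;> field_simp
  · linear_combination (-(x 1)) * h
  · linear_combination x 0 * h

/-- The nonzero operators of the convex hull with a kernel have a negative eigenvalue. -/
theorem trace_neg_of_dissipative {𝒜 : Set Mat} (hcomp : IsCompact 𝒜) {f : Seminorm ℝ Plane}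
    (hdef : ∀ x, f x = 0 → x = 0) (hdis : Dissipative 𝒜 f 0) {A : Mat}
    (hA : A ∈ convexHull ℝ 𝒜) (hA0 : A ≠ 0) (hdet : A.det = 0) : A.trace < 0 := by
  obtain ⟨x, hx⟩ := exists_act_ne_zero hA0
  have hw := act_act_of_det_eq_zero hdet x
  set w := act A x with hwdef
  by_contra! ht
  rcases ht.lt_or_eq with ht | ht
  -- A positive trace is an eigenvalue, with a radial velocity pointing outwards.
  · obtain ⟨γ, hγ⟩ := exists_eq_smul_unitVec w
    obtain ⟨m, hm⟩ := exists_isSupportSlope hdef γ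
    have hadm := hm.admissible hdef hdis.convexHull A hA
    have hn : ‖w‖ ≠ 0 := norm_ne_zero_iff.2 hx
    have h1 : act A (unitVec γ) = A.trace • unitVec γ := by
      rw [hγ, act_smul_right, smul_comm] at hw
      exact smul_right_injective _ hn hw
    have h2 : radial A γ • unitVec γ + angular A γ • normalVec γ
        = A.trace • unitVec γ + (0 : ℝ) • normalVec γ := by rw [← act_unitVec, h1]; simp
    obtain ⟨h3, h4⟩ := polar_eq_iff.1 h2
    rw [h3, h4] at hadm
    linarith
  -- With zero trace the matrix is nilpotent and `x + t w` is an unbounded trajectory.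
  · rw [← ht, zero_smul] at hw
    have hco := isCompact_convexHull_of_finiteDimensional hcomp
    obtain ⟨K, hK0, hK⟩ := exists_act_bound hco
    have htraj : IsTrajectory (convexHull ℝ 𝒜) fun t => x + t • w :=
      isTrajectory_const hco hA fun t => by
        rw [act_add_right, act_smul_right, hw, smul_zero, add_zero, ← hwdef]
        simpa using ((hasDerivAt_id t).smul_const w).const_add x
    have hle : ∀ n : ℕ, (n : ℝ) * f w ≤ 2 * f x := by
      intro n
      have h1 := hdis.convexHull.le_exp hK hK0.le htraj (T := n) (Nat.cast_nonneg n)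
      simp at h1
      have h2 := map_sub_le_add f (x + (n : ℝ) • w) x
      rw [add_sub_cancel_left, map_smul_eq_mul, Real.norm_of_nonneg (Nat.cast_nonneg n)] at h2
      linarith
    have hfw : 0 < f w := (apply_nonneg f w).lt_of_ne fun h => hx (hdef _ h.symm)
    obtain ⟨n, hn⟩ := exists_nat_gt (2 * f x / f w)
    rw [div_lt_iff₀ hfw] at hn
    linarith [hle n]

/-- The projection along the image of a degenerate operator does not increase the norm. -/
theorem le_of_kernel_of_image {𝒜 : Set Mat} (hcomp : IsCompact 𝒜) {f : Seminorm ℝ Plane}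
    (hdis : Dissipative 𝒜 f 0) {A : Mat} (hA : A ∈ convexHull ℝ 𝒜) {t : ℝ} (ht : t < 0)
    {x w : Plane} (hx : act A x = 0) (hw : act A w = t • w) : f x ≤ f (x + w) := by
  have hco := isCompact_convexHull_of_finiteDimensional hcomp
  obtain ⟨K, hK0, hK⟩ := exists_act_bound hco
  -- The trajectory from `x + w` tends to `x`, and `f` does not increase along it.
  have htraj : IsTrajectory (convexHull ℝ 𝒜) fun s => x + Real.exp (t * s) • w :=
    isTrajectory_const hco hA fun s => by
      rw [act_add_right, act_smul_right, hx, hw, zero_add]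
      have h1 : HasDerivAt (fun s => Real.exp (t * s)) (Real.exp (t * s) * t) s := by
        have := ((hasDerivAt_id s).const_mul t).exp
        simpa using this
      have h2 := (h1.smul_const w).const_add x
      rwa [mul_smul] at h2
  have hlim : Tendsto (fun s : ℝ => f (x + Real.exp (t * s) • w)) atTop (𝓝 (f (x + (0 : ℝ) • w))) := by
    have h1 : Tendsto (fun s : ℝ => Real.exp (t * s)) atTop (𝓝 0) :=
      Real.tendsto_exp_atBot.comp (tendsto_id.const_mul_atTop_of_neg ht)
    exact ((continuous_seminorm f).tendsto _).comp ((h1.smul_const w).const_add x)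
  rw [zero_smul, add_zero] at hlim
  refine le_of_tendsto hlim ?_
  filter_upwards [eventually_ge_atTop 0] with s hs
  simpa using hdis.convexHull.le_exp hK hK0.le htraj hs

/-- The line through `u(τ)` parallel to the image is projected onto `u(τ)` along the image, so `f`
is minimal there: this is a line of support, and it makes the angle `φ` with the position vector. -/
theorem isSupportSlope_cot {𝒜 : Set Mat} (hcomp : IsCompact 𝒜) {f : Seminorm ℝ Plane}
    (hdef : ∀ x, f x = 0 → x = 0) (hdis : Dissipative 𝒜 f 0) {τ φ : ℝ}
    (h : IsKernelAngle 𝒜 τ φ) : IsSupportSlope f τ (Real.cot φ) := by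
  obtain ⟨hφ, A, hA, hker, him⟩ := h
  have hneg := trace_neg_of_dissipative hcomp hdef hdis hA.1 hA.2.1 hA.2.2.1
  rw [Real.cot_eq_cos_div_sin]
  refine isSupportSlope_of_line (Real.sin_pos_of_pos_of_lt_pi hφ.1 hφ.2).ne' fun q => ?_
  rw [← unitVec_add]
  refine le_of_kernel_of_image hcomp hdis hA.1 hneg (mem_kernel.1 hker) ?_
  rw [act_smul_right, act_of_mem_image hA.2.2.1 him, smul_comm]

/-- The image is not the kernel, because the operator multiplies its image by a nonzero trace; hence
the angle is not 0. -/
theorem exists_isKernelAngle {𝒜 : Set Mat} (hcomp : IsCompact 𝒜) {f : Seminorm ℝ Plane}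
    (hdef : ∀ x, f x = 0 → x = 0) (hdis : Dissipative 𝒜 f 0) {τ : ℝ} {A : Mat}
    (hA : A ∈ degenerate 𝒜) (hker : unitVec τ ∈ kernel A) : ∃ φ, IsKernelAngle 𝒜 τ φ := by
  have hneg := trace_neg_of_dissipative hcomp hdef hdis hA.1 hA.2.1 hA.2.2.1
  obtain ⟨x, hx⟩ := exists_act_ne_zero hA.2.1
  obtain ⟨a, b, hab⟩ := exists_polar_components τ (act A x)
  obtain ⟨ψ, hψ, r, hr, hrab⟩ := exists_eq_smul_unitVec_mem (!₂[a, b] : Plane)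
  have ha : a = r * Real.cos ψ := by simpa [unitVec] using congrArg (fun y : Plane => y 0) hrab
  have hb : b = r * Real.sin ψ := by simpa [unitVec] using congrArg (fun y : Plane => y 1) hrab
  have hw : act A x = r • unitVec (τ + ψ) := by
    rw [hab, unitVec_add, ha, hb]; module
  have hr0 : r ≠ 0 := by
    rintro rfl; rw [zero_smul] at hw; exact hx hw
  refine ⟨ψ, ⟨hψ.1.lt_of_ne ?_, hψ.2⟩, A, hA, hker, mem_image.2 ⟨r⁻¹ • x, ?_⟩⟩
  · rintro rfl
    have h1 := act_act_of_det_eq_zero hA.2.2.1 x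
    rw [hw, add_zero, act_smul_right, mem_kernel.1 hker, smul_zero] at h1
    exact smul_ne_zero hneg.ne (smul_ne_zero hr0 (unitVec_ne_zero τ)) h1.symm
  · rw [act_smul_right, hw, smul_smul, inv_mul_cancel₀ hr0, one_smul]

/-- The condition `A ≠ 0` could destroy closedness. It holds automatically in both cases: either
only members of `𝒜` count and 0 is not one of them, or 0 is not in the convex hull. -/
theorem isCompact_degenerate {𝒜 : Set Mat} (hcomp : IsCompact 𝒜) (hzero : (0 : Mat) ∉ 𝒜) :
    IsCompact (degenerate 𝒜) := by
  have hdet : IsClosed {A : Mat | A.det = 0} :=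
    isClosed_eq (Continuous.matrix_det continuous_id) continuous_const
  by_cases h : (0 : Mat) ∈ convexHull ℝ 𝒜
  · have : degenerate 𝒜 = 𝒜 ∩ {A : Mat | A.det = 0} := by
      ext A
      refine ⟨fun hA => ⟨hA.2.2.2.resolve_right fun h' => h' h, hA.2.2.1⟩, fun hA =>
        ⟨subset_convexHull ℝ 𝒜 hA.1, ?_, hA.2, Or.inl hA.1⟩⟩
      rintro rfl
      exact hzero hA.1
    rw [this]
    exact hcomp.inter_right hdet
  · have : degenerate 𝒜 = convexHull ℝ 𝒜 ∩ {A : Mat | A.det = 0} := by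
      ext A
      refine ⟨fun hA => ⟨hA.1, hA.2.2.1⟩, fun hA => ⟨hA.1, ?_, hA.2, Or.inr h⟩⟩
      rintro rfl
      exact h hA.1
    rw [this]
    exact (isCompact_convexHull_of_finiteDimensional hcomp).inter_right hdet

/-- The arguments of the kernels of the degenerate operators. -/
def kernelSet (𝒜 : Set Mat) : Set ℝ := {γ | ∃ A ∈ degenerate 𝒜, unitVec γ ∈ kernel A}

theorem isClosed_kernelSet {𝒜 : Set Mat} (hcomp : IsCompact 𝒜) (hzero : (0 : Mat) ∉ 𝒜) :
    IsClosed (kernelSet 𝒜) := by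
  have hZ : IsClosed {p : Mat × ℝ | act p.1 (unitVec p.2) = 0} :=
    isClosed_eq (continuous_act.comp (continuous_fst.prodMk (continuous_unitVec.comp continuous_snd)))
      continuous_const
  have := isClosed_exists_mem (isCompact_degenerate hcomp hzero) hZ
  convert! this using 3

theorem mem_kernelSet_of_act_eq_zero {𝒜 : Set Mat} (hne : (0 : Mat) ∉ convexHull ℝ 𝒜) {A : Mat}
    (hA : A ∈ convexHull ℝ 𝒜) {γ : ℝ} (h : act A (unitVec γ) = 0) : γ ∈ kernelSet 𝒜 := by
  refine ⟨A, ⟨hA, ?_, det_eq_zero_of_act_eq_zero (unitVec_ne_zero γ) h, Or.inr hne⟩, mem_kernel.2 h⟩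
  rintro rfl
  exact hne hA

theorem add_pi_mem_kernelSet {𝒜 : Set Mat} {γ : ℝ} : γ + Real.pi ∈ kernelSet 𝒜 ↔ γ ∈ kernelSet 𝒜 := by
  simp [kernelSet, unitVec_add_pi]

/-- In the exceptional case, two operators turning all points in opposite directions are tangent to
the unit sphere everywhere. -/
theorem exists_tangent_of_zero_mem {𝒜 : Set Mat} (hcomp : IsCompact 𝒜) (hzero : (0 : Mat) ∉ 𝒜)
    {f : Seminorm ℝ Plane} (hdef : ∀ x, f x = 0 → x = 0) (hdis : Dissipative 𝒜 f 0)
    (h0 : (0 : Mat) ∈ convexHull ℝ 𝒜) :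
    ∃ A ∈ 𝒜, ∃ B ∈ 𝒜, ∀ γ, 0 < angular A γ ∧ angular B γ < 0 ∧ ∀ m, IsSupportSlope f γ m →
      radial A γ = m * angular A γ ∧ radial B γ = m * angular B γ := by
  obtain ⟨ι, _, z, w, hz, -, hw, hw1, hsum⟩ := eq_pos_convex_span_of_mem_convexHull h0
  have hz' : ∀ i, z i ∈ 𝒜 := fun i => hz ⟨i, rfl⟩
  have hrad : ∀ γ, ∑ i, w i * radial (z i) γ = 0 := by
    intro γ
    have : ∀ i j, ∑ k, w k * z k i j = 0 := fun i j => by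
      have := congrFun (congrFun hsum i) j
      simpa [Matrix.sum_apply] using this
    simp only [radial]
    calc _ = ((∑ k, w k * z k 0 0) * Real.cos γ + (∑ k, w k * z k 0 1) * Real.sin γ) * Real.cos γ +
        ((∑ k, w k * z k 1 0) * Real.cos γ + (∑ k, w k * z k 1 1) * Real.sin γ) * Real.sin γ := by
          simp only [Finset.sum_mul, ← Finset.sum_add_distrib]
          exact Finset.sum_congr rfl fun k _ => by ring
      _ = 0 := by simp only [this]; ring
  have hang : ∀ γ, ∑ i, w i * angular (z i) γ = 0 := by
    intro γ
    have : ∀ i j, ∑ k, w k * z k i j = 0 := fun i j => by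
      have := congrFun (congrFun hsum i) j
      simpa [Matrix.sum_apply] using this
    simp only [angular]
    calc _ = ((∑ k, w k * z k 1 0) * Real.cos γ + (∑ k, w k * z k 1 1) * Real.sin γ) * Real.cos γ -
        ((∑ k, w k * z k 0 0) * Real.cos γ + (∑ k, w k * z k 0 1) * Real.sin γ) * Real.sin γ := by
          simp only [Finset.sum_mul, ← Finset.sum_add_distrib, ← Finset.sum_sub_distrib]
          exact Finset.sum_congr rfl fun k _ => by ring
      _ = 0 := by simp only [this]; ring
  -- Zero is a combination of the `z i` with positive weights, so the admissibility inequalities add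
  -- up to an equality and each of them is one.
  have htan : ∀ γ m, IsSupportSlope f γ m → ∀ i, radial (z i) γ = m * angular (z i) γ := by
    intro γ m hm i
    have hadm := hm.admissible hdef hdis
    have hnn : ∀ i ∈ Finset.univ, 0 ≤ w i * (m * angular (z i) γ - radial (z i) γ) := fun i _ =>
      mul_nonneg (hw i).le (sub_nonneg.2 (hadm _ (hz' i)))
    have hs : ∑ i, w i * (m * angular (z i) γ - radial (z i) γ) = 0 := by
      calc _ = m * ∑ i, w i * angular (z i) γ - ∑ i, w i * radial (z i) γ := by
            rw [Finset.mul_sum, ← Finset.sum_sub_distrib]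
            exact Finset.sum_congr rfl fun k _ => by ring
        _ = 0 := by rw [hrad, hang]; ring
    have := (Finset.sum_eq_zero_iff_of_nonneg hnn).1 hs i (Finset.mem_univ i)
    have := (mul_eq_zero.1 this).resolve_left (hw i).ne'
    linarith
  -- If the angular component vanished, tangency would make the velocity zero. Then `z i` would be
  -- degenerate with a negative eigenvalue, while tangency at that eigenvector says that the
  -- eigenvalue is zero.
  have hne : ∀ i γ, angular (z i) γ ≠ 0 := by
    intro i γ h
    obtain ⟨m, hm⟩ := exists_isSupportSlope hdef γ
    have h1 := htan γ m hm i
    have hact : act (z i) (unitVec γ) = 0 := by rw [act_unitVec, h1, h]; simp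
    have hz0 : z i ≠ 0 := fun h => hzero (h ▸ hz' i)
    have hdet := det_eq_zero_of_act_eq_zero (unitVec_ne_zero γ) hact
    have hneg := trace_neg_of_dissipative hcomp hdef hdis (subset_convexHull ℝ 𝒜 (hz' i)) hz0 hdet
    obtain ⟨x, hx⟩ := exists_act_ne_zero hz0
    have hw2 := act_act_of_det_eq_zero hdet x
    obtain ⟨γ', hγ'⟩ := exists_eq_smul_unitVec (act (z i) x)
    have hn : ‖act (z i) x‖ ≠ 0 := norm_ne_zero_iff.2 hx
    have h2 : act (z i) (unitVec γ') = (z i).trace • unitVec γ' := by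
      rw [hγ', act_smul_right, smul_comm] at hw2
      exact smul_right_injective _ hn hw2
    have h3 : radial (z i) γ' • unitVec γ' + angular (z i) γ' • normalVec γ'
        = (z i).trace • unitVec γ' + (0 : ℝ) • normalVec γ' := by rw [← act_unitVec, h2]; simp
    obtain ⟨h4, h5⟩ := polar_eq_iff.1 h3
    obtain ⟨m', hm'⟩ := exists_isSupportSlope hdef γ'
    have h6 := htan γ' m' hm' i
    rw [h4, h5] at h6
    linarith
  have hcont : ∀ i, Continuous (angular (z i)) := fun i =>
    continuous_angular.comp (continuous_const.prodMk continuous_id)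
  have hpos : ∀ i, 0 < angular (z i) 0 → ∀ γ, 0 < angular (z i) γ := by
    intro i hi γ
    by_contra! hle
    obtain ⟨c, hc⟩ := mem_range_of_exists_le_of_exists_ge (hcont i) ⟨γ, hle⟩ ⟨0, hi.le⟩
    exact hne i c hc
  have hnegv : ∀ i, angular (z i) 0 < 0 → ∀ γ, angular (z i) γ < 0 := by
    intro i hi γ
    by_contra! hle
    obtain ⟨c, hc⟩ := mem_range_of_exists_le_of_exists_ge (hcont i) ⟨0, hi.le⟩ ⟨γ, hle⟩
    exact hne i c hc
  obtain ⟨k, -⟩ : ∃ k ∈ Finset.univ, w k ≠ 0 :=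
    Finset.exists_ne_zero_of_sum_ne_zero (by rw [hw1]; exact one_ne_zero)
  -- Both signs occur, since the positively weighted sum of the nonzero angular components is zero;
  -- by continuity each sign is the same at all arguments.
  obtain ⟨i, hi⟩ : ∃ i, 0 < angular (z i) 0 := by
    by_contra! hle
    have hnn : ∀ i ∈ Finset.univ, w i * angular (z i) 0 ≤ 0 := fun i _ =>
      mul_nonpos_of_nonneg_of_nonpos (hw i).le (hle i)
    have := (Finset.sum_eq_zero_iff_of_nonpos hnn).1 (hang 0) k (Finset.mem_univ k)
    exact hne k 0 ((mul_eq_zero.1 this).resolve_left (hw k).ne')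
  obtain ⟨j, hj⟩ : ∃ i, angular (z i) 0 < 0 := by
    by_contra! hle
    have hnn : ∀ i ∈ Finset.univ, 0 ≤ w i * angular (z i) 0 := fun i _ =>
      mul_nonneg (hw i).le (hle i)
    have := (Finset.sum_eq_zero_iff_of_nonneg hnn).1 (hang 0) k (Finset.mem_univ k)
    exact hne k 0 ((mul_eq_zero.1 this).resolve_left (hw k).ne')
  exact ⟨z i, hz' i, z j, hz' j, fun γ => ⟨hpos i hi γ, hnegv j hj γ, fun m hm =>
    ⟨htan γ m hm i, htan γ m hm j⟩⟩⟩

/-! ### Reverse segments -/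

/-- The oriented area of the parallelogram spanned by two vectors. -/
def cross (x y : Plane) : ℝ := x 0 * y 1 - x 1 * y 0

section ReversePair

variable {𝒜 : Set Mat} {f : Seminorm ℝ Plane} {A₁ A₂ : Mat} {x₁ x₂ : Plane}

/-- If the ends were collinear, their difference would lie both in the kernel and in the image of
`A₁`. Hence the ends would coincide, and so would the kernels. -/
theorem IsReverseSegment.cross_ne_zero (hp : IsReversePair 𝒜 A₁ A₂)
    (hs : IsReverseSegment A₁ A₂ x₁ x₂) : cross x₁ x₂ ≠ 0 := by
  obtain ⟨hA₁, hA₂, ht₁, ht₂, him, hker⟩ := hp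
  obtain ⟨hx₁, hx₂, hk₁, hk₂, hv⟩ := hs
  intro h
  obtain ⟨c, rfl⟩ := exists_smul_eq_of_cross_eq_zero hx₁ h
  rw [mem_kernel] at hk₁ hk₂
  have h1 := act_of_mem_image hA₁.2.2.1 hv
  rw [act_sub_right, act_smul_right, hk₁, smul_zero, sub_zero] at h1
  have h2 := (smul_eq_zero.1 h1.symm).resolve_left ht₁.ne
  have h3 : act A₂ x₁ = 0 := by rw [sub_eq_zero] at h2; rwa [h2] at hk₂
  refine hker (le_antisymm (fun y hy => ?_) fun y hy => ?_)
  · rw [mem_kernel] at hy ⊢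
    by_cases hxy : x₁ 0 * y 1 - x₁ 1 * y 0 = 0
    · obtain ⟨d, rfl⟩ := exists_smul_eq_of_cross_eq_zero hx₁ hxy
      rw [act_smul_right, h3, smul_zero]
    · exact absurd (eq_zero_of_act_eq_zero hxy hk₁ hy) hA₁.2.1
  · rw [mem_kernel] at hy ⊢
    by_cases hxy : x₁ 0 * y 1 - x₁ 1 * y 0 = 0
    · obtain ⟨d, rfl⟩ := exists_smul_eq_of_cross_eq_zero hx₁ hxy
      rw [act_smul_right, hk₁, smul_zero]
    · exact absurd (eq_zero_of_act_eq_zero hxy h3 hy) hA₂.2.1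

theorem IsReverseSegment.act_left (hp : IsReversePair 𝒜 A₁ A₂)
    (hs : IsReverseSegment A₁ A₂ x₁ x₂) (a b : ℝ) :
    act A₁ (a • x₁ + b • x₂) = (b * A₁.trace) • (x₂ - x₁) := by
  have h1 := act_of_mem_image hp.1.2.2.1 hs.2.2.2.2
  rw [act_sub_right, mem_kernel.1 hs.2.2.1, sub_zero] at h1
  rw [act_add_right, act_smul_right, act_smul_right, mem_kernel.1 hs.2.2.1, h1]
  module

theorem IsReverseSegment.act_right (hp : IsReversePair 𝒜 A₁ A₂)
    (hs : IsReverseSegment A₁ A₂ x₁ x₂) (a b : ℝ) :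
    act A₂ (a • x₁ + b • x₂) = (-(a * A₂.trace)) • (x₂ - x₁) := by
  have h1 := act_of_mem_image hp.2.1.2.2.1 (hp.2.2.2.2.1 ▸ hs.2.2.2.2)
  rw [act_sub_right, mem_kernel.1 hs.2.2.2.1, zero_sub] at h1
  have h2 : act A₂ x₁ = -(A₂.trace • (x₂ - x₁)) := by rw [← h1, neg_neg]
  rw [act_add_right, act_smul_right, act_smul_right, mem_kernel.1 hs.2.2.2.1, h2]
  module

theorem IsReverseSegment.le_line (hcomp : IsCompact 𝒜) (hdis : Dissipative 𝒜 f 0)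
    (hp : IsReversePair 𝒜 A₁ A₂) (hs : IsReverseSegment A₁ A₂ x₁ x₂) (s : ℝ) :
    f x₁ ≤ f (x₁ + s • (x₂ - x₁)) ∧ f x₂ ≤ f (x₂ + s • (x₂ - x₁)) := by
  have h1 := act_of_mem_image hp.1.2.2.1 hs.2.2.2.2
  have h2 := act_of_mem_image hp.2.1.2.2.1 (hp.2.2.2.2.1 ▸ hs.2.2.2.2)
  exact ⟨le_of_kernel_of_image hcomp hdis hp.1.1 hp.2.2.1 (mem_kernel.1 hs.2.2.1)
      (by rw [act_smul_right, h1, smul_comm]),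
    le_of_kernel_of_image hcomp hdis hp.2.1.1 hp.2.2.2.1 (mem_kernel.1 hs.2.2.2.1)
      (by rw [act_smul_right, h2, smul_comm])⟩

/-- Each end minimizes `f` on the line of the segment. -/
theorem IsReverseSegment.seminorm_eq (hcomp : IsCompact 𝒜) (hdis : Dissipative 𝒜 f 0)
    (hp : IsReversePair 𝒜 A₁ A₂) (hs : IsReverseSegment A₁ A₂ x₁ x₂) : f x₁ = f x₂ := by
  have h1 := (hs.le_line hcomp hdis hp 1).1
  have h2 := (hs.le_line hcomp hdis hp (-1)).2
  have e1 : x₁ + (1 : ℝ) • (x₂ - x₁) = x₂ := by module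
  have e2 : x₂ + (-1 : ℝ) • (x₂ - x₁) = x₁ := by module
  rw [e1] at h1
  rw [e2] at h2
  exact le_antisymm h1 h2

/-- On the segment `f` is at most the common end value by convexity, and at least that value because
the ends are minima on the line. -/
theorem IsReverseSegment.seminorm_comb (hcomp : IsCompact 𝒜) (hdis : Dissipative 𝒜 f 0)
    (hp : IsReversePair 𝒜 A₁ A₂) (hs : IsReverseSegment A₁ A₂ x₁ x₂) {a b : ℝ} (ha : 0 < a)
    (hb : 0 < b) : f (a • x₁ + b • x₂) = (a + b) * f x₁ := by
  have heq := hs.seminorm_eq hcomp hdis hp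
  refine le_antisymm ?_ ?_
  · refine (map_add_le_add f _ _).trans ?_
    rw [map_smul_eq_mul, map_smul_eq_mul, Real.norm_of_nonneg ha.le, Real.norm_of_nonneg hb.le, heq]
    linarith
  · have h1 := (hs.le_line hcomp hdis hp (b / (a + b))).1
    have e : a • x₁ + b • x₂ = (a + b) • (x₁ + (b / (a + b)) • (x₂ - x₁)) := by
      rw [smul_add, smul_smul, mul_div_cancel₀ _ (by positivity)]; module
    rw [e, map_smul_eq_mul, Real.norm_of_nonneg (by positivity)]
    gcongr

theorem comb_eq_of_cross (hx : cross x₁ x₂ ≠ 0) (y : Plane) :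
    y = (cross y x₂ / cross x₁ x₂) • x₁ + (cross x₁ y / cross x₁ x₂) • x₂ := by
  apply plane_ext <;> simp only [PiLp.add_apply, PiLp.smul_apply, smul_eq_mul] <;> field_simp <;>
    simp only [cross] <;> ring

theorem coeff_eq_of_comb (hx : cross x₁ x₂ ≠ 0) {y : Plane} {a b : ℝ} (h : y = a • x₁ + b • x₂) :
    a = cross y x₂ / cross x₁ x₂ ∧ b = cross x₁ y / cross x₁ x₂ := by
  subst h
  constructor <;> rw [eq_div_iff hx] <;> simp [cross] <;> ring

theorem eventually_comb (hx : cross x₁ x₂ ≠ 0) {γ a b : ℝ} (ha : 0 < a) (hb : 0 < b)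
    (h : unitVec γ = a • x₁ + b • x₂) :
    ∀ᶠ δ in 𝓝 γ, 0 < cross (unitVec δ) x₂ / cross x₁ x₂ ∧ 0 < cross x₁ (unitVec δ) / cross x₁ x₂ := by
  obtain ⟨h1, h2⟩ := coeff_eq_of_comb hx h
  have c1 : Continuous fun δ => cross (unitVec δ) x₂ / cross x₁ x₂ := by
    unfold cross unitVec; simp; fun_prop
  have c2 : Continuous fun δ => cross x₁ (unitVec δ) / cross x₁ x₂ := by
    unfold cross unitVec; simp; fun_prop
  exact (c1.continuousAt.eventually (lt_mem_nhds (by rw [h1] at ha; exact ha))).and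
    (c2.continuousAt.eventually (lt_mem_nhds (by rw [h2] at hb; exact hb)))

end ReversePair

theorem isOpen_reverseSet (𝒜 : Set Mat) : IsOpen (reverseSet 𝒜) := by
  rw [isOpen_iff_mem_nhds]
  rintro γ ⟨A₁, A₂, x₁, x₂, hp, hs, a, b, ha, hb, h⟩
  have hx := hs.cross_ne_zero hp
  filter_upwards [eventually_comb hx ha hb h] with δ hδ
  exact ⟨A₁, A₂, x₁, x₂, hp, hs, _, _, hδ.1, hδ.2, comb_eq_of_cross hx _⟩

/-- On the reverse set the norm is locally linear, the operators that kill the point moving all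
points along the level lines. -/
theorem exists_linear_of_mem_reverseSet {𝒜 : Set Mat} (hcomp : IsCompact 𝒜)
    {f : Seminorm ℝ Plane} (hdis : Dissipative 𝒜 f 0) {γ : ℝ} (hγ : γ ∈ reverseSet 𝒜) :
    ∃ p q : ℝ, (∀ᶠ δ in 𝓝 γ, f (unitVec δ) = p * Real.cos δ + q * Real.sin δ) ∧
      ∃ A ∈ convexHull ℝ 𝒜, act A (unitVec γ) = 0 ∧
        ∀ y, p * act A y 0 + q * act A y 1 = 0 := by
  obtain ⟨A₁, A₂, x₁, x₂, hp, hs, a, b, ha, hb, h⟩ := hγ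
  have hx := hs.cross_ne_zero hp
  refine ⟨f x₁ * ((x₂ 1 - x₁ 1) / cross x₁ x₂), f x₁ * ((x₁ 0 - x₂ 0) / cross x₁ x₂), ?_, ?_⟩
  · filter_upwards [eventually_comb hx ha hb h] with δ hδ
    conv_lhs => rw [comb_eq_of_cross hx (unitVec δ)]
    rw [hs.seminorm_comb hcomp hdis hp hδ.1 hδ.2]
    simp [cross, unitVec]
    ring
  -- At the given point the two velocities are multiples of `x₂ - x₁` with opposite signs; these
  -- weights cancel them. The sign of the traces makes the combination convex.
  · set c := a * A₂.trace + b * A₁.trace with hc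
    have h1 : a * A₂.trace < 0 := mul_neg_of_pos_of_neg ha hp.2.2.2.1
    have h2 : b * A₁.trace < 0 := mul_neg_of_pos_of_neg hb hp.2.2.1
    have hc0 : c < 0 := by rw [hc]; linarith
    refine ⟨(a * A₂.trace / c) • A₁ + (b * A₁.trace / c) • A₂,
      convex_convexHull ℝ 𝒜 hp.1.1 hp.2.1.1 (div_nonneg_of_nonpos h1.le hc0.le)
        (div_nonneg_of_nonpos h2.le hc0.le) (by rw [← add_div, ← hc, div_self hc0.ne]), ?_, ?_⟩
    · rw [h, act_add_left, act_smul_left, act_smul_left, hs.act_left hp, hs.act_right hp]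
      module
    · intro y
      rw [act_add_left, act_smul_left, act_smul_left, comb_eq_of_cross hx y, hs.act_left hp,
        hs.act_right hp]
      simp [cross]
      ring

theorem reverseSet_subset_kernelSet {𝒜 : Set Mat} (hcomp : IsCompact 𝒜)
    {f : Seminorm ℝ Plane} (hdis : Dissipative 𝒜 f 0) (hne : (0 : Mat) ∉ convexHull ℝ 𝒜) :
    reverseSet 𝒜 ⊆ kernelSet 𝒜 := by
  intro γ hγ
  obtain ⟨-, -, -, A, hA, hA0, -⟩ := exists_linear_of_mem_reverseSet hcomp hdis hγ
  exact mem_kernelSet_of_act_eq_zero hne hA hA0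

theorem hasDerivAt_logRadius_of_linear {f : Seminorm ℝ Plane} (hdef : ∀ x, f x = 0 → x = 0)
    {p q γ : ℝ} (h : ∀ᶠ δ in 𝓝 γ, f (unitVec δ) = p * Real.cos δ + q * Real.sin δ) :
    HasDerivAt (logRadius f)
      ((p * Real.sin γ - q * Real.cos γ) / (p * Real.cos γ + q * Real.sin γ)) γ := by
  have hF := seminorm_unitVec_pos hdef γ
  rw [h.self_of_nhds] at hF
  have h1 : HasDerivAt (fun δ => -Real.log (p * Real.cos δ + q * Real.sin δ))
      ((p * Real.sin γ - q * Real.cos γ) / (p * Real.cos γ + q * Real.sin γ)) γ := by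
    have := ((((Real.hasDerivAt_cos γ).const_mul p).add
      ((Real.hasDerivAt_sin γ).const_mul q)).log hF.ne').neg
    refine this.congr_deriv ?_
    simp only [Pi.add_apply]
    field_simp
    ring
  refine h1.congr_of_eventuallyEq ?_
  filter_upwards [h] with δ hδ
  rw [logRadius_eq hdef, hδ]

theorem coeff_eq_zero_of_eventually {a b γ : ℝ}
    (h : ∀ᶠ δ in 𝓝 γ, a * Real.cos δ + b * Real.sin δ = 0) : a = 0 ∧ b = 0 := by
  have h0 := h.self_of_nhds
  have h1 : HasDerivAt (fun δ => a * Real.cos δ + b * Real.sin δ)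
      (a * -Real.sin γ + b * Real.cos γ) γ :=
    ((Real.hasDerivAt_cos γ).const_mul a).add ((Real.hasDerivAt_sin γ).const_mul b)
  have h2 := h1.unique ((hasDerivAt_const γ (0 : ℝ)).congr_of_eventuallyEq h)
  have e := Real.cos_sq_add_sin_sq γ
  constructor
  · linear_combination Real.cos γ * h0 - Real.sin γ * h2 - a * e
  · linear_combination Real.sin γ * h0 + Real.cos γ * h2 - b * e

/-- Near a reverse point the norm is a linear function with coefficients `p, q`, and by
`exists_tangent_of_zero_mem` a certain `A` moves all points along the sphere. So `(p, q)`
annihilates the image of `A`, and the level direction `(-q, p)` is turned by `A` through no angle.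
This contradicts the positive angular component of `A`. -/
theorem reverseSet_eq_empty {𝒜 : Set Mat} (hcomp : IsCompact 𝒜) (hzero : (0 : Mat) ∉ 𝒜)
    {f : Seminorm ℝ Plane} (hdef : ∀ x, f x = 0 → x = 0) (hdis : Dissipative 𝒜 f 0)
    (h0 : (0 : Mat) ∈ convexHull ℝ 𝒜) : reverseSet 𝒜 = ∅ := by
  obtain ⟨A, hA, B, hB, htan⟩ := exists_tangent_of_zero_mem hcomp hzero hdef hdis h0
  rw [Set.eq_empty_iff_forall_notMem]
  intro γ hγ
  obtain ⟨p, q, hloc, -⟩ := exists_linear_of_mem_reverseSet hcomp hdis hγ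
  have hF := seminorm_unitVec_pos hdef γ
  have hzero' : ∀ᶠ δ in 𝓝 γ, (p * A 0 0 + q * A 1 0) * Real.cos δ
      + (p * A 0 1 + q * A 1 1) * Real.sin δ = 0 := by
    filter_upwards [hloc.eventually_nhds] with δ hδ
    have hFδ := seminorm_unitVec_pos hdef δ
    rw [hδ.self_of_nhds] at hFδ
    have h1 := ((htan δ).2.2 _
      (isSupportSlope_of_hasDerivAt hdef (hasDerivAt_logRadius_of_linear hdef hδ))).1
    rw [div_mul_eq_mul_div, eq_div_iff hFδ.ne', radial, angular] at h1
    have e := Real.cos_sq_add_sin_sq δ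
    linear_combination h1 - ((p * A 0 0 + q * A 1 0) * Real.cos δ
      + (p * A 0 1 + q * A 1 1) * Real.sin δ) * e
  obtain ⟨h1, h2⟩ := coeff_eq_zero_of_eventually hzero'
  obtain ⟨δ, hδ⟩ := exists_eq_smul_unitVec (!₂[-q, p] : Plane)
  set r := ‖(!₂[-q, p] : Plane)‖
  have e0 : -q = r * Real.cos δ := by simpa [unitVec] using congrArg (fun y : Plane => y 0) hδ
  have e1 : p = r * Real.sin δ := by simpa [unitVec] using congrArg (fun y : Plane => y 1) hδ
  have hr : r ≠ 0 := by
    intro hr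
    rw [hr, zero_mul] at e0 e1
    rw [hloc.self_of_nhds, e1, neg_eq_zero.1 e0] at hF
    simp at hF
  have hang : r * angular A δ = 0 := by
    have hq : q = -(r * Real.cos δ) := by linarith
    rw [e1, hq] at h1 h2
    rw [angular]
    linear_combination -Real.cos δ * h1 - Real.sin δ * h2
  exact (htan δ).1.ne' ((mul_eq_zero.1 hang).resolve_left hr)

/-! ### Extremal slopes -/

section TopSlope

variable {ι : Type*} {s : Set ι} {D C : ι → ℝ → ℝ}

/-- `m` is the largest slope `D / C` of the vectors with components `D`, `C` whose angular component
`C` is positive. -/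
def IsTopSlope (s : Set ι) (D C : ι → ℝ → ℝ) (γ m : ℝ) : Prop :=
  (∃ A ∈ s, 0 < C A γ ∧ D A γ = m * C A γ) ∧ ∀ B ∈ s, 0 < C B γ → D B γ ≤ m * C B γ

/-- No vector is a nonnegative multiple of the position vector. -/
def IsFeasibleAt (s : Set ι) (D C : ι → ℝ → ℝ) (γ : ℝ) : Prop := ∀ A ∈ s, C A γ = 0 → D A γ < 0

theorem IsTopSlope.le_of_admissible {γ m m' : ℝ} (h : IsTopSlope s D C γ m)
    (h' : ∀ A ∈ s, D A γ ≤ m' * C A γ) : m ≤ m' := by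
  obtain ⟨A, hA, hC, hD⟩ := h.1
  exact le_of_mul_le_mul_right (hD ▸ h' A hA) hC

theorem IsTopSlope.eq {γ m m' : ℝ} (h : IsTopSlope s D C γ m) (h' : IsTopSlope s D C γ m') :
    m = m' := by
  obtain ⟨A, hA, hC, hD⟩ := h.1
  obtain ⟨B, hB, hC', hD'⟩ := h'.1
  exact le_antisymm (le_of_mul_le_mul_right (hD ▸ h'.2 A hA hC) hC)
    (le_of_mul_le_mul_right (hD' ▸ h.2 B hB hC') hC')

variable [TopologicalSpace ι]

/-- The quotient is maximized over the vectors of slope at least that of `A`. Feasibility keeps this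
compact set away from `C = 0`, so the quotient is continuous on it. -/
theorem exists_isTopSlope (hs : IsCompact s) (hD : Continuous fun p : ι × ℝ => D p.1 p.2)
    (hC : Continuous fun p : ι × ℝ => C p.1 p.2) {γ : ℝ} (hf : IsFeasibleAt s D C γ) {A : ι}
    (hA : A ∈ s) (hpos : 0 < C A γ) : ∃ m, IsTopSlope s D C γ m := by
  have hDγ : Continuous fun B => D B γ := hD.comp (continuous_id.prodMk continuous_const)
  have hCγ : Continuous fun B => C B γ := hC.comp (continuous_id.prodMk continuous_const)
  set m₀ := D A γ / C A γ with hm₀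
  have hT : IsCompact (s ∩ {B | 0 ≤ C B γ ∧ m₀ * C B γ ≤ D B γ}) :=
    hs.inter_right ((isClosed_le continuous_const hCγ).inter
      (isClosed_le (continuous_const.mul hCγ) hDγ))
  have hposT : ∀ B ∈ s ∩ {B | 0 ≤ C B γ ∧ m₀ * C B γ ≤ D B γ}, 0 < C B γ := by
    rintro B ⟨hB, h1, h2⟩
    refine h1.lt_of_ne fun h => ?_
    have := hf B hB h.symm
    rw [← h, mul_zero] at h2
    linarith
  obtain ⟨B, hB, hmax⟩ := hT.exists_isMaxOn
    ⟨A, hA, hpos.le, by rw [hm₀, div_mul_cancel₀ _ hpos.ne']⟩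
    (f := fun B => D B γ / C B γ)
    (hDγ.continuousOn.div hCγ.continuousOn fun B hB => (hposT B hB).ne')
  have hBpos := hposT B hB
  refine ⟨D B γ / C B γ, ⟨B, hB.1, hBpos, by rw [div_mul_cancel₀ _ hBpos.ne']⟩, fun B' hB' h' => ?_⟩
  rcases le_or_gt (m₀ * C B' γ) (D B' γ) with h | h
  · have := hmax ⟨hB', h'.le, h⟩
    simp only [Set.mem_ofPred_eq] at this
    exact (div_le_iff₀ h').1 this
  · have : m₀ ≤ D B γ / C B γ := (le_div_iff₀ hBpos).2 hB.2.2
    nlinarith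

theorem eventually_exists_isTopSlope (hs : IsCompact s)
    (hD : Continuous fun p : ι × ℝ => D p.1 p.2) (hC : Continuous fun p : ι × ℝ => C p.1 p.2)
    {γ m : ℝ} (hf : ∀ᶠ x in 𝓝 γ, IsFeasibleAt s D C x) (hm : IsTopSlope s D C γ m) :
    ∀ᶠ x in 𝓝 γ, ∃ m, IsTopSlope s D C x m := by
  obtain ⟨A, hA, hpos, -⟩ := hm.1
  have hCA : Continuous fun x => C A x := hC.comp (continuous_const.prodMk continuous_id)
  filter_upwards [hf, hCA.continuousAt.eventually (lt_mem_nhds hpos)] with x h1 h2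
  exact exists_isTopSlope hs hD hC h1 hA h2

theorem eventually_lt_of_feasible (hs : IsCompact s)
    (hD : Continuous fun p : ι × ℝ => D p.1 p.2) (hC : Continuous fun p : ι × ℝ => C p.1 p.2)
    {γ M : ℝ} (hf : IsFeasibleAt s D C γ) (hM : ∀ A ∈ s, 0 < C A γ → D A γ < M * C A γ) :
    ∀ᶠ x in 𝓝 γ, ∀ A ∈ s, 0 ≤ C A x → D A x < M * C A x := by
  have hZ : IsClosed {p : ι × ℝ | 0 ≤ C p.1 p.2 ∧ M * C p.1 p.2 ≤ D p.1 p.2} :=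
    (isClosed_le continuous_const hC).inter (isClosed_le (continuous_const.mul hC) hD)
  have hcl := isClosed_exists_mem hs hZ
  have hnot : γ ∈ {x | ∃ A ∈ s, (A, x) ∈ {p : ι × ℝ | 0 ≤ C p.1 p.2 ∧ M * C p.1 p.2 ≤ D p.1 p.2}}ᶜ := by
    rintro ⟨A, hA, h1, h2⟩
    simp only at h1 h2
    rcases h1.lt_or_eq with h | h
    · exact (hM A hA h).not_ge h2
    · have := hf A hA h.symm
      rw [← h, mul_zero] at h2
      linarith
  filter_upwards [hcl.isOpen_compl.mem_nhds hnot] with x hx A hA h1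
  by_contra! h2
  exact hx ⟨A, hA, h1, h2⟩

/-- Lower semicontinuity comes from following one maximizer, upper semicontinuity from compactness;
feasibility excludes vectors of small angular component and large slope. -/
theorem continuousAt_of_isTopSlope (hs : IsCompact s)
    (hD : Continuous fun p : ι × ℝ => D p.1 p.2) (hC : Continuous fun p : ι × ℝ => C p.1 p.2)
    {γ : ℝ} {a : ℝ → ℝ} (hf : IsFeasibleAt s D C γ) (ha : ∀ᶠ x in 𝓝 γ, IsTopSlope s D C x (a x)) :
    ContinuousAt a γ := by
  have ha0 := ha.self_of_nhds
  rw [ContinuousAt, tendsto_order]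
  constructor
  · intro l hl
    obtain ⟨A, hA, hpos, heq⟩ := ha0.1
    have hCA : Continuous fun x => C A x := hC.comp (continuous_const.prodMk continuous_id)
    have hDA : Continuous fun x => D A x := hD.comp (continuous_const.prodMk continuous_id)
    have h1 : l * C A γ < D A γ := by rw [heq]; exact mul_lt_mul_of_pos_right hl hpos
    filter_upwards [ha, hCA.continuousAt.eventually (lt_mem_nhds hpos),
      ((continuous_const.mul hCA).continuousAt.eventually_lt hDA.continuousAt h1)] with x h2 h3 h4
    exact lt_of_mul_lt_mul_right (h4.trans_le (h2.2 A hA h3)) h3.le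
  · intro u hu
    have h1 := eventually_lt_of_feasible hs hD hC (M := u) hf fun A hA hpos =>
      (ha0.2 A hA hpos).trans_lt (mul_lt_mul_of_pos_right hu hpos)
    filter_upwards [h1, ha] with x h2 h3
    obtain ⟨A, hA, hpos, heq⟩ := h3.1
    have := h2 A hA hpos.le
    rw [heq] at this
    exact lt_of_mul_lt_mul_right this hpos.le

end TopSlope

/-- The slope of the left leading direction. -/
def LeftSlope (𝒜 : Set Mat) (γ m : ℝ) : Prop := IsTopSlope 𝒜 radial angular γ m

/-- The radial component in the reflected plane. -/
noncomputable def radial' (A : Mat) (γ : ℝ) : ℝ := radial A (-γ)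

/-- The angular component in the reflected plane. -/
noncomputable def angular' (A : Mat) (γ : ℝ) : ℝ := -angular A (-γ)

/-- The slope of the right leading direction. -/
def RightSlope (𝒜 : Set Mat) (γ m : ℝ) : Prop := IsTopSlope 𝒜 radial' angular' (-γ) (-m)

theorem continuous_radial' : Continuous fun p : Mat × ℝ => radial' p.1 p.2 :=
  continuous_radial.comp (continuous_fst.prodMk continuous_snd.neg)

theorem continuous_angular' : Continuous fun p : Mat × ℝ => angular' p.1 p.2 :=
  (continuous_angular.comp (continuous_fst.prodMk continuous_snd.neg)).neg

/-- The reflection `γ ↦ -γ` turns right leading data into left ones, so every result on `IsTopSlope`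
serves both sides; this undoes the reflection. -/
theorem rightSlope_iff {𝒜 : Set Mat} {γ m : ℝ} : RightSlope 𝒜 γ m ↔
    (∃ A ∈ 𝒜, angular A γ < 0 ∧ radial A γ = m * angular A γ) ∧
      ∀ B ∈ 𝒜, angular B γ < 0 → radial B γ ≤ m * angular B γ := by
  simp [RightSlope, IsTopSlope, radial', angular']

/-! ### Leading directions and slopes -/

theorem orientedAngle_act {r : ℝ} (hr : 0 < r) (γ : ℝ) (B : Mat) :
    orientedAngle (r • unitVec γ) (act B (r • unitVec γ)) = Complex.arg ⟨radial B γ, angular B γ⟩ := by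
  have e := Real.cos_sq_add_sin_sq γ
  rw [orientedAngle]
  congr 1
  have hne : (⟨(r • unitVec γ) 0, (r • unitVec γ) 1⟩ : ℂ) ≠ 0 := by
    intro h
    have h0 := congrArg Complex.re h
    have h1 := congrArg Complex.im h
    simp [unitVec, hr.ne'] at h0 h1
    rw [h0, h1] at e
    simp at e
  rw [div_eq_iff hne]
  simp only [act_smul_right, act_unitVec]
  apply Complex.ext <;> simp [unitVec, normalVec] <;> ring

theorem arg_mem_Ioo_zero_pi {z : ℂ} : Complex.arg z ∈ Set.Ioo 0 Real.pi ↔ 0 < z.im := by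
  constructor
  · rintro ⟨h1, h2⟩
    refine (Complex.arg_nonneg_iff.1 h1.le).lt_of_ne fun h => ?_
    rcases le_or_gt 0 z.re with hr | hr
    · exact h1.ne' (Complex.arg_eq_zero_iff.2 ⟨hr, h.symm⟩)
    · exact h2.ne (Complex.arg_eq_pi_iff.2 ⟨hr, h.symm⟩)
  · intro h
    refine ⟨(Complex.arg_nonneg_iff.2 h.le).lt_of_ne fun h' => ?_, Complex.arg_lt_pi_iff.2 (Or.inr h.ne')⟩
    exact h.ne' (Complex.arg_eq_zero_iff.1 h'.symm).2

theorem arg_mem_Ioo_neg_pi_zero {z : ℂ} : Complex.arg z ∈ Set.Ioo (-Real.pi) 0 ↔ z.im < 0 :=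
  ⟨fun h => Complex.arg_neg_iff.1 h.2, fun h => ⟨Complex.neg_pi_lt_arg z, Complex.arg_neg_iff.2 h⟩⟩

/-- The right side is the sine of the difference of the arguments, up to a positive factor; it has
the sign of the difference as long as that is smaller than `π` in absolute value. -/
theorem arg_le_arg_iff {z w : ℂ} (hz : z ≠ 0) (hw : w ≠ 0)
    (h : |Complex.arg w - Complex.arg z| < Real.pi) :
    Complex.arg z ≤ Complex.arg w ↔ 0 ≤ w.im * z.re - w.re * z.im := by
  have hs : Real.sin (Complex.arg w - Complex.arg z) * (‖w‖ * ‖z‖) = w.im * z.re - w.re * z.im := by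
    have h1 := norm_ne_zero_iff.2 hz
    have h2 := norm_ne_zero_iff.2 hw
    rw [Real.sin_sub, Complex.sin_arg, Complex.sin_arg, Complex.cos_arg hz, Complex.cos_arg hw]
    field_simp
  have hpos : 0 < ‖w‖ * ‖z‖ := mul_pos (norm_pos_iff.2 hw) (norm_pos_iff.2 hz)
  rw [abs_lt] at h
  rw [← hs]
  constructor
  · intro hle
    exact mul_nonneg (Real.sin_nonneg_of_nonneg_of_le_pi (by linarith) h.2.le) hpos.le
  · intro hnn
    by_contra! hlt
    have := Real.sin_neg_of_neg_of_neg_pi_lt (sub_neg.2 hlt) h.1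
    nlinarith

theorem leadingLeft_iff {𝒜 : Set Mat} {r γ : ℝ} (hr : 0 < r) {A : Mat} :
    IsLeadingLeft 𝒜 (r • unitVec γ) A ↔ IsFeasible 𝒜 (r • unitVec γ) ∧ A ∈ 𝒜 ∧ 0 < angular A γ ∧
      ∀ B ∈ 𝒜, 0 < angular B γ → radial B γ * angular A γ ≤ radial A γ * angular B γ ∧
        (radial B γ * angular A γ = radial A γ * angular B γ →
          ‖act B (r • unitVec γ)‖ ≤ ‖act A (r • unitVec γ)‖) := by
  simp only [IsLeadingLeft, orientedAngle_act hr, arg_mem_Ioo_zero_pi]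
  refine and_congr_right fun _ => and_congr_right fun _ => and_congr_right fun hA => ?_
  refine forall₃_congr fun B hB hpos => ?_
  have hz : (⟨radial A γ, angular A γ⟩ : ℂ) ≠ 0 := fun h => hA.ne' (congrArg Complex.im h)
  have hw : (⟨radial B γ, angular B γ⟩ : ℂ) ≠ 0 := fun h => hpos.ne' (congrArg Complex.im h)
  have h1 := (arg_mem_Ioo_zero_pi (z := ⟨radial A γ, angular A γ⟩)).2 hA
  have h2 := (arg_mem_Ioo_zero_pi (z := ⟨radial B γ, angular B γ⟩)).2 hpos
  have h3 := arg_le_arg_iff hz hw (by rw [abs_lt]; constructor <;> linarith [h1.1, h1.2, h2.1, h2.2])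
  have h4 := arg_le_arg_iff hw hz (by rw [abs_lt]; constructor <;> linarith [h1.1, h1.2, h2.1, h2.2])
  have e : Complex.arg ⟨radial B γ, angular B γ⟩ = Complex.arg ⟨radial A γ, angular A γ⟩ ↔
      radial B γ * angular A γ = radial A γ * angular B γ := by
    rw [le_antisymm_iff, h3, h4, le_antisymm_iff]
    constructor <;> rintro ⟨a, b⟩ <;> constructor <;> linarith
  rw [e, h3]
  refine and_congr ?_ Iff.rfl
  constructor <;> intro h <;> simp only at * <;> linarith

theorem leadingRight_iff {𝒜 : Set Mat} {r γ : ℝ} (hr : 0 < r) {A : Mat} :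
    IsLeadingRight 𝒜 (r • unitVec γ) A ↔ IsFeasible 𝒜 (r • unitVec γ) ∧ A ∈ 𝒜 ∧ angular A γ < 0 ∧
      ∀ B ∈ 𝒜, angular B γ < 0 → radial A γ * angular B γ ≤ radial B γ * angular A γ ∧
        (radial B γ * angular A γ = radial A γ * angular B γ →
          ‖act B (r • unitVec γ)‖ ≤ ‖act A (r • unitVec γ)‖) := by
  simp only [IsLeadingRight, orientedAngle_act hr, arg_mem_Ioo_neg_pi_zero]
  refine and_congr_right fun _ => and_congr_right fun _ => and_congr_right fun hA => ?_
  refine forall₃_congr fun B hB hpos => ?_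
  have hz : (⟨radial A γ, angular A γ⟩ : ℂ) ≠ 0 := fun h => hA.ne (congrArg Complex.im h)
  have hw : (⟨radial B γ, angular B γ⟩ : ℂ) ≠ 0 := fun h => hpos.ne (congrArg Complex.im h)
  have h1 := (arg_mem_Ioo_neg_pi_zero (z := ⟨radial A γ, angular A γ⟩)).2 hA
  have h2 := (arg_mem_Ioo_neg_pi_zero (z := ⟨radial B γ, angular B γ⟩)).2 hpos
  have h3 := arg_le_arg_iff hz hw (by rw [abs_lt]; constructor <;> linarith [h1.1, h1.2, h2.1, h2.2])
  have h4 := arg_le_arg_iff hw hz (by rw [abs_lt]; constructor <;> linarith [h1.1, h1.2, h2.1, h2.2])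
  have e : Complex.arg ⟨radial B γ, angular B γ⟩ = Complex.arg ⟨radial A γ, angular A γ⟩ ↔
      radial B γ * angular A γ = radial A γ * angular B γ := by
    rw [le_antisymm_iff, h3, h4, le_antisymm_iff]
    constructor <;> rintro ⟨a, b⟩ <;> constructor <;> linarith
  rw [e, h4]
  refine and_congr ?_ Iff.rfl
  constructor <;> intro h <;> simp only at * <;> linarith

theorem isFeasible_smul_iff {𝒜 : Set Mat} {r γ : ℝ} (hr : 0 < r) :
    IsFeasible 𝒜 (r • unitVec γ) ↔ IsFeasibleAt 𝒜 radial angular γ := by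
  have key : ∀ A : Mat, ∀ c : ℝ, act A (r • unitVec γ) = c • r • unitVec γ ↔
      radial A γ = c ∧ angular A γ = 0 := by
    intro A c
    rw [act_smul_right, smul_comm c, (smul_right_injective _ hr.ne').eq_iff, act_unitVec]
    have := polar_eq_iff (γ := γ) (a := radial A γ) (b := angular A γ) (c := c) (d := 0)
    rwa [zero_smul, add_zero] at this
  simp only [IsFeasible, key, IsFeasibleAt]
  constructor
  · intro h A hA h0
    by_contra! hle
    exact h ⟨A, hA, _, hle, rfl, h0⟩
  · rintro h ⟨A, hA, c, hc, rfl, h0⟩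
    exact (h A hA h0).not_ge hc

theorem hasDerivAt_smul_unitVec {ρ : ℝ → ℝ} {d γ : ℝ} (h : HasDerivAt ρ d γ) :
    HasDerivAt (fun τ => ρ τ • unitVec τ) (d • unitVec γ + ρ γ • normalVec γ) γ := by
  have := h.smul (hasDerivAt_unitVec γ)
  rwa [add_comm] at this

theorem hasDerivAt_of_smul_unitVec {ρ : ℝ → ℝ} {a b γ : ℝ}
    (h : HasDerivAt (fun τ => ρ τ • unitVec τ) (a • unitVec γ + b • normalVec γ) γ) :
    HasDerivAt ρ a γ ∧ b = ρ γ := by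
  have hi : ∀ i, HasDerivAt (fun τ => (ρ τ • unitVec τ) i) ((a • unitVec γ + b • normalVec γ) i) γ :=
    fun i => by
      have := (EuclideanSpace.proj (𝕜 := ℝ) i : Plane →L[ℝ] ℝ).hasFDerivAt.comp_hasDerivAt γ h
      exact this
  have h0 := ((hi 0).mul (Real.hasDerivAt_cos γ)).add ((hi 1).mul (Real.hasDerivAt_sin γ))
  have hd : HasDerivAt ρ a γ := by
    have e := Real.cos_sq_add_sin_sq γ
    refine (h0.congr_of_eventuallyEq (Eventually.of_forall fun τ => ?_)).congr_deriv ?_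
    · have e := Real.cos_sq_add_sin_sq τ
      simp [unitVec]
      linear_combination (-(ρ τ)) * e
    · simp [unitVec, normalVec]
      linear_combination a * e
  have := (hasDerivAt_smul_unitVec hd).unique h
  exact ⟨hd, ((polar_eq_iff.1 this).2).symm⟩

/-- In the logarithmic polar parametrization, a curve tangent to the vector field of `A` has the
slope of `A`. -/
theorem hasDerivAt_log_of_tangent {ρ : ℝ → ℝ} {A : Mat} {γ e : ℝ} (hρ : 0 < ρ γ)
    (h : HasDerivAt (fun τ => ρ τ • unitVec τ) (e • act A (ρ γ • unitVec γ)) γ) :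
    e * angular A γ = 1 ∧ HasDerivAt (fun τ => Real.log (ρ τ)) (radial A γ / angular A γ) γ := by
  have hv : e • act A (ρ γ • unitVec γ) = (e * ρ γ * radial A γ) • unitVec γ +
      (e * ρ γ * angular A γ) • normalVec γ := by
    rw [act_smul_right, act_unitVec]; module
  rw [hv] at h
  obtain ⟨hd, hb⟩ := hasDerivAt_of_smul_unitVec h
  have h1 : e * angular A γ = 1 := by
    have : (e * angular A γ) * ρ γ = 1 * ρ γ := by linarith
    exact mul_right_cancel₀ hρ.ne' this
  refine ⟨h1, (hd.log hρ.ne').congr_deriv ?_⟩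
  have hne : angular A γ ≠ 0 := fun h0 => by rw [h0, mul_zero] at h1; exact zero_ne_one h1
  have he : e = 1 / angular A γ := by field_simp; exact h1
  rw [he]
  field_simp

theorem hasDerivAt_tangent_of_slope {k : ℝ → ℝ} {A : Mat} {γ m : ℝ} (hA : angular A γ ≠ 0)
    (hm : radial A γ = m * angular A γ) (h : HasDerivAt k m γ) :
    HasDerivAt (fun τ => Real.exp (k τ) • unitVec τ)
      ((angular A γ)⁻¹ • act A (Real.exp (k γ) • unitVec γ)) γ := by
  refine (hasDerivAt_smul_unitVec h.exp).congr_deriv ?_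
  have hv : (angular A γ)⁻¹ • act A (Real.exp (k γ) • unitVec γ) =
      (Real.exp (k γ) * (radial A γ * (angular A γ)⁻¹)) • unitVec γ +
      (Real.exp (k γ) * (angular A γ * (angular A γ)⁻¹)) • normalVec γ := by
    rw [act_smul_right, act_unitVec]; module
  rw [hv, mul_inv_cancel₀ hA, hm, mul_assoc, mul_inv_cancel₀ hA, mul_one, mul_one]

/-- The logarithmic polar form of a left leading trajectory. -/
def TopArc {ι : Type*} (s : Set ι) (D C : ι → ℝ → ℝ) (α β : ℝ) (k : ℝ → ℝ) : Prop :=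
  ContinuousOn k (Set.Icc α β) ∧ ∀ γ ∈ Set.Ioo α β, ∃ m, IsTopSlope s D C γ m ∧ HasDerivAt k m γ

theorem TopArc.mono {ι : Type*} {s : Set ι} {D C : ι → ℝ → ℝ} {α β α' β' : ℝ} {k : ℝ → ℝ}
    (h : TopArc s D C α β k) (h1 : α ≤ α') (h2 : β' ≤ β) : TopArc s D C α' β' k :=
  ⟨h.1.mono (Set.Icc_subset_Icc h1 h2), fun γ hγ => h.2 γ (Set.Ioo_subset_Ioo h1 h2 hγ)⟩

theorem antitoneOn_Icc_of_hasDerivAt {y : ℝ → ℝ} {a b : ℝ} (hy : ContinuousOn y (Set.Icc a b))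
    (h : ∀ x ∈ Set.Ioo a b, ∃ d ≤ 0, HasDerivAt y d x) : AntitoneOn y (Set.Icc a b) := by
  choose! d hd0 hd using h
  refine antitoneOn_of_hasDerivWithinAt_nonpos (f' := d) (convex_Icc a b) hy ?_ ?_ <;>
    rw [interior_Icc]
  · exact fun x hx => (hd x hx).hasDerivWithinAt
  · exact hd0

/-- The top slope at a given argument is unique, so two leading trajectories over the same interval
have the same derivative and differ by a constant. -/
theorem TopArc.sub_eq {ι : Type*} {s : Set ι} {D C : ι → ℝ → ℝ} {α β : ℝ} {k k' : ℝ → ℝ}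
    (h : TopArc s D C α β k) (h' : TopArc s D C α β k') {x y : ℝ} (hx : x ∈ Set.Icc α β)
    (hy : y ∈ Set.Icc α β) : k x - k' x = k y - k' y := by
  have key : ∀ k k' : ℝ → ℝ, TopArc s D C α β k → TopArc s D C α β k' →
      AntitoneOn (fun x => k x - k' x) (Set.Icc α β) := by
    intro k k' h h'
    refine antitoneOn_Icc_of_hasDerivAt (h.1.sub h'.1) fun x hx => ?_
    obtain ⟨m, hm, hd⟩ := h.2 x hx
    obtain ⟨m', hm', hd'⟩ := h'.2 x hx
    exact ⟨_, (sub_eq_zero.2 (hm.eq hm')).le, hd.sub hd'⟩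
  have h1 := key k k' h h'
  have h2 := key k' k h' h
  rcases le_total x y with hxy | hxy
  · have e1 := h1 hx hy hxy
    have e2 := h2 hx hy hxy
    simp only at e1 e2
    linarith
  · have e1 := h1 hy hx hxy
    have e2 := h2 hy hx hxy
    simp only at e1 e2
    linarith

theorem LeftArc.topArc {𝒜 : Set Mat} {α β : ℝ} {ρ : ℝ → ℝ} (h : LeftArc 𝒜 α β ρ) :
    TopArc 𝒜 radial angular α β fun γ => Real.log (ρ γ) := by
  obtain ⟨hle, hc, hpos, harc⟩ := h
  refine ⟨hc.log fun γ hγ => (hpos γ hγ).ne', fun γ hγ => ?_⟩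
  obtain ⟨A, hA, c, hc, hder⟩ := harc γ hγ
  have hp := hpos γ (Set.Ioo_subset_Icc_self hγ)
  obtain ⟨-, hA, hang, hB⟩ := (leadingLeft_iff hp).1 hA
  refine ⟨radial A γ / angular A γ, ⟨⟨A, hA, hang, ?_⟩, fun B hB' hBpos => ?_⟩,
    (hasDerivAt_log_of_tangent hp hder).2⟩
  · field_simp
  · rw [div_mul_eq_mul_div, le_div_iff₀ hang]
    exact (hB B hB' hBpos).1

theorem RightArc.topArc {𝒜 : Set Mat} {α β : ℝ} {ρ : ℝ → ℝ} (h : RightArc 𝒜 α β ρ) :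
    TopArc 𝒜 radial' angular' (-β) (-α) fun γ => Real.log (ρ (-γ)) := by
  obtain ⟨hle, hc, hpos, harc⟩ := h
  refine ⟨?_, fun γ hγ => ?_⟩
  · refine ContinuousOn.log (hc.comp continuousOn_neg fun γ hγ => ?_) fun γ hγ => (hpos (-γ) ?_).ne'
    · exact ⟨by linarith [hγ.2], by linarith [hγ.1]⟩
    · exact ⟨by linarith [hγ.2], by linarith [hγ.1]⟩
  · have hγ' : -γ ∈ Set.Ioo α β := ⟨by linarith [hγ.2], by linarith [hγ.1]⟩
    obtain ⟨A, hA, c, hc, hder⟩ := harc (-γ) hγ'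
    have hp := hpos (-γ) (Set.Ioo_subset_Icc_self hγ')
    obtain ⟨-, hA, hang, hB⟩ := (leadingRight_iff hp).1 hA
    rw [← neg_smul] at hder
    refine ⟨-(radial A (-γ) / angular A (-γ)), ⟨⟨A, hA, neg_pos.2 hang, ?_⟩, fun B hB' hBpos => ?_⟩, ?_⟩
    · simp only [radial', angular']
      have := hang.ne
      field_simp
    · simp only [radial', angular'] at hBpos ⊢
      have := (hB B hB' (neg_pos.1 hBpos)).1
      rw [neg_mul_neg, div_mul_eq_mul_div, le_div_iff_of_neg hang]
      exact this
    · have h2 := (hasDerivAt_log_of_tangent hp hder).2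
      have := HasDerivAt.comp γ (h₂ := fun τ => Real.log (ρ τ)) (h := fun τ => -τ) h2 (hasDerivAt_neg γ)
      refine this.congr_deriv ?_
      ring

/-- A leading matrix of the largest length. -/
theorem exists_longest {𝒜 : Set Mat} (hcomp : IsCompact 𝒜) {γ m : ℝ} (x : Plane)
    (hf : IsFeasibleAt 𝒜 radial angular γ) {ε : ℝ} (hε : ε ≠ 0) {A₀ : Mat} (hA₀ : A₀ ∈ 𝒜)
    (hpos : 0 < ε * angular A₀ γ) (hm : radial A₀ γ = m * angular A₀ γ) :
    ∃ A ∈ 𝒜, 0 < ε * angular A γ ∧ radial A γ = m * angular A γ ∧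
      ∀ B ∈ 𝒜, 0 < ε * angular B γ → radial B γ = m * angular B γ → ‖act B x‖ ≤ ‖act A x‖ := by
  have hDγ : Continuous fun B => radial B γ :=
    continuous_radial.comp (continuous_id.prodMk continuous_const)
  have hCγ : Continuous fun B => angular B γ :=
    continuous_angular.comp (continuous_id.prodMk continuous_const)
  have hact : Continuous fun B : Mat => ‖act B x‖ :=
    (continuous_act.comp (continuous_id.prodMk continuous_const)).norm
  have hT : IsCompact (𝒜 ∩ {B | 0 ≤ ε * angular B γ ∧ radial B γ = m * angular B γ}) :=
    hcomp.inter_right ((isClosed_le continuous_const (continuous_const.mul hCγ)).inter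
      (isClosed_eq hDγ (continuous_const.mul hCγ)))
  obtain ⟨A, hA, hmax⟩ := hT.exists_isMaxOn ⟨A₀, hA₀, hpos.le, hm⟩ hact.continuousOn
  -- The maximum was taken over the closed condition; feasibility shows that the angular component
  -- of the maximizer is not zero.
  refine ⟨A, hA.1, hA.2.1.lt_of_ne fun h => ?_, hA.2.2, fun B hB h1 h2 => hmax ⟨hB, h1.le, h2⟩⟩
  have h0 := (mul_eq_zero.1 h.symm).resolve_left hε
  have := hf A hA.1 h0
  rw [hA.2.2, h0, mul_zero] at this
  exact lt_irrefl _ this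

theorem TopArc.leftArc {𝒜 : Set Mat} (hcomp : IsCompact 𝒜) {α β : ℝ} (hle : α ≤ β) {k : ℝ → ℝ}
    (h : TopArc 𝒜 radial angular α β k)
    (hf : ∀ γ ∈ Set.Ioo α β, IsFeasibleAt 𝒜 radial angular γ) :
    LeftArc 𝒜 α β fun γ => Real.exp (k γ) := by
  refine ⟨hle, h.1.rexp, fun γ _ => Real.exp_pos _, fun γ hγ => ?_⟩
  obtain ⟨m, ⟨⟨A₀, hA₀, hpos₀, hm₀⟩, hmax⟩, hder⟩ := h.2 γ hγ
  obtain ⟨A, hA, hpos, hm, hlong⟩ := exists_longest hcomp (Real.exp (k γ) • unitVec γ) (hf γ hγ)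
    one_ne_zero hA₀ (by simpa using hpos₀) hm₀
  rw [one_mul] at hpos
  refine ⟨A, (leadingLeft_iff (Real.exp_pos _)).2 ⟨(isFeasible_smul_iff (Real.exp_pos _)).2 (hf γ hγ),
    hA, hpos, fun B hB hB0 => ⟨?_, fun h => hlong B hB (by simpa using hB0) ?_⟩⟩,
    (angular A γ)⁻¹, inv_pos.2 hpos, hasDerivAt_tangent_of_slope hpos.ne' hm hder⟩
  · rw [hm]; nlinarith [hmax B hB hB0]
  · rw [hm] at h
    exact mul_right_cancel₀ hpos.ne' (by linarith)

theorem TopArc.rightArc {𝒜 : Set Mat} (hcomp : IsCompact 𝒜) {α β : ℝ} (hle : α ≤ β) {k : ℝ → ℝ}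
    (h : TopArc 𝒜 radial' angular' (-β) (-α) fun γ => k (-γ))
    (hf : ∀ γ ∈ Set.Ioo α β, IsFeasibleAt 𝒜 radial angular γ) :
    RightArc 𝒜 α β fun γ => Real.exp (k γ) := by
  have hk : ContinuousOn k (Set.Icc α β) := by
    have h1 := h.1.comp (s := Set.Icc α β) continuousOn_neg fun γ hγ =>
      ⟨by linarith [hγ.2], by linarith [hγ.1]⟩
    refine h1.congr fun γ _ => ?_
    simp
  refine ⟨hle, hk.rexp, fun γ _ => Real.exp_pos _, fun γ hγ => ?_⟩
  obtain ⟨m, ⟨⟨A₀, hA₀, hpos₀, hm₀⟩, hmax⟩, hder⟩ :=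
    h.2 (-γ) ⟨by linarith [hγ.2], by linarith [hγ.1]⟩
  simp only [radial', angular', neg_neg] at hpos₀ hm₀ hmax
  have hder' : HasDerivAt k (-m) γ := by
    have h1 := HasDerivAt.comp γ (h₂ := fun τ => k (-τ)) (h := fun τ => -τ) hder (hasDerivAt_neg γ)
    refine (h1.congr_of_eventuallyEq (Eventually.of_forall fun τ => ?_)).congr_deriv (by ring)
    simp
  obtain ⟨A, hA, hpos, hm, hlong⟩ := exists_longest hcomp (m := -m) (Real.exp (k γ) • unitVec γ)
    (hf γ hγ) (ε := -1) (by norm_num) hA₀ (by simpa using hpos₀) (by rw [hm₀]; ring)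
  have hneg : angular A γ < 0 := by linarith
  refine ⟨A, (leadingRight_iff (Real.exp_pos _)).2
    ⟨(isFeasible_smul_iff (Real.exp_pos _)).2 (hf γ hγ),
    hA, hneg, fun B hB hB0 => ⟨?_, fun h => hlong B hB (by linarith) ?_⟩⟩,
    -(angular A γ)⁻¹, neg_pos.2 (inv_lt_zero.2 hneg), ?_⟩
  · rw [hm]; nlinarith [hmax B hB (neg_pos.2 hB0)]
  · rw [hm] at h
    exact mul_right_cancel₀ hneg.ne (by linarith)
  · rw [← neg_smul, neg_neg]
    exact hasDerivAt_tangent_of_slope hneg.ne hm hder'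

/-! ### The unit sphere over an interval without kernels -/

section Gap

variable {𝒜 : Set Mat} {f : Seminorm ℝ Plane}

/-- A radial velocity cannot point outwards, by admissibility of a support slope, and it is not zero
outside of the kernels. -/
theorem isFeasibleAt_of_notMem_kernelSet (hzero : (0 : Mat) ∉ 𝒜)
    (hdef : ∀ x, f x = 0 → x = 0) (hdis : Dissipative 𝒜 f 0) {γ : ℝ} (hγ : γ ∉ kernelSet 𝒜) :
    IsFeasibleAt 𝒜 radial angular γ := by
  intro A hA h0
  obtain ⟨m, hm⟩ := exists_isSupportSlope hdef γ
  have h1 := hm.admissible hdef hdis A hA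
  rw [h0, mul_zero] at h1
  refine h1.lt_of_ne fun h => hγ ?_
  have hact : act A (unitVec γ) = 0 := by rw [act_unitVec, h0, h]; simp
  refine ⟨A, ⟨subset_convexHull ℝ 𝒜 hA, ?_, det_eq_zero_of_act_eq_zero (unitVec_ne_zero γ) hact,
    Or.inl hA⟩, mem_kernel.2 hact⟩
  rintro rfl
  exact hzero hA

/-- An extremal slope that is attained in the convex hull is attained by the operators themselves. -/
theorem exists_mem_of_mem_convexHull {γ m ε : ℝ} (hadm : AdmissibleSlope 𝒜 γ m) {A : Mat}
    (hA : A ∈ convexHull ℝ 𝒜) (hpos : 0 < ε * angular A γ) (hm : radial A γ = m * angular A γ) :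
    ∃ B ∈ 𝒜, 0 < ε * angular B γ ∧ radial B γ = m * angular B γ := by
  by_contra! hno
  -- If no operator attained the slope on the given side, all of `𝒜` would lie in this convex set,
  -- hence `A` too.
  have hc : Convex ℝ {B : Mat | radial B γ ≤ m * angular B γ ∧
      (radial B γ = m * angular B γ → ε * angular B γ ≤ 0)} := by
    intro B hB B' hB' a b ha hb hab
    simp only [Set.mem_ofPred_eq, radial_comb, angular_comb] at *
    refine ⟨by nlinarith, fun h => ?_⟩
    have h1 : a * (m * angular B γ - radial B γ) = 0 := by
      have h1 := mul_nonneg ha (sub_nonneg.2 hB.1)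
      have h2 := mul_nonneg hb (sub_nonneg.2 hB'.1)
      nlinarith
    have h2 : b * (m * angular B' γ - radial B' γ) = 0 := by linarith
    have h3 : a * (ε * angular B γ) ≤ 0 := by
      rcases mul_eq_zero.1 h1 with h | h
      · rw [h, zero_mul]
      · exact mul_nonpos_of_nonneg_of_nonpos ha (hB.2 (by linarith))
    have h4 : b * (ε * angular B' γ) ≤ 0 := by
      rcases mul_eq_zero.1 h2 with h | h
      · rw [h, zero_mul]
      · exact mul_nonpos_of_nonneg_of_nonpos hb (hB'.2 (by linarith))
    linarith
  have hsub : 𝒜 ⊆ {B : Mat | radial B γ ≤ m * angular B γ ∧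
      (radial B γ = m * angular B γ → ε * angular B γ ≤ 0)} := fun B hB =>
    ⟨hadm B hB, fun h => by
      by_contra! hlt
      exact hno B hB hlt h⟩
  exact ((convexHull_min hsub hc hA).2 hm).not_gt hpos

/-- The left leading direction is tangent to the unit sphere. -/
def LeftTangent (𝒜 : Set Mat) (f : Seminorm ℝ Plane) (γ : ℝ) : Prop :=
  ∃ m, IsSupportSlope f γ m ∧ LeftSlope 𝒜 γ m

/-- The right leading direction is tangent to the unit sphere. -/
def RightTangent (𝒜 : Set Mat) (f : Seminorm ℝ Plane) (γ : ℝ) : Prop :=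
  ∃ m, IsSupportSlope f γ m ∧ RightSlope 𝒜 γ m

theorem leftTangent_or_rightTangent (hne : (0 : Mat) ∉ convexHull ℝ 𝒜)
    (hdef : ∀ x, f x = 0 → x = 0) (hdis : Dissipative 𝒜 f 0)
    (hsus : Sustained (convexHull ℝ 𝒜) f) {γ : ℝ} (hγ : γ ∉ kernelSet 𝒜) :
    LeftTangent 𝒜 f γ ∨ RightTangent 𝒜 f γ := by
  obtain ⟨A, hA, h | ⟨hang, hm⟩⟩ := hsus.exists_slope hdef hdis γ
  · exact absurd (mem_kernelSet_of_act_eq_zero hne hA h) hγ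
  · have hadm := hm.admissible hdef hdis
    have heq : radial A γ = radial A γ / angular A γ * angular A γ := by field_simp
    rcases hang.lt_or_gt with hlt | hlt
    · right
      obtain ⟨B, hB, h1, h2⟩ := exists_mem_of_mem_convexHull (ε := -1) hadm hA (by linarith) heq
      exact ⟨_, hm, rightSlope_iff.2 ⟨⟨B, hB, by linarith, h2⟩, fun B hB _ => hadm B hB⟩⟩
    · left
      obtain ⟨B, hB, h1, h2⟩ := exists_mem_of_mem_convexHull (ε := 1) hadm hA (by linarith) heq
      exact ⟨_, hm, ⟨B, hB, by linarith, h2⟩, fun B hB _ => hadm B hB⟩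

theorem leftTangent_and_rightTangent (hcomp : IsCompact 𝒜) (hzero : (0 : Mat) ∉ 𝒜)
    (h0 : (0 : Mat) ∈ convexHull ℝ 𝒜) (hdef : ∀ x, f x = 0 → x = 0) (hdis : Dissipative 𝒜 f 0)
    (γ : ℝ) : LeftTangent 𝒜 f γ ∧ RightTangent 𝒜 f γ := by
  obtain ⟨A, hA, B, hB, htan⟩ := exists_tangent_of_zero_mem hcomp hzero hdef hdis h0
  obtain ⟨m, hm⟩ := exists_isSupportSlope hdef γ
  have hadm := hm.admissible hdef hdis
  obtain ⟨h1, h2, h3⟩ := htan γ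
  exact ⟨⟨m, hm, ⟨A, hA, h1, (h3 m hm).1⟩, fun B hB _ => hadm B hB⟩,
    ⟨m, hm, rightSlope_iff.2 ⟨⟨B, hB, h2, (h3 m hm).2⟩, fun B hB _ => hadm B hB⟩⟩⟩

/-- The leading slopes are support slopes and depend continuously on the argument, so they are the
derivatives of the log-radius. -/
theorem LeftTangent.topArc (hcomp : IsCompact 𝒜) (hdef : ∀ x, f x = 0 → x = 0)
    {α β : ℝ} (hf : ∀ γ ∈ Set.Ioo α β, IsFeasibleAt 𝒜 radial angular γ)
    (h : ∀ γ ∈ Set.Ioo α β, LeftTangent 𝒜 f γ) : TopArc 𝒜 radial angular α β (logRadius f) := by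
  choose! a hsup ha using h
  refine ⟨(continuous_logRadius hdef).continuousOn, fun γ hγ => ⟨a γ, ha γ hγ, ?_⟩⟩
  have hnhds := Ioo_mem_nhds hγ.1 hγ.2
  exact hasDerivAt_logRadius_of_continuousAt hdef (eventually_of_mem hnhds hsup)
    (continuousAt_of_isTopSlope hcomp continuous_radial continuous_angular (hf γ hγ)
      (eventually_of_mem hnhds ha))

theorem isFeasibleAt_reflect {γ : ℝ} (h : IsFeasibleAt 𝒜 radial angular γ) :
    IsFeasibleAt 𝒜 radial' angular' (-γ) := by
  intro A hA h0
  simp only [radial', angular', neg_neg, neg_eq_zero] at *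
  exact h A hA h0

theorem RightTangent.topArc (hcomp : IsCompact 𝒜) (hdef : ∀ x, f x = 0 → x = 0)
    {α β : ℝ} (hf : ∀ γ ∈ Set.Ioo α β, IsFeasibleAt 𝒜 radial angular γ)
    (h : ∀ γ ∈ Set.Ioo α β, RightTangent 𝒜 f γ) :
    TopArc 𝒜 radial' angular' (-β) (-α) fun γ => logRadius f (-γ) := by
  choose! b hsup hb using h
  refine ⟨((continuous_logRadius hdef).comp continuous_neg).continuousOn, fun γ hγ => ?_⟩
  have hγ' : -γ ∈ Set.Ioo α β := ⟨by linarith [hγ.2], by linarith [hγ.1]⟩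
  refine ⟨-b (-γ), by simpa [RightSlope] using hb (-γ) hγ', ?_⟩
  have hcont : ContinuousAt (fun x => -b (-x)) γ := by
    have hf' := isFeasibleAt_reflect (hf (-γ) hγ')
    rw [neg_neg] at hf'
    refine continuousAt_of_isTopSlope hcomp continuous_radial' continuous_angular' hf' ?_
    filter_upwards [Ioo_mem_nhds hγ.1 hγ.2] with x hx
    simpa [RightSlope] using hb (-x) ⟨by linarith [hx.2], by linarith [hx.1]⟩
  have hcont' : ContinuousAt b (-γ) := by
    have h1 := (ContinuousAt.comp (g := fun x => -b (-x)) (f := fun x : ℝ => -x) (x := -γ)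
      (by simpa using hcont) continuous_neg.continuousAt).neg
    refine h1.congr (Eventually.of_forall fun x => ?_)
    simp
  have hd := hasDerivAt_logRadius_of_continuousAt hdef
    (eventually_of_mem (Ioo_mem_nhds hγ'.1 hγ'.2) hsup) hcont'
  have := HasDerivAt.comp γ (h₂ := logRadius f) (h := fun τ => -τ) hd (hasDerivAt_neg γ)
  exact this.congr_deriv (by ring)

/-- Away from the kernels, the left and the right leading directions are strictly separated. -/
theorem eventually_separated (hcomp : IsCompact 𝒜) (hne : (0 : Mat) ∉ convexHull ℝ 𝒜)
    (hdef : ∀ x, f x = 0 → x = 0) (hdis : Dissipative 𝒜 f 0) {γ : ℝ} (hγ : γ ∉ kernelSet 𝒜) :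
    ∃ m₁ m₂ : ℝ, m₁ < m₂ ∧ ∀ᶠ x in 𝓝 γ, ∀ A ∈ 𝒜, radial A x < m₁ * angular A x ∧
      radial A x < m₂ * angular A x := by
  have hco := isCompact_convexHull_of_finiteDimensional hcomp
  obtain ⟨K, hK0, hK⟩ := exists_act_bound hcomp
  have hact : Continuous fun A : Mat => act A (unitVec γ) :=
    continuous_act.comp (continuous_id.prodMk continuous_const)
  have hconv : Convex ℝ ((fun A : Mat => act A (unitVec γ)) '' convexHull ℝ 𝒜) := by
    rintro _ ⟨A, hA, rfl⟩ _ ⟨B, hB, rfl⟩ a b ha hb hab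
    refine ⟨a • A + b • B, convex_convexHull ℝ 𝒜 hA hB ha hb hab, ?_⟩
    simp only [act_add_left, act_smul_left]
  have h0 : (0 : Plane) ∉ (fun A : Mat => act A (unitVec γ)) '' convexHull ℝ 𝒜 := by
    rintro ⟨A, hA, h⟩
    exact hγ (mem_kernelSet_of_act_eq_zero hne hA h)
  obtain ⟨ℓ, u, hu, hℓ⟩ := geometric_hahn_banach_point_closed hconv (hco.image hact).isClosed h0
  rw [map_zero] at hu
  obtain ⟨m, hm⟩ := exists_isSupportSlope hdef γ
  have hadm := hm.admissible hdef hdis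
  set p := ℓ (unitVec γ)
  set q := ℓ (normalVec γ)
  have hlin : ∀ A ∈ 𝒜, u < radial A γ * p + angular A γ * q := by
    intro A hA
    have := hℓ _ ⟨A, subset_convexHull ℝ 𝒜 hA, rfl⟩
    simp only [act_unitVec, map_add, map_smul, smul_eq_mul] at this
    exact this
  -- The inequality of support with weight `|p| + 1` is added to the one that separates 0 from the
  -- velocities. The weight makes the coefficient `c` of the radial component positive, and the
  -- result is a line of slope `M` with all velocities strictly on its inner side. The margin
  -- permits a range of slopes, first at `γ` and then nearby.
  set c := |p| + 1 - p with hc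
  have hc0 : 0 < c := by linarith [le_abs_self p]
  set M := ((|p| + 1) * m + q) / c with hM
  have hcM : c * M = (|p| + 1) * m + q := by rw [hM]; field_simp
  have hstrict : ∀ A ∈ 𝒜, radial A γ - M * angular A γ < -(u / c) := by
    intro A hA
    rw [← neg_div, lt_div_iff₀ hc0]
    have h1 := hlin A hA
    have h2 := mul_le_mul_of_nonneg_left (hadm A hA) (by positivity : 0 ≤ |p| + 1)
    have e : (radial A γ - M * angular A γ) * c = (|p| + 1) * radial A γ - p * radial A γ
        - (c * M) * angular A γ := by rw [hc]; ring
    rw [e, hcM]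
    linarith
  set η := u / c / K with hη
  have hη0 : 0 < η := by positivity
  have hηK : η * K = u / c := by rw [hη]; field_simp
  have hev : ∀ M', |M' - M| ≤ η → ∀ᶠ x in 𝓝 γ, ∀ A ∈ 𝒜, radial A x < M' * angular A x := by
    intro M' hM'
    have hZ : IsClosed {z : Mat × ℝ | M' * angular z.1 z.2 ≤ radial z.1 z.2} :=
      isClosed_le (continuous_const.mul continuous_angular) continuous_radial
    have hnot : γ ∈ {x | ∃ A ∈ 𝒜, (A, x) ∈ {z : Mat × ℝ | M' * angular z.1 z.2 ≤ radial z.1 z.2}}ᶜ := by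
      rintro ⟨A, hA, h⟩
      simp only [Set.mem_ofPred_eq] at h
      have h1 := hstrict A hA
      have h2 : |(M' - M) * angular A γ| ≤ η * K := by
        rw [abs_mul]
        exact mul_le_mul hM' (abs_angular_le (hK A hA) γ) (abs_nonneg _) hη0.le
      have h3 := (abs_le.1 h2).1
      rw [hηK] at h3
      linarith
    filter_upwards [(isClosed_exists_mem hcomp hZ).isOpen_compl.mem_nhds hnot] with x hx A hA
    by_contra! h
    exact hx ⟨A, hA, h⟩
  refine ⟨M - η, M + η, by linarith, ?_⟩
  filter_upwards [hev (M - η) (by simp [abs_of_pos hη0]), hev (M + η) (by simp [abs_of_pos hη0])]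
    with x h1 h2 A hA using ⟨h1 A hA, h2 A hA⟩

/-- Nearby, left leading slopes lie below `m₁` and right leading slopes above `m₂ > m₁`, whereas
support slopes cannot rise by a fixed amount over a short distance. -/
theorem eventually_not_left_right (hcomp : IsCompact 𝒜) (hne : (0 : Mat) ∉ convexHull ℝ 𝒜)
    (hdef : ∀ x, f x = 0 → x = 0) (hdis : Dissipative 𝒜 f 0) {γ : ℝ} (hγ : γ ∉ kernelSet 𝒜) :
    ∃ ε > 0, ∀ x y, |x - γ| < ε → |y - γ| < ε → x < y →
      ¬(LeftTangent 𝒜 f x ∧ RightTangent 𝒜 f y) := by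
  obtain ⟨m₁, m₂, hlt, hev⟩ := eventually_separated hcomp hne hdef hdis hγ
  obtain ⟨C, hC0, δ₀, hδ₀, hC⟩ := exists_supportSlope_le hdef
  obtain ⟨ε₀, hε₀, hball⟩ := Metric.eventually_nhds_iff.1 hev
  refine ⟨min ε₀ (min (δ₀ / 2) ((m₂ - m₁) / (2 * C))), by
    have := sub_pos.2 hlt; positivity, ?_⟩
  rintro x y hx hy hxy ⟨⟨m, hm, hl⟩, ⟨m', hm', hr⟩⟩
  rw [lt_min_iff, lt_min_iff] at hx hy
  obtain ⟨A, hA, hpos, hrad⟩ := hl.1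
  obtain ⟨B, hB, hneg, hrad'⟩ := (rightSlope_iff.1 hr).1
  have h1 := (hball (by rw [Real.dist_eq]; exact hx.1) A hA).1
  have h2 := (hball (by rw [Real.dist_eq]; exact hy.1) B hB).2
  rw [hrad] at h1
  rw [hrad'] at h2
  have h3 : m < m₁ := lt_of_mul_lt_mul_right h1 hpos.le
  have h4 : m₂ < m' := by
    by_contra! h
    nlinarith
  have hyx : y - x < 2 * min (δ₀ / 2) ((m₂ - m₁) / (2 * C)) := by
    rcases abs_lt.1 (lt_min_iff.2 hx.2) with ⟨a1, a2⟩
    rcases abs_lt.1 (lt_min_iff.2 hy.2) with ⟨b1, b2⟩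
    linarith
  have h5 := hC x m y m' hm hm' hxy (by linarith [min_le_left (δ₀ / 2) ((m₂ - m₁) / (2 * C))])
  have h6 : C * (y - x) ≤ C * (2 * ((m₂ - m₁) / (2 * C))) := by
    gcongr
    linarith [min_le_right (δ₀ / 2) ((m₂ - m₁) / (2 * C))]
  have h7 : C * (2 * ((m₂ - m₁) / (2 * C))) = m₂ - m₁ := by field_simp
  linarith

/-- The local statement is applied at the infimum of the right tangencies: there are right
tangencies at it or just after it, and left ones just before it, or at `x` itself. -/
theorem not_left_right (hcomp : IsCompact 𝒜) (hne : (0 : Mat) ∉ convexHull ℝ 𝒜)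
    (hdef : ∀ x, f x = 0 → x = 0) (hdis : Dissipative 𝒜 f 0)
    (hsus : Sustained (convexHull ℝ 𝒜) f) {x y : ℝ} (hxy : x < y)
    (hker : ∀ γ ∈ Set.Icc x y, γ ∉ kernelSet 𝒜) (hx : LeftTangent 𝒜 f x) :
    ¬RightTangent 𝒜 f y := by
  intro hy
  set S := {γ | γ ∈ Set.Ioc x y ∧ RightTangent 𝒜 f γ} with hS
  have hyS : y ∈ S := ⟨⟨hxy, le_rfl⟩, hy⟩
  have hbdd : BddBelow S := ⟨x, fun γ hγ => hγ.1.1.le⟩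
  set s := sInf S with hs
  have hxs : x ≤ s := le_csInf ⟨y, hyS⟩ fun γ hγ => hγ.1.1.le
  have hsy : s ≤ y := csInf_le hbdd hyS
  obtain ⟨ε, hε, hloc⟩ := eventually_not_left_right hcomp hne hdef hdis (hker s ⟨hxs, hsy⟩)
  obtain ⟨z, hz, hzlt⟩ := exists_lt_of_csInf_lt ⟨y, hyS⟩ (show sInf S < s + ε by linarith)
  have hsz : s ≤ z := csInf_le hbdd hz
  have hz' : |z - s| < ε := by rw [abs_of_nonneg (by linarith)]; linarith
  rcases hxs.eq_or_lt with h | h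
  · exact hloc x z (by rw [h, sub_self, abs_zero]; exact hε) hz' hz.1.1 ⟨hx, hz.2⟩
  · set w := max x (s - ε / 2) with hw
    have hws : w < s := max_lt h (by linarith)
    have hw' : |w - s| < ε := by
      rw [abs_of_neg (by linarith)]; linarith [le_max_right x (s - ε / 2)]
    refine hloc w z hw' hz' (hws.trans_le hsz) ⟨?_, hz.2⟩
    rcases (le_max_left x (s - ε / 2)).eq_or_lt with h' | h'
    · rw [hw, ← h']; exact hx
    · refine (leftTangent_or_rightTangent hne hdef hdis hsus
        (hker w ⟨h'.le, hws.le.trans hsy⟩)).resolve_right fun hr => ?_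
      exact hws.not_ge (csInf_le hbdd ⟨⟨h', hws.le.trans hsy⟩, hr⟩)

/-- Over an interval without kernels, the unit sphere consists of a right and a left leading
trajectory with a common source. -/
theorem exists_topArcs (hcomp : IsCompact 𝒜) (hzero : (0 : Mat) ∉ 𝒜)
    (hdef : ∀ x, f x = 0 → x = 0) (hdis : Dissipative 𝒜 f 0)
    (hsus : Sustained (convexHull ℝ 𝒜) f) {α β : ℝ} (hαβ : α < β)
    (hker : ∀ γ ∈ Set.Ioo α β, γ ∉ kernelSet 𝒜) :
    ∃ t ∈ Set.Icc α β, TopArc 𝒜 radial' angular' (-t) (-α) (fun γ => logRadius f (-γ)) ∧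
      TopArc 𝒜 radial angular t β (logRadius f) := by
  have hfeas : ∀ γ ∈ Set.Ioo α β, IsFeasibleAt 𝒜 radial angular γ := fun γ hγ =>
    isFeasibleAt_of_notMem_kernelSet hzero hdef hdis (hker γ hγ)
  suffices h : ∃ t ∈ Set.Icc α β, (∀ γ ∈ Set.Ioo α t, RightTangent 𝒜 f γ) ∧
      ∀ γ ∈ Set.Ioo t β, LeftTangent 𝒜 f γ by
    obtain ⟨t, ht, hr, hl⟩ := h
    exact ⟨t, ht, RightTangent.topArc hcomp hdef
      (fun γ hγ => hfeas γ (Set.Ioo_subset_Ioo_right ht.2 hγ)) hr,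
      LeftTangent.topArc hcomp hdef (fun γ hγ => hfeas γ (Set.Ioo_subset_Ioo_left ht.1 hγ)) hl⟩
  by_cases h0 : (0 : Mat) ∈ convexHull ℝ 𝒜
  -- In the exceptional case every point is a left tangency, so the left end serves as the source.
  · exact ⟨α, ⟨le_rfl, hαβ.le⟩, by simp, fun γ _ =>
      (leftTangent_and_rightTangent hcomp hzero h0 hdef hdis γ).1⟩
  -- The source is the supremum of the right tangencies; the left end is added for the case when
  -- there are none.
  · set S := insert α {γ | γ ∈ Set.Ioo α β ∧ RightTangent 𝒜 f γ} with hS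
    have hne : S.Nonempty := ⟨α, Set.mem_insert _ _⟩
    have hbdd : ∀ γ ∈ S, γ ≤ β := by
      rintro γ (rfl | hγ)
      · exact hαβ.le
      · exact hγ.1.2.le
    have hαs : α ≤ sSup S := le_csSup ⟨β, hbdd⟩ (Set.mem_insert _ _)
    refine ⟨sSup S, ⟨hαs, csSup_le hne hbdd⟩, fun γ hγ => ?_, fun γ hγ => ?_⟩
    · obtain ⟨y, hy, hγy⟩ := exists_lt_of_lt_csSup hne hγ.2
      rcases hy with rfl | hy
      · exact absurd hγ.1 hγy.not_gt
      · refine (leftTangent_or_rightTangent h0 hdef hdis hsus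
          (hker γ ⟨hγ.1, hγy.trans hy.1.2⟩)).resolve_left fun hl => ?_
        exact not_left_right hcomp h0 hdef hdis hsus hγy (fun x hx => hker x
          ⟨hγ.1.trans_le hx.1, hx.2.trans_lt hy.1.2⟩) hl hy.2
    · have hγ' : γ ∈ Set.Ioo α β := ⟨hαs.trans_lt hγ.1, hγ.2⟩
      refine (leftTangent_or_rightTangent h0 hdef hdis hsus (hker γ hγ')).resolve_right fun hr => ?_
      exact hγ.1.not_ge (le_csSup ⟨β, hbdd⟩ (Or.inr ⟨hγ', hr⟩))

end Gap

/-! ### Comparison with leading trajectories -/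

/-- Both points are moved slightly towards their midpoint, into the open interval. -/
theorem monotoneOn_Icc_of_Ioo {y : ℝ → ℝ} {a b : ℝ} (hc : ContinuousOn y (Set.Icc a b))
    (h : MonotoneOn y (Set.Ioo a b)) : MonotoneOn y (Set.Icc a b) := by
  intro u hu v hv huv
  rcases huv.eq_or_lt with rfl | hlt
  · exact le_rfl
  set c := (u + v) / 2 with hcdef
  have huc : u < c := by rw [hcdef]; linarith
  have hcv : c < v := by rw [hcdef]; linarith
  have key : ∀ w ∈ Set.Icc a b, Tendsto (fun t : ℝ => y (w + t * (c - w))) (𝓝[>] 0) (𝓝 (y w)) := by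
    intro w hw
    have h1 : Tendsto (fun t : ℝ => w + t * (c - w)) (𝓝[>] 0) (𝓝[Set.Icc a b] w) := by
      refine tendsto_nhdsWithin_iff.2 ⟨?_, ?_⟩
      · have : Continuous fun t : ℝ => w + t * (c - w) := by fun_prop
        have h2 := (this.tendsto 0).mono_left (nhdsWithin_le_nhds (s := Set.Ioi 0))
        simpa using h2
      · filter_upwards [Ioo_mem_nhdsGT (zero_lt_one' ℝ)] with t ht
        have hca : a ≤ c := hu.1.trans huc.le
        have hcb : c ≤ b := hcv.le.trans hv.2
        constructor <;> nlinarith [ht.1, ht.2, hw.1, hw.2]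
    exact (hc w hw).tendsto.comp h1
  refine le_of_tendsto_of_tendsto (key u hu) (key v hv) ?_
  filter_upwards [Ioo_mem_nhdsGT (zero_lt_one' ℝ)] with t ht
  have h1 := mul_pos ht.1 (sub_pos.2 huc)
  have h2 := mul_pos ht.1 (sub_pos.2 hcv)
  have h3 := mul_pos (sub_pos.2 ht.2) (sub_pos.2 huc)
  have h4 := mul_pos (sub_pos.2 ht.2) (sub_pos.2 hcv)
  refine h ⟨?_, ?_⟩ ⟨?_, ?_⟩ ?_
  · linarith [hu.1]
  · linarith [hv.2]
  · linarith [hu.1]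
  · linarith [hv.2]
  · linarith

/-- A function is semiconcave with admissible superdifferentials. -/
def SemiconcaveAdmissible {ι : Type*} (s : Set ι) (D C : ι → ℝ → ℝ) (h : ℝ → ℝ) : Prop :=
  ∃ c > 0, ∃ δ₀ > 0, ∀ γ, ∃ m, (∀ A ∈ s, D A γ ≤ m * C A γ) ∧
    ∀ δ : ℝ, |δ| ≤ δ₀ → h (γ + δ) ≤ h γ + m * δ + c * δ ^ 2

theorem semiconcaveAdmissible_logRadius {𝒜 : Set Mat} {f : Seminorm ℝ Plane}
    (hdef : ∀ x, f x = 0 → x = 0) (hdis : Dissipative 𝒜 f 0) :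
    SemiconcaveAdmissible 𝒜 radial angular (logRadius f) := by
  obtain ⟨C, hC, δ₀, hδ₀, h⟩ := exists_logRadius_le hdef
  refine ⟨C, hC, δ₀, hδ₀, fun γ => ?_⟩
  obtain ⟨m, hm⟩ := exists_isSupportSlope hdef γ
  exact ⟨m, hm.admissible hdef hdis, h γ m hm⟩

theorem SemiconcaveAdmissible.reflect {𝒜 : Set Mat} {g : ℝ → ℝ}
    (h : SemiconcaveAdmissible 𝒜 radial angular g) :
    SemiconcaveAdmissible 𝒜 radial' angular' fun γ => g (-γ) := by
  obtain ⟨C, hC, δ₀, hδ₀, h⟩ := h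
  refine ⟨C, hC, δ₀, hδ₀, fun γ => ?_⟩
  obtain ⟨m, hm, hle⟩ := h (-γ)
  refine ⟨-m, fun A hA => ?_, fun δ hδ => ?_⟩
  · simp only [radial', angular', neg_mul_neg]
    exact hm A hA
  · have := hle (-δ) (by rwa [abs_neg])
    have e : -(γ + δ) = -γ + -δ := by ring
    change g (-(γ + δ)) ≤ g (-γ) + -m * δ + C * δ ^ 2
    rw [e]
    linarith

section Compare

variable {ι : Type*} [TopologicalSpace ι] {s : Set ι} {D C : ι → ℝ → ℝ}

/-- The comparison principle: an admissible slope is at least the top slope, so `h` grows at least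
as fast as the leading trajectory `k`. Since `h` need not be differentiable, a one-sided estimate of
difference quotients is used. -/
theorem SemiconcaveAdmissible.monotoneOn_sub (hs : IsCompact s)
    (hD : Continuous fun p : ι × ℝ => D p.1 p.2) (hC : Continuous fun p : ι × ℝ => C p.1 p.2)
    {h k : ℝ → ℝ} (hh : SemiconcaveAdmissible s D C h) (hcont : Continuous h) {α β : ℝ}
    (hf : ∀ γ ∈ Set.Ioo α β, IsFeasibleAt s D C γ) (hk : TopArc s D C α β k) :
    MonotoneOn (fun γ => h γ - k γ) (Set.Icc α β) := by
  refine monotoneOn_Icc_of_Ioo (hcont.continuousOn.sub hk.1) fun x hx y hy hxy => ?_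
  obtain ⟨c, hc, δ₀, hδ₀, hsc⟩ := hh
  obtain ⟨hk1, hk2⟩ := hk
  choose! a ha hd using hk2
  have hsub : Set.Icc x y ⊆ Set.Ioo α β := fun z hz => ⟨hx.1.trans_le hz.1, hz.2.trans_lt hy.2⟩
  have key := image_le_of_liminf_slope_right_le_deriv_boundary (f := fun z => -h z) (a := x) (b := y)
    hcont.neg.continuousOn (B := fun z => -k z + (k x - h x)) (B' := fun z => -a z)
    (by simp) (((hk1.mono (hsub.trans Set.Ioo_subset_Icc_self)).neg).add continuousOn_const)
    (fun z hz => ((hd z (hsub ⟨hz.1, hz.2.le⟩)).neg.add_const _).hasDerivWithinAt)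
    (fun z hz r hr => Eventually.frequently ?_) (Set.right_mem_Icc.2 hxy)
  · change h x - k x ≤ h y - k y
    linarith
  · have hz' := hsub ⟨hz.1, hz.2.le⟩
    have hca : ContinuousAt a z := continuousAt_of_isTopSlope hs hD hC (hf z hz')
      (eventually_of_mem (Ioo_mem_nhds hz'.1 hz'.2) ha)
    have hlim : ContinuousAt (fun w => -a w + c * (w - z)) z :=
      hca.neg.add (continuousAt_const.mul (continuousAt_id.sub continuousAt_const))
    have h1 := hlim.eventually (gt_mem_nhds (show -a z + c * (z - z) < r by simpa using hr))
    filter_upwards [nhdsWithin_le_nhds h1, nhdsWithin_le_nhds (Ioo_mem_nhds hz'.1 hz'.2),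
      nhdsWithin_le_nhds (eventually_abs_sub_lt z hδ₀), self_mem_nhdsWithin] with w hw1 hw2 hw3 hw4
    -- Semiconcavity is used at the right point `w`, looking back to `z`: this bounds the forward
    -- quotient from below by `m - c (w - z)`, where `m` is at least the top slope at `w`.
    obtain ⟨m, hm, hle⟩ := hsc w
    have h2 := hle (z - w) (by rw [abs_sub_comm]; exact hw3.le)
    rw [add_sub_cancel] at h2
    have h3 := (ha w hw2).le_of_admissible hm
    have hpos : 0 < w - z := sub_pos.2 hw4
    refine lt_of_le_of_lt ?_ hw1
    rw [slope_def_field, div_le_iff₀ hpos]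
    nlinarith

end Compare

section Bounds

variable {𝒜 : Set Mat} {f : Seminorm ℝ Plane}

theorem mem_gaps {I : ℝ × ℝ} (h : I ∈ gaps 𝒜) :
    I.1 < I.2 ∧ 0 ≤ I.1 ∧ I.2 ≤ Real.pi ∧ ∀ γ ∈ Set.Ioo I.1 I.2, γ ∉ kernelSet 𝒜 ∧ γ ∉ reverseSet 𝒜 := by
  obtain ⟨hlt, hsub, -, -⟩ := h
  have hcl : Set.Icc I.1 I.2 ⊆ Set.Icc 0 Real.pi := by
    rw [← closure_Ioo hlt.ne, ← closure_Ioo Real.pi_pos.ne]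
    exact closure_mono fun γ hγ => (hsub hγ).1
  refine ⟨hlt, (hcl (Set.left_mem_Icc.2 hlt.le)).1, (hcl (Set.right_mem_Icc.2 hlt.le)).2,
    fun γ hγ => ?_⟩
  obtain ⟨h1, h2⟩ := hsub hγ
  rw [Set.mem_union, not_or] at h2
  exact ⟨fun h => h2.2 ⟨Set.Ioo_subset_Icc_self h1, h2.1, h⟩, h2.1⟩

theorem LeftArc.mono {α β α' β' : ℝ} {ρ : ℝ → ℝ} (h : LeftArc 𝒜 α β ρ) (h1 : α ≤ α') (h2 : α' ≤ β')
    (h3 : β' ≤ β) : LeftArc 𝒜 α' β' ρ :=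
  ⟨h2, h.2.1.mono (Set.Icc_subset_Icc h1 h3), fun γ hγ => h.2.2.1 γ (Set.Icc_subset_Icc h1 h3 hγ),
    fun γ hγ => h.2.2.2 γ (Set.Ioo_subset_Ioo h1 h3 hγ)⟩

theorem RightArc.mono {α β α' β' : ℝ} {ρ : ℝ → ℝ} (h : RightArc 𝒜 α β ρ) (h1 : α ≤ α') (h2 : α' ≤ β')
    (h3 : β' ≤ β) : RightArc 𝒜 α' β' ρ :=
  ⟨h2, h.2.1.mono (Set.Icc_subset_Icc h1 h3), fun γ hγ => h.2.2.1 γ (Set.Icc_subset_Icc h1 h3 hγ),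
    fun γ hγ => h.2.2.2 γ (Set.Ioo_subset_Ioo h1 h3 hγ)⟩

theorem LeftArc.log_div_le (hcomp : IsCompact 𝒜) (hzero : (0 : Mat) ∉ 𝒜)
    (hdef : ∀ x, f x = 0 → x = 0) (hdis : Dissipative 𝒜 f 0) {I : ℝ × ℝ} (hI : I ∈ gaps 𝒜)
    {ρ : ℝ → ℝ} (h : LeftArc 𝒜 I.1 I.2 ρ) : Real.log (ρ I.2 / ρ I.1) ≤ increment f I := by
  obtain ⟨hlt, -, -, hker⟩ := mem_gaps hI
  have hmono := (semiconcaveAdmissible_logRadius hdef hdis).monotoneOn_sub hcomp continuous_radial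
    continuous_angular (continuous_logRadius hdef) (fun γ hγ =>
      isFeasibleAt_of_notMem_kernelSet hzero hdef hdis (hker γ hγ).1) h.topArc
  have := hmono (Set.left_mem_Icc.2 hlt.le) (Set.right_mem_Icc.2 hlt.le) hlt.le
  simp only at this
  rw [Real.log_div (h.2.2.1 _ (Set.right_mem_Icc.2 hlt.le)).ne'
    (h.2.2.1 _ (Set.left_mem_Icc.2 hlt.le)).ne', increment]
  linarith

theorem RightArc.le_log_div (hcomp : IsCompact 𝒜) (hzero : (0 : Mat) ∉ 𝒜)
    (hdef : ∀ x, f x = 0 → x = 0) (hdis : Dissipative 𝒜 f 0) {I : ℝ × ℝ} (hI : I ∈ gaps 𝒜)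
    {ρ : ℝ → ℝ} (h : RightArc 𝒜 I.1 I.2 ρ) : increment f I ≤ -Real.log (ρ I.1 / ρ I.2) := by
  obtain ⟨hlt, -, -, hker⟩ := mem_gaps hI
  have hmono := (semiconcaveAdmissible_logRadius hdef hdis).reflect.monotoneOn_sub hcomp
    continuous_radial' continuous_angular' ((continuous_logRadius hdef).comp continuous_neg)
    (fun γ hγ => by
      have := isFeasibleAt_reflect (isFeasibleAt_of_notMem_kernelSet hzero hdef hdis
        (hker (-γ) ⟨by linarith [hγ.2], by linarith [hγ.1]⟩).1)
      rwa [neg_neg] at this) h.topArc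
  have := hmono (Set.left_mem_Icc.2 (by linarith)) (Set.right_mem_Icc.2 (by linarith))
    (show -I.2 ≤ -I.1 by linarith)
  simp only [neg_neg] at this
  rw [Real.log_div (h.2.2.1 _ (Set.left_mem_Icc.2 hlt.le)).ne'
    (h.2.2.1 _ (Set.right_mem_Icc.2 hlt.le)).ne', increment]
  linarith

/-- As a by-product `ln k₁ ≤ -ln k₂`, so the first is always the minimum and the second the maximum.
-/
theorem increment_mem_bounds (hcomp : IsCompact 𝒜) (hzero : (0 : Mat) ∉ 𝒜)
    (hdef : ∀ x, f x = 0 → x = 0) (hdis : Dissipative 𝒜 f 0) {I : ℝ × ℝ} (hI : I ∈ gaps 𝒜) :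
    logK₁ 𝒜 I ≤ ((increment f I : ℝ) : EReal) ∧ ((increment f I : ℝ) : EReal) ≤ negLogK₂ 𝒜 I := by
  constructor
  · refine sSup_le ?_
    rintro _ ⟨ρ, hρ, rfl⟩
    exact EReal.coe_le_coe_iff.2 (hρ.log_div_le hcomp hzero hdef hdis hI)
  · refine le_sInf ?_
    rintro _ ⟨ρ, hρ, rfl⟩
    exact EReal.coe_le_coe_iff.2 (hρ.le_log_div hcomp hzero hdef hdis hI)

theorem exists_arcs (hcomp : IsCompact 𝒜) (hzero : (0 : Mat) ∉ 𝒜)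
    (hdef : ∀ x, f x = 0 → x = 0) (hdis : Dissipative 𝒜 f 0)
    (hsus : Sustained (convexHull ℝ 𝒜) f) {I : ℝ × ℝ} (hI : I ∈ gaps 𝒜) :
    ∃ t ∈ Set.Icc I.1 I.2, RightArc 𝒜 I.1 t (fun γ => Real.exp (logRadius f γ)) ∧
      LeftArc 𝒜 t I.2 fun γ => Real.exp (logRadius f γ) := by
  obtain ⟨hlt, -, -, hker⟩ := mem_gaps hI
  obtain ⟨t, ht, h1, h2⟩ := exists_topArcs hcomp hzero hdef hdis hsus hlt fun γ hγ => (hker γ hγ).1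
  have hf : ∀ γ ∈ Set.Ioo I.1 I.2, IsFeasibleAt 𝒜 radial angular γ := fun γ hγ =>
    isFeasibleAt_of_notMem_kernelSet hzero hdef hdis (hker γ hγ).1
  exact ⟨t, ht, h1.rightArc hcomp ht.1 fun γ hγ => hf γ (Set.Ioo_subset_Ioo_right ht.2 hγ),
    h2.leftArc hcomp ht.2 fun γ hγ => hf γ (Set.Ioo_subset_Ioo_left ht.1 hγ)⟩

/-- The unit sphere itself provides a source in every gap. -/
theorem gaps_eq (hcomp : IsCompact 𝒜) (hzero : (0 : Mat) ∉ 𝒜)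
    (hdef : ∀ x, f x = 0 → x = 0) (hdis : Dissipative 𝒜 f 0)
    (hsus : Sustained (convexHull ℝ 𝒜) f) : gaps 𝒜 = setP 𝒜 ∪ setH 𝒜 := by
  ext I
  refine ⟨fun hI => ?_, ?_⟩
  · obtain ⟨t, ht, h1, h2⟩ := exists_arcs hcomp hzero hdef hdis hsus hI
    by_cases h : (sources 𝒜 I ∩ Set.Ioo I.1 I.2).Nonempty
    · exact Or.inl ⟨hI, h⟩
    · exact Or.inr ⟨hI, ⟨t, ⟨_, h1⟩, _, h2⟩, Set.not_nonempty_iff_eq_empty.1 h⟩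
  · rintro (h | h) <;> exact h.1

theorem disjoint_setP_setH : Disjoint (setP 𝒜) (setH 𝒜) :=
  Set.disjoint_left.2 fun _ h1 h2 => h1.2.ne_empty h2.2.2

theorem disjoint_setR_gaps : Disjoint (setR 𝒜) (gaps 𝒜) := by
  refine Set.disjoint_left.2 fun I h1 h2 => ?_
  obtain ⟨hlt, -, -, h⟩ := mem_gaps h2
  obtain ⟨γ, hγ⟩ := Set.nonempty_Ioo.2 hlt
  exact (h γ hγ).2 (h1.2.2.2.1 hγ)

/-- The source provided by the sphere can only be an end, so the sphere over the interval is a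
single leading trajectory. A left and a right one cannot both join the rays, since every interior
point would then be a source. -/
theorem setH_increment (hcomp : IsCompact 𝒜) (hzero : (0 : Mat) ∉ 𝒜)
    (hdef : ∀ x, f x = 0 → x = 0) (hdis : Dissipative 𝒜 f 0)
    (hsus : Sustained (convexHull ℝ 𝒜) f) {q : ℝ × ℝ} (hq : q ∈ setH 𝒜) :
    (∃ ρ, (LeftArc 𝒜 q.1 q.2 ρ ∨ RightArc 𝒜 q.1 q.2 ρ) ∧
      increment f q = Real.log (ρ q.2 / ρ q.1)) ∧
    ∀ ρ, LeftArc 𝒜 q.1 q.2 ρ ∨ RightArc 𝒜 q.1 q.2 ρ →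
      Real.log (ρ q.2 / ρ q.1) = increment f q := by
  obtain ⟨hlt, -, -, -⟩ := mem_gaps hq.1
  obtain ⟨t, ht, h1, h2⟩ := exists_arcs hcomp hzero hdef hdis hsus hq.1
  have hne : t ∉ Set.Ioo q.1 q.2 := fun h => by
    have : t ∈ sources 𝒜 q ∩ Set.Ioo q.1 q.2 := ⟨⟨⟨_, h1⟩, _, h2⟩, h⟩
    rw [hq.2.2] at this
    exact this
  have hboth : ∀ ρ ρ', LeftArc 𝒜 q.1 q.2 ρ → RightArc 𝒜 q.1 q.2 ρ' → False := by
    intro ρ ρ' h h'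
    obtain ⟨z, hz⟩ := Set.nonempty_Ioo.2 hlt
    have : z ∈ sources 𝒜 q ∩ Set.Ioo q.1 q.2 :=
      ⟨⟨⟨ρ', h'.mono le_rfl hz.1.le hz.2.le⟩, ρ, h.mono hz.1.le hz.2.le le_rfl⟩, hz⟩
    rw [hq.2.2] at this
    exact this
  have hexp : Real.log (Real.exp (logRadius f q.2) / Real.exp (logRadius f q.1)) = increment f q := by
    rw [← Real.exp_sub, Real.log_exp, increment]
  rcases ht.1.eq_or_lt with h | h
  · rw [← h] at h2
    refine ⟨⟨_, Or.inl h2, hexp.symm⟩, ?_⟩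
    rintro ρ (hρ | hρ)
    · have := hρ.topArc.sub_eq h2.topArc (Set.left_mem_Icc.2 hlt.le) (Set.right_mem_Icc.2 hlt.le)
      simp only [Real.log_exp] at this
      rw [Real.log_div (hρ.2.2.1 _ (Set.right_mem_Icc.2 hlt.le)).ne'
        (hρ.2.2.1 _ (Set.left_mem_Icc.2 hlt.le)).ne', increment]
      linarith
    · exact (hboth _ _ h2 hρ).elim
  · have htβ : t = q.2 := by
      by_contra hne'
      exact hne ⟨h, ht.2.lt_of_ne hne'⟩
    rw [htβ] at h1
    refine ⟨⟨_, Or.inr h1, hexp.symm⟩, ?_⟩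
    rintro ρ (hρ | hρ)
    · exact (hboth _ _ hρ h1).elim
    · have hle : -q.2 ≤ -q.1 := by linarith
      have := hρ.topArc.sub_eq h1.topArc (Set.left_mem_Icc.2 hle) (Set.right_mem_Icc.2 hle)
      simp only [Real.log_exp, neg_neg] at this
      rw [Real.log_div (hρ.2.2.1 _ (Set.right_mem_Icc.2 hlt.le)).ne'
        (hρ.2.2.1 _ (Set.left_mem_Icc.2 hlt.le)).ne', increment]
      linarith

end Bounds

/-! ### Reverse intervals -/

theorem eq_const_of_eventually {U : Set ℝ} (hU : IsOpen U) (hconn : IsPreconnected U) {p : ℝ → ℝ}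
    (h : ∀ γ ∈ U, ∀ᶠ δ in 𝓝 γ, p δ = p γ) {x y : ℝ} (hx : x ∈ U) (hy : y ∈ U) : p x = p y := by
  have hd : ∀ γ ∈ U, HasDerivAt p 0 γ := fun γ hγ =>
    (hasDerivAt_const γ (p γ)).congr_of_eventuallyEq (h γ hγ)
  exact hU.is_const_of_deriv_eq_zero hconn
    (fun γ hγ => (hd γ hγ).differentiableAt.differentiableWithinAt)
    (fun γ hγ => (hd γ hγ).deriv) hx hy

section Reverse

variable {𝒜 : Set Mat} {f : Seminorm ℝ Plane}

/-- The coefficients of the local linear forms agree at neighbouring points, hence are constant on a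
connected open set. -/
theorem exists_linear_on (hcomp : IsCompact 𝒜) (hdis : Dissipative 𝒜 f 0) {U : Set ℝ}
    (hU : IsOpen U) (hconn : IsPreconnected U) (hsub : U ⊆ reverseSet 𝒜) :
    ∃ p q : ℝ, ∀ γ ∈ U, f (unitVec γ) = p * Real.cos γ + q * Real.sin γ ∧
      ∃ A ∈ convexHull ℝ 𝒜, act A (unitVec γ) = 0 ∧
        p * A 0 0 + q * A 1 0 = 0 ∧ p * A 0 1 + q * A 1 1 = 0 := by
  rcases U.eq_empty_or_nonempty with rfl | ⟨γ₀, hγ₀⟩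
  · exact ⟨0, 0, by simp⟩
  have h := fun γ (hγ : γ ∈ U) => exists_linear_of_mem_reverseSet hcomp hdis (hsub hγ)
  choose! p q hloc A hA hker hlin using h
  have heq : ∀ γ ∈ U, ∀ᶠ δ in 𝓝 γ, p δ = p γ ∧ q δ = q γ := by
    intro γ hγ
    filter_upwards [hU.mem_nhds hγ, (hloc γ hγ).eventually_nhds] with δ hδ hev
    have : ∀ᶠ x in 𝓝 δ, (p δ - p γ) * Real.cos x + (q δ - q γ) * Real.sin x = 0 := by
      filter_upwards [hev, hloc δ hδ] with x h1 h2
      linarith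
    obtain ⟨h1, h2⟩ := coeff_eq_zero_of_eventually this
    exact ⟨by linarith, by linarith⟩
  refine ⟨p γ₀, q γ₀, fun γ hγ => ?_⟩
  rw [eq_const_of_eventually hU hconn (fun γ hγ => (heq γ hγ).mono fun _ h => h.1) hγ₀ hγ,
    eq_const_of_eventually hU hconn (fun γ hγ => (heq γ hγ).mono fun _ h => h.2) hγ₀ hγ]
  refine ⟨(hloc γ hγ).self_of_nhds, A γ, hA γ hγ, hker γ hγ, ?_, ?_⟩
  · simpa [act_apply] using hlin γ hγ !₂[1, 0]
  · simpa [act_apply] using hlin γ hγ !₂[0, 1]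

theorem add_pi_mem_reverseSet {γ : ℝ} : γ + Real.pi ∈ reverseSet 𝒜 ↔ γ ∈ reverseSet 𝒜 := by
  have key : ∀ γ δ : ℝ, unitVec δ = -unitVec γ → γ ∈ reverseSet 𝒜 → δ ∈ reverseSet 𝒜 := by
    rintro γ δ h ⟨A₁, A₂, x₁, x₂, hp, ⟨h1, h2, h3, h4, h5⟩, a, b, ha, hb, hab⟩
    refine ⟨A₁, A₂, -x₁, -x₂, hp, ⟨neg_ne_zero.2 h1, neg_ne_zero.2 h2, neg_mem h3, neg_mem h4, ?_⟩,
      a, b, ha, hb, ?_⟩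
    · rw [neg_sub_neg, ← neg_sub]; exact neg_mem h5
    · rw [h, hab]; module
  exact ⟨key _ _ (by rw [unitVec_add_pi, neg_neg]), key _ _ (unitVec_add_pi γ)⟩

theorem reverseSet_subset (hcomp : IsCompact 𝒜) (hzero : (0 : Mat) ∉ 𝒜)
    (hdef : ∀ x, f x = 0 → x = 0) (hdis : Dissipative 𝒜 f 0) : reverseSet 𝒜 ⊆ kernelSet 𝒜 := by
  by_cases h0 : (0 : Mat) ∈ convexHull ℝ 𝒜
  · rw [reverseSet_eq_empty hcomp hzero hdef hdis h0]
    exact Set.empty_subset _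
  · exact reverseSet_subset_kernelSet hcomp hdis h0

theorem exists_mem_Icc_period (γ : ℝ) : ∃ δ ∈ Set.Icc 0 Real.pi,
    (γ ∈ reverseSet 𝒜 ↔ δ ∈ reverseSet 𝒜) ∧ (γ ∈ kernelSet 𝒜 ↔ δ ∈ kernelSet 𝒜) ∧
      (unitVec γ = unitVec δ ∨ unitVec γ = -unitVec δ) := by
  have hper : Function.Periodic (fun γ => (γ ∈ reverseSet 𝒜, γ ∈ kernelSet 𝒜,
      ({unitVec γ, -unitVec γ} : Set Plane))) Real.pi := by
    intro γ
    simp only [add_pi_mem_reverseSet, add_pi_mem_kernelSet, unitVec_add_pi, neg_neg]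
    rw [Set.pair_comm]
  obtain ⟨δ, hδ, h⟩ := hper.exists_mem_Ico₀ Real.pi_pos γ
  simp only [Prod.mk.injEq, eq_iff_iff] at h
  refine ⟨δ, Set.Ico_subset_Icc_self hδ, h.1, h.2.1, ?_⟩
  have : unitVec γ ∈ ({unitVec δ, -unitVec δ} : Set Plane) := by rw [← h.2.2]; simp
  simpa using this

/-- Otherwise the open reverse set equals the closed kernel set and is the whole line. Then the norm
is linear on the whole circle, although it takes equal positive values at opposite points. -/
theorem setD_nonempty_of_reverseSet (hcomp : IsCompact 𝒜) (hzero : (0 : Mat) ∉ 𝒜)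
    (hdef : ∀ x, f x = 0 → x = 0) (hdis : Dissipative 𝒜 f 0) (h : (reverseSet 𝒜).Nonempty) :
    (setD 𝒜).Nonempty := by
  by_contra hD
  rw [Set.not_nonempty_iff_eq_empty] at hD
  have heq : reverseSet 𝒜 = kernelSet 𝒜 := by
    refine (reverseSet_subset hcomp hzero hdef hdis).antisymm fun γ hγ => ?_
    obtain ⟨δ, hδ, h1, h2, -⟩ := exists_mem_Icc_period (𝒜 := 𝒜) γ
    by_contra hγr
    have : δ ∈ setD 𝒜 := ⟨hδ, fun h => hγr (h1.2 h), h2.1 hγ⟩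
    rw [hD] at this
    exact this
  have huniv : reverseSet 𝒜 = Set.univ := by
    refine (isClopen_iff.1 ⟨?_, isOpen_reverseSet 𝒜⟩).resolve_left h.ne_empty
    rw [heq]
    exact isClosed_kernelSet hcomp hzero
  obtain ⟨p, q, hpq⟩ := exists_linear_on hcomp hdis isOpen_univ isPreconnected_univ huniv.ge
  have h1 := seminorm_unitVec_pos hdef 0
  have h2 := seminorm_unitVec_pos hdef Real.pi
  rw [(hpq 0 trivial).1] at h1
  rw [(hpq Real.pi trivial).1] at h2
  simp at h1 h2
  linarith

theorem zero_notMem_reverseSet (hcomp : IsCompact 𝒜) (hzero : (0 : Mat) ∉ 𝒜)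
    (hdef : ∀ x, f x = 0 → x = 0) (hdis : Dissipative 𝒜 f 0)
    (haxis : (0 : ℝ) ∈ setD 𝒜 ∨ setD 𝒜 = ∅) : (0 : ℝ) ∉ reverseSet 𝒜 ∧ Real.pi ∉ reverseSet 𝒜 := by
  have h0 : (0 : ℝ) ∉ reverseSet 𝒜 := fun h => by
    rcases haxis with h' | h'
    · exact h'.2.1 h
    · exact (setD_nonempty_of_reverseSet hcomp hzero hdef hdis ⟨0, h⟩).ne_empty h'
  refine ⟨h0, fun h => h0 ?_⟩
  rwa [← zero_add Real.pi, add_pi_mem_reverseSet] at h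

theorem mem_image_iff_of_linear {A : Mat} (hA : A ≠ 0) {p q : ℝ} (hpq : p ≠ 0 ∨ q ≠ 0)
    (h0 : p * A 0 0 + q * A 1 0 = 0) (h1 : p * A 0 1 + q * A 1 1 = 0) (y : Plane) :
    y ∈ image A ↔ p * y 0 + q * y 1 = 0 := by
  have hlin : ∀ x, p * act A x 0 + q * act A x 1 = 0 := fun x => by
    rw [act_apply, act_apply]; linear_combination x 0 * h0 + x 1 * h1
  rw [mem_image]
  constructor
  · rintro ⟨x, rfl⟩
    exact hlin x
  · intro hy
    obtain ⟨x, hx⟩ := exists_act_ne_zero hA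
    have hcross : (act A x) 0 * y 1 - (act A x) 1 * y 0 = 0 := by
      have hw := hlin x
      rcases hpq with h | h
      · have : p * ((act A x) 0 * y 1 - (act A x) 1 * y 0) = 0 := by
          linear_combination y 1 * hw - (act A x) 1 * hy
        exact (mul_eq_zero.1 this).resolve_left h
      · have : q * ((act A x) 0 * y 1 - (act A x) 1 * y 0) = 0 := by
          linear_combination (act A x) 0 * hy - y 0 * hw
        exact (mul_eq_zero.1 this).resolve_left h
    obtain ⟨c, rfl⟩ := exists_smul_eq_of_cross_eq_zero hx hcross
    exact ⟨c • x, act_smul_right _ _ _⟩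

/-- A maximal reverse interval is spanned by a reverse segment that lies on the unit sphere. -/
theorem setR_linear (hcomp : IsCompact 𝒜) (hzero : (0 : Mat) ∉ 𝒜)
    (hdef : ∀ x, f x = 0 → x = 0) (hdis : Dissipative 𝒜 f 0) {I : ℝ × ℝ} (hI : I ∈ setR 𝒜) :
    I.2 < I.1 + Real.pi ∧ ∃ p q : ℝ, ∀ γ ∈ Set.Icc I.1 I.2,
      f (unitVec γ) = p * Real.cos γ + q * Real.sin γ ∧
      ∃ A ∈ degenerate 𝒜, act A (unitVec γ) = 0 ∧
        p * A 0 0 + q * A 1 0 = 0 ∧ p * A 0 1 + q * A 1 1 = 0 := by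
  obtain ⟨-, -, hlt, hsub, -, -⟩ := hI
  obtain ⟨p, q, hpq⟩ := exists_linear_on hcomp hdis isOpen_Ioo isPreconnected_Ioo hsub
  have hne : (0 : Mat) ∉ convexHull ℝ 𝒜 := fun h0 => by
    rw [reverseSet_eq_empty hcomp hzero hdef hdis h0, Set.subset_empty_iff, Set.Ioo_eq_empty_iff] at hsub
    exact hsub hlt
  have hF : Continuous fun γ => f (unitVec γ) := (continuous_seminorm f).comp continuous_unitVec
  have h1 : ∀ γ ∈ Set.Icc I.1 I.2, f (unitVec γ) = p * Real.cos γ + q * Real.sin γ := by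
    have hcl : IsClosed {γ | f (unitVec γ) = p * Real.cos γ + q * Real.sin γ} :=
      isClosed_eq hF (by fun_prop)
    rw [← closure_Ioo hlt.ne]
    exact hcl.closure_subset_iff.2 fun γ hγ => (hpq γ hγ).1
  have h2 : ∀ γ ∈ Set.Icc I.1 I.2, ∃ A ∈ degenerate 𝒜, act A (unitVec γ) = 0 ∧
        p * A 0 0 + q * A 1 0 = 0 ∧ p * A 0 1 + q * A 1 1 = 0 := by
    have hZ : IsClosed {z : Mat × ℝ | act z.1 (unitVec z.2) = 0 ∧
        p * z.1 0 0 + q * z.1 1 0 = 0 ∧ p * z.1 0 1 + q * z.1 1 1 = 0} := by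
      have e1 : IsClosed {z : Mat × ℝ | act z.1 (unitVec z.2) = 0} := isClosed_eq
        (continuous_act.comp (continuous_fst.prodMk (continuous_unitVec.comp continuous_snd)))
        continuous_const
      have e2 : IsClosed {z : Mat × ℝ | p * z.1 0 0 + q * z.1 1 0 = 0} :=
        isClosed_eq (by fun_prop) continuous_const
      have e3 : IsClosed {z : Mat × ℝ | p * z.1 0 1 + q * z.1 1 1 = 0} :=
        isClosed_eq (by fun_prop) continuous_const
      exact e1.inter (e2.inter e3)
    have hcl := isClosed_exists_mem (isCompact_degenerate hcomp hzero) hZ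
    rw [← closure_Ioo hlt.ne]
    refine hcl.closure_subset_iff.2 fun γ hγ => ?_
    obtain ⟨-, A, hA, hker, h3, h4⟩ := hpq γ hγ
    refine ⟨A, ⟨hA, ?_, det_eq_zero_of_act_eq_zero (unitVec_ne_zero γ) hker, Or.inr hne⟩, hker, h3, h4⟩
    rintro rfl
    exact hne hA
  refine ⟨?_, p, q, fun γ hγ => ⟨h1 γ hγ, h2 γ hγ⟩⟩
  -- Over a length of at least `π`, the linear form would be positive at two opposite points.
  by_contra! hle
  have e1 := seminorm_unitVec_pos hdef I.1
  have e2 := seminorm_unitVec_pos hdef (I.1 + Real.pi)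
  rw [h1 _ ⟨le_rfl, hlt.le⟩] at e1
  rw [h1 _ ⟨by linarith [Real.pi_pos], hle⟩] at e2
  simp at e2
  linarith

/-- By compactness both ends of the interval lie in kernels of degenerate operators whose image is
the level line of the linear form. These two operators form a reverse pair, and the points of the
sphere on the end rays are the ends of a reverse segment. -/
theorem setR_isIncrement (hcomp : IsCompact 𝒜) (hzero : (0 : Mat) ∉ 𝒜)
    (hdef : ∀ x, f x = 0 → x = 0) (hdis : Dissipative 𝒜 f 0) {I : ℝ × ℝ} (hI : I ∈ setR 𝒜) :
    IsIncrement 𝒜 I (increment f I) := by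
  obtain ⟨hpi, p, q, hpq⟩ := setR_linear hcomp hzero hdef hdis hI
  have hlt : I.1 < I.2 := hI.2.2.1
  obtain ⟨hf₁, A₁, hA₁, hk₁, ha₁, hb₁⟩ := hpq I.1 (Set.left_mem_Icc.2 hlt.le)
  obtain ⟨hf₂, A₂, hA₂, hk₂, ha₂, hb₂⟩ := hpq I.2 (Set.right_mem_Icc.2 hlt.le)
  have hF₁ := seminorm_unitVec_pos hdef I.1
  have hF₂ := seminorm_unitVec_pos hdef I.2
  have hpq0 : p ≠ 0 ∨ q ≠ 0 := by
    by_contra! h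
    rw [hf₁, h.1, h.2] at hF₁
    simp at hF₁
  have him₁ := mem_image_iff_of_linear hA₁.2.1 hpq0 ha₁ hb₁
  have him₂ := mem_image_iff_of_linear hA₂.2.1 hpq0 ha₂ hb₂
  refine Or.inl ⟨hI, A₁, A₂, ⟨hA₁, hA₂, trace_neg_of_dissipative hcomp hdef hdis hA₁.1 hA₁.2.1 hA₁.2.2.1,
    trace_neg_of_dissipative hcomp hdef hdis hA₂.1 hA₂.2.1 hA₂.2.2.1,
    Submodule.ext fun y => by rw [him₁, him₂], fun hker => ?_⟩, (f (unitVec I.1))⁻¹,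
    (f (unitVec I.2))⁻¹, inv_pos.2 hF₁, inv_pos.2 hF₂, ⟨?_, ?_, ?_, ?_, ?_⟩, ?_⟩
  · have h2 : act A₁ (unitVec I.2) = 0 := by
      rw [← mem_kernel, hker]; exact mem_kernel.2 hk₂
    refine hA₁.2.1 (eq_zero_of_act_eq_zero ?_ hk₁ h2)
    have : Real.sin (I.2 - I.1) = unitVec I.1 0 * unitVec I.2 1 - unitVec I.1 1 * unitVec I.2 0 := by
      rw [Real.sin_sub]; simp [unitVec]; ring
    rw [← this]
    exact (Real.sin_pos_of_pos_of_lt_pi (by linarith) (by linarith)).ne'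
  · exact smul_ne_zero (inv_pos.2 hF₁).ne' (unitVec_ne_zero _)
  · exact smul_ne_zero (inv_pos.2 hF₂).ne' (unitVec_ne_zero _)
  · exact Submodule.smul_mem _ _ (mem_kernel.2 hk₁)
  · exact Submodule.smul_mem _ _ (mem_kernel.2 hk₂)
  · rw [him₁]
    have e : ∀ γ, p * unitVec γ 0 + q * unitVec γ 1 = p * Real.cos γ + q * Real.sin γ := fun γ => by
      simp [unitVec]
    have e1 := e I.1
    have e2 := e I.2
    rw [← hf₁] at e1
    rw [← hf₂] at e2
    simp only [PiLp.sub_apply, PiLp.smul_apply, smul_eq_mul]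
    have h1 : (f (unitVec I.1))⁻¹ * f (unitVec I.1) = 1 := inv_mul_cancel₀ hF₁.ne'
    have h2 : (f (unitVec I.2))⁻¹ * f (unitVec I.2) = 1 := inv_mul_cancel₀ hF₂.ne'
    linear_combination (f (unitVec I.2))⁻¹ * e2 - (f (unitVec I.1))⁻¹ * e1 + h2 - h1
  · rw [Real.log_div (inv_pos.2 hF₂).ne' (inv_pos.2 hF₁).ne', Real.log_inv, Real.log_inv, increment,
      logRadius_eq hdef, logRadius_eq hdef]

theorem isIncrement_iff (hcomp : IsCompact 𝒜) (hzero : (0 : Mat) ∉ 𝒜)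
    (hdef : ∀ x, f x = 0 → x = 0) (hdis : Dissipative 𝒜 f 0)
    (hsus : Sustained (convexHull ℝ 𝒜) f) {q : ℝ × ℝ} (hq : q ∈ setQ 𝒜) {r : ℝ} :
    IsIncrement 𝒜 q r ↔ r = increment f q := by
  constructor
  · rintro (⟨-, A₁, A₂, hp, r₁, r₂, hr₁, hr₂, hs, rfl⟩ | ⟨hH, ρ, hρ, rfl⟩)
    · have h := hs.seminorm_eq hcomp hdis hp
      have hF₁ := seminorm_unitVec_pos hdef q.1
      have hF₂ := seminorm_unitVec_pos hdef q.2
      rw [map_smul_eq_mul, map_smul_eq_mul, Real.norm_of_nonneg hr₁.le, Real.norm_of_nonneg hr₂.le] at h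
      have h1 := congrArg Real.log h
      rw [Real.log_mul hr₁.ne' hF₁.ne', Real.log_mul hr₂.ne' hF₂.ne'] at h1
      rw [Real.log_div hr₂.ne' hr₁.ne', increment, logRadius_eq hdef, logRadius_eq hdef]
      linarith
    · exact (setH_increment hcomp hzero hdef hdis hsus hH).2 ρ hρ
  · rintro rfl
    rcases hq with hq | hq
    · exact setR_isIncrement hcomp hzero hdef hdis hq
    · obtain ⟨ρ, hρ, h⟩ := (setH_increment hcomp hzero hdef hdis hsus hq).1
      exact Or.inr ⟨hq, ρ, hρ, h⟩

end Reverse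

/-! ### Decomposition of the half-circle -/

theorem exists_isComponent {U : Set ℝ} (hU : IsOpen U) {a b γ : ℝ} (ha : a ∉ U) (hb : b ∉ U)
    (haγ : a ≤ γ) (hγb : γ ≤ b) (hγ : γ ∈ U) :
    ∃ I, IsComponent U I ∧ γ ∈ Set.Ioo I.1 I.2 ∧ a ≤ I.1 ∧ I.2 ≤ b := by
  have hcl := hU.isClosed_compl
  have h1 : sSup (Uᶜ ∩ Set.Iic γ) ∈ Uᶜ ∩ Set.Iic γ :=
    (hcl.inter isClosed_Iic).csSup_mem ⟨a, ha, haγ⟩ ⟨γ, fun x hx => hx.2⟩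
  have h2 : sInf (Uᶜ ∩ Set.Ici γ) ∈ Uᶜ ∩ Set.Ici γ :=
    (hcl.inter isClosed_Ici).csInf_mem ⟨b, hb, hγb⟩ ⟨γ, fun x hx => hx.2⟩
  have hne : ∀ z ∈ Uᶜ, z ≠ γ := fun z hz h => hz (h ▸ hγ)
  have hl : sSup (Uᶜ ∩ Set.Iic γ) < γ := lt_of_le_of_ne h1.2 (hne _ h1.1)
  have hr : γ < sInf (Uᶜ ∩ Set.Ici γ) := lt_of_le_of_ne h2.2 (hne _ h2.1).symm
  refine ⟨(sSup (Uᶜ ∩ Set.Iic γ), sInf (Uᶜ ∩ Set.Ici γ)), ⟨hl.trans hr, fun x hx => ?_, h1.1, h2.1⟩,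
    ⟨hl, hr⟩, le_csSup ⟨γ, fun x hx => hx.2⟩ ⟨ha, haγ⟩, csInf_le ⟨γ, fun x hx => hx.2⟩ ⟨hb, hγb⟩⟩
  by_contra hxU
  rcases le_total x γ with h | h
  · exact hx.1.not_ge (le_csSup ⟨γ, fun x hx => hx.2⟩ ⟨hxU, h⟩)
  · exact hx.2.not_ge (csInf_le ⟨γ, fun x hx => hx.2⟩ ⟨hxU, h⟩)

theorem IsComponent.eq_of_mem {U : Set ℝ} {I J : ℝ × ℝ} (hI : IsComponent U I) (hJ : IsComponent U J)
    {γ : ℝ} (h1 : γ ∈ Set.Ioo I.1 I.2) (h2 : γ ∈ Set.Ioo J.1 J.2) : I = J := by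
  have key : ∀ I J : ℝ × ℝ, IsComponent U I → IsComponent U J → γ ∈ Set.Ioo I.1 I.2 →
      γ ∈ Set.Ioo J.1 J.2 → J.1 ≤ I.1 ∧ I.2 ≤ J.2 := by
    intro I J hI hJ h1 h2
    constructor
    · by_contra! h
      exact hJ.2.2.1 (hI.2.1 ⟨h, h2.1.trans h1.2⟩)
    · by_contra! h
      exact hJ.2.2.2 (hI.2.1 ⟨h1.1.trans h2.2, h⟩)
  obtain ⟨a1, a2⟩ := key I J hI hJ h1 h2
  obtain ⟨b1, b2⟩ := key J I hJ hI h2 h1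
  exact Prod.ext (le_antisymm b1 a1) (le_antisymm a2 b2)

/-- The intervals that make up the complement of `D`. -/
def pieces (𝒜 : Set Mat) : Set (ℝ × ℝ) := setR 𝒜 ∪ gaps 𝒜

/-- The properties of the sets of the decomposition that its integration theory needs. -/
structure GoodFamily (𝒜 : Set Mat) : Prop where
  closed : IsClosed (kernelSet 𝒜)
  reverse_subset : reverseSet 𝒜 ⊆ kernelSet 𝒜
  zero_notMem : (0 : ℝ) ∉ reverseSet 𝒜
  pi_notMem : Real.pi ∉ reverseSet 𝒜

namespace GoodFamily

variable {𝒜 : Set Mat}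

theorem gapSet_eq (h : GoodFamily 𝒜) :
    Set.Ioo 0 Real.pi \ (reverseSet 𝒜 ∪ setD 𝒜) = Set.Ioo 0 Real.pi ∩ (kernelSet 𝒜)ᶜ := by
  ext γ
  constructor
  · rintro ⟨h1, h2⟩
    rw [Set.mem_union, not_or] at h2
    exact ⟨h1, fun h3 => h2.2 ⟨Set.Ioo_subset_Icc_self h1, h2.1, h3⟩⟩
  · rintro ⟨h1, h2⟩
    refine ⟨h1, ?_⟩
    rintro (h3 | h3)
    · exact h2 (h.reverse_subset h3)
    · exact h2 h3.2.2

theorem isOpen_gapSet (h : GoodFamily 𝒜) :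
    IsOpen (Set.Ioo 0 Real.pi \ (reverseSet 𝒜 ∪ setD 𝒜)) := by
  rw [h.gapSet_eq]
  exact isOpen_Ioo.inter h.closed.isOpen_compl

theorem measurableSet_setD (h : GoodFamily 𝒜) : MeasurableSet (setD 𝒜) := by
  have : setD 𝒜 = Set.Icc 0 Real.pi ∩ ((reverseSet 𝒜)ᶜ ∩ kernelSet 𝒜) := rfl
  rw [this]
  exact measurableSet_Icc.inter ((isOpen_reverseSet 𝒜).measurableSet.compl.inter h.closed.measurableSet)

theorem piece_lt {I : ℝ × ℝ} (hI : I ∈ pieces 𝒜) : I.1 < I.2 ∧ 0 ≤ I.1 ∧ I.2 ≤ Real.pi := by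
  rcases hI with hI | hI
  · exact ⟨hI.2.2.1, hI.1, hI.2.1⟩
  · obtain ⟨h1, h2, h3, -⟩ := mem_gaps hI
    exact ⟨h1, h2, h3⟩

theorem biUnion_pieces (h : GoodFamily 𝒜) :
    ⋃ I ∈ pieces 𝒜, Set.Ioo I.1 I.2 = Set.Ioo 0 Real.pi \ setD 𝒜 := by
  ext γ
  simp only [Set.mem_iUnion, exists_prop]
  constructor
  · rintro ⟨I, hI, hγ⟩
    obtain ⟨h1, h2, h3⟩ := piece_lt hI
    refine ⟨⟨h2.trans_lt hγ.1, hγ.2.trans_le h3⟩, fun hD => ?_⟩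
    rcases hI with hI | hI
    · exact hD.2.1 (hI.2.2.2.1 hγ)
    · exact (hI.2.1 hγ).2 (Or.inr hD)
  · rintro ⟨hγ, hD⟩
    by_cases hr : γ ∈ reverseSet 𝒜
    · obtain ⟨I, hI, h1, h2, h3⟩ := exists_isComponent (isOpen_reverseSet 𝒜) h.zero_notMem h.pi_notMem
        hγ.1.le hγ.2.le hr
      exact ⟨I, Or.inl ⟨h2, h3, hI⟩, h1⟩
    · obtain ⟨I, hI, h1, -, -⟩ := exists_isComponent h.isOpen_gapSet (a := 0) (b := Real.pi)
        (fun h => lt_irrefl _ h.1.1) (fun h => lt_irrefl _ h.1.2) hγ.1.le hγ.2.le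
        ⟨hγ, fun h => h.elim hr hD⟩
      exact ⟨I, Or.inr hI, h1⟩

theorem eq_of_mem_pieces {I J : ℝ × ℝ} (hI : I ∈ pieces 𝒜) (hJ : J ∈ pieces 𝒜) {γ : ℝ}
    (h1 : γ ∈ Set.Ioo I.1 I.2) (h2 : γ ∈ Set.Ioo J.1 J.2) : I = J := by
  rcases hI with hI | hI <;> rcases hJ with hJ | hJ
  · exact hI.2.2.eq_of_mem hJ.2.2 h1 h2
  · exact absurd (Or.inl (hI.2.2.2.1 h1)) (hJ.2.1 h2).2
  · exact absurd (Or.inl (hJ.2.2.2.1 h2)) (hI.2.1 h1).2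
  · exact hI.eq_of_mem hJ h1 h2

theorem pairwiseDisjoint : (pieces 𝒜).PairwiseDisjoint fun I => Set.Ioo I.1 I.2 :=
  fun _ hI _ hJ hne => Set.disjoint_left.2 fun _ h1 h2 => hne (eq_of_mem_pieces hI hJ h1 h2)

theorem countable_pieces : (pieces 𝒜).Countable :=
  pairwiseDisjoint.countable_of_isOpen (fun _ _ => isOpen_Ioo)
    fun _ hI => Set.nonempty_Ioo.2 (piece_lt hI).1

theorem endpoint_notMem {I J : ℝ × ℝ} (hI : I ∈ pieces 𝒜) (hJ : J ∈ pieces 𝒜)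
    {γ : ℝ} (hγ : γ = I.1 ∨ γ = I.2) : γ ∉ Set.Ioo J.1 J.2 := by
  intro hmem
  obtain ⟨hlt, -, -⟩ := piece_lt hI
  have hcl : γ ∈ closure (Set.Ioo I.1 I.2) := by
    rw [closure_Ioo hlt.ne]
    rcases hγ with rfl | rfl
    · exact Set.left_mem_Icc.2 hlt.le
    · exact Set.right_mem_Icc.2 hlt.le
  obtain ⟨x, hx1, hx2⟩ := mem_closure_iff.1 hcl _ isOpen_Ioo hmem
  obtain rfl := eq_of_mem_pieces hI hJ hx2 hx1
  rcases hγ with rfl | rfl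
  · exact lt_irrefl _ hmem.1
  · exact lt_irrefl _ hmem.2

/-- The points of `[0, π]` outside of all intervals of the decomposition. -/
def nodes (𝒜 : Set Mat) : Set ℝ := {γ | γ ∈ Set.Icc 0 Real.pi ∧ ∀ I ∈ pieces 𝒜, γ ∉ Set.Ioo I.1 I.2}

theorem mem_nodes_of_mem_setD (h : GoodFamily 𝒜) {γ : ℝ} (hγ : γ ∈ setD 𝒜) : γ ∈ nodes 𝒜 := by
  refine ⟨hγ.1, fun I hI hmem => ?_⟩
  have : γ ∈ ⋃ I ∈ pieces 𝒜, Set.Ioo I.1 I.2 := Set.mem_biUnion hI hmem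
  rw [h.biUnion_pieces] at this
  exact this.2 hγ

theorem mem_nodes_of_endpoint {I : ℝ × ℝ} (hI : I ∈ pieces 𝒜) {γ : ℝ}
    (hγ : γ = I.1 ∨ γ = I.2) : γ ∈ nodes 𝒜 := by
  obtain ⟨h1, h2, h3⟩ := piece_lt hI
  refine ⟨?_, fun J hJ => endpoint_notMem hI hJ hγ⟩
  rcases hγ with rfl | rfl
  · exact ⟨h2, h1.le.trans h3⟩
  · exact ⟨h2.trans h1.le, h3⟩

theorem pi_mem_nodes : Real.pi ∈ nodes 𝒜 :=
  ⟨⟨Real.pi_pos.le, le_rfl⟩, fun _ hI h => (piece_lt hI).2.2.not_gt h.2⟩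

/-- No interval of the decomposition contains a node. So up to a null set `[0, γ]` is the disjoint
union of its part of `D` and of the intervals that end before or at `γ`. -/
theorem hasSum_pieces (h : GoodFamily 𝒜) {u : ℝ → ℝ} (hu : IntegrableOn u (Set.Icc 0 Real.pi)) {γ : ℝ}
    (hγ : γ ∈ nodes 𝒜) :
    HasSum (fun I : {I : ℝ × ℝ // I ∈ pieces 𝒜 ∧ I.2 ≤ γ} => ∫ τ in Set.Ioo I.1.1 I.1.2, u τ)
      ((∫ τ in Set.Icc 0 γ, u τ) - ∫ τ in Set.Icc 0 γ ∩ setD 𝒜, u τ) := by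
  have hcount : Countable {I : ℝ × ℝ // I ∈ pieces 𝒜 ∧ I.2 ≤ γ} :=
    ((countable_pieces (𝒜 := 𝒜)).mono (fun I (hI : I ∈ {I | I ∈ pieces 𝒜 ∧ I.2 ≤ γ}) => hI.1)).to_subtype
  set V : Set ℝ := ⋃ I : {I : ℝ × ℝ // I ∈ pieces 𝒜 ∧ I.2 ≤ γ}, Set.Ioo I.1.1 I.1.2 with hV
  have hsubI : V ⊆ Set.Icc 0 γ := by
    refine Set.iUnion_subset fun I => fun x hx => ?_
    exact ⟨(piece_lt I.2.1).2.1.trans hx.1.le, hx.2.le.trans I.2.2⟩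
  have hsub : Set.Icc 0 γ ⊆ Set.Icc 0 Real.pi := Set.Icc_subset_Icc_right hγ.1.2
  have hVm : MeasurableSet V := MeasurableSet.iUnion fun _ => measurableSet_Ioo
  have hdisj : Disjoint (Set.Icc 0 γ ∩ setD 𝒜) V := by
    refine Set.disjoint_left.2 fun x hx hxV => ?_
    obtain ⟨I, hI⟩ := Set.mem_iUnion.1 hxV
    have : x ∈ ⋃ I ∈ pieces 𝒜, Set.Ioo I.1 I.2 := Set.mem_biUnion I.2.1 hI
    rw [h.biUnion_pieces] at this
    exact this.2 hx.2
  have hcover : Set.Icc 0 γ =ᵐ[volume] ((Set.Icc 0 γ ∩ setD 𝒜) ∪ V : Set ℝ) := by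
    have hnull : ∀ᵐ x : ℝ, x ≠ 0 ∧ x ≠ γ := by
      filter_upwards [Measure.ae_ne volume (0 : ℝ), Measure.ae_ne volume γ] with x h1 h2
      exact ⟨h1, h2⟩
    filter_upwards [hnull] with x hx
    refine propext ⟨fun hx' => ?_, ?_⟩
    · by_cases hD : x ∈ setD 𝒜
      · exact Or.inl ⟨hx', hD⟩
      · right
        have hx0 : 0 < x := lt_of_le_of_ne hx'.1 (Ne.symm hx.1)
        have hxγ : x < γ := lt_of_le_of_ne hx'.2 hx.2
        have : x ∈ ⋃ I ∈ pieces 𝒜, Set.Ioo I.1 I.2 := by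
          rw [h.biUnion_pieces]
          exact ⟨⟨hx0, hxγ.trans_le hγ.1.2⟩, hD⟩
        simp only [Set.mem_iUnion, exists_prop] at this
        obtain ⟨I, hI, hxI⟩ := this
        have hle : I.2 ≤ γ := by
          by_contra! hlt
          exact hγ.2 I hI ⟨hxI.1.trans hxγ, hlt⟩
        exact Set.mem_iUnion.2 ⟨⟨I, hI, hle⟩, hxI⟩
    · rintro (hx' | hx')
      · exact hx'.1
      · exact hsubI hx'
  have hsum := hasSum_integral_iUnion (μ := volume) (f := u)
    (s := fun I : {I : ℝ × ℝ // I ∈ pieces 𝒜 ∧ I.2 ≤ γ} => Set.Ioo I.1.1 I.1.2)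
    (fun _ => measurableSet_Ioo)
    (fun I J hne => Set.disjoint_left.2 fun x h1 h2 =>
      hne (Subtype.ext (eq_of_mem_pieces I.2.1 J.2.1 h1 h2)))
    (hu.mono_set (hsubI.trans hsub))
  convert! hsum using 1
  rw [setIntegral_congr_set hcover, setIntegral_union hdisj hVm
    (hu.mono_set (Set.inter_subset_left.trans hsub)) (hu.mono_set (hsubI.trans hsub))]
  ring

end GoodFamily

theorem goodFamily {𝒜 : Set Mat} {f : Seminorm ℝ Plane} (hcomp : IsCompact 𝒜) (hzero : (0 : Mat) ∉ 𝒜)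
    (hdef : ∀ x, f x = 0 → x = 0) (hdis : Dissipative 𝒜 f 0)
    (haxis : (0 : ℝ) ∈ setD 𝒜 ∨ setD 𝒜 = ∅) : GoodFamily 𝒜 where
  closed := isClosed_kernelSet hcomp hzero
  reverse_subset := reverseSet_subset hcomp hzero hdef hdis
  zero_notMem := (zero_notMem_reverseSet hcomp hzero hdef hdis haxis).1
  pi_notMem := (zero_notMem_reverseSet hcomp hzero hdef hdis haxis).2

/-! ### The formula for the logarithm of the radius -/

/-- The standing assumptions on the system and on an invariant norm `f`. -/
structure Setting (𝒜 : Set Mat) (f : Seminorm ℝ Plane) : Prop where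
  comp : IsCompact 𝒜
  zero : (0 : Mat) ∉ 𝒜
  definite : ∀ x, f x = 0 → x = 0
  dissipative : Dissipative 𝒜 f 0
  sustained : Sustained (convexHull ℝ 𝒜) f
  axis : (0 : ℝ) ∈ setD 𝒜 ∨ setD 𝒜 = ∅

/-- The difference quotient of the sphere point, divided by the position as a complex number, tends
to `cot φ + i`, whose argument is `φ`. -/
theorem isTangentAngle_of_hasDerivAt {f : Seminorm ℝ Plane} (hdef : ∀ x, f x = 0 → x = 0) {γ φ : ℝ}
    (hφ : φ ∈ Set.Ioo 0 Real.pi) (h : HasDerivAt (logRadius f) (Real.cot φ) γ) :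
    IsTangentAngle f γ φ := by
  have hpt : ∀ τ, spherePoint f τ = Real.exp (logRadius f τ) • unitVec τ := fun τ => by
    rw [spherePoint, seminorm_unitVec_eq hdef, ← Real.exp_neg, neg_neg]
  have hsin := Real.sin_pos_of_pos_of_lt_pi hφ.1 hφ.2
  set r := Real.exp (logRadius f γ) with hr
  have hr0 : 0 < r := Real.exp_pos _
  have hder : HasDerivAt (spherePoint f) ((r * Real.cot φ) • unitVec γ + r • normalVec γ) γ := by
    have := hasDerivAt_smul_unitVec h.exp
    refine this.congr_of_eventuallyEq (Eventually.of_forall hpt)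
  have hslope := hder.tendsto_slope_zero_right
  have hz : ∀ y : Plane, (⟨y 0, y 1⟩ : ℂ) = (y 0 : ℂ) + (y 1 : ℂ) * Complex.I := fun y =>
    Complex.mk_eq_add_mul_I _ _
  have hcont : Continuous fun y : Plane => (⟨y 0, y 1⟩ : ℂ) := by
    simp only [hz]; fun_prop
  have hx0 : (⟨(spherePoint f γ) 0, (spherePoint f γ) 1⟩ : ℂ) ≠ 0 := by
    intro h0
    have h1 : spherePoint f γ = 0 := plane_ext (congrArg Complex.re h0) (congrArg Complex.im h0)
    rw [hpt] at h1
    exact smul_ne_zero hr0.ne' (unitVec_ne_zero γ) h1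
  have hlim : Tendsto (fun δ : ℝ => (⟨(δ⁻¹ • (spherePoint f (γ + δ) - spherePoint f γ)) 0,
      (δ⁻¹ • (spherePoint f (γ + δ) - spherePoint f γ)) 1⟩ : ℂ) /
        (⟨(spherePoint f γ) 0, (spherePoint f γ) 1⟩ : ℂ)) (𝓝[>] 0) (𝓝 ⟨Real.cot φ, 1⟩) := by
    have h1 := ((hcont.tendsto _).comp hslope).div_const
      (⟨(spherePoint f γ) 0, (spherePoint f γ) 1⟩ : ℂ)
    convert! h1 using 2
    rw [eq_div_iff hx0, hpt]
    apply Complex.ext <;> simp [unitVec, normalVec, ← hr] <;> ring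
  have harg : Complex.arg ⟨Real.cot φ, 1⟩ = φ := by
    have : (⟨Real.cot φ, 1⟩ : ℂ) = ((1 / Real.sin φ : ℝ) : ℂ) * (Real.cos φ + Real.sin φ * Complex.I) := by
      rw [Real.cot_eq_cos_div_sin]
      apply Complex.ext
      · simp [-Complex.ofReal_cos, -Complex.ofReal_sin, -Complex.ofReal_inv]; field_simp
      · simp [-Complex.ofReal_cos, -Complex.ofReal_sin, -Complex.ofReal_inv]; field_simp
    rw [this, Complex.arg_real_mul _ (by positivity), Complex.ofReal_cos, Complex.ofReal_sin]
    exact Complex.arg_cos_add_sin_mul_I ⟨by linarith [hφ.1, Real.pi_pos], hφ.2.le⟩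
  have hargc : ContinuousAt Complex.arg ⟨Real.cot φ, 1⟩ :=
    Complex.continuousAt_arg (Or.inr (by simp))
  have hfin := hargc.tendsto.comp hlim
  rw [harg] at hfin
  refine hfin.congr' ?_
  filter_upwards [self_mem_nhdsWithin] with δ hδ
  have hδ0 : (0 : ℝ) < δ⁻¹ := inv_pos.2 hδ
  simp only [Function.comp, orientedAngle]
  rw [← Complex.arg_real_mul ((⟨(spherePoint f (γ + δ) - spherePoint f γ) 0,
    (spherePoint f (γ + δ) - spherePoint f γ) 1⟩ : ℂ) /
        (⟨(spherePoint f γ) 0, (spherePoint f γ) 1⟩ : ℂ)) hδ0, ← mul_div_assoc]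
  congr 2
  apply Complex.ext <;> simp

namespace Setting

variable {𝒜 : Set Mat} {f : Seminorm ℝ Plane}

theorem goodFamily (S : Setting 𝒜 f) : GoodFamily 𝒜 :=
  PlanarSwitching.goodFamily S.comp S.zero S.definite S.dissipative S.axis

theorem gaps_eq (S : Setting 𝒜 f) : gaps 𝒜 = setP 𝒜 ∪ setH 𝒜 :=
  PlanarSwitching.gaps_eq S.comp S.zero S.definite S.dissipative S.sustained

theorem pieces_eq (S : Setting 𝒜 f) : pieces 𝒜 = setQ 𝒜 ∪ setP 𝒜 := by
  rw [pieces, S.gaps_eq, setQ, Set.union_assoc, Set.union_comm (setP 𝒜)]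

theorem disjoint_setQ_setP : Disjoint (setQ 𝒜) (setP 𝒜) := by
  refine Set.disjoint_union_left.2 ⟨?_, disjoint_setP_setH.symm⟩
  exact disjoint_setR_gaps.mono_right fun _ h => h.1

theorem absolutelyContinuous (S : Setting 𝒜 f) (a b : ℝ) :
    AbsolutelyContinuousOnInterval (logRadius f) a b := by
  obtain ⟨L, hL⟩ := exists_lipschitz_logRadius S.definite
  exact (hL.lipschitzOnWith (s := Set.uIcc a b)).absolutelyContinuousOnInterval

theorem integral_deriv (S : Setting 𝒜 f) {a b : ℝ} (hab : a ≤ b) :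
    ∫ τ in Set.Ioo a b, deriv (logRadius f) τ = logRadius f b - logRadius f a := by
  rw [← integral_Ioc_eq_integral_Ioo, ← intervalIntegral.integral_of_le hab]
  exact (S.absolutelyContinuous a b).integral_deriv_eq_sub

theorem integrableOn_deriv (S : Setting 𝒜 f) (a b : ℝ) :
    IntegrableOn (deriv (logRadius f)) (Set.Icc a b) := by
  rcases le_or_gt a b with hab | hab
  · rw [integrableOn_Icc_iff_integrableOn_Ioc, ← intervalIntegrable_iff_integrableOn_Ioc_of_le hab]
    exact (S.absolutelyContinuous a b).intervalIntegrable_deriv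
  · rw [Set.Icc_eq_empty_of_lt hab]
    exact integrableOn_empty

theorem ae_hasDerivAt (S : Setting 𝒜 f) :
    ∀ᵐ τ, HasDerivAt (logRadius f) (deriv (logRadius f) τ) τ := by
  obtain ⟨L, hL⟩ := exists_lipschitz_logRadius S.definite
  filter_upwards [hL.ae_differentiableAt_real] with τ hτ using hτ.hasDerivAt

/-- The Lipschitz function `g` is differentiable almost everywhere, and there the derivative is the
only support slope; `cot φ` is one, whatever admissible angle `φ` is chosen. -/
theorem ae_hasDerivAt_cot (S : Setting 𝒜 f) {φ : ℝ → ℝ} (hφ : ∀ τ ∈ setD 𝒜, IsKernelAngle 𝒜 τ (φ τ)) :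
    ∀ᵐ τ ∂(volume.restrict (setD 𝒜)), HasDerivAt (logRadius f) (Real.cot (φ τ)) τ := by
  rw [ae_restrict_iff' S.goodFamily.measurableSet_setD]
  filter_upwards [S.ae_hasDerivAt] with τ hd hτ
  rwa [(isSupportSlope_cot S.comp S.definite S.dissipative (hφ τ hτ)).eq_of_hasDerivAt S.definite hd]

theorem integrableOn_cot (S : Setting 𝒜 f) {φ : ℝ → ℝ} (hφ : ∀ τ ∈ setD 𝒜, IsKernelAngle 𝒜 τ (φ τ)) :
    IntegrableOn (fun τ => Real.cot (φ τ)) (setD 𝒜) := by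
  have h1 : IntegrableOn (deriv (logRadius f)) (setD 𝒜) :=
    (S.integrableOn_deriv 0 Real.pi).mono_set fun τ hτ => hτ.1
  refine h1.congr ?_
  filter_upwards [S.ae_hasDerivAt_cot hφ] with τ hτ using hτ.deriv

/-- Fundamental theorem of calculus for the log-radius, split over `D` and the complementary
intervals. -/
theorem hasSum_increment (S : Setting 𝒜 f) {φ : ℝ → ℝ}
    (hφ : ∀ τ ∈ setD 𝒜, IsKernelAngle 𝒜 τ (φ τ)) {γ : ℝ} (hγ : γ ∈ GoodFamily.nodes 𝒜) :
    HasSum (fun I : {I : ℝ × ℝ // I ∈ pieces 𝒜 ∧ I.2 ≤ γ} => increment f I)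
      (logRadius f γ - logRadius f 0 - ∫ τ in Set.Icc 0 γ ∩ setD 𝒜, Real.cot (φ τ)) := by
  have h := S.goodFamily.hasSum_pieces (S.integrableOn_deriv 0 Real.pi) hγ
  have e1 : ∫ τ in Set.Icc 0 γ, deriv (logRadius f) τ = logRadius f γ - logRadius f 0 := by
    rw [integral_Icc_eq_integral_Ioc, integral_Ioc_eq_integral_Ioo, S.integral_deriv hγ.1.1]
  have e2 : ∫ τ in Set.Icc 0 γ ∩ setD 𝒜, deriv (logRadius f) τ =
      ∫ τ in Set.Icc 0 γ ∩ setD 𝒜, Real.cot (φ τ) := by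
    refine integral_congr_ae ?_
    filter_upwards [ae_restrict_of_ae_restrict_of_subset Set.inter_subset_right
      (S.ae_hasDerivAt_cot hφ)] with τ hτ using hτ.deriv
  rw [e1, e2] at h
  convert! h using 2 with I
  exact (S.integral_deriv (GoodFamily.piece_lt I.2.1).1.le).symm

theorem summable_increment (S : Setting 𝒜 f) {s : Set (ℝ × ℝ)} (hs : s ⊆ pieces 𝒜) :
    Summable fun I : s => increment f I := by
  have hπ := S.goodFamily.hasSum_pieces (S.integrableOn_deriv 0 Real.pi) GoodFamily.pi_mem_nodes
  have h2 : Summable fun I : {I : ℝ × ℝ // I ∈ pieces 𝒜 ∧ I.2 ≤ Real.pi} => increment f I := by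
    convert! hπ.summable using 2 with I
    exact (S.integral_deriv (GoodFamily.piece_lt I.2.1).1.le).symm
  exact h2.comp_injective (i := fun I : s =>
    (⟨I.1, hs I.2, (GoodFamily.piece_lt (hs I.2)).2.2⟩ : {I : ℝ × ℝ // I ∈ pieces 𝒜 ∧ I.2 ≤ Real.pi}))
    fun I J h => Subtype.ext (congrArg (fun x => x.1) h)

theorem logRadius_formula (S : Setting 𝒜 f) {φ : ℝ → ℝ}
    (hφ : ∀ τ ∈ setD 𝒜, IsKernelAngle 𝒜 τ (φ τ)) {γ : ℝ} (hγ : γ ∈ GoodFamily.nodes 𝒜) :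
    logRadius f γ = logRadius f 0 + (∫ τ in Set.Icc 0 γ ∩ setD 𝒜, Real.cot (φ τ)) +
      (∑' q : {q : ℝ × ℝ // q ∈ setQ 𝒜 ∧ q.2 ≤ γ}, increment f q) +
      ∑' p : {p : ℝ × ℝ // p ∈ setP 𝒜 ∧ p.2 ≤ γ}, increment f p := by
  have h := (S.hasSum_increment hφ hγ).tsum_eq
  have hQ : setQ 𝒜 ⊆ pieces 𝒜 := by rw [S.pieces_eq]; exact Set.subset_union_left
  have hP : setP 𝒜 ⊆ pieces 𝒜 := by rw [S.pieces_eq]; exact Set.subset_union_right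
  have hsplit : ∑' I : {I : ℝ × ℝ // I ∈ pieces 𝒜 ∧ I.2 ≤ γ}, increment f I =
      (∑' q : {q : ℝ × ℝ // q ∈ setQ 𝒜 ∧ q.2 ≤ γ}, increment f q) +
      ∑' p : {p : ℝ × ℝ // p ∈ setP 𝒜 ∧ p.2 ≤ γ}, increment f p := by
    have hset : {I : ℝ × ℝ | I ∈ pieces 𝒜 ∧ I.2 ≤ γ} =
        {q | q ∈ setQ 𝒜 ∧ q.2 ≤ γ} ∪ {p | p ∈ setP 𝒜 ∧ p.2 ≤ γ} := by
      ext I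
      simp only [S.pieces_eq, Set.mem_union, Set.mem_ofPred_eq]
      tauto
    have hdis : Disjoint {q : ℝ × ℝ | q ∈ setQ 𝒜 ∧ q.2 ≤ γ} {p | p ∈ setP 𝒜 ∧ p.2 ≤ γ} :=
      Set.disjoint_left.2 fun I h1 h2 => Set.disjoint_left.1 disjoint_setQ_setP h1.1 h2.1
    have h1 := Summable.tsum_union_disjoint (f := increment f) hdis
      (S.summable_increment fun I hI => hQ hI.1) (S.summable_increment fun I hI => hP hI.1)
    rw [← hset] at h1
    exact h1
  linarith

end Setting

/-! ### Uniqueness -/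

/-- Up to `t₁` the function is both nonincreasing and nondecreasing, hence constant. From there it
can only increase, and it ends at its initial value. -/
theorem eq_of_monotone_of_antitone {h : ℝ → ℝ} {α β t₁ t₂ : ℝ} (h1 : AntitoneOn h (Set.Icc α t₁))
    (h2 : MonotoneOn h (Set.Icc t₁ β)) (h3 : MonotoneOn h (Set.Icc α t₂)) (ht₁ : t₁ ∈ Set.Icc α β)
    (ht : t₁ ≤ t₂) (hαβ : h α = h β) {γ : ℝ} (hγ : γ ∈ Set.Icc α β) : h γ = h α := by
  have key : ∀ γ ∈ Set.Icc α t₁, h γ = h α := fun γ hγ =>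
    le_antisymm (h1 (Set.left_mem_Icc.2 ht₁.1) hγ hγ.1)
      (h3 (Set.left_mem_Icc.2 (ht₁.1.trans ht)) ⟨hγ.1, hγ.2.trans ht⟩ hγ.1)
  rcases le_total γ t₁ with hle | hle
  · exact key γ ⟨hγ.1, hle⟩
  · refine le_antisymm ?_ ?_
    · rw [hαβ]; exact h2 ⟨hle, hγ.2⟩ (Set.right_mem_Icc.2 ht₁.2) hγ.2
    · rw [← key t₁ (Set.right_mem_Icc.2 ht₁.1)]
      exact h2 (Set.left_mem_Icc.2 ht₁.2) ⟨hle, hγ.2⟩ hle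

/-- Over the interval `I`, the curve consists of a right and a left leading trajectory that start from
a common source. -/
def IsGapArc (𝒜 : Set Mat) (I : ℝ × ℝ) (k : ℝ → ℝ) : Prop :=
  ∃ t ∈ Set.Icc I.1 I.2, TopArc 𝒜 radial' angular' (-t) (-I.1) (fun γ => k (-γ)) ∧
    TopArc 𝒜 radial angular t I.2 k

namespace Setting

variable {𝒜 : Set Mat} {f f₁ f₂ : Seminorm ℝ Plane}

theorem feasible (S : Setting 𝒜 f) {I : ℝ × ℝ} (hI : I ∈ gaps 𝒜) :
    ∀ γ ∈ Set.Ioo I.1 I.2, IsFeasibleAt 𝒜 radial angular γ := fun γ hγ =>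
  isFeasibleAt_of_notMem_kernelSet S.zero S.definite S.dissipative ((mem_gaps hI).2.2.2 γ hγ).1

theorem isGapArc (S : Setting 𝒜 f) {I : ℝ × ℝ} (hI : I ∈ gaps 𝒜) : IsGapArc 𝒜 I (logRadius f) := by
  obtain ⟨hlt, -, -, hker⟩ := mem_gaps hI
  exact exists_topArcs S.comp S.zero S.definite S.dissipative S.sustained hlt fun γ hγ => (hker γ hγ).1

/-- A semiconcave function with admissible superdifferentials differs from the leading trajectories
over an interval without kernels by a function that decreases, and then increases. -/
theorem exists_monotoneOn_sub (S : Setting 𝒜 f) {h : ℝ → ℝ} (hcont : Continuous h)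
    (hh : SemiconcaveAdmissible 𝒜 radial angular h) {I : ℝ × ℝ} (hI : I ∈ gaps 𝒜) {k : ℝ → ℝ}
    (hk : IsGapArc 𝒜 I k) : ∃ t ∈ Set.Icc I.1 I.2,
      AntitoneOn (fun γ => h γ - k γ) (Set.Icc I.1 t) ∧
      MonotoneOn (fun γ => h γ - k γ) (Set.Icc t I.2) := by
  obtain ⟨t, ht, h1, h2⟩ := hk
  refine ⟨t, ht, ?_, ?_⟩
  · have := hh.reflect.monotoneOn_sub
      S.comp continuous_radial' continuous_angular'
      (hcont.comp continuous_neg) (fun γ hγ => by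
        have := isFeasibleAt_reflect (S.feasible hI (-γ) ⟨by linarith [hγ.2], by linarith [hγ.1, ht.2]⟩)
        rwa [neg_neg] at this) h1
    intro x hx y hy hxy
    have := this (a := -y) (b := -x) ⟨by linarith [hy.2], by linarith [hy.1]⟩
      ⟨by linarith [hx.2], by linarith [hx.1]⟩ (by linarith)
    simpa using this
  · exact hh.monotoneOn_sub S.comp
      continuous_radial continuous_angular hcont (fun γ hγ =>
        S.feasible hI γ (Set.Ioo_subset_Ioo_left ht.1 hγ)) h2

/-- Each log-radius is an admissible semiconcave function compared with the leading trajectories of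
the other. So the difference and its negative both decrease up to a source and increase afterwards.
-/
theorem sub_eq_of_mem_gaps (S₁ : Setting 𝒜 f₁) (S₂ : Setting 𝒜 f₂) {I : ℝ × ℝ} (hI : I ∈ gaps 𝒜)
    (h : logRadius f₂ I.1 - logRadius f₁ I.1 = logRadius f₂ I.2 - logRadius f₁ I.2) {γ : ℝ}
    (hγ : γ ∈ Set.Icc I.1 I.2) :
    logRadius f₂ γ - logRadius f₁ γ = logRadius f₂ I.1 - logRadius f₁ I.1 := by
  obtain ⟨t₁, ht₁, a1, b1⟩ := S₁.exists_monotoneOn_sub (continuous_logRadius S₂.definite)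
    (semiconcaveAdmissible_logRadius S₂.definite S₂.dissipative) hI (S₁.isGapArc hI)
  obtain ⟨t₂, ht₂, a2, b2⟩ := S₂.exists_monotoneOn_sub (continuous_logRadius S₁.definite)
    (semiconcaveAdmissible_logRadius S₁.definite S₁.dissipative) hI (S₂.isGapArc hI)
  rcases le_total t₁ t₂ with hle | hle
  · refine eq_of_monotone_of_antitone (h := fun γ => logRadius f₂ γ - logRadius f₁ γ) a1 b1 ?_ ht₁ hle
      h hγ
    intro x hx y hy hxy
    have := a2 hx hy hxy
    simp only at *
    linarith
  · have := eq_of_monotone_of_antitone (h := fun γ => logRadius f₁ γ - logRadius f₂ γ) a2 b2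
      (fun x hx y hy hxy => by
        have := a1 hx hy hxy
        simp only at *
        linarith) ht₂ hle (by linarith) hγ
    linarith

theorem sub_eq_of_mem_nodes (S₁ : Setting 𝒜 f₁) (S₂ : Setting 𝒜 f₂)
    (h : ∀ p ∈ setP 𝒜, increment f₁ p = increment f₂ p) {γ : ℝ} (hγ : γ ∈ GoodFamily.nodes 𝒜) :
    logRadius f₂ γ - logRadius f₁ γ = logRadius f₂ 0 - logRadius f₁ 0 := by
  have hφ : ∀ τ ∈ setD 𝒜, ∃ θ, IsKernelAngle 𝒜 τ θ := fun τ hτ => by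
    obtain ⟨A, hA, hk⟩ := hτ.2.2
    exact exists_isKernelAngle S₁.comp S₁.definite S₁.dissipative hA hk
  choose! φ hφ using hφ
  rw [S₁.logRadius_formula hφ hγ, S₂.logRadius_formula hφ hγ]
  have hQ : ∀ q ∈ setQ 𝒜, increment f₁ q = increment f₂ q := fun q hq =>
    (isIncrement_iff S₂.comp S₂.zero S₂.definite S₂.dissipative S₂.sustained hq).1
      ((isIncrement_iff S₁.comp S₁.zero S₁.definite S₁.dissipative S₁.sustained hq).2 rfl)
  have e1 : (∑' q : {q : ℝ × ℝ // q ∈ setQ 𝒜 ∧ q.2 ≤ γ}, increment f₁ q) =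
      ∑' q : {q : ℝ × ℝ // q ∈ setQ 𝒜 ∧ q.2 ≤ γ}, increment f₂ q :=
    tsum_congr fun q => hQ q q.2.1
  have e2 : (∑' p : {p : ℝ × ℝ // p ∈ setP 𝒜 ∧ p.2 ≤ γ}, increment f₁ p) =
      ∑' p : {p : ℝ × ℝ // p ∈ setP 𝒜 ∧ p.2 ≤ γ}, increment f₂ p :=
    tsum_congr fun p => h p p.2.1
  rw [e1, e2]
  ring

theorem seminorm_unitVec_eq_mul (S₁ : Setting 𝒜 f₁) (S₂ : Setting 𝒜 f₂) {γ c : ℝ} :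
    f₂ (unitVec γ) = Real.exp c * f₁ (unitVec γ) ↔ logRadius f₂ γ - logRadius f₁ γ = -c := by
  rw [seminorm_unitVec_eq S₁.definite, seminorm_unitVec_eq S₂.definite, ← Real.exp_add,
    Real.exp_eq_exp]
  constructor <;> intro h <;> linarith

/-- The formula fixes the ratio at the nodes. A reverse interval is shorter than `π`, so its linear
form is determined by its two ends; over gaps `sub_eq_of_mem_gaps` applies. -/
theorem eq_mul_of_increment_eq (S₁ : Setting 𝒜 f₁) (S₂ : Setting 𝒜 f₂)
    (h : ∀ p ∈ setP 𝒜, increment f₁ p = increment f₂ p) : ∃ c : ℝ, 0 < c ∧ ∀ x, f₂ x = c * f₁ x := by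
  set e := -(logRadius f₂ 0 - logRadius f₁ 0) with he
  have hnodes : ∀ γ ∈ GoodFamily.nodes 𝒜, f₂ (unitVec γ) = Real.exp e * f₁ (unitVec γ) :=
    fun γ hγ => (S₁.seminorm_unitVec_eq_mul S₂).2
      (by rw [S₁.sub_eq_of_mem_nodes S₂ h hγ, he, neg_neg])
  have hcirc : ∀ γ ∈ Set.Icc 0 Real.pi, f₂ (unitVec γ) = Real.exp e * f₁ (unitVec γ) := by
    intro γ hγ
    by_cases hn : γ ∈ GoodFamily.nodes 𝒜
    · exact hnodes γ hn
    · have : ∃ I ∈ pieces 𝒜, γ ∈ Set.Ioo I.1 I.2 := by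
        by_contra! h'
        exact hn ⟨hγ, h'⟩
      obtain ⟨I, hI, hγI⟩ := this
      have h1 := hnodes I.1 (GoodFamily.mem_nodes_of_endpoint hI (Or.inl rfl))
      have h2 := hnodes I.2 (GoodFamily.mem_nodes_of_endpoint hI (Or.inr rfl))
      have hlt := (GoodFamily.piece_lt hI).1
      rcases hI with hI | hI
      · obtain ⟨hpi, p₁, q₁, hl₁⟩ := setR_linear S₁.comp S₁.zero S₁.definite S₁.dissipative hI
        obtain ⟨-, p₂, q₂, hl₂⟩ := setR_linear S₂.comp S₂.zero S₂.definite S₂.dissipative hI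
        rw [(hl₁ _ (Set.left_mem_Icc.2 hlt.le)).1, (hl₂ _ (Set.left_mem_Icc.2 hlt.le)).1] at h1
        rw [(hl₁ _ (Set.right_mem_Icc.2 hlt.le)).1, (hl₂ _ (Set.right_mem_Icc.2 hlt.le)).1] at h2
        rw [(hl₁ γ (Set.Ioo_subset_Icc_self hγI)).1, (hl₂ γ (Set.Ioo_subset_Icc_self hγI)).1]
        have hs : Real.sin (I.2 - I.1) ≠ 0 :=
          (Real.sin_pos_of_pos_of_lt_pi (by linarith) (by linarith)).ne'
        rw [Real.sin_sub] at hs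
        have hp : p₂ - Real.exp e * p₁ = 0 := by
          refine (mul_eq_zero.1 ?_).resolve_right hs
          linear_combination Real.sin I.2 * h1 - Real.sin I.1 * h2
        have hq : q₂ - Real.exp e * q₁ = 0 := by
          refine (mul_eq_zero.1 ?_).resolve_right hs
          linear_combination Real.cos I.1 * h2 - Real.cos I.2 * h1
        linear_combination Real.cos γ * hp + Real.sin γ * hq
      · rw [S₁.seminorm_unitVec_eq_mul S₂] at h1 h2 ⊢
        rw [S₁.sub_eq_of_mem_gaps S₂ hI (h1.trans h2.symm) (Set.Ioo_subset_Icc_self hγI), h1]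
  refine ⟨Real.exp e, Real.exp_pos _, fun x => ?_⟩
  obtain ⟨γ, hγ, r, -, rfl⟩ := exists_eq_smul_unitVec_mem x
  rw [map_smul_eq_mul, map_smul_eq_mul, hcirc γ (Set.Ico_subset_Icc_self hγ)]
  ring

end Setting

/-! ### Extension of leading trajectories -/

section Extend

variable {ι : Type*} {s : Set ι} {D C : ι → ℝ → ℝ}

theorem TopArc.congr {α β : ℝ} {k k' : ℝ → ℝ} (h : TopArc s D C α β k)
    (hk : Set.EqOn k' k (Set.Icc α β)) : TopArc s D C α β k' := by
  refine ⟨h.1.congr hk, fun γ hγ => ?_⟩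
  obtain ⟨m, hm, hd⟩ := h.2 γ hγ
  exact ⟨m, hm, hd.congr_of_eventuallyEq (eventually_of_mem (Ioo_mem_nhds hγ.1 hγ.2)
    fun x hx => hk (Set.Ioo_subset_Icc_self hx))⟩

theorem TopArc.add_const {α β : ℝ} {k : ℝ → ℝ} (h : TopArc s D C α β k) (c : ℝ) :
    TopArc s D C α β fun γ => k γ + c := by
  refine ⟨h.1.add continuousOn_const, fun γ hγ => ?_⟩
  obtain ⟨m, hm, hd⟩ := h.2 γ hγ
  exact ⟨m, hm, hd.add_const c⟩

theorem TopArc.of_self {α : ℝ} {k : ℝ → ℝ} : TopArc s D C α α k := by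
  refine ⟨by simp, fun γ hγ => ?_⟩
  simp at hγ

variable [TopologicalSpace ι]

/-- A leading trajectory cannot start from a direction where there are no leading vectors: its radius
would be infinite there. -/
theorem TopArc.exists_pos_left (hs : IsCompact s) (hD : Continuous fun p : ι × ℝ => D p.1 p.2)
    (hC : Continuous fun p : ι × ℝ => C p.1 p.2) {K : ℝ} (hK0 : 0 < K)
    (hK : ∀ A ∈ s, ∀ γ δ, |C A γ - C A δ| ≤ K * |γ - δ|) {c b : ℝ} (hcb : c < b) {k : ℝ → ℝ}
    (hf : IsFeasibleAt s D C c) (h : TopArc s D C c b k) : ∃ A ∈ s, 0 < C A c := by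
  by_contra! hno
  have hDc : Continuous fun B => D B c := hD.comp (continuous_id.prodMk continuous_const)
  have hCc : Continuous fun B => C B c := hC.comp (continuous_id.prodMk continuous_const)
  -- Near `c`, every vector with a nonnegative angular component has radial component below `-η`,
  -- and that angular component is at most `K (x - c)`. So the top slopes are at most `-η / (K (x -
  -- c))`.
  obtain ⟨η, hη, hlt⟩ : ∃ η > 0, ∀ A ∈ s, C A c = 0 → D A c < -η := by
    have hT : IsCompact (s ∩ {A | C A c = 0}) :=
      hs.inter_right (isClosed_eq hCc continuous_const)
    rcases (s ∩ {A | C A c = 0}).eq_empty_or_nonempty with he | hne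
    · refine ⟨1, one_pos, fun A hA h0 => ?_⟩
      have : A ∈ s ∩ {A | C A c = 0} := ⟨hA, h0⟩
      rw [he] at this
      exact this.elim
    · obtain ⟨B, hB, hmax⟩ := hT.exists_isMaxOn hne hDc.continuousOn
      have hneg := hf B hB.1 hB.2
      refine ⟨-D B c / 2, by linarith, fun A hA h0 => ?_⟩
      have : D A c ≤ D B c := hmax ⟨hA, h0⟩
      linarith
  have hev : ∀ᶠ x in 𝓝 c, ∀ A ∈ s, 0 ≤ C A x → D A x < -η := by
    have hZ : IsClosed {p : ι × ℝ | 0 ≤ C p.1 p.2 ∧ -η ≤ D p.1 p.2} :=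
      (isClosed_le continuous_const hC).inter (isClosed_le continuous_const hD)
    have hcl := isClosed_exists_mem hs hZ
    have hnot : c ∈ {x | ∃ A ∈ s, (A, x) ∈ {p : ι × ℝ | 0 ≤ C p.1 p.2 ∧ -η ≤ D p.1 p.2}}ᶜ := by
      rintro ⟨A, hA, h1, h2⟩
      exact (hlt A hA (le_antisymm (hno A hA) h1)).not_ge h2
    filter_upwards [hcl.isOpen_compl.mem_nhds hnot] with x hx A hA h1
    by_contra! h2
    exact hx ⟨A, hA, h1, h2⟩
  obtain ⟨ε, hε, hball⟩ := Metric.eventually_nhds_iff.1 hev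
  set b' := min ((c + b) / 2) (c + ε / 2) with hb'
  have hcb' : c < b' := lt_min (by linarith) (by linarith)
  have hb'b : b' < b := (min_le_left _ _).trans_lt (by linarith)
  -- This slope is not integrable at `c`. The sum is nonincreasing, yet it would tend to `-∞` as `x`
  -- decreases to `c`, because `k` is continuous there.
  have hanti : ∀ x ∈ Set.Ioc c b', k b' + η / K * Real.log (b' - c) ≤ k x + η / K * Real.log (x - c) := by
    intro x hx
    have := antitoneOn_Icc_of_hasDerivAt (y := fun x => k x + η / K * Real.log (x - c)) (a := x) (b := b')
      ?_ ?_
    · exact this (Set.left_mem_Icc.2 hx.2) (Set.right_mem_Icc.2 hx.2) hx.2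
    · refine (h.1.mono (Set.Icc_subset_Icc hx.1.le hb'b.le)).add (continuousOn_const.mul ?_)
      exact (continuousOn_id.sub continuousOn_const).log fun y hy =>
        (sub_pos.2 (hx.1.trans_le hy.1)).ne'
    · intro y hy
      have hcy : c < y := hx.1.trans hy.1
      obtain ⟨m, hm, hd⟩ := h.2 y ⟨hcy, hy.2.trans hb'b⟩
      have hl : HasDerivAt (fun x => Real.log (x - c)) (1 / (y - c)) y :=
        ((hasDerivAt_id y).sub_const c).log (sub_pos.2 hcy).ne'
      refine ⟨_, ?_, hd.add (hl.const_mul (η / K))⟩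
      obtain ⟨A, hA, hpos, heq⟩ := hm.1
      have h1 := hball (y := y) (by
        rw [Real.dist_eq, abs_of_pos (sub_pos.2 hcy)]
        linarith [hy.2, min_le_right ((c + b) / 2) (c + ε / 2)]) A hA hpos.le
      have h2 := (le_abs_self _).trans (hK A hA y c)
      rw [abs_of_pos (sub_pos.2 hcy)] at h2
      have h3 := hno A hA
      have hyc := sub_pos.2 hcy
      rw [heq] at h1
      have h4 : m < 0 := by
        by_contra! h
        nlinarith
      have h5 : m * (K * (y - c)) < -η := by nlinarith
      have e : η / K * (1 / (y - c)) = η / (K * (y - c)) := by field_simp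
      rw [e, ← le_neg_iff_add_nonpos_right, ← neg_div, le_div_iff₀ (by positivity)]
      exact h5.le
  have hlim : Tendsto (fun x => k x + η / K * Real.log (x - c)) (𝓝[>] c) atBot := by
    have h1 : Tendsto k (𝓝[>] c) (𝓝 (k c)) :=
      ((h.1 c (Set.left_mem_Icc.2 hcb.le)).mono_of_mem_nhdsWithin (Icc_mem_nhdsGT hcb))
    have h2 : Tendsto (fun x => Real.log (x - c)) (𝓝[>] c) atBot := by
      refine Real.tendsto_log_nhdsGT_zero.comp (tendsto_nhdsWithin_iff.2 ⟨?_, ?_⟩)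
      · have : Continuous fun x : ℝ => x - c := by fun_prop
        have := (this.tendsto c).mono_left (nhdsWithin_le_nhds (s := Set.Ioi c))
        simpa using this
      · filter_upwards [self_mem_nhdsWithin] with x hx using sub_pos.2 (Set.mem_Ioi.1 hx)
    exact h1.add_atBot (h2.const_mul_atBot (by positivity))
  obtain ⟨x, hx1, hx2⟩ := ((hlim.eventually_lt_atBot (k b' + η / K * Real.log (b' - c))).and
    (Ioc_mem_nhdsGT hcb')).exists
  exact (hanti x hx2).not_gt hx1

/-- A leading trajectory that ends in a given direction can be extended backwards over an interval
with leading directions. -/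
theorem TopArc.exists_extend (hs : IsCompact s) (hD : Continuous fun p : ι × ℝ => D p.1 p.2)
    (hC : Continuous fun p : ι × ℝ => C p.1 p.2) {c z b : ℝ} (hcz : c < z) (hzb : z < b) {k : ℝ → ℝ}
    (hf : ∀ γ ∈ Set.Ioo c b, IsFeasibleAt s D C γ) (h : TopArc s D C z b k)
    (htop : ∀ γ ∈ Set.Ioo c b, ∃ m, IsTopSlope s D C γ m) :
    ∃ k', ∀ c' ∈ Set.Ioo c b, TopArc s D C c' b k' := by
  choose! a ha using htop
  have hca : ContinuousOn a (Set.Ioo c b) := fun γ hγ =>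
    (continuousAt_of_isTopSlope hs hD hC (hf γ hγ)
      (eventually_of_mem (Ioo_mem_nhds hγ.1 hγ.2) ha)).continuousWithinAt
  set w := (z + b) / 2 with hw
  have hwm : w ∈ Set.Ioo c b := ⟨by linarith, by linarith⟩
  have hder : ∀ γ ∈ Set.Ioo c b, HasDerivAt (fun x => ∫ v in w..x, a v) (a γ) γ := by
    intro γ hγ
    refine intervalIntegral.integral_hasDerivAt_right ?_ ?_ (hca.continuousAt (Ioo_mem_nhds hγ.1 hγ.2))
    · refine (hca.mono fun x hx => ?_).intervalIntegrable
      exact (Set.ordConnected_Ioo (a := c) (b := b)).uIcc_subset hwm hγ hx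
    · exact hca.stronglyMeasurableAtFilter isOpen_Ioo γ hγ
  -- A primitive of the continuous top slope, normalized to agree with `k` at `w`. It replaces `k`
  -- to the left of `w`, while `k` is kept on the right up to the end `b`, where the primitive need
  -- not be controlled.
  set k₁ : ℝ → ℝ := fun x => k w + ∫ v in w..x, a v with hk₁
  have hder₁ : ∀ γ ∈ Set.Ioo c b, HasDerivAt k₁ (a γ) γ := fun γ hγ => (hder γ hγ).const_add _
  have harc₁ : ∀ c' ∈ Set.Ioo c b, ∀ b' ∈ Set.Ioo c b, TopArc s D C c' b' k₁ := by
    intro c' hc' b' hb'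
    refine ⟨fun x hx => (hder₁ x ⟨hc'.1.trans_le hx.1, hx.2.trans_lt hb'.2⟩).continuousAt.continuousWithinAt,
      fun γ hγ => ?_⟩
    have hγ' : γ ∈ Set.Ioo c b := ⟨hc'.1.trans hγ.1, hγ.2.trans hb'.2⟩
    exact ⟨a γ, ha γ hγ', hder₁ γ hγ'⟩
  have heq : ∀ x ∈ Set.Ioo z b, k₁ x = k x := by
    intro x hx
    have hzw : z < w := by rw [hw]; linarith
    set u := min w x with hu
    set v := max w x with hv
    have huv : u ≤ v := min_le_max
    have hzu : z < u := lt_min hzw hx.1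
    have hvb : v < b := max_lt hwm.2 hx.2
    have h1 := (harc₁ u ⟨hcz.trans hzu, huv.trans_lt hvb⟩ v ⟨hcz.trans (hzu.trans_le huv), hvb⟩).sub_eq
      (h.mono hzu.le hvb.le) (x := x) (y := w) ⟨min_le_right _ _, le_max_right _ _⟩
      ⟨min_le_left _ _, le_max_left _ _⟩
    have h2 : k₁ w = k w := by simp [hk₁]
    linarith
  refine ⟨fun x => if x ≤ w then k₁ x else k x, fun c' hc' => ?_⟩
  have hloc : ∀ x ∈ Set.Ioo c b, (fun x => if x ≤ w then k₁ x else k x) =ᶠ[𝓝 x] k₁ := by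
    intro x hx
    rcases lt_or_ge x w with hxw | hxw
    · filter_upwards [Iio_mem_nhds hxw] with y hy
      simp [le_of_lt (Set.mem_Iio.1 hy)]
    · filter_upwards [Ioo_mem_nhds (show z < x by linarith) hx.2] with y hy
      split_ifs with hyw
      · rfl
      · exact (heq y hy).symm
  refine ⟨fun x hx => ?_, fun γ hγ => ?_⟩
  · rcases hx.2.eq_or_lt with rfl | hxb
    · have hzx : z < x := hzb
      have h1 : ContinuousWithinAt k (Set.Icc c' x) x := by
        have := h.1 x (Set.right_mem_Icc.2 hzx.le)
        refine this.mono_of_mem_nhdsWithin ?_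
        exact mem_nhdsWithin.2 ⟨Set.Ioi z, isOpen_Ioi, hzx, fun y hy => ⟨hy.1.le, hy.2.2⟩⟩
      refine h1.congr_of_eventuallyEq ?_ (by simp [not_le.2 hwm.2])
      filter_upwards [mem_nhdsWithin_of_mem_nhds (Ioi_mem_nhds hwm.2)] with y hy
      simp [not_le.2 (Set.mem_Ioi.1 hy)]
    · have hx' : x ∈ Set.Ioo c b := ⟨hc'.1.trans_le hx.1, hxb⟩
      exact ((hder₁ x hx').continuousAt.congr (hloc x hx').symm).continuousWithinAt
  · have hγ' : γ ∈ Set.Ioo c b := ⟨hc'.1.trans hγ.1, hγ.2⟩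
    exact ⟨a γ, ha γ hγ', (hder₁ γ hγ').congr_of_eventuallyEq (hloc γ hγ')⟩

/-- The increment over an interval without kernels can be decreased, down to that of the leading
trajectory over the whole interval, by moving the starting point of the final leading trajectory. -/
theorem exists_topArc_of_increment_le (hs : IsCompact s)
    (hD : Continuous fun p : ι × ℝ => D p.1 p.2)
    (hC : Continuous fun p : ι × ℝ => C p.1 p.2) {K : ℝ} (hK0 : 0 < K)
    (hK : ∀ A ∈ s, ∀ γ δ, |C A γ - C A δ| ≤ K * |γ - δ|) {h : ℝ → ℝ}
    (hh : SemiconcaveAdmissible s D C h) (hcont : Continuous h) {α β t₀ z r : ℝ}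
    (hf : ∀ γ ∈ Set.Ioo α β, IsFeasibleAt s D C γ) (ht₀ : t₀ ∈ Set.Icc α β)
    (harc : TopArc s D C t₀ β h) (hz : z ∈ Set.Ioo α β) {kz : ℝ → ℝ} (hkz : TopArc s D C z β kz)
    (hr : r ≤ h β - h α) (hbound : ∀ k, TopArc s D C α β k → k β - k α ≤ r) :
    ∃ t ∈ Set.Icc α t₀, ∃ k, TopArc s D C t β k ∧ k t = h t ∧
      MonotoneOn (fun γ => h γ - k γ) (Set.Icc t β) ∧ k β - h α = r := by
  rcases ht₀.1.eq_or_lt with rfl | hαt₀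
  · refine ⟨α, ⟨le_rfl, le_rfl⟩, h, harc, rfl, by simpa using monotoneOn_const,
      le_antisymm (hbound h harc) hr⟩
  -- The infimum of `J` is the furthest point down to which the leading directions exist without
  -- interruption.
  set J : Set ℝ := {c | α ≤ c ∧ c < β ∧ ∀ γ ∈ Set.Ioo c β, ∃ m, IsTopSlope s D C γ m} with hJ
  have hzJ : z ∈ J := ⟨hz.1.le, hz.2, fun γ hγ => (hkz.2 γ hγ).imp fun m hm => hm.1⟩
  have hbdd : BddBelow J := ⟨α, fun c hc => hc.1⟩
  set c := sInf J with hc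
  have hαc : α ≤ c := le_csInf ⟨z, hzJ⟩ fun x hx => hx.1
  have hcz : c ≤ z := csInf_le hbdd hzJ
  have htop : ∀ γ ∈ Set.Ioo c β, ∃ m, IsTopSlope s D C γ m := by
    intro γ hγ
    obtain ⟨x, hx, hxγ⟩ := exists_lt_of_csInf_lt ⟨z, hzJ⟩ hγ.1
    exact hx.2.2 γ ⟨hxγ, hγ.2⟩
  have hcβ : c < β := hcz.trans_lt hz.2
  -- A trajectory starting at an interior point `c` has leading vectors there, hence also a little
  -- further to the left, against the choice of `c`.
  have hstep : ∀ k, TopArc s D C c β k → c = α := by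
    intro k hk
    by_contra hne
    have hαc' : α < c := lt_of_le_of_ne hαc (Ne.symm hne)
    have hfc := hf c ⟨hαc', hcβ⟩
    obtain ⟨A, hA, hpos⟩ := hk.exists_pos_left hs hD hC hK0 hK hcβ hfc
    obtain ⟨m, hm⟩ := exists_isTopSlope hs hD hC hfc hA hpos
    have hev := eventually_exists_isTopSlope hs hD hC
      (eventually_of_mem (Ioo_mem_nhds hαc' hcβ) hf) hm
    obtain ⟨ε, hε, hball⟩ := Metric.eventually_nhds_iff.1 hev
    have hmem : max α (c - ε / 2) ∈ J := by
      refine ⟨le_max_left _ _, max_lt (hαc'.trans hcβ) (by linarith), fun γ hγ => ?_⟩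
      rcases lt_or_ge c γ with h1 | h1
      · exact htop γ ⟨h1, hγ.2⟩
      · refine hball ?_
        rw [Real.dist_eq, abs_of_nonpos (by linarith)]
        linarith [hγ.1, le_max_right α (c - ε / 2)]
    have := csInf_le hbdd hmem
    rw [← hc] at this
    exact this.not_gt (max_lt hαc' (by linarith))
  have hct₀ : c < t₀ := by
    rcases ht₀.2.eq_or_lt with h1 | h1
    · rw [h1]; exact hcβ
    · have hle : c ≤ t₀ := csInf_le hbdd ⟨ht₀.1, h1, fun γ hγ => (harc.2 γ hγ).imp fun m hm => hm.1⟩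
      refine hle.lt_of_ne fun h2 => ?_
      rw [← h2] at harc
      have := hstep h harc
      linarith
  set z' := (z + β) / 2 with hz'
  obtain ⟨k, hk⟩ := (hkz.mono (show z ≤ z' by linarith [hz.2]) le_rfl).exists_extend hs hD hC
    (show c < z' by linarith [hz.2]) (show z' < β by linarith [hz.2])
    (fun γ hγ => hf γ ⟨hαc.trans_lt hγ.1, hγ.2⟩) htop
  have hmono : ∀ c' ∈ Set.Ioo c β, MonotoneOn (fun γ => h γ - k γ) (Set.Icc c' β) := fun c' hc' =>
    hh.monotoneOn_sub hs hD hC hcont (fun γ hγ => hf γ ⟨hαc.trans_lt (hc'.1.trans hγ.1), hγ.2⟩) (hk c' hc')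
  have hkt₀ : h β - k β = h t₀ - k t₀ := by
    rcases ht₀.2.eq_or_lt with h1 | h1
    · rw [h1]
    · exact harc.sub_eq (hk t₀ ⟨hct₀, h1⟩) (Set.right_mem_Icc.2 ht₀.2) (Set.left_mem_Icc.2 ht₀.2)
  have hfin : ∀ k : ℝ → ℝ, ∀ t ∈ Set.Icc α t₀, TopArc s D C t β k →
      MonotoneOn (fun γ => h γ - k γ) (Set.Icc t β) → k β - k t + h t - h α = r →
      ∃ t ∈ Set.Icc α t₀, ∃ k, TopArc s D C t β k ∧ k t = h t ∧
      MonotoneOn (fun γ => h γ - k γ) (Set.Icc t β) ∧ k β - h α = r := by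
    intro k t ht h1 h2 h3
    refine ⟨t, ht, fun γ => k γ + (h t - k t), h1.add_const _, by ring, ?_, by linarith⟩
    intro x hx y hy hxy
    have := h2 hx hy hxy
    simp only at *
    linarith
  have hkc : ContinuousOn k (Set.Ioc c β) := by
    intro x hx
    set c' := (c + x) / 2 with hc'
    have hx1 := hx.1
    have hx2 := hx.2
    have h1 := (hk c' ⟨by linarith, by linarith⟩).1 x ⟨by linarith, hx2⟩
    refine h1.mono_of_mem_nhdsWithin (mem_nhdsWithin.2
      ⟨Set.Ioi c', isOpen_Ioi, show c' < x by linarith, fun y hy => ⟨hy.1.le, hy.2.2⟩⟩)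
  -- The increment of the curve that follows `h` up to `t` and a leading trajectory afterwards is
  -- continuous in `t`; at `t₀` it is that of `h`, hence at least `r`. If it falls to `r`, the
  -- intermediate value theorem gives `t`.
  by_cases hle : ∃ t₁ ∈ Set.Ioc c t₀, k β - k t₁ + h t₁ - h α ≤ r
  · obtain ⟨t₁, ht₁, hle⟩ := hle
    have hcG : ContinuousOn (fun t => k β - k t + h t - h α) (Set.Icc t₁ t₀) :=
      ((continuousOn_const.sub (hkc.mono fun x hx => ⟨ht₁.1.trans_le hx.1, hx.2.trans ht₀.2⟩)).add
        hcont.continuousOn).sub continuousOn_const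
    obtain ⟨t, ht, heq⟩ := intermediate_value_Icc ht₁.2 hcG (show r ∈ Set.Icc _ _ from ⟨hle, by
      linarith⟩)
    have hct : c < t := ht₁.1.trans_le ht.1
    have ht' : t ∈ Set.Icc α t₀ := ⟨hαc.trans hct.le, ht.2⟩
    rcases (ht.2.trans ht₀.2).eq_or_lt with h1 | h1
    · refine hfin k t ht' (by rw [h1]; exact TopArc.of_self) ?_ heq
      rw [h1]
      intro x hx y hy _
      simp only [Set.Icc_self, Set.mem_singleton_iff] at hx hy
      rw [hx, hy]
    · exact hfin k t ht' (hk t ⟨hct, h1⟩) (hmono t ⟨hct, h1⟩) heq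
  · push Not at hle
    -- the extended trajectory converges at `c`
    have hmono' : MonotoneOn (fun γ => h γ - k γ) (Set.Ioc c β) := by
      intro x hx y hy hxy
      rcases hx.2.eq_or_lt with h1 | h1
      · have : y = x := le_antisymm (hy.2.trans h1.ge) hxy
        rw [this]
      · exact hmono x ⟨hx.1, h1⟩ ⟨le_rfl, hx.2⟩ ⟨hxy, hy.2⟩ hxy
    have hbd : ∀ x ∈ Set.Ioc c t₀, r + h α - k β ≤ h x - k x := fun x hx => by
      have := hle x hx
      linarith
    set ℓ := sInf ((fun γ => h γ - k γ) '' Set.Ioo c t₀) with hℓ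
    have hlim : Tendsto (fun γ => h γ - k γ) (𝓝[>] c) (𝓝 ℓ) := by
      have hm : MonotoneOn (fun γ => h γ - k γ) (Set.Ioo c t₀) := hmono'.mono fun x hx =>
        ⟨hx.1, hx.2.le.trans ht₀.2⟩
      refine hm.tendsto_nhdsWithin_Ioo_right ⟨_, (Set.nonempty_Ioo.2 hct₀).some_mem⟩ ⟨r + h α - k β, ?_⟩
      rintro _ ⟨x, hx, rfl⟩
      exact hbd x ⟨hx.1, hx.2.le⟩
    have hlimk : Tendsto k (𝓝[>] c) (𝓝 (h c - ℓ)) := by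
      have := ((hcont.tendsto c).mono_left (nhdsWithin_le_nhds (s := Set.Ioi c))).sub hlim
      simpa using this
    have hℓr : r + h α - k β ≤ ℓ := by
      refine ge_of_tendsto hlim ?_
      filter_upwards [Ioo_mem_nhdsGT hct₀] with x hx using hbd x ⟨hx.1, hx.2.le⟩
    -- With the limit as its value at `c`, the trajectory reaches `c`, so `c = α`. Then `hbound`
    -- gives one inequality for `r`, and the failure of `hle` gives the other.
    set k' := Function.update k c (h c - ℓ) with hk'
    have hk'eq : ∀ x, c < x → k' x = k x := fun x hx => by
      rw [hk', Function.update_of_ne hx.ne']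
    have harc' : TopArc s D C c β k' := by
      refine ⟨fun x hx => ?_, fun γ hγ => ?_⟩
      · rcases hx.1.eq_or_lt with rfl | hcx
        · have h1 : ContinuousWithinAt k' (Set.Ioi c) c := by
            rw [ContinuousWithinAt, hk', Function.update_self]
            refine hlimk.congr' ?_
            filter_upwards [self_mem_nhdsWithin] with y hy
            exact (hk'eq y hy).symm
          exact (continuousWithinAt_Ioi_iff_Ici.1 h1).mono fun y hy => hy.1
        · have h1 := (hkc x ⟨hcx, hx.2⟩)
          have h2 : ContinuousWithinAt k (Set.Icc c β) x :=
            h1.mono_of_mem_nhdsWithin (mem_nhdsWithin.2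
              ⟨Set.Ioi c, isOpen_Ioi, hcx, fun y hy => ⟨hy.1, hy.2.2⟩⟩)
          refine h2.congr_of_eventuallyEq ?_ (hk'eq x hcx)
          filter_upwards [mem_nhdsWithin_of_mem_nhds (Ioi_mem_nhds hcx)] with y hy using hk'eq y hy
      · obtain ⟨m, hm, hd⟩ := (hk ((c + γ) / 2) ⟨by linarith [hγ.1], by linarith [hγ.1, hγ.2]⟩).2 γ
          ⟨by linarith [hγ.1], hγ.2⟩
        refine ⟨m, hm, hd.congr_of_eventuallyEq ?_⟩
        filter_upwards [Ioi_mem_nhds hγ.1] with y hy using hk'eq y hy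
    have hcα := hstep k' harc'
    have h1 := hbound k' (hcα ▸ harc')
    rw [hk'eq β hcβ, ← hcα, hk', Function.update_self] at h1
    refine hfin k' c ⟨hαc, hct₀.le⟩ harc' ?_ ?_
    · exact hh.monotoneOn_sub hs hD hC hcont (fun γ hγ => hf γ ⟨hαc.trans_lt hγ.1, hγ.2⟩) harc'
    · rw [hk'eq β hcβ, hk', Function.update_self]
      rw [← hcα] at hℓr ⊢
      linarith

end Extend

/-! ### Leading trajectories with a prescribed increment -/

theorem IsGapArc.congr {𝒜 : Set Mat} {I : ℝ × ℝ} {k k' : ℝ → ℝ} (h : IsGapArc 𝒜 I k)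
    (hk : Set.EqOn k' k (Set.Icc I.1 I.2)) : IsGapArc 𝒜 I k' := by
  obtain ⟨t, ht, h1, h2⟩ := h
  refine ⟨t, ht, h1.congr fun x hx => hk ⟨by linarith [hx.2], by linarith [hx.1, ht.2]⟩,
    h2.congr fun x hx => hk ⟨ht.1.trans hx.1, hx.2⟩⟩

theorem IsGapArc.add_const {𝒜 : Set Mat} {I : ℝ × ℝ} {k : ℝ → ℝ} (h : IsGapArc 𝒜 I k) (c : ℝ) :
    IsGapArc 𝒜 I fun γ => k γ + c := by
  obtain ⟨t, ht, h1, h2⟩ := h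
  exact ⟨t, ht, h1.add_const c, h2.add_const c⟩

theorem IsGapArc.continuousOn {𝒜 : Set Mat} {I : ℝ × ℝ} {k : ℝ → ℝ} (h : IsGapArc 𝒜 I k) :
    ContinuousOn k (Set.Icc I.1 I.2) := by
  obtain ⟨t, ht, h1, h2⟩ := h
  rw [← Set.Icc_union_Icc_eq_Icc ht.1 ht.2]
  refine ContinuousOn.union_of_isClosed ?_ h2.1 isClosed_Icc isClosed_Icc
  have := h1.1.comp (s := Set.Icc I.1 t) continuousOn_neg fun γ hγ =>
      ⟨by linarith [hγ.2], by linarith [hγ.1]⟩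
  refine this.congr fun γ _ => ?_
  simp

/-- Matrices turning left are controlled by maximality, those turning right by the admissible `m₀ ≥
m`, and radial ones by feasibility. -/
theorem LeftSlope.admissible {𝒜 : Set Mat} {γ m m₀ : ℝ} (h : LeftSlope 𝒜 γ m)
    (hf : IsFeasibleAt 𝒜 radial angular γ) (h₀ : AdmissibleSlope 𝒜 γ m₀) : AdmissibleSlope 𝒜 γ m := by
  intro A hA
  rcases lt_trichotomy (angular A γ) 0 with h1 | h1 | h1
  · exact (h₀ A hA).trans (mul_le_mul_of_nonpos_right (h.le_of_admissible h₀) h1.le)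
  · have := hf A hA h1
    rw [h1, mul_zero]
    exact this.le
  · exact h.2 A hA h1

theorem RightSlope.admissible {𝒜 : Set Mat} {γ m m₀ : ℝ} (h : RightSlope 𝒜 γ m)
    (hf : IsFeasibleAt 𝒜 radial angular γ) (h₀ : AdmissibleSlope 𝒜 γ m₀) : AdmissibleSlope 𝒜 γ m := by
  have hle : m₀ ≤ m := by
    have := IsTopSlope.le_of_admissible (m' := -m₀) h fun A hA => by
      simp only [radial', angular', neg_neg, neg_mul_neg]
      exact h₀ A hA
    linarith
  intro A hA
  rcases lt_trichotomy (angular A γ) 0 with h1 | h1 | h1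
  · exact (rightSlope_iff.1 h).2 A hA h1
  · have := hf A hA h1
    rw [h1, mul_zero]
    exact this.le
  · exact (h₀ A hA).trans (mul_le_mul_of_nonneg_right hle h1.le)

namespace Setting

variable {𝒜 : Set Mat} {f : Seminorm ℝ Plane}

/-- Only one half of the sphere curve is changed: a smaller increment is reached by starting the
left trajectory earlier, a larger one by the reflected construction for the right trajectory. The
monotone difference from the sphere is recorded because it bounds the correction by its value at the
end. -/
theorem exists_isGapArc (S : Setting 𝒜 f) {p : ℝ × ℝ} (hp : p ∈ setP 𝒜) {r : ℝ}
    (h₁ : lowerBd 𝒜 p ≤ (r : EReal)) (h₂ : (r : EReal) ≤ upperBd 𝒜 p) :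
    ∃ k, IsGapArc 𝒜 p k ∧ k p.1 = logRadius f p.1 ∧ k p.2 - k p.1 = r ∧
      (AntitoneOn (fun γ => k γ - logRadius f γ) (Set.Icc p.1 p.2) ∨
        MonotoneOn (fun γ => k γ - logRadius f γ) (Set.Icc p.1 p.2)) := by
  obtain ⟨hlt, -, -, -⟩ := mem_gaps hp.1
  obtain ⟨hb₁, hb₂⟩ := increment_mem_bounds S.comp S.zero S.definite S.dissipative hp.1
  rw [lowerBd, min_eq_left (hb₁.trans hb₂)] at h₁
  rw [upperBd, max_eq_right (hb₁.trans hb₂)] at h₂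
  obtain ⟨K, hK0, hK⟩ := exists_lipschitz_angular S.comp
  have hfeas := S.feasible hp.1
  obtain ⟨t₀, ht₀, ha₁, ha₂⟩ := S.isGapArc hp.1
  obtain ⟨z, ⟨⟨ρ', hρ'⟩, ⟨ρ, hρ⟩⟩, hz⟩ := hp.2
  have hg := continuous_logRadius S.definite
  have hsc := semiconcaveAdmissible_logRadius S.definite S.dissipative
  rcases le_total r (increment f p) with hr | hr
  · have hbound : ∀ k, TopArc 𝒜 radial angular p.1 p.2 k → k p.2 - k p.1 ≤ r := by
      intro k hk
      refine EReal.coe_le_coe_iff.1 (le_trans ?_ h₁)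
      refine le_sSup ⟨_, hk.leftArc S.comp hlt.le hfeas, ?_⟩
      rw [← Real.exp_sub, Real.log_exp]
    obtain ⟨t, ht, k, hk, hkt, hmono, hinc⟩ := exists_topArc_of_increment_le S.comp continuous_radial
      continuous_angular hK0 hK hsc hg hfeas ht₀ ha₂ hz hρ.topArc hr hbound
    have ht' : t ∈ Set.Icc p.1 p.2 := ⟨ht.1, ht.2.trans ht₀.2⟩
    set k' : ℝ → ℝ := fun γ => if γ ≤ t then logRadius f γ else k γ with hk'
    have e1 : ∀ γ, γ ≤ t → k' γ = logRadius f γ := fun γ hγ => if_pos hγ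
    have e2 : ∀ γ, t ≤ γ → k' γ = k γ := fun γ hγ => by
      rcases hγ.eq_or_lt with rfl | h
      · rw [e1 _ le_rfl, hkt]
      · exact if_neg h.not_ge
    refine ⟨k', ⟨t, ht', (ha₁.mono (neg_le_neg ht.2) le_rfl).congr fun x hx => e1 _ (by linarith [hx.1]),
      hk.congr fun x hx => e2 _ hx.1⟩, e1 _ ht.1, by rw [e1 _ ht.1, e2 _ ht'.2, hinc], Or.inl ?_⟩
    rw [← Set.Icc_union_Icc_eq_Icc ht'.1 ht'.2]
    refine AntitoneOn.union_right ?_ ?_ (isGreatest_Icc ht'.1) (isLeast_Icc ht'.2)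
    · intro x hx y hy _
      simp only [e1 x hx.2, e1 y hy.2, sub_self, le_refl]
    · intro x hx y hy hxy
      have := hmono hx hy hxy
      simp only [e2 x hx.1, e2 y hy.1] at *
      linarith
  · have hbound : ∀ k, TopArc 𝒜 radial' angular' (-p.2) (-p.1) k → k (-p.1) - k (-p.2) ≤ -r := by
      intro k hk
      have hk' : TopArc 𝒜 radial' angular' (-p.2) (-p.1) fun γ => (fun γ => k (-γ)) (-γ) := by
        simpa using hk
      have : (r : EReal) ≤ ((-(k (-p.1) - k (-p.2)) : ℝ) : EReal) := by
        refine h₂.trans (sInf_le ⟨_, TopArc.rightArc (k := fun γ => k (-γ)) S.comp hlt.le hk' hfeas, ?_⟩)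
        rw [← Real.exp_sub, Real.log_exp]
      have := EReal.coe_le_coe_iff.1 this
      linarith
    have hfeas' : ∀ γ ∈ Set.Ioo (-p.2) (-p.1), IsFeasibleAt 𝒜 radial' angular' γ := fun γ hγ => by
      have := isFeasibleAt_reflect (hfeas (-γ) ⟨by linarith [hγ.2], by linarith [hγ.1]⟩)
      rwa [neg_neg] at this
    have hK' : ∀ A ∈ 𝒜, ∀ γ δ, |angular' A γ - angular' A δ| ≤ K * |γ - δ| := by
      intro A hA γ δ
      have := hK A hA (-δ) (-γ)
      simp only [angular']
      rw [show -δ - -γ = γ - δ by ring] at this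
      rwa [neg_sub_neg]
    obtain ⟨t, ht, k, hk, hkt, hmono, hinc⟩ := exists_topArc_of_increment_le S.comp continuous_radial'
      continuous_angular' hK0 hK' hsc.reflect (hg.comp continuous_neg) (t₀ := -t₀) (z := -z) hfeas'
      ⟨by linarith [ht₀.2], by linarith [ht₀.1]⟩ ha₁ ⟨by linarith [hz.2], by linarith [hz.1]⟩ hρ'.topArc
      (r := -r) (by rw [increment] at hr; simp only [neg_neg]; linarith) hbound
    simp only [neg_neg] at hkt hmono hinc
    have ht' : -t ∈ Set.Icc p.1 p.2 := ⟨by linarith [ht.2, ht₀.1], by linarith [ht.1]⟩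
    -- Reflected case: the curve agrees with the sphere on the right of the new source and is the
    -- new right trajectory on the left of it.
    set k' : ℝ → ℝ := fun γ => if -t ≤ γ then logRadius f γ else k (-γ) with hk'
    have e1 : ∀ γ, -t ≤ γ → k' γ = logRadius f γ := fun γ hγ => if_pos hγ
    have e2 : ∀ γ, γ ≤ -t → k' γ = k (-γ) := fun γ hγ => by
      rcases hγ.eq_or_lt with rfl | h
      · rw [e1 _ le_rfl, neg_neg, hkt]
      · exact if_neg h.not_ge
    have harc : IsGapArc 𝒜 p k' := by
      refine ⟨-t, ht', ?_, (ha₂.mono (by linarith [ht.2]) le_rfl).congr fun x hx => e1 _ hx.1⟩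
      rw [neg_neg]
      refine hk.congr fun x hx => ?_
      rw [e2 _ (by linarith [hx.1]), neg_neg]
    have h1 : k' p.1 = logRadius f p.2 - r := by rw [e2 _ ht'.1]; linarith
    have h2 : k' p.2 = logRadius f p.2 := e1 _ ht'.2
    -- The reflected curve starts from the right end of the gap; a constant shift makes it agree
    -- with the sphere at the left end.
    refine ⟨fun γ => k' γ + (logRadius f p.1 - k' p.1), harc.add_const _, by ring, by
      change k' p.2 + _ - (k' p.1 + _) = r
      rw [h2, h1]; ring, Or.inr ?_⟩
    have hm : MonotoneOn (fun γ => k' γ - logRadius f γ) (Set.Icc p.1 p.2) := by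
      rw [← Set.Icc_union_Icc_eq_Icc ht'.1 ht'.2]
      refine MonotoneOn.union_right ?_ ?_ (isGreatest_Icc ht'.1) (isLeast_Icc ht'.2)
      · intro x hx y hy hxy
        have := hmono (a := -y) (b := -x) ⟨by linarith [hy.2], by linarith [hy.1]⟩
          ⟨by linarith [hx.2], by linarith [hx.1]⟩ (by linarith)
        simp only [e2 x hx.2, e2 y hy.2, neg_neg] at *
        linarith
      · intro x hx y hy _
        simp only [e1 x hx.1, e1 y hy.1, sub_self, le_refl]
    intro x hx y hy hxy
    have := hm hx hy hxy
    simp only at *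
    linarith

end Setting

/-! ### Monotonicity along the trajectories of a constant matrix -/

theorem monotoneOn_of_exists_hasDerivAt {y : ℝ → ℝ} {a b t : ℝ} (hy : ContinuousOn y (Set.Icc a b))
    (h : ∀ x ∈ Set.Ioo a b, x ≠ t → ∃ d, 0 ≤ d ∧ HasDerivAt y d x) : MonotoneOn y (Set.Icc a b) := by
  have key : ∀ a' b', a ≤ a' → b' ≤ b → t ∉ Set.Ioo a' b' → MonotoneOn y (Set.Icc a' b') := by
    intro a' b' h1 h2 ht
    have := antitoneOn_Icc_of_hasDerivAt (hy.mono (Set.Icc_subset_Icc h1 h2)).neg (fun x hx => by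
      obtain ⟨d, hd, hder⟩ := h x (Set.Ioo_subset_Ioo h1 h2 hx) fun h => ht (h ▸ hx)
      exact ⟨-d, by linarith, hder.neg⟩)
    intro x hx z hz hxz
    exact neg_le_neg_iff.1 (this hx hz hxz)
  by_cases ht : t ∈ Set.Ioo a b
  · rw [← Set.Icc_union_Icc_eq_Icc ht.1.le ht.2.le]
    exact (key a t le_rfl ht.2.le fun h => lt_irrefl _ h.2).union_right
      (key t b ht.1.le le_rfl fun h => lt_irrefl _ h.1) (isGreatest_Icc ht.1.le) (isLeast_Icc ht.2.le)
  · exact key a b le_rfl le_rfl ht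

/-- `g` increases (in the direction given by the sign `ε`) at least as fast as the logarithm of the
radius along the trajectories of the matrix `A`. -/
def Dominates (g : ℝ → ℝ) (A : Mat) (J : Set ℝ) : Prop :=
  ∀ (ε : ℝ) (Λ : ℝ → ℝ), (∀ γ ∈ J, 0 < ε * angular A γ) →
    (∀ γ ∈ J, HasDerivAt Λ (radial A γ / angular A γ) γ) → MonotoneOn (fun γ => ε * (g γ - Λ γ)) J

namespace Setting

variable {𝒜 : Set Mat} {f : Seminorm ℝ Plane}

theorem exists_admissibleSlope (S : Setting 𝒜 f) (γ : ℝ) : ∃ m, AdmissibleSlope 𝒜 γ m := by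
  obtain ⟨m, hm⟩ := exists_isSupportSlope S.definite γ
  exact ⟨m, hm.admissible S.definite S.dissipative⟩

theorem exists_hasDerivAt_of_isGapArc (S : Setting 𝒜 f) {I : ℝ × ℝ} (hI : I ∈ gaps 𝒜) {k : ℝ → ℝ}
    (h : IsGapArc 𝒜 I k) : ∃ t ∈ Set.Icc I.1 I.2, ∀ γ ∈ Set.Ioo I.1 I.2, γ ≠ t →
      ∃ m, AdmissibleSlope 𝒜 γ m ∧ HasDerivAt k m γ ∧
        ∃ A ∈ 𝒜, angular A γ ≠ 0 ∧ radial A γ = m * angular A γ := by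
  obtain ⟨t, ht, h1, h2⟩ := h
  refine ⟨t, ht, fun γ hγ hne => ?_⟩
  obtain ⟨m₀, hm₀⟩ := S.exists_admissibleSlope γ
  have hf := S.feasible hI γ hγ
  rcases hne.lt_or_gt with hlt | hlt
  · obtain ⟨m, hm, hd⟩ := h1.2 (-γ) ⟨by linarith, by linarith [hγ.1]⟩
    have hr : RightSlope 𝒜 γ (-m) := by simpa [RightSlope] using hm
    refine ⟨-m, hr.admissible hf hm₀, ?_, ?_⟩
    · have h3 := HasDerivAt.comp γ (h₂ := fun τ => k (-τ)) (h := fun τ => -τ) hd (hasDerivAt_neg γ)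
      refine (h3.congr_of_eventuallyEq (Eventually.of_forall fun τ => ?_)).congr_deriv (by ring)
      simp
    · obtain ⟨A, hA, hneg, heq⟩ := (rightSlope_iff.1 hr).1
      exact ⟨A, hA, hneg.ne, heq⟩
  · obtain ⟨m, hm, hd⟩ := h2.2 γ ⟨hlt, hγ.2⟩
    obtain ⟨A, hA, hpos, heq⟩ := hm.1
    exact ⟨m, LeftSlope.admissible hm hf hm₀, hd, A, hA, hpos.ne', heq⟩

/-- Away from the source the slopes of the curve are admissible, also for the convex hull, and one
exceptional point does no harm to monotonicity. -/
theorem dominates_of_isGapArc (S : Setting 𝒜 f) {I : ℝ × ℝ} (hI : I ∈ gaps 𝒜) {k : ℝ → ℝ}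
    (h : IsGapArc 𝒜 I k) {A : Mat} (hA : A ∈ convexHull ℝ 𝒜) {a b : ℝ} (ha : I.1 ≤ a) (hb : b ≤ I.2) :
    Dominates k A (Set.Icc a b) := by
  intro ε Λ hε hΛ
  obtain ⟨t, -, ht⟩ := S.exists_hasDerivAt_of_isGapArc hI h
  refine monotoneOn_of_exists_hasDerivAt (t := t) (continuousOn_const.mul
    ((h.continuousOn.mono (Set.Icc_subset_Icc ha hb)).sub
      fun γ hγ => (hΛ γ hγ).continuousAt.continuousWithinAt)) fun γ hγ hne => ?_
  obtain ⟨m, hm, hd, -⟩ := ht γ (Set.Ioo_subset_Ioo ha hb hγ) hne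
  have hγ' := Set.Ioo_subset_Icc_self hγ
  refine ⟨_, ?_, (hd.sub (hΛ γ hγ')).const_mul ε⟩
  have h1 := hm.convexHull A hA
  have h2 := hε γ hγ'
  have h3 : angular A γ ≠ 0 := fun h0 => by rw [h0, mul_zero] at h2; exact lt_irrefl _ h2
  have e : ε * (m - radial A γ / angular A γ) =
      (m * angular A γ - radial A γ) * (ε * angular A γ) / angular A γ ^ 2 := by field_simp
  rw [e]
  exact div_nonneg (mul_nonneg (sub_nonneg.2 h1) h2.le) (sq_nonneg _)

/-- The comparison principle for the one-matrix system `{A}`, for which the trajectory of `A` is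
leading as long as it turns. -/
theorem dominates_logRadius (S : Setting 𝒜 f) {A : Mat} (hA : A ∈ convexHull ℝ 𝒜) (a b : ℝ) :
    Dominates (logRadius f) A (Set.Icc a b) := by
  intro ε Λ hε hΛ
  have hsc : SemiconcaveAdmissible {A} radial angular (logRadius f) :=
    semiconcaveAdmissible_logRadius S.definite
      ((S.dissipative.convexHull).mono (Set.singleton_subset_iff.2 hA))
  have hg := continuous_logRadius S.definite
  rcases lt_trichotomy ε 0 with h0 | h0 | h0
  · have hneg : ∀ γ ∈ Set.Icc a b, angular A γ < 0 := fun γ hγ => by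
      have := hε γ hγ
      by_contra! h
      nlinarith
    have harc : TopArc {A} radial' angular' (-b) (-a) fun γ => Λ (-γ) := by
      refine ⟨fun γ hγ => ?_, fun γ hγ => ?_⟩
      · have := (hΛ (-γ) ⟨by linarith [hγ.2], by linarith [hγ.1]⟩).continuousAt
        exact (ContinuousAt.comp (f := fun x : ℝ => -x) this continuous_neg.continuousAt).continuousWithinAt
      · have hγ' : -γ ∈ Set.Icc a b := ⟨by linarith [hγ.2], by linarith [hγ.1]⟩
        have hn := hneg _ hγ'
        refine ⟨-(radial A (-γ) / angular A (-γ)), ⟨⟨A, rfl, neg_pos.2 hn, ?_⟩, ?_⟩, ?_⟩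
        · have := hn.ne
          simp only [radial', angular']
          field_simp
        · rintro B rfl hB
          have := hn.ne
          simp only [radial', angular']
          field_simp
          exact le_rfl
        · have := HasDerivAt.comp γ (h₂ := Λ) (h := fun τ => -τ) (hΛ _ hγ') (hasDerivAt_neg γ)
          exact this.congr_deriv (by ring)
    have := hsc.reflect.monotoneOn_sub isCompact_singleton continuous_radial' continuous_angular'
      (hg.comp continuous_neg) (fun γ hγ => by
        rintro B rfl h0
        have := hneg (-γ) ⟨by linarith [hγ.2], by linarith [hγ.1]⟩
        simp only [angular', neg_eq_zero] at h0
        linarith) harc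
    intro x hx y hy hxy
    have := this (a := -y) (b := -x) ⟨by linarith [hy.2], by linarith [hy.1]⟩
      ⟨by linarith [hx.2], by linarith [hx.1]⟩ (by linarith)
    simp only [neg_neg] at this ⊢
    exact mul_le_mul_of_nonpos_left this h0.le
  -- For `ε = 0` the sign condition cannot hold at any point, so the interval is empty.
  · intro x hx
    have := hε x hx
    rw [h0, zero_mul] at this
    exact absurd this (lt_irrefl _)
  · have hpos : ∀ γ ∈ Set.Icc a b, 0 < angular A γ := fun γ hγ => (mul_pos_iff_of_pos_left h0).1 (hε γ hγ)
    have harc : TopArc {A} radial angular a b Λ := by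
      refine ⟨fun γ hγ => (hΛ γ hγ).continuousAt.continuousWithinAt, fun γ hγ => ?_⟩
      have hp := hpos γ (Set.Ioo_subset_Icc_self hγ)
      refine ⟨_, ⟨⟨A, rfl, hp, ?_⟩, ?_⟩, hΛ γ (Set.Ioo_subset_Icc_self hγ)⟩
      · field_simp
      · rintro B rfl hB
        field_simp
        exact le_rfl
    have := hsc.monotoneOn_sub isCompact_singleton continuous_radial continuous_angular hg
      (fun γ hγ => by
        rintro B rfl h0
        exact absurd h0 (hpos γ (Set.Ioo_subset_Icc_self hγ)).ne') harc
    intro x hx y hy hxy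
    exact mul_le_mul_of_nonneg_left (this hx hy hxy) h0.le

end Setting

/-! ### Gluing of the unit sphere -/

theorem monotoneOn_of_Iic_of_Ici {y : ℝ → ℝ} {s : Set ℝ} (hs : s.OrdConnected) {c : ℝ}
    (h1 : MonotoneOn y (s ∩ Set.Iic c)) (h2 : MonotoneOn y (s ∩ Set.Ici c)) : MonotoneOn y s := by
  intro u hu v hv huv
  rcases le_total v c with h | h
  · exact h1 ⟨hu, huv.trans h⟩ ⟨hv, h⟩ huv
  · rcases le_total c u with h' | h'
    · exact h2 ⟨hu, h'⟩ ⟨hv, h'.trans huv⟩ huv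
    · have hc : c ∈ s := hs.out hu hv ⟨h', h⟩
      exact (h1 ⟨hu, h'⟩ ⟨hc, le_refl c⟩ h').trans (h2 ⟨hc, le_refl c⟩ ⟨hv, h⟩ h)

section Glue

variable {ι : Type*} {I : ι → ℝ × ℝ} {v : ι → ℝ → ℝ} {d : ι → ℝ}

/-- On a given interval only its own correction varies, the others being constant there. So
monotonicity can be checked for one correction at a time. -/
theorem monotoneOn_add_sum (hdisj : ∀ i j, i ≠ j → (I i).2 ≤ (I j).1 ∨ (I j).2 ≤ (I i).1)
    (hv0 : ∀ i γ, γ ≤ (I i).1 → v i γ = 0) (hv1 : ∀ i γ, (I i).2 ≤ γ → v i γ = d i) {H : ℝ → ℝ}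
    {J : Set ℝ} (hJ : J.OrdConnected) (hH : MonotoneOn H J)
    (hi : ∀ i, MonotoneOn (fun γ => H γ + v i γ) (J ∩ Set.Icc (I i).1 (I i).2)) (F : Finset ι) :
    MonotoneOn (fun γ => H γ + ∑ i ∈ F, v i γ) J := by
  classical
  induction F using Finset.induction_on with
  | empty => simpa using hH
  | insert i F hiF ih =>
    have hconst : ∀ x ∈ Set.Icc (I i).1 (I i).2, ∀ y ∈ Set.Icc (I i).1 (I i).2,
        ∑ j ∈ F, v j x = ∑ j ∈ F, v j y := by
      intro x hx y hy
      refine Finset.sum_congr rfl fun j hj => ?_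
      rcases hdisj j i (fun h => hiF (h ▸ hj)) with h | h
      · rw [hv1 j x (h.trans hx.1), hv1 j y (h.trans hy.1)]
      · rw [hv0 j x (hx.2.trans h), hv0 j y (hy.2.trans h)]
    simp only [Finset.sum_insert hiF]
    refine monotoneOn_of_Iic_of_Ici hJ (c := (I i).1) (fun x hx y hy hxy => ?_)
      (monotoneOn_of_Iic_of_Ici (hJ.inter Set.ordConnected_Ici) (c := (I i).2)
        (fun x hx y hy hxy => ?_) fun x hx y hy hxy => ?_)
    · have := ih hx.1 hy.1 hxy
      simp only at *
      rw [hv0 i x hx.2, hv0 i y hy.2]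
      linarith
    · have := hi i ⟨hx.1.1, hx.1.2, hx.2⟩ ⟨hy.1.1, hy.1.2, hy.2⟩ hxy
      have e := hconst x ⟨hx.1.2, hx.2⟩ y ⟨hy.1.2, hy.2⟩
      simp only at *
      linarith
    · have := ih hx.1.1 hy.1.1 hxy
      simp only at *
      rw [hv1 i x hx.2, hv1 i y hy.2]
      linarith

theorem monotoneOn_add_tsum (hdisj : ∀ i j, i ≠ j → (I i).2 ≤ (I j).1 ∨ (I j).2 ≤ (I i).1)
    (hv0 : ∀ i γ, γ ≤ (I i).1 → v i γ = 0) (hv1 : ∀ i γ, (I i).2 ≤ γ → v i γ = d i) {H : ℝ → ℝ}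
    {J : Set ℝ} (hJ : J.OrdConnected) (hH : MonotoneOn H J)
    (hi : ∀ i, MonotoneOn (fun γ => H γ + v i γ) (J ∩ Set.Icc (I i).1 (I i).2))
    (hsum : ∀ γ, Summable fun i => v i γ) : MonotoneOn (fun γ => H γ + ∑' i, v i γ) J := by
  intro x hx y hy hxy
  refine le_of_tendsto_of_tendsto ((hsum x).hasSum.const_add (H x)) ((hsum y).hasSum.const_add (H y))
    (Eventually.of_forall fun F => ?_)
  exact monotoneOn_add_sum hdisj hv0 hv1 hJ hH hi F hx hy hxy

theorem tsum_eq_of_disjoint (hdisj : ∀ i j, i ≠ j → (I i).2 ≤ (I j).1 ∨ (I j).2 ≤ (I i).1)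
    (hv0 : ∀ i γ, γ ≤ (I i).1 → v i γ = 0) (hv1 : ∀ i γ, (I i).2 ≤ γ → v i γ = d i)
    (hsum : ∀ γ, Summable fun i => v i γ) (i : ι) {x y : ℝ} (hx : x ∈ Set.Icc (I i).1 (I i).2)
    (hy : y ∈ Set.Icc (I i).1 (I i).2) :
    ∑' j, v j x - ∑' j, v j y = v i x - v i y := by
  classical
  rw [(hsum x).tsum_eq_add_tsum_ite i, (hsum y).tsum_eq_add_tsum_ite i]
  have : (∑' j, if j = i then 0 else v j x) = ∑' j, if j = i then 0 else v j y := by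
    refine tsum_congr fun j => ?_
    split_ifs with h
    · rfl
    · rcases hdisj j i h with h | h
      · rw [hv1 j x (h.trans hx.1), hv1 j y (h.trans hy.1)]
      · rw [hv0 j x (hx.2.trans h), hv0 j y (hy.2.trans h)]
  rw [this]
  ring

end Glue

/-- The correction is continued by constants. Being monotone and starting at zero, it is bounded by
its final value, which supplies a summable majorant. -/
theorem exists_truncation {w : ℝ → ℝ} {a b : ℝ} (hab : a ≤ b) (hw : ContinuousOn w (Set.Icc a b))
    (hmono : AntitoneOn w (Set.Icc a b) ∨ MonotoneOn w (Set.Icc a b)) (hwa : w a = 0) :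
    ∃ v : ℝ → ℝ, Continuous v ∧ Set.EqOn v w (Set.Icc a b) ∧ (∀ γ ≤ a, v γ = 0) ∧
      (∀ γ, b ≤ γ → v γ = w b) ∧ ∀ γ, |v γ| ≤ |w b| := by
  refine ⟨Set.IccExtend hab (Set.domRestrict _ w), hw.domRestrict.Icc_extend', fun γ hγ => ?_, fun γ hγ => ?_,
    fun γ hγ => ?_, fun γ => ?_⟩
  · rw [Set.IccExtend_of_mem _ _ hγ, Set.domRestrict_apply]
  · rw [Set.IccExtend_of_le_left _ _ hγ, Set.domRestrict_apply, hwa]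
  · rw [Set.IccExtend_of_right_le _ _ hγ, Set.domRestrict_apply]
  · set z := Set.projIcc a b hab γ
    have hl := Set.left_mem_Icc.2 hab
    have hr := Set.right_mem_Icc.2 hab
    change |w z| ≤ |w b|
    rcases hmono with h | h
    · have h1 := h hl z.2 z.2.1
      have h2 := h z.2 hr z.2.2
      rw [hwa] at h1
      rw [abs_of_nonpos h1, abs_of_nonpos (h2.trans h1)]
      linarith
    · have h1 := h hl z.2 z.2.1
      have h2 := h z.2 hr z.2.2
      rw [hwa] at h1
      rw [abs_of_nonneg h1, abs_of_nonneg (h1.trans h2)]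
      exact h2

theorem exists_periodic_extension {g : ℝ → ℝ} (hg : Continuous g) (h : g 0 = g Real.pi) :
    ∃ g' : ℝ → ℝ, Continuous g' ∧ (∀ γ, g' (γ + Real.pi) = g' γ) ∧ Set.EqOn g' g (Set.Icc 0 Real.pi) := by
  have : Fact (0 < Real.pi) := ⟨Real.pi_pos⟩
  have hco : Set.EqOn (fun γ : ℝ => AddCircle.liftIco Real.pi 0 g (γ : AddCircle Real.pi)) g
      (Set.Icc 0 Real.pi) := by
    intro γ hγ
    rcases hγ.2.eq_or_lt with rfl | hlt
    · change AddCircle.liftIco Real.pi 0 g ((Real.pi : ℝ) : AddCircle Real.pi) = _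
      rw [AddCircle.coe_period, ← h]
      exact AddCircle.liftIco_coe_apply (a := 0) (x := 0) ⟨le_rfl, by simpa using Real.pi_pos⟩
    · exact AddCircle.liftIco_coe_apply ⟨hγ.1, by simpa using hlt⟩
  refine ⟨fun γ => AddCircle.liftIco Real.pi 0 g (γ : AddCircle Real.pi), ?_, fun γ => ?_, hco⟩
  · exact (AddCircle.liftIco_continuous (by simpa using h) hg.continuousOn).comp
      (AddCircle.continuous_mk' Real.pi)
  · change AddCircle.liftIco Real.pi 0 g ((γ + Real.pi : ℝ) : AddCircle Real.pi) = _
    rw [AddCircle.coe_add_period]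

/-- The logarithm of the radius of an invariant sphere, as a function of the argument. -/
structure IsSphereRadius (𝒜 : Set Mat) (g : ℝ → ℝ) : Prop where
  continuous : Continuous g
  periodic : ∀ γ, g (γ + Real.pi) = g γ
  gapArc : ∀ I ∈ gaps 𝒜, IsGapArc 𝒜 I g
  dominates : ∀ A ∈ convexHull ℝ 𝒜, ∀ a b, 0 ≤ a → b ≤ Real.pi → Dominates g A (Set.Icc a b)

theorem gaps_separated {𝒜 : Set Mat} {I J : ℝ × ℝ} (hI : I ∈ pieces 𝒜) (hJ : J ∈ pieces 𝒜)
    (hne : I ≠ J) : I.2 ≤ J.1 ∨ J.2 ≤ I.1 := by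
  by_contra! h
  have h1 := (GoodFamily.piece_lt hI).1
  have h2 := (GoodFamily.piece_lt hJ).1
  have hlt : max I.1 J.1 < min I.2 J.2 := max_lt (lt_min h1 h.2) (lt_min h.1 h2)
  obtain ⟨x, hx1, hx2⟩ := exists_between hlt
  exact hne (GoodFamily.eq_of_mem_pieces hI hJ
    ⟨(le_max_left _ _).trans_lt hx1, hx2.trans_le (min_le_left _ _)⟩
    ⟨(le_max_right _ _).trans_lt hx1, hx2.trans_le (min_le_right _ _)⟩)

/-- The log-radius of the given sphere plus the sum of the truncated corrections over the intervals
of `P`. Summability of `s` and of the old increments makes the sum converge uniformly, and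
domination passes to it by `monotoneOn_add_tsum`. -/
theorem Setting.exists_isSphereRadius {𝒜 : Set Mat} {f : Seminorm ℝ Plane} (S : Setting 𝒜 f)
    (s : setP 𝒜 → ℝ) (hs : ∀ p : setP 𝒜, lowerBd 𝒜 p ≤ ((s p : ℝ) : EReal) ∧
      ((s p : ℝ) : EReal) ≤ upperBd 𝒜 p) (hsum : Summable s)
    (htsum : ∑' p : setP 𝒜, s p = ∑' p : setP 𝒜, increment f p) :
    ∃ g, IsSphereRadius 𝒜 g ∧ ∀ p : setP 𝒜, g p.1.2 - g p.1.1 = s p := by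
  have hP : setP 𝒜 ⊆ pieces 𝒜 := fun p hp => Or.inr hp.1
  have hg := continuous_logRadius S.definite
  have hsumf := S.summable_increment hP
  have hk := fun p : setP 𝒜 => S.exists_isGapArc p.2 (hs p).1 (hs p).2
  choose k harc hk1 hk2 hmono using hk
  have hlt : ∀ p : setP 𝒜, p.1.1 < p.1.2 := fun p => (mem_gaps p.2.1).1
  have hv := fun p : setP 𝒜 => exists_truncation (hlt p).le
    ((harc p).continuousOn.sub hg.continuousOn) (hmono p) (sub_eq_zero.2 (hk1 p))
  choose v hvc hveq hv0 hv1 hvle using hv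
  have hd : ∀ p : setP 𝒜, k p p.1.2 - logRadius f p.1.2 = s p - increment f p := fun p => by
    rw [← hk2 p, increment, hk1 p]; ring
  simp only [Pi.sub_apply, hd] at hv1 hvle
  have hdisj : ∀ p q : setP 𝒜, p ≠ q → p.1.2 ≤ q.1.1 ∨ q.1.2 ≤ p.1.1 := fun p q hne =>
    gaps_separated (hP p.2) (hP q.2) fun h => hne (Subtype.ext h)
  have hsumd : Summable fun p : setP 𝒜 => |s p - increment f p| := (hsum.sub hsumf).abs
  have hsumv : ∀ γ, Summable fun p : setP 𝒜 => v p γ := fun γ =>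
    Summable.of_norm_bounded hsumd fun p => hvle p γ
  set g₁ : ℝ → ℝ := fun γ => logRadius f γ + ∑' p, v p γ with hg₁
  have hg₁c : Continuous g₁ := hg.add (continuous_tsum hvc hsumd fun p γ => hvle p γ)
  have h0 : g₁ 0 = logRadius f 0 := by
    have : ∀ p, v p 0 = 0 := fun p => hv0 p 0 (mem_gaps p.2.1).2.1
    simp [hg₁, this]
  -- The total correction at `π` is the difference of the two sums of increments, which is zero; so
  -- the curve extends periodically.
  have hπ : g₁ Real.pi = logRadius f 0 := by
    have : ∀ p, v p Real.pi = s p - increment f p := fun p => hv1 p _ (mem_gaps p.2.1).2.2.1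
    have e : logRadius f Real.pi = logRadius f 0 := by rw [← zero_add Real.pi, logRadius_add_pi]
    simp only [hg₁, this, hsum.tsum_sub hsumf, htsum, e, sub_self, add_zero]
  obtain ⟨g, hgc, hgper, hgeq⟩ := exists_periodic_extension hg₁c (h0.trans hπ.symm)
  have hgp : ∀ p : setP 𝒜, ∀ γ ∈ Set.Icc p.1.1 p.1.2, g γ = k p γ + (g p.1.1 - k p p.1.1) := by
    intro p γ hγ
    have hsub := Set.Icc_subset_Icc (mem_gaps p.2.1).2.1 (mem_gaps p.2.1).2.2.1
    have hl := Set.left_mem_Icc.2 (hlt p).le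
    rw [hgeq (hsub hγ), hgeq (hsub hl)]
    have h1 := tsum_eq_of_disjoint hdisj hv0 hv1 hsumv p hγ hl
    rw [hveq p hγ, hveq p hl] at h1
    simp only [hg₁, Pi.sub_apply] at *
    linarith
  refine ⟨g, ⟨hgc, hgper, fun I hI => ?_, fun A hA a b ha hb => ?_⟩, fun p => ?_⟩
  · by_cases hIP : I ∈ setP 𝒜
    · exact ((harc ⟨I, hIP⟩).add_const _).congr (hgp ⟨I, hIP⟩)
    · refine ((S.isGapArc hI).add_const (g I.1 - logRadius f I.1)).congr fun γ hγ => ?_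
      obtain ⟨hltI, hI0, hIπ, -⟩ := mem_gaps hI
      have hsub := Set.Icc_subset_Icc hI0 hIπ
      have hl := Set.left_mem_Icc.2 hltI.le
      simp only
      rw [hgeq (hsub hγ), hgeq (hsub hl)]
      have : ∑' p, v p γ = ∑' p, v p I.1 := by
        refine tsum_congr fun p => ?_
        rcases gaps_separated (hP p.2) (Or.inr hI) (fun h => hIP (h ▸ p.2)) with h | h
        · rw [hv1 p _ (h.trans hγ.1), hv1 p _ h]
        · rw [hv0 p _ (hγ.2.trans h), hv0 p _ (hltI.le.trans h)]
      simp only [hg₁, this]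
      ring
  · intro ε Λ hε hΛ
    have hsub : Set.Icc a b ⊆ Set.Icc 0 Real.pi := Set.Icc_subset_Icc ha hb
    have := monotoneOn_add_tsum (I := fun p : setP 𝒜 => p.1) (v := fun p γ => ε * v p γ)
      (d := fun p => ε * (s p - increment f p)) (H := fun γ => ε * (logRadius f γ - Λ γ))
      (J := Set.Icc a b) hdisj
      (fun p γ h => by rw [hv0 p γ h, mul_zero]) (fun p γ h => by rw [hv1 p γ h]) Set.ordConnected_Icc
      (S.dominates_logRadius hA a b ε Λ hε hΛ) (fun p => ?_) (fun γ => (hsumv γ).mul_left ε)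
    · refine this.congr fun γ hγ => ?_
      simp only [tsum_mul_left]
      rw [hgeq (hsub hγ)]
      simp only [hg₁]
      ring
    · rw [Set.Icc_inter_Icc]
      have h1 := S.dominates_of_isGapArc p.2.1 (harc p) hA (a := a ⊔ p.1.1) (b := b ⊓ p.1.2)
        le_sup_right inf_le_right ε Λ (fun γ hγ => hε γ ⟨le_sup_left.trans hγ.1, hγ.2.trans inf_le_left⟩)
        (fun γ hγ => hΛ γ ⟨le_sup_left.trans hγ.1, hγ.2.trans inf_le_left⟩)
      refine h1.congr fun γ hγ => ?_
      simp only
      rw [hveq p ⟨le_sup_right.trans hγ.1, hγ.2.trans inf_le_right⟩, Pi.sub_apply]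
      ring
  · rw [hgp p _ (Set.right_mem_Icc.2 (hlt p).le), ← hk2 p]
    ring

/-! ### Decrease of the gauge along the flows -/

theorem hasDerivAt_flow' (A : Mat) (x : Plane) (t : ℝ) :
    HasDerivAt (fun s => flow A s x) (flow A t (act A x)) t := by
  have h := hasDerivAt_exp_smul_const (op A) t
  exact h.clm_apply (hasDerivAt_const t x) |>.congr_deriv (by simp [flow, act_eq_op])

theorem flow_eq_exp_smul {A : Mat} {x : Plane} {c : ℝ} (h : act A x = c • x) (t : ℝ) :
    flow A t x = Real.exp (c * t) • x := by
  have hd : ∀ t, HasDerivAt (fun s => Real.exp (-c * s) • flow A s x) 0 t := by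
    intro t
    have h1 : HasDerivAt (fun s => Real.exp (-c * s)) (Real.exp (-c * t) * -c) t := by
      simpa using ((hasDerivAt_id t).const_mul (-c)).exp
    have h2 := h1.smul (hasDerivAt_flow' A x t)
    refine h2.congr_deriv ?_
    rw [h, map_smul]
    module
  have h3 := is_const_of_deriv_eq_zero (fun t => (hd t).differentiableAt) (fun t => (hd t).deriv) t 0
  simp only [mul_zero, Real.exp_zero, one_smul, flow_zero] at h3
  have h4 := congrArg (fun y => Real.exp (c * t) • y) h3
  simp only [smul_smul, ← Real.exp_add] at h4
  simpa using h4

theorem flow_ne_zero {A : Mat} {x : Plane} (hx : x ≠ 0) (t : ℝ) : flow A t x ≠ 0 := fun h => by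
  have := flow_neg_flow A t x
  rw [h, map_zero] at this
  exact hx this.symm

/-! ### The homogeneous function with a prescribed polar radius, and flows in polar coordinates -/

theorem polar_eq_smul_unitVec {γ a b : ℝ} (ha : 0 < a) :
    a • unitVec γ + b • normalVec γ = √(a ^ 2 + b ^ 2) • unitVec (γ + Real.arctan (b / a)) := by
  have e : √(1 + (b / a) ^ 2) = √(a ^ 2 + b ^ 2) / a := by
    rw [show 1 + (b / a) ^ 2 = (a ^ 2 + b ^ 2) / a ^ 2 by field_simp, Real.sqrt_div (by positivity),
      Real.sqrt_sq ha.le]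
  have hr : 0 < √(a ^ 2 + b ^ 2) := Real.sqrt_pos.2 (by positivity)
  rw [unitVec_add, Real.cos_arctan, Real.sin_arctan, e, smul_add, smul_smul, smul_smul, polar_eq_iff]
  constructor <;> field_simp

theorem eq_of_unitVec_eq {g : ℝ → ℝ} (hg : Function.Periodic g Real.pi) {γ δ r s : ℝ} (hr : r ≠ 0)
    (h : r • unitVec γ = s • unitVec δ) : g γ = g δ := by
  have h0 := congrArg (fun x : Plane => x 0) h
  have h1 := congrArg (fun x : Plane => x 1) h
  simp [unitVec] at h0 h1
  have hs : Real.sin (γ - δ) = 0 := by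
    refine (mul_eq_zero.1 ?_).resolve_left hr
    rw [Real.sin_sub]
    linear_combination Real.cos δ * h1 - Real.sin δ * h0
  obtain ⟨n, hn⟩ := Real.sin_eq_zero_iff.1 hs
  have := hg.int_mul n δ
  rw [hn] at this
  rw [← this]
  ring_nf

/-- The positively homogeneous function whose unit sphere has the logarithmic radius `g`. -/
noncomputable def gauge (g : ℝ → ℝ) (x : Plane) : ℝ :=
  ‖x‖ * Real.exp (-g (exists_eq_smul_unitVec x).choose)

section Gauge

variable {g : ℝ → ℝ}

theorem gauge_smul_unitVec (hg : Function.Periodic g Real.pi) (r γ : ℝ) :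
    gauge g (r • unitVec γ) = |r| * Real.exp (-g γ) := by
  rw [gauge]
  rcases eq_or_ne r 0 with rfl | hr
  · simp
  · have h := (exists_eq_smul_unitVec (r • unitVec γ)).choose_spec
    rw [← eq_of_unitVec_eq hg hr h, norm_smul, norm_unitVec, Real.norm_eq_abs, mul_one]

theorem gauge_unitVec (hg : Function.Periodic g Real.pi) (γ : ℝ) :
    gauge g (unitVec γ) = Real.exp (-g γ) := by
  have := gauge_smul_unitVec hg 1 γ
  simpa using this

theorem gauge_smul (hg : Function.Periodic g Real.pi) (r : ℝ) (x : Plane) :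
    gauge g (r • x) = |r| * gauge g x := by
  obtain ⟨γ, h⟩ := exists_eq_smul_unitVec x
  rw [h, smul_smul, gauge_smul_unitVec hg, gauge_smul_unitVec hg, abs_mul, mul_assoc]

theorem gauge_polar (hg : Function.Periodic g Real.pi) {γ a b : ℝ} (ha : 0 < a) :
    gauge g (a • unitVec γ + b • normalVec γ) =
      √(a ^ 2 + b ^ 2) * Real.exp (-g (γ + Real.arctan (b / a))) := by
  rw [polar_eq_smul_unitVec ha, gauge_smul_unitVec hg, abs_of_nonneg (Real.sqrt_nonneg _)]

theorem polar_components (γ : ℝ) (x : Plane) :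
    x = (x 0 * Real.cos γ + x 1 * Real.sin γ) • unitVec γ +
      (x 1 * Real.cos γ - x 0 * Real.sin γ) • normalVec γ := by
  have e := Real.cos_sq_add_sin_sq γ
  apply plane_ext
  · simp [unitVec, normalVec]; linear_combination -(x 0) * e
  · simp [unitVec, normalVec]; linear_combination -(x 1) * e

/-- In an open half-plane around `x` the argument is a continuous arctangent; periodicity makes the
chosen argument in the definition irrelevant. -/
theorem continuousAt_gauge (hg : Function.Periodic g Real.pi) (hc : Continuous g) {x : Plane}
    (hx : x ≠ 0) : ContinuousAt (gauge g) x := by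
  obtain ⟨γ, hγ⟩ := exists_eq_smul_unitVec x
  have hca : Continuous fun y : Plane => y 0 * Real.cos γ + y 1 * Real.sin γ := by fun_prop
  have hcb : Continuous fun y : Plane => y 1 * Real.cos γ - y 0 * Real.sin γ := by fun_prop
  have hpos : 0 < x 0 * Real.cos γ + x 1 * Real.sin γ := by
    have : x 0 * Real.cos γ + x 1 * Real.sin γ = ‖x‖ := by
      have h0 := congrArg (fun x : Plane => x 0) hγ
      have h1 := congrArg (fun x : Plane => x 1) hγ
      simp [unitVec] at h0 h1
      rw [h0, h1]
      linear_combination ‖x‖ * Real.cos_sq_add_sin_sq γ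
    rw [this]
    exact norm_pos_iff.2 hx
  have hev : gauge g =ᶠ[𝓝 x] fun y =>
      √((y 0 * Real.cos γ + y 1 * Real.sin γ) ^ 2 + (y 1 * Real.cos γ - y 0 * Real.sin γ) ^ 2) *
      Real.exp (-g (γ + Real.arctan ((y 1 * Real.cos γ - y 0 * Real.sin γ) /
        (y 0 * Real.cos γ + y 1 * Real.sin γ)))) := by
    filter_upwards [hca.continuousAt.eventually (lt_mem_nhds hpos)] with y hy
    rw [← gauge_polar hg hy, ← polar_components]
  refine ContinuousAt.congr ?_ hev.symm
  have h1 : ContinuousAt (fun y : Plane => (y 1 * Real.cos γ - y 0 * Real.sin γ) /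
        (y 0 * Real.cos γ + y 1 * Real.sin γ)) x :=
    hcb.continuousAt.div hca.continuousAt hpos.ne'
  have h2 : ContinuousAt (fun y : Plane => γ + Real.arctan ((y 1 * Real.cos γ - y 0 * Real.sin γ) /
        (y 0 * Real.cos γ + y 1 * Real.sin γ))) x :=
    continuousAt_const.add (Real.continuous_arctan.continuousAt.comp h1)
  exact (((hca.pow 2).add (hcb.pow 2)).sqrt.continuousAt).mul
    (Real.continuous_exp.continuousAt.comp (hc.continuousAt.comp h2).neg)

/-- The polar coordinates along the flow of a constant matrix. -/
theorem exists_polar_flow (A : Mat) (γ : ℝ) : ∃ θ L : ℝ → ℝ, θ 0 = γ ∧ L 0 = 0 ∧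
    ∃ T > 0, ∀ t, |t| < T → flow A t (unitVec γ) = Real.exp (L t) • unitVec (θ t) ∧
      HasDerivAt θ (angular A (θ t)) t ∧ HasDerivAt L (radial A (θ t)) t := by
  set y : ℝ → Plane := fun t => flow A t (unitVec γ) with hy
  set a : ℝ → ℝ := fun t => y t 0 * Real.cos γ + y t 1 * Real.sin γ with ha
  set b : ℝ → ℝ := fun t => y t 1 * Real.cos γ - y t 0 * Real.sin γ with hb
  have hyi : ∀ (i : Fin 2) t, HasDerivAt (fun s => y s i) (act A (y t) i) t := fun i t =>
    (EuclideanSpace.proj (𝕜 := ℝ) i : Plane →L[ℝ] ℝ).hasFDerivAt.comp_hasDerivAt t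
      (hasDerivAt_flow A (unitVec γ) t)
  have hpolar : ∀ t, y t = a t • unitVec γ + b t • normalVec γ := fun t => polar_components γ (y t)
  have hda : ∀ t, HasDerivAt a (act A (y t) 0 * Real.cos γ + act A (y t) 1 * Real.sin γ) t :=
    fun t => ((hyi 0 t).mul_const _).add ((hyi 1 t).mul_const _)
  have hdb : ∀ t, HasDerivAt b (act A (y t) 1 * Real.cos γ - act A (y t) 0 * Real.sin γ) t :=
    fun t => ((hyi 1 t).mul_const _).sub ((hyi 0 t).mul_const _)
  have hy0 : y 0 = unitVec γ := flow_zero A _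
  have ha0 : a 0 = 1 := by
    simp only [ha, hy0, unitVec]
    simp only [Matrix.cons_val_zero, Matrix.cons_val_one]
    linear_combination Real.cos_sq_add_sin_sq γ
  have hb0 : b 0 = 0 := by
    simp only [hb, hy0, unitVec]
    simp only [Matrix.cons_val_zero, Matrix.cons_val_one]
    ring
  have hpos : ∀ᶠ t in 𝓝 0, 0 < a t := (hda 0).continuousAt.eventually (lt_mem_nhds (by rw [ha0]; exact one_pos))
  obtain ⟨T, hT, hball⟩ := Metric.eventually_nhds_iff.1 hpos
  refine ⟨fun t => γ + Real.arctan (b t / a t), fun t => Real.log (a t ^ 2 + b t ^ 2) / 2,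
    by simp [hb0], by simp [ha0, hb0], T, hT, fun t ht => ?_⟩
  have hat : 0 < a t := hball (by rwa [Real.dist_eq, sub_zero])
  have hr2 : 0 < a t ^ 2 + b t ^ 2 := by positivity
  have hexp : Real.exp (Real.log (a t ^ 2 + b t ^ 2) / 2) = √(a t ^ 2 + b t ^ 2) := by
    rw [Real.sqrt_eq_rpow, Real.rpow_def_of_pos hr2]
    ring_nf
  have hflow : y t = √(a t ^ 2 + b t ^ 2) • unitVec (γ + Real.arctan (b t / a t)) := by
    rw [hpolar t, polar_eq_smul_unitVec hat]
  refine ⟨by rw [hexp]; exact hflow, ?_⟩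
  set θ := γ + Real.arctan (b t / a t) with hθ
  set r := √(a t ^ 2 + b t ^ 2) with hr
  have hr0 : 0 < r := Real.sqrt_pos.2 hr2
  have hrr : r ^ 2 = a t ^ 2 + b t ^ 2 := Real.sq_sqrt hr2.le
  have hcs : a t = r * Real.cos (θ - γ) ∧ b t = r * Real.sin (θ - γ) := by
    have h1 := hpolar t
    rw [hflow, show θ = γ + (θ - γ) by ring, unitVec_add, smul_add, smul_smul, smul_smul,
      polar_eq_iff] at h1
    exact ⟨h1.1.symm, h1.2.symm⟩
  have hact : act A (y t) = (r * radial A θ) • unitVec θ + (r * angular A θ) • normalVec θ := by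
    rw [hflow, act_smul_right, act_unitVec]
    module
  have hcos : Real.cos θ = Real.cos γ * Real.cos (θ - γ) - Real.sin γ * Real.sin (θ - γ) := by
    rw [← Real.cos_add]; ring_nf
  have hsin : Real.sin θ = Real.sin γ * Real.cos (θ - γ) + Real.cos γ * Real.sin (θ - γ) := by
    rw [← Real.sin_add]; ring_nf
  have e := Real.cos_sq_add_sin_sq γ
  have hA0 : act A (y t) 0 = r * radial A θ * Real.cos θ - r * angular A θ * Real.sin θ := by
    rw [hact]; simp [unitVec, normalVec]; ring
  have hA1 : act A (y t) 1 = r * radial A θ * Real.sin θ + r * angular A θ * Real.cos θ := by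
    rw [hact]; simp [unitVec, normalVec]
  have hda' : HasDerivAt a (radial A θ * a t - angular A θ * b t) t := by
    refine (hda t).congr_deriv ?_
    rw [hA0, hA1, hcs.1, hcs.2, hcos, hsin]
    linear_combination (r * radial A θ * Real.cos (θ - γ) - r * angular A θ * Real.sin (θ - γ)) * e
  have hdb' : HasDerivAt b (radial A θ * b t + angular A θ * a t) t := by
    refine (hdb t).congr_deriv ?_
    rw [hA0, hA1, hcs.1, hcs.2, hcos, hsin]
    linear_combination (r * radial A θ * Real.sin (θ - γ) + r * angular A θ * Real.cos (θ - γ)) * e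
  constructor
  · refine ((hdb'.div hda' hat.ne').arctan.const_add γ).congr_deriv ?_
    have : 1 + (b t / a t) ^ 2 = (a t ^ 2 + b t ^ 2) / a t ^ 2 := by field_simp
    rw [Pi.div_apply, this]
    field_simp
    ring
  · refine ((((hda'.pow 2).add (hdb'.pow 2)).log hr2.ne').div_const 2).congr_deriv ?_
    simp only [Pi.add_apply, Pi.pow_apply]
    field_simp
    ring

/-- With `Λ` the log-radius of the trajectory of `A` as a function of the argument, `L - Λ ∘ θ` is
constant along the flow. So the logarithm of the gauge is `Λ - g` at the current argument, up to a
constant. -/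
theorem gauge_flow_le_of_compare (hg : Function.Periodic g Real.pi) {A : Mat} {γ ε δ : ℝ} (hδ : 0 < δ)
    (hpos : ∀ x, |x - γ| < δ → 0 < ε * angular A x)
    (hcmp : ∀ Λ : ℝ → ℝ, (∀ x, |x - γ| < δ → HasDerivAt Λ (radial A x / angular A x) x) →
      ∀ x, |x - γ| < δ → 0 ≤ ε * (x - γ) → Λ x - g x ≤ Λ γ - g γ) :
    ∃ T > 0, ∀ t, 0 ≤ t → t < T → gauge g (flow A t (unitVec γ)) ≤ gauge g (unitVec γ) := by
  obtain ⟨θ, L, hθ0, hL0, T, hT, hpol⟩ := exists_polar_flow A γ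
  have hball : ∀ x, |x - γ| < δ ↔ x ∈ Set.Ioo (γ - δ) (γ + δ) := fun x => by
    rw [abs_lt, Set.mem_Ioo]
    constructor <;> rintro ⟨h1, h2⟩ <;> constructor <;> linarith
  have hne : ∀ x ∈ Set.Ioo (γ - δ) (γ + δ), angular A x ≠ 0 := fun x hx h0 => by
    have := hpos x ((hball x).2 hx)
    rw [h0, mul_zero] at this
    exact lt_irrefl _ this
  have hcont : ContinuousOn (fun x => radial A x / angular A x) (Set.Ioo (γ - δ) (γ + δ)) :=
    ((continuous_radial.comp (continuous_const.prodMk continuous_id)).continuousOn).div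
      ((continuous_angular.comp (continuous_const.prodMk continuous_id)).continuousOn) hne
  have hγm : γ ∈ Set.Ioo (γ - δ) (γ + δ) := ⟨by linarith, by linarith⟩
  set Λ : ℝ → ℝ := fun x => ∫ v in γ..x, radial A v / angular A v with hΛ
  have hΛd : ∀ x ∈ Set.Ioo (γ - δ) (γ + δ), HasDerivAt Λ (radial A x / angular A x) x := by
    intro x hx
    refine intervalIntegral.integral_hasDerivAt_right ?_ ?_ (hcont.continuousAt (Ioo_mem_nhds hx.1 hx.2))
    · refine (hcont.mono fun z hz => ?_).intervalIntegrable
      exact Set.ordConnected_Ioo.uIcc_subset hγm hx hz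
    · exact hcont.stronglyMeasurableAtFilter isOpen_Ioo x hx
  have hθc : ContinuousAt θ 0 := (hpol 0 (by simpa using hT)).2.1.continuousAt
  obtain ⟨T', hT', hθb⟩ := Metric.continuousAt_iff.1 hθc δ hδ
  rw [hθ0] at hθb
  simp only [Real.dist_eq, sub_zero] at hθb
  refine ⟨min T T', lt_min hT hT', fun t ht0 htT => ?_⟩
  have hin : ∀ s ∈ Set.Icc 0 t, |s| < T ∧ |θ s - γ| < δ := fun s hs => by
    have : |s| < min T T' := by rw [abs_of_nonneg hs.1]; exact hs.2.trans_lt htT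
    exact ⟨this.trans_le (min_le_left _ _), hθb (this.trans_le (min_le_right _ _))⟩
  have h0m := Set.left_mem_Icc.2 ht0
  have htm := Set.right_mem_Icc.2 ht0
  have hmono : 0 ≤ ε * (θ t - γ) := by
    have := monotoneOn_of_exists_hasDerivAt (y := fun s => ε * θ s) (a := 0) (b := t) (t := 0)
      (fun s hs => (((hpol s (hin s hs).1).2.1).const_mul ε).continuousAt.continuousWithinAt)
      (fun s hs _ => by
        have hs' := hin s (Set.Ioo_subset_Icc_self hs)
        exact ⟨_, (hpos _ hs'.2).le, ((hpol s hs'.1).2.1).const_mul ε⟩) h0m htm ht0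
    simp only [hθ0] at this
    linarith
  have hzero : ∀ s ∈ Set.Icc 0 t, HasDerivAt (fun s => L s - Λ (θ s)) 0 s := by
    intro s hs
    obtain ⟨h1, h2⟩ := hin s hs
    have h3 := (hball _).1 h2
    have h4 := HasDerivAt.comp s (hΛd _ h3) (hpol s h1).2.1
    refine ((hpol s h1).2.2.sub h4).congr_deriv ?_
    rw [div_mul_cancel₀ _ (hne _ h3), sub_self]
  have hle := antitoneOn_Icc_of_hasDerivAt (y := fun s => L s - Λ (θ s))
    (fun s hs => (hzero s hs).continuousAt.continuousWithinAt)
    (fun s hs => ⟨0, le_rfl, hzero s (Set.Ioo_subset_Icc_self hs)⟩) h0m htm ht0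
  simp only [hθ0, hL0] at hle
  have hfin := hcmp Λ (fun x hx => hΛd x ((hball x).1 hx)) (θ t) (hin t htm).2 hmono
  rw [(hpol t (hin t htm).1).1, gauge_smul_unitVec hg, gauge_unitVec hg, abs_of_pos (Real.exp_pos _),
    ← Real.exp_add]
  refine Real.exp_le_exp.2 ?_
  linarith

end Gauge

section Decrease

/-! ### The gauge does not increase along the flows of the convex hull -/

variable {𝒜 : Set Mat} {f : Seminorm ℝ Plane} {g : ℝ → ℝ}

/-- Domination is known only inside `[0, π]`. So the direction is represented by an argument with
room in the sense of rotation: in `(0, π]` for clockwise and in `[0, π)` for counterclockwise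
motion. -/
theorem IsSphereRadius.gauge_flow_le_unitVec (hg : IsSphereRadius 𝒜 g) (S : Setting 𝒜 f) {A : Mat}
    (hA : A ∈ convexHull ℝ 𝒜) (γ : ℝ) :
    ∃ T > 0, ∀ t, 0 ≤ t → t < T → gauge g (flow A t (unitVec γ)) ≤ gauge g (unitVec γ) := by
  have hper : Function.Periodic g Real.pi := hg.periodic
  have hred : ∀ δ r : ℝ, unitVec γ = r • unitVec δ →
      (∃ T > 0, ∀ t, 0 ≤ t → t < T → gauge g (flow A t (unitVec δ)) ≤ gauge g (unitVec δ)) →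
      ∃ T > 0, ∀ t, 0 ≤ t → t < T → gauge g (flow A t (unitVec γ)) ≤ gauge g (unitVec γ) := by
    rintro δ r h ⟨T, hT, hle⟩
    refine ⟨T, hT, fun t h0 ht => ?_⟩
    rw [h, map_smul, gauge_smul hper, gauge_smul hper]
    exact mul_le_mul_of_nonneg_left (hle t h0 ht) (abs_nonneg r)
  obtain ⟨γ₁, hγ₁, r, -, hr⟩ := exists_eq_smul_unitVec_mem (unitVec γ)
  have hang : Continuous fun x => angular A x :=
    continuous_angular.comp (continuous_const.prodMk continuous_id)
  rcases lt_trichotomy (angular A γ₁) 0 with h | h | h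
  · obtain ⟨γ₂, hγ₂, r₂, hr₂, hneg⟩ : ∃ γ₂ ∈ Set.Ioc 0 Real.pi, ∃ r₂ : ℝ,
        unitVec γ = r₂ • unitVec γ₂ ∧ angular A γ₂ < 0 := by
      rcases hγ₁.1.eq_or_lt with rfl | h0
      · refine ⟨0 + Real.pi, ⟨by linarith [Real.pi_pos], by linarith⟩, -r, ?_, ?_⟩
        · rw [unitVec_add_pi, smul_neg, neg_smul, neg_neg, ← hr]
        · rwa [angular_add_pi]
      · exact ⟨γ₁, ⟨h0, hγ₁.2.le⟩, r, hr, h⟩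
    refine hred γ₂ r₂ hr₂ ?_
    obtain ⟨δ, hδ, hball⟩ := Metric.eventually_nhds_iff.1 (hang.continuousAt.eventually (gt_mem_nhds hneg))
    refine gauge_flow_le_of_compare hper (ε := -1) (lt_min hδ hγ₂.1) (fun x hx => ?_)
      fun Λ hΛ x hx hxγ => ?_
    · have := hball (y := x) (hx.trans_le (min_le_left _ _))
      linarith
    · have hsub : ∀ z ∈ Set.Icc x γ₂, |z - γ₂| < min δ γ₂ := fun z hz => by
        rw [abs_of_nonpos (by linarith [hz.2])]
        rw [abs_of_nonpos (by linarith)] at hx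
        linarith [hz.1]
      have hx0 : 0 ≤ x := by
        have := hx.trans_le (min_le_right _ _)
        rw [abs_of_nonpos (by linarith)] at this
        linarith
      have hxle : x ≤ γ₂ := by linarith
      have := hg.dominates A hA x γ₂ hx0 hγ₂.2 (-1) Λ (fun z hz => by
        have := hball (y := z) ((hsub z hz).trans_le (min_le_left _ _))
        linarith) (fun z hz => hΛ z (hsub z hz)) (Set.left_mem_Icc.2 hxle) (Set.right_mem_Icc.2 hxle) hxle
      simp only at this
      linarith
  · refine hred γ₁ r hr ⟨1, one_pos, fun t ht _ => ?_⟩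
    obtain ⟨m, hm⟩ := S.exists_admissibleSlope γ₁
    have hle := hm.convexHull A hA
    rw [h, mul_zero] at hle
    have hact : act A (unitVec γ₁) = radial A γ₁ • unitVec γ₁ := by rw [act_unitVec, h]; simp
    rw [flow_eq_exp_smul hact, gauge_smul hper, abs_of_pos (Real.exp_pos _)]
    have h1 : Real.exp (radial A γ₁ * t) ≤ 1 := Real.exp_le_one_iff.2 (mul_nonpos_of_nonpos_of_nonneg hle ht)
    have h2 : 0 ≤ gauge g (unitVec γ₁) := by rw [gauge_unitVec hper]; exact (Real.exp_pos _).le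
    nlinarith
  · refine hred γ₁ r hr ?_
    obtain ⟨δ, hδ, hball⟩ := Metric.eventually_nhds_iff.1 (hang.continuousAt.eventually (lt_mem_nhds h))
    refine gauge_flow_le_of_compare hper (ε := 1) (lt_min hδ (sub_pos.2 hγ₁.2)) (fun x hx => ?_)
      fun Λ hΛ x hx hxγ => ?_
    · have := hball (y := x) (hx.trans_le (min_le_left _ _))
      linarith
    · have hsub : ∀ z ∈ Set.Icc γ₁ x, |z - γ₁| < min δ (Real.pi - γ₁) := fun z hz => by
        rw [abs_of_nonneg (by linarith [hz.1])]
        rw [abs_of_nonneg (by linarith)] at hx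
        linarith [hz.2]
      have hx0 : x ≤ Real.pi := by
        have := hx.trans_le (min_le_right _ _)
        rw [abs_of_nonneg (by linarith)] at this
        linarith
      have hxle : γ₁ ≤ x := by linarith
      have := hg.dominates A hA γ₁ x hγ₁.1 hx0 1 Λ (fun z hz => by
        have := hball (y := z) ((hsub z hz).trans_le (min_le_left _ _))
        linarith) (fun z hz => hΛ z (hsub z hz)) (Set.left_mem_Icc.2 hxle) (Set.right_mem_Icc.2 hxle) hxle
      simp only at this
      linarith

/-- The local decrease at every point of the orbit bounds the right difference quotients by zero,
which suffices for a continuous function. -/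
theorem IsSphereRadius.gauge_flow_le (hg : IsSphereRadius 𝒜 g) (S : Setting 𝒜 f) {A : Mat}
    (hA : A ∈ convexHull ℝ 𝒜) (x : Plane) {t : ℝ} (ht : 0 ≤ t) :
    gauge g (flow A t x) ≤ gauge g x := by
  have hper : Function.Periodic g Real.pi := hg.periodic
  rcases eq_or_ne x 0 with rfl | hx
  · rw [map_zero]
  have hloc : ∀ y : Plane, ∃ T > 0, ∀ t, 0 ≤ t → t < T → gauge g (flow A t y) ≤ gauge g y := by
    intro y
    obtain ⟨γ, hγ⟩ := exists_eq_smul_unitVec y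
    obtain ⟨T, hT, hle⟩ := hg.gauge_flow_le_unitVec S hA γ
    refine ⟨T, hT, fun t h0 hT => ?_⟩
    rw [hγ, map_smul, gauge_smul hper, gauge_smul hper]
    exact mul_le_mul_of_nonneg_left (hle t h0 hT) (abs_nonneg _)
  refine image_le_of_liminf_slope_right_le_deriv_boundary (f := fun s => gauge g (flow A s x))
    (a := 0) (b := t) (B := fun _ => gauge g x) (B' := fun _ => 0)
    (fun s _ => ((continuousAt_gauge hper hg.continuous (flow_ne_zero hx s)).comp
      (f := fun s => flow A s x) (continuous_flow A x).continuousAt).continuousWithinAt)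
    (by rw [flow_zero]) continuousOn_const (fun s _ => hasDerivWithinAt_const _ _ _)
    (fun s hs r hr => Eventually.frequently ?_) (Set.right_mem_Icc.2 ht)
  obtain ⟨T, hT, hle⟩ := hloc (flow A s x)
  filter_upwards [Ioo_mem_nhdsGT (show s < s + T by linarith)] with z hz
  have h1 := hle (z - s) (by linarith [hz.1]) (by linarith [hz.2])
  rw [← flow_add, sub_add_cancel] at h1
  refine lt_of_le_of_lt ?_ hr
  rw [slope_def_field]
  exact div_nonpos_of_nonpos_of_nonneg (by linarith) (by linarith [hz.1])

end Decrease

/-! ### Existence of the invariant norm with a given radius -/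

/-- The largest seminorm that does not exceed a function `N`. -/
theorem exists_largest_seminorm {N : Plane → ℝ} {C : ℝ} (h0 : ∀ x, 0 ≤ N x) (hC : ∀ x, N x ≤ C * ‖x‖) :
    ∃ f : Seminorm ℝ Plane,
      (∀ ℓ : Plane →L[ℝ] ℝ, (∀ x, |ℓ x| ≤ N x) → ∀ x, |ℓ x| ≤ f x) ∧
      ∀ x c, (∀ ℓ : Plane →L[ℝ] ℝ, (∀ y, |ℓ y| ≤ N y) → |ℓ x| ≤ c) → f x ≤ c := by
  set p : {ℓ : Plane →L[ℝ] ℝ // ∀ x, |ℓ x| ≤ N x} → Seminorm ℝ Plane := fun ℓ =>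
    (normSeminorm ℝ ℝ).comp ℓ.1.toLinearMap with hp
  have hpx : ∀ ℓ x, p ℓ x = |ℓ.1 x| := fun ℓ x => rfl
  have hC0 : 0 ≤ C := by
    have h := (h0 (unitVec 0)).trans (hC (unitVec 0))
    rwa [norm_unitVec, mul_one] at h
  have hbdd : BddAbove (Set.range p) := by
    refine ⟨C.toNNReal • normSeminorm ℝ Plane, ?_⟩
    rintro _ ⟨ℓ, rfl⟩
    intro x
    rw [hpx]
    change _ ≤ (C.toNNReal : ℝ) * ‖x‖
    rw [Real.coe_toNNReal C hC0]
    exact (ℓ.2 x).trans (hC x)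
  have hne : Nonempty {ℓ : Plane →L[ℝ] ℝ // ∀ x, |ℓ x| ≤ N x} := ⟨0, fun x => by simpa using h0 x⟩
  have happ : ∀ x, (⨆ ℓ, p ℓ) x = ⨆ ℓ, p ℓ x := fun x => Seminorm.iSup_apply hbdd
  refine ⟨⨆ ℓ, p ℓ, fun ℓ hℓ x => ?_, fun x c h => ?_⟩
  · rw [happ]
    refine le_ciSup (f := fun ℓ => p ℓ x) ⟨N x, ?_⟩ (⟨ℓ, hℓ⟩ : {ℓ : Plane →L[ℝ] ℝ // ∀ x, |ℓ x| ≤ N x})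
    rintro _ ⟨ℓ, rfl⟩
    exact ℓ.2 x
  · rw [happ]
    exact ciSup_le fun ℓ => h ℓ.1 ℓ.2

/-- The projection onto the kernel along the image, as a coordinate. -/
theorem exists_kernel_coordinate {A : Mat} (hA : A ≠ 0) (hdet : A.det = 0) (htr : A.trace < 0) {γ : ℝ}
    (hker : act A (unitVec γ) = 0) : ∃ ℓ : Plane →L[ℝ] ℝ, ℓ (unitVec γ) = 1 ∧
      ∀ x, Tendsto (fun t => flow A t x) atTop (𝓝 (ℓ x • unitVec γ)) := by
  -- The projection onto the kernel along the image; the complementary part is an eigenvector with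
  -- the negative eigenvalue `A.trace` and decays.
  set P : Plane →L[ℝ] Plane := ContinuousLinearMap.id ℝ Plane - A.trace⁻¹ • op A with hP
  have hPx : ∀ x, P x = x - A.trace⁻¹ • act A x := fun x => rfl
  have hkerP : ∀ x, act A (P x) = 0 := fun x => by
    rw [hPx, act_eq_op, map_sub, map_smul, ← act_eq_op, ← act_eq_op, act_act_of_det_eq_zero hdet,
      smul_smul, inv_mul_cancel₀ htr.ne, one_smul, sub_self]
  set ℓ : Plane →L[ℝ] ℝ := (innerSL ℝ (unitVec γ)).comp P with hℓ
  have hℓx : ∀ x, ℓ x = inner ℝ (unitVec γ) (P x) := fun x => rfl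
  have hPℓ : ∀ x, P x = ℓ x • unitVec γ := by
    intro x
    have hcross : unitVec γ 0 * P x 1 - unitVec γ 1 * P x 0 = 0 := by
      by_contra h
      exact hA (eq_zero_of_act_eq_zero h hker (hkerP x))
    obtain ⟨c, hc⟩ := exists_smul_eq_of_cross_eq_zero (unitVec_ne_zero γ) hcross
    rw [hℓx, hc, inner_smul_right, real_inner_self_eq_norm_sq, norm_unitVec]
    simp
  refine ⟨ℓ, ?_, fun x => ?_⟩
  · rw [hℓx, hPx, hker, smul_zero, sub_zero, real_inner_self_eq_norm_sq, norm_unitVec, one_pow]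
  · have hflow : ∀ t, flow A t x = ℓ x • unitVec γ + Real.exp (A.trace * t) • (A.trace⁻¹ • act A x) := by
      intro t
      have hx : x = P x + A.trace⁻¹ • act A x := by rw [hPx]; abel
      have h1 : flow A t (P x) = P x := by
        have := flow_eq_exp_smul (A := A) (x := P x) (c := 0) (by rw [hkerP, zero_smul]) t
        simpa using this
      have h2 : act A (A.trace⁻¹ • act A x) = A.trace • (A.trace⁻¹ • act A x) := by
        rw [act_smul_right, act_act_of_det_eq_zero hdet, smul_comm]
      conv_lhs => rw [hx]
      rw [map_add, h1, flow_eq_exp_smul h2, hPℓ]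
    simp only [hflow]
    have hexp : Tendsto (fun t => Real.exp (A.trace * t)) atTop (𝓝 0) :=
      Real.tendsto_exp_atBot.comp (tendsto_id.const_mul_atTop_of_neg htr)
    simpa using tendsto_const_nhds.add (hexp.smul_const (A.trace⁻¹ • act A x))

section Existence

variable {𝒜 : Set Mat} {f : Seminorm ℝ Plane} {g : ℝ → ℝ}

theorem exists_gauge_bounds (hg : Function.Periodic g Real.pi) (hc : Continuous g) :
    ∃ c > 0, ∃ C, ∀ x, c * ‖x‖ ≤ gauge g x ∧ gauge g x ≤ C * ‖x‖ := by
  obtain ⟨M, hM⟩ := isCompact_Icc.exists_bound_of_continuousOn (s := Set.Icc 0 Real.pi) hc.continuousOn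
  refine ⟨Real.exp (-M), Real.exp_pos _, Real.exp M, fun x => ?_⟩
  obtain ⟨γ, hγ, r, hr, rfl⟩ := exists_eq_smul_unitVec_mem x
  have h := abs_le.1 (hM γ (Set.Ico_subset_Icc_self hγ))
  rw [gauge_smul_unitVec hg, norm_smul, norm_unitVec, Real.norm_eq_abs, mul_one, mul_comm, mul_comm (Real.exp M)]
  exact ⟨mul_le_mul_of_nonneg_left (Real.exp_le_exp.2 (by linarith)) (abs_nonneg r),
    mul_le_mul_of_nonneg_left (Real.exp_le_exp.2 (by linarith)) (abs_nonneg r)⟩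

theorem gauge_nonneg (g : ℝ → ℝ) (x : Plane) : 0 ≤ gauge g x :=
  mul_nonneg (norm_nonneg _) (Real.exp_pos _).le

/-- A point of the half-circle lies in a kernel or in an interval without kernels with both ends in
kernels. -/
theorem GoodFamily.mem_kernelSet_or (h : GoodFamily 𝒜) (h0 : (0 : ℝ) ∈ kernelSet 𝒜) {γ : ℝ}
    (hγ : γ ∈ Set.Icc 0 Real.pi) : γ ∈ kernelSet 𝒜 ∨
      ∃ I ∈ gaps 𝒜, γ ∈ Set.Ioo I.1 I.2 ∧ I.1 ∈ kernelSet 𝒜 ∧ I.2 ∈ kernelSet 𝒜 := by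
  have hπ : Real.pi ∈ kernelSet 𝒜 := by
    rw [← zero_add Real.pi, add_pi_mem_kernelSet]; exact h0
  by_cases hk : γ ∈ kernelSet 𝒜
  · exact Or.inl hk
  · right
    have hγ' : γ ∈ Set.Ioo 0 Real.pi :=
      ⟨hγ.1.lt_of_ne fun h => hk (h ▸ h0), hγ.2.lt_of_ne fun h => hk (h ▸ hπ)⟩
    obtain ⟨I, hI, h1, -, -⟩ := exists_isComponent h.isOpen_gapSet (a := 0) (b := Real.pi)
        (fun h => lt_irrefl _ h.1.1) (fun h => lt_irrefl _ h.1.2) hγ.1 hγ.2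
        (by rw [h.gapSet_eq]; exact ⟨hγ', hk⟩)
    have hI' : I ∈ gaps 𝒜 := hI
    obtain ⟨hlt, hI0, hIπ, -⟩ := mem_gaps hI'
    obtain ⟨-, -, hn1, hn2⟩ := hI
    rw [h.gapSet_eq] at hn1 hn2
    refine ⟨I, hI', h1, ?_, ?_⟩
    · rcases hI0.eq_or_lt with h2 | h2
      · rwa [← h2]
      · by_contra h3
        exact hn1 ⟨⟨h2, hlt.trans_le hIπ⟩, h3⟩
    · rcases hIπ.eq_or_lt with h2 | h2
      · rwa [h2]
      · by_contra h3
        exact hn2 ⟨⟨hI0.trans_lt hlt, h2⟩, h3⟩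

theorem Setting.exists_mem_degenerate (S : Setting 𝒜 f) {γ : ℝ} (h : γ ∈ kernelSet 𝒜) :
    ∃ A ∈ convexHull ℝ 𝒜, A ≠ 0 ∧ A.det = 0 ∧ A.trace < 0 ∧ act A (unitVec γ) = 0 := by
  obtain ⟨A, hA, hk⟩ := h
  exact ⟨A, hA.1, hA.2.1, hA.2.2.1, trace_neg_of_dissipative S.comp S.definite S.dissipative hA.1 hA.2.1
    hA.2.2.1, mem_kernel.1 hk⟩

/-- The largest seminorm below the gauge. Functionals bounded by the gauge remain so after
composition with a flow, which makes the seminorm dissipative. At a kernel, the coordinate along the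
kernel, scaled by `exp (-g γ)`, is such a functional and attains the gauge. -/
theorem IsSphereRadius.exists_seminorm (hg : IsSphereRadius 𝒜 g) (S : Setting 𝒜 f) :
    ∃ F : Seminorm ℝ Plane, (∀ x, F x = 0 → x = 0) ∧ Dissipative 𝒜 F 0 ∧
      (∀ γ, g γ ≤ logRadius F γ) ∧ ∀ γ ∈ kernelSet 𝒜, logRadius F γ = g γ := by
  have hper : Function.Periodic g Real.pi := hg.periodic
  obtain ⟨c, hc, C, hcC⟩ := exists_gauge_bounds hper hg.continuous
  obtain ⟨F, hF1, hF2⟩ := exists_largest_seminorm (gauge_nonneg g) fun x => (hcC x).2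
  have hFg : ∀ x, F x ≤ gauge g x := fun x => hF2 x _ fun ℓ hℓ => hℓ x
  have hdef : ∀ x, F x = 0 → x = 0 := by
    intro x hx
    by_contra hne
    have hx0 : 0 < ‖x‖ := norm_pos_iff.2 hne
    -- A functional of Euclidean norm `c` is bounded by the gauge and does not vanish at `x`.
    have := hF1 ((c / ‖x‖) • innerSL ℝ x) (fun y => ?_) x
    · rw [hx] at this
      have h2 : ((c / ‖x‖) • innerSL ℝ x) x = c * ‖x‖ := by
        change c / ‖x‖ * inner ℝ x x = _
        rw [real_inner_self_eq_norm_sq]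
        field_simp
      rw [h2, abs_of_pos (by positivity)] at this
      exact this.not_gt (by positivity)
    · refine le_trans ?_ (hcC y).1
      change |c / ‖x‖ * inner ℝ x y| ≤ _
      rw [abs_mul, abs_of_pos (by positivity)]
      have h3 := abs_real_inner_le_norm x y
      calc c / ‖x‖ * |inner ℝ x y| ≤ c / ‖x‖ * (‖x‖ * ‖y‖) := by gcongr
        _ = c * ‖y‖ := by field_simp
  have hle : ∀ γ, g γ ≤ logRadius F γ := fun γ => by
    have := hFg (unitVec γ)
    rw [gauge_unitVec hper, seminorm_unitVec_eq hdef, Real.exp_le_exp] at this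
    linarith
  refine ⟨F, hdef, dissipative_of_flow_le S.comp fun A hA x ε hε => ⟨1, one_pos, fun t ht _ => ?_⟩, hle,
    fun γ hγ => le_antisymm ?_ (hle γ)⟩
  · have h1 : F (flow A t x) ≤ F x := hF2 _ _ fun ℓ hℓ =>
      hF1 (ℓ.comp (flow A t)) (fun y => (hℓ _).trans
        (hg.gauge_flow_le S (subset_convexHull ℝ 𝒜 hA) y ht.le)) x
    have := mul_pos ht hε
    simp only [zero_mul, sub_zero]
    linarith
  · obtain ⟨A, hA, hA0, hdet, htr, hker⟩ := S.exists_mem_degenerate hγ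
    obtain ⟨ℓ, hℓ1, hℓ2⟩ := exists_kernel_coordinate hA0 hdet htr hker
    -- The flow carries `x` to `ℓ x • unitVec γ` in the limit without increasing the gauge, which is
    -- the bound required of this functional.
    have h1 := hF1 (Real.exp (-g γ) • ℓ) (fun x => ?_) (unitVec γ)
    · change |Real.exp (-g γ) * ℓ (unitVec γ)| ≤ _ at h1
      rw [hℓ1, mul_one, abs_of_pos (Real.exp_pos _), seminorm_unitVec_eq hdef, Real.exp_le_exp] at h1
      linarith
    · change |Real.exp (-g γ) * ℓ x| ≤ _
      rcases eq_or_ne (ℓ x) 0 with h0 | h0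
      · rw [h0, mul_zero, abs_zero]; exact gauge_nonneg g x
      · have h2 := ((continuousAt_gauge hper hg.continuous
          (smul_ne_zero h0 (unitVec_ne_zero γ))).tendsto.comp (hℓ2 x))
        have h3 := le_of_tendsto h2 (by
          filter_upwards [eventually_ge_atTop 0] with t ht using hg.gauge_flow_le S hA x ht)
        rw [gauge_smul_unitVec hper] at h3
        rwa [abs_mul, abs_of_pos (Real.exp_pos _), mul_comm]

theorem sustained_of_forall_unitVec {F : Seminorm ℝ Plane} {𝒞 : Set Mat}
    (h : ∀ γ ∈ Set.Icc 0 Real.pi, ∃ A ∈ 𝒞, ∀ q : ℝ, 0 ≤ q →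
      F (unitVec γ) ≤ F (unitVec γ + q • act A (unitVec γ))) : Sustained 𝒞 F := by
  intro x
  obtain ⟨γ, hγ, r, -, rfl⟩ := exists_eq_smul_unitVec_mem x
  obtain ⟨A, hA, hle⟩ := h γ (Set.Ico_subset_Icc_self hγ)
  refine ⟨A, hA, fun q hq => ?_⟩
  rw [act_smul_right, smul_comm q, ← smul_add, map_smul_eq_mul, map_smul_eq_mul]
  exact mul_le_mul_of_nonneg_left (hle q hq) (norm_nonneg _)

/-- A function with the properties of the radius of an invariant sphere is the radius of an invariant
sphere. -/
theorem IsSphereRadius.exists_setting (hg : IsSphereRadius 𝒜 g) (S : Setting 𝒜 f)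
    (h0 : (0 : ℝ) ∈ kernelSet 𝒜) :
    ∃ F : Seminorm ℝ Plane, Setting 𝒜 F ∧ ∀ γ ∈ Set.Icc 0 Real.pi, logRadius F γ = g γ := by
  obtain ⟨F, hdef, hdis, hle, hker⟩ := hg.exists_seminorm S
  -- The nonnegative function `logRadius F - g` first decreases and then increases, and it is zero
  -- at both ends; so it vanishes. In this way convexity of the sphere is recovered.
  have hgap : ∀ I ∈ gaps 𝒜, I.1 ∈ kernelSet 𝒜 → I.2 ∈ kernelSet 𝒜 → ∀ γ ∈ Set.Icc I.1 I.2,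
      logRadius F γ = g γ := by
    intro I hI h1 h2 γ hγ
    refine le_antisymm ?_ (hle γ)
    obtain ⟨t, ht, ha, hm⟩ := S.exists_monotoneOn_sub (continuous_logRadius hdef)
      (semiconcaveAdmissible_logRadius hdef hdis) hI (hg.gapArc I hI)
    rcases le_total γ t with h | h
    · have := ha (Set.left_mem_Icc.2 ht.1) ⟨hγ.1, h⟩ hγ.1
      simp only at this
      rw [hker _ h1] at this
      linarith
    · have := hm ⟨h, hγ.2⟩ (Set.right_mem_Icc.2 ht.2) hγ.2
      simp only at this
      rw [hker _ h2] at this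
      linarith
  have heq : ∀ γ ∈ Set.Icc 0 Real.pi, logRadius F γ = g γ := by
    intro γ hγ
    rcases S.goodFamily.mem_kernelSet_or h0 hγ with h | ⟨I, hI, h, h1, h2⟩
    · exact hker γ h
    · exact hgap I hI h1 h2 γ (Set.Ioo_subset_Icc_self h)
  refine ⟨F, ⟨S.comp, S.zero, hdef, hdis, sustained_of_forall_unitVec fun γ hγ => ?_, S.axis⟩, heq⟩
  -- The arguments at which the sphere is sustained form a closed set, so a single point of a gap
  -- may be left to a limit.
  set T : Set ℝ := {γ | ∃ A ∈ convexHull ℝ 𝒜, (A, γ) ∈ {z : Mat × ℝ | ∀ q : ℝ, 0 ≤ q →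
      F (unitVec z.2) ≤ F (unitVec z.2 + q • act z.1 (unitVec z.2))}} with hT
  have hTcl : IsClosed T := by
    refine isClosed_exists_mem (isCompact_convexHull_of_finiteDimensional S.comp) ?_
    simp only [Set.ofPred_forall]
    refine isClosed_iInter fun q => isClosed_iInter fun _ => ?_
    have hu : Continuous fun z : Mat × ℝ => unitVec z.2 := continuous_unitVec.comp continuous_snd
    exact isClosed_le ((continuous_seminorm F).comp hu) ((continuous_seminorm F).comp
      (hu.add ((continuous_act.comp (continuous_fst.prodMk hu)).const_smul q)))
  change γ ∈ T
  rcases S.goodFamily.mem_kernelSet_or h0 hγ with h | ⟨I, hI, h, -, -⟩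
  · obtain ⟨A, hA, -, -, -, hk⟩ := S.exists_mem_degenerate h
    refine ⟨A, hA, fun q _ => ?_⟩
    simp [hk]
  · obtain ⟨-, hI0, hIπ, -⟩ := mem_gaps hI
    obtain ⟨t, ht, hder⟩ := S.exists_hasDerivAt_of_isGapArc hI (hg.gapArc I hI)
    have hmem : ∀ x ∈ Set.Ioo I.1 I.2, x ≠ t → x ∈ T := by
      intro x hx hne
      obtain ⟨m, -, hd, A, hA, -, hrad⟩ := hder x hx hne
      have hd' : HasDerivAt (logRadius F) m x := hd.congr_of_eventuallyEq
        (eventually_of_mem (Ioo_mem_nhds hx.1 hx.2) fun y hy =>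
          heq y ⟨hI0.trans hy.1.le, hy.2.le.trans hIπ⟩)
      have hsup := isSupportSlope_of_hasDerivAt hdef hd'
      refine ⟨A, subset_convexHull ℝ 𝒜 hA, fun q _ => ?_⟩
      have h1 := hsup (1 + q * radial A x) (q * angular A x)
      have e1 : 1 + q * radial A x - m * (q * angular A x) = 1 := by rw [hrad]; ring
      rw [e1, mul_one] at h1
      refine h1.trans (le_of_eq ?_)
      congr 1
      simp only
      rw [act_unitVec]
      module
    -- The source is the only interior point where the slope may be missing; it is a limit of points
    -- of `T`.
    by_cases hγt : γ = t
    · rw [hγt] at h ⊢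
      have hsub : Set.Ioo t I.2 ⊆ T := fun x hx => hmem x ⟨h.1.trans hx.1, hx.2⟩ hx.1.ne'
      have := hTcl.closure_subset_iff.2 hsub
      rw [closure_Ioo h.2.ne] at this
      exact this (Set.left_mem_Icc.2 h.2.le)
    · exact hmem γ h hγt

end Existence

/-! ### The increments of the invariant spheres -/

namespace Setting

variable {𝒜 : Set Mat} {f : Seminorm ℝ Plane}

theorem of_isBarabanov (hcomp : IsCompact 𝒜) (hzero : (0 : Mat) ∉ 𝒜)
    (hσ : lyapunovExponent 𝒜 = 0) (haxis : (0 : ℝ) ∈ setD 𝒜 ∨ setD 𝒜 = ∅) (h : IsBarabanov 𝒜 f) :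
    Setting 𝒜 f :=
  have h' := (isBarabanov_iff hcomp hσ).1 h
  ⟨hcomp, hzero, h'.1, h'.2.1, h'.2.2, haxis⟩

theorem isBarabanov (S : Setting 𝒜 f) (hσ : lyapunovExponent 𝒜 = 0) : IsBarabanov 𝒜 f :=
  (isBarabanov_iff S.comp hσ).2 ⟨S.definite, S.dissipative, S.sustained⟩

theorem exists_isKernelAngle (S : Setting 𝒜 f) {τ : ℝ} (hτ : τ ∈ setD 𝒜) :
    ∃ θ, IsKernelAngle 𝒜 τ θ := by
  obtain ⟨A, hA, hk⟩ := hτ.2.2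
  exact PlanarSwitching.exists_isKernelAngle S.comp S.definite S.dissipative hA hk

theorem isIncrement_iff (S : Setting 𝒜 f) {q : ℝ × ℝ} (hq : q ∈ setQ 𝒜) {r : ℝ} :
    IsIncrement 𝒜 q r ↔ r = increment f q :=
  PlanarSwitching.isIncrement_iff S.comp S.zero S.definite S.dissipative S.sustained hq

theorem setQ_subset (S : Setting 𝒜 f) : setQ 𝒜 ⊆ pieces 𝒜 := by
  rw [S.pieces_eq]; exact Set.subset_union_left

theorem setP_subset (S : Setting 𝒜 f) : setP 𝒜 ⊆ pieces 𝒜 := by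
  rw [S.pieces_eq]; exact Set.subset_union_right

theorem increment_mem (S : Setting 𝒜 f) {p : ℝ × ℝ} (hp : p ∈ setP 𝒜) :
    lowerBd 𝒜 p ≤ ((increment f p : ℝ) : EReal) ∧ ((increment f p : ℝ) : EReal) ≤ upperBd 𝒜 p := by
  obtain ⟨h1, h2⟩ := increment_mem_bounds S.comp S.zero S.definite S.dissipative hp.1
  exact ⟨(min_le_left _ _).trans h1, h2.trans (le_max_right _ _)⟩

theorem mem_nodes (S : Setting 𝒜 f) {γ : ℝ}
    (h : γ ∈ setD 𝒜 ∨ ∃ I ∈ setQ 𝒜 ∪ setP 𝒜, γ = I.1 ∨ γ = I.2) : γ ∈ GoodFamily.nodes 𝒜 := by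
  rcases h with h | ⟨I, hI, h⟩
  · exact S.goodFamily.mem_nodes_of_mem_setD h
  · rw [← S.pieces_eq] at hI
    exact GoodFamily.mem_nodes_of_endpoint hI h

/-- The formula at `π`, where symmetry gives the same radius as at 0. -/
theorem tsum_increment (S : Setting 𝒜 f) {φ : ℝ → ℝ}
    (hφ : ∀ τ ∈ setD 𝒜, IsKernelAngle 𝒜 τ (φ τ)) :
    ∑' p : setP 𝒜, increment f p =
      -(∫ τ in setD 𝒜, Real.cot (φ τ)) - ∑' q : setQ 𝒜, increment f q := by
  have h := S.logRadius_formula hφ GoodFamily.pi_mem_nodes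
  have e0 : logRadius f Real.pi = logRadius f 0 := by rw [← zero_add Real.pi, logRadius_add_pi]
  have eD : Set.Icc 0 Real.pi ∩ setD 𝒜 = setD 𝒜 := Set.inter_eq_right.2 fun τ hτ => hτ.1
  have key : ∀ s : Set (ℝ × ℝ), s ⊆ pieces 𝒜 → ∑' I : {I : ℝ × ℝ // I ∈ s ∧ I.2 ≤ Real.pi}, increment f I =
      ∑' I : s, increment f I := by
    intro s hs
    have : {I : ℝ × ℝ | I ∈ s ∧ I.2 ≤ Real.pi} = s := by
      ext I
      exact ⟨fun h => h.1, fun h => ⟨h, (GoodFamily.piece_lt (hs h)).2.2⟩⟩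
    exact tsum_congr_set_coe (increment f) this
  rw [key _ S.setQ_subset, key _ S.setP_subset, e0, eD] at h
  linarith

/-- Without `D` there are no reverse intervals either, so the whole open half-circle is one gap. -/
theorem eq_of_mem_setP_of_setD_eq_empty (S : Setting 𝒜 f) (hD : setD 𝒜 = ∅) {p : ℝ × ℝ}
    (hp : p ∈ setP 𝒜) : p = (0, Real.pi) := by
  have hR : reverseSet 𝒜 = ∅ := by
    by_contra h
    exact (setD_nonempty_of_reverseSet S.comp S.zero S.definite S.dissipative
      (Set.nonempty_iff_ne_empty.2 h)).ne_empty hD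
  obtain ⟨⟨hlt, hsub, h1, h2⟩, -⟩ := hp
  rw [hD, hR, Set.union_empty, Set.sdiff_empty] at hsub h1 h2
  obtain ⟨h3, h4⟩ := (Set.Ioo_subset_Ioo_iff hlt).1 hsub
  refine Prod.ext ?_ ?_
  · by_contra h
    exact h1 ⟨h3.lt_of_ne (Ne.symm h), hlt.trans_le h4⟩
  · by_contra h
    exact h2 ⟨h3.trans_lt hlt, h4.lt_of_ne h⟩

/-- If 0 lies in `D`, every gap ends in kernels and the construction applies. If `D` is empty, `P`
has at most one element, the sum condition prescribes its increment, and the given norm already has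
it. -/
theorem exists_increment_eq (S : Setting 𝒜 f) (s : setP 𝒜 → ℝ)
    (hs : ∀ p : setP 𝒜, lowerBd 𝒜 p ≤ ((s p : ℝ) : EReal) ∧ ((s p : ℝ) : EReal) ≤ upperBd 𝒜 p)
    (hsum : Summable s) (htsum : ∑' p : setP 𝒜, s p = ∑' p : setP 𝒜, increment f p) :
    ∃ F : Seminorm ℝ Plane, Setting 𝒜 F ∧ ∀ p : setP 𝒜, increment F p = s p := by
  rcases S.axis with h0 | hD
  · obtain ⟨g, hg, hgs⟩ := S.exists_isSphereRadius s hs hsum htsum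
    obtain ⟨F, SF, hF⟩ := hg.exists_setting S h0.2.2
    refine ⟨F, SF, fun p => ?_⟩
    obtain ⟨hlt, hp0, hpπ, -⟩ := mem_gaps p.2.1
    rw [increment, hF _ ⟨hp0, hlt.le.trans hpπ⟩, hF _ ⟨hp0.trans hlt.le, hpπ⟩, hgs]
  · refine ⟨f, S, fun p => ?_⟩
    have huniq : ∀ q : setP 𝒜, q = p := fun q => Subtype.ext
      ((S.eq_of_mem_setP_of_setD_eq_empty hD q.2).trans (S.eq_of_mem_setP_of_setD_eq_empty hD p.2).symm)
    rw [tsum_eq_single p fun q hq => absurd (huniq q) hq,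
      tsum_eq_single p fun q hq => absurd (huniq q) hq] at htsum
    exact htsum.symm

end Setting

end PlanarSwitching

theorem mainTheorem4 (𝒜 : Set Mat) (hcompact : IsCompact 𝒜) (hirr : IsIrreducibleFamily 𝒜)
    (hzero : (0 : Mat) ∉ 𝒜) (hσ : lyapunovExponent 𝒜 = 0)
    (haxis : (0 : ℝ) ∈ setD 𝒜 ∨ setD 𝒜 = ∅) :
    (∀ τ ∈ setD 𝒜, ∃ θ, IsKernelAngle 𝒜 τ θ) ∧
    (∀ q ∈ setQ 𝒜, ∃! r, IsIncrement 𝒜 q r) ∧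
    ∀ (φ : ℝ → ℝ) (Δ : ℝ × ℝ → ℝ),
      (∀ τ ∈ setD 𝒜, IsKernelAngle 𝒜 τ (φ τ)) →
      (∀ q ∈ setQ 𝒜, IsIncrement 𝒜 q (Δ q)) →
      IntegrableOn (fun τ => Real.cot (φ τ)) (setD 𝒜) ∧
      Summable (fun q : setQ 𝒜 => Δ q) ∧
      (∀ f : Seminorm ℝ Plane, IsBarabanov 𝒜 f →
        (∀ᵐ τ ∂(volume.restrict (setD 𝒜)), IsTangentAngle f τ (φ τ)) ∧
        (∀ q ∈ setQ 𝒜, increment f q = Δ q) ∧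
        (∀ p ∈ setP 𝒜, lowerBd 𝒜 p ≤ ((increment f p : ℝ) : EReal) ∧
          ((increment f p : ℝ) : EReal) ≤ upperBd 𝒜 p) ∧
        Summable (fun p : setP 𝒜 => increment f p) ∧
        ∀ γ ∈ Set.Icc 0 Real.pi,
          (γ ∈ setD 𝒜 ∨ ∃ I ∈ setQ 𝒜 ∪ setP 𝒜, γ = I.1 ∨ γ = I.2) →
          logRadius f γ = logRadius f 0 + (∫ τ in Set.Icc 0 γ ∩ setD 𝒜, Real.cot (φ τ)) +
            (∑' q : {q : ℝ × ℝ // q ∈ setQ 𝒜 ∧ q.2 ≤ γ}, Δ q) +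
            ∑' p : {p : ℝ × ℝ // p ∈ setP 𝒜 ∧ p.2 ≤ γ}, increment f p) ∧
      ∀ s : setP 𝒜 → ℝ,
        (∀ p : setP 𝒜, lowerBd 𝒜 p ≤ ((s p : ℝ) : EReal) ∧ ((s p : ℝ) : EReal) ≤ upperBd 𝒜 p) →
        ((∃ f : Seminorm ℝ Plane, IsBarabanov 𝒜 f ∧ ∀ p : setP 𝒜, increment f p = s p) ↔
          Summable s ∧
            ∑' p : setP 𝒜, s p =
              -(∫ τ in setD 𝒜, Real.cot (φ τ)) - ∑' q : setQ 𝒜, Δ q) ∧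
        ∀ f₁ f₂ : Seminorm ℝ Plane, IsBarabanov 𝒜 f₁ → IsBarabanov 𝒜 f₂ →
          (∀ p : setP 𝒜, increment f₁ p = s p) → (∀ p : setP 𝒜, increment f₂ p = s p) →
          ∃ c : ℝ, 0 < c ∧ ∀ x, f₂ x = c * f₁ x := by
  obtain ⟨f₀, hf₀⟩ := exists_isBarabanov hcompact hirr hσ
  have toS : ∀ {f : Seminorm ℝ Plane}, IsBarabanov 𝒜 f → Setting 𝒜 f :=
    fun h => Setting.of_isBarabanov hcompact hzero hσ haxis h
  have S₀ := toS hf₀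
  refine ⟨fun τ hτ => S₀.exists_isKernelAngle hτ, fun q hq =>
    ⟨increment f₀ q, (S₀.isIncrement_iff hq).2 rfl, fun r hr => (S₀.isIncrement_iff hq).1 hr⟩,
    fun φ Δ hφ hΔ => ?_⟩
  have hQ : ∀ {f : Seminorm ℝ Plane}, IsBarabanov 𝒜 f → ∀ q ∈ setQ 𝒜, increment f q = Δ q :=
    fun h q hq => (((toS h).isIncrement_iff hq).1 (hΔ q hq)).symm
  have hsumQ : Summable (fun q : setQ 𝒜 => Δ q) :=
    (S₀.summable_increment S₀.setQ_subset).congr fun q => hQ hf₀ q q.2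
  have htsum : ∀ {f : Seminorm ℝ Plane}, IsBarabanov 𝒜 f → ∑' p : setP 𝒜, increment f p =
      -(∫ τ in setD 𝒜, Real.cot (φ τ)) - ∑' q : setQ 𝒜, Δ q := fun h => by
    rw [(toS h).tsum_increment hφ, tsum_congr fun q : setQ 𝒜 => hQ h q q.2]
  refine ⟨S₀.integrableOn_cot hφ, hsumQ, fun f hf => ?_, fun s hs => ⟨⟨?_, ?_⟩, ?_⟩⟩
  · have S := toS hf
    refine ⟨?_, hQ hf, fun p hp => S.increment_mem hp, S.summable_increment S.setP_subset,
      fun γ _ hγ => ?_⟩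
    · filter_upwards [S.ae_hasDerivAt_cot hφ, ae_restrict_mem S.goodFamily.measurableSet_setD]
        with τ h1 h2 using isTangentAngle_of_hasDerivAt S.definite (hφ τ h2).1 h1
    · rw [S.logRadius_formula hφ (S.mem_nodes hγ),
        tsum_congr fun q : {q : ℝ × ℝ // q ∈ setQ 𝒜 ∧ q.2 ≤ γ} => hQ hf q q.2.1]
  · rintro ⟨f, hf, hfs⟩
    have S := toS hf
    exact ⟨(S.summable_increment S.setP_subset).congr hfs, by rw [← htsum hf, tsum_congr hfs]⟩
  · rintro ⟨hsum, hs'⟩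
    -- The increments of the known norm `f₀` have the same sum, so the closing condition says that
    -- `s` redistributes them.
    obtain ⟨F, SF, hF⟩ := S₀.exists_increment_eq s hs hsum (hs'.trans (htsum hf₀).symm)
    exact ⟨F, SF.isBarabanov hσ, hF⟩
  · intro f₁ f₂ h₁ h₂ e₁ e₂
    exact (toS h₁).eq_mul_of_increment_eq (toS h₂) fun p hp => (e₁ ⟨p, hp⟩).trans (e₂ ⟨p, hp⟩).symm
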